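/- Let $M$ be a compact smooth Riemannian $3$-manifold with nonempty boundary $\partial M$. Let $K$ be a closed subgroup of $O(n)$ or $U(n)$, acting on $V=\mathbb R^n$ or $\mathbb C^n$, with Lie algebra $\mathfrak k\neq 0$. Let $P\to M$ be a smooth principal $K$-bundle with adjoint bundle $\mathfrak k_P$, and let $A_0$ be a smooth connection on $P$. The spaces $H^m$ are the $L^2$-based Sobolev spaces of order $m$, that is, completions of the smooth objects. For $m\ge 1$ put $$H^m_{con}(\Omega^j(\mathfrak k_P))=\{\alpha\in H^m(\Omega^j(\mathfrak k_P)) : \iota^*\alpha=0\}\quad (j=0,1),$$ where $\iota:\partial M\to M$ is the inclusion and $\iota^*\alpha$ is taken in the trace sense. For an integer $k\ge 1$ let $\mathcal C^k_{con,A_0}=A_0+H^k_{con}(\Omega^1(\mathfrak k_P))$, and let $A\in\mathcal C^k_{con,A_0}$. For $\mathfrak k_P$-valued one-forms $\alpha=\sum\alpha_b\,dx_b$, $\beta=\sum\beta_c\,dx_c$ write $[\alpha\cdot\beta]=\sum_{b,c}g^{bc}[\alpha_b,\beta_c]$. Let $\nu$ be the inward unit normal on $\partial M$, and let $\tau=2H$,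 where $H$ is the mean curvature (half the trace of the second fundamental form) of $\partial M$ with respect to the outward unit normal. **(1)** Suppose $k+1>3/2$, and let $s$ be an integer with $s>3/2$ (for instance $s=k+1$). If $\alpha,\beta\in H^s_{con}(\Omega^1(\mathfrak k_P))$ satisfy $d_A^*\alpha=d_A^*\beta=0$, then $[\alpha\cdot\beta]\in H^s(\mathfrak k_P)$, and $$d_A[\alpha\cdot\beta](\nu)=-2\tau[\alpha\cdot\beta]\quad\text{on }\partial M,$$ where both sides are elements of $L^2(\mathfrak k_P|_{\partial M})$, in the trace sense. **(2)** Suppose $k>3/2+1$. Let $\Delta_A=d_A^*d_A$, and let $G_A:H^{k-1}(\mathfrak k_P)\to H^{k+1}_{con}(\mathfrak k_P)$ be the inverse of $\Delta_A:H^{k+1}_{con}(\mathfrak k_P)\to H^{k-1}(\mathfrak k_P)$. Let $H_A=\{\alpha\in H^k_{con}(\Omega^1(\mathfrak k_P)) : d_A^*\alpha=0\}$, put $\mathcal R_A(\alpha,\beta)=-2G_A[\alpha\cdot\beta]$ for $\alpha,\beta\in H_A$ (the curvature of the Coulomb connection), and let $$\mathcal L_A=\mathrm{Span}\{\mathcal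 R_A(\alpha,\beta) : \alpha,\beta\in H_A\}\subseteq H^{k+1}_{con}(\mathfrak k_P),$$ where $H^{k+1}_{con}(\mathfrak k_P)$ is the gauge Lie algebra. Then $$T_A: H^{k+1}_{con}(\mathfrak k_P)\to L^2(\mathfrak k_P|_{\partial M}),\qquad T_A(f)=d_A(\Delta_Af)(\nu)+2\tau\,\Delta_Af\,|_{\partial M},$$ is a well-defined bounded linear operator, $T_A\neq 0$, and $\mathcal L_A\subseteq\ker T_A$. In particular, $\mathcal L_A$ is not dense in $H^{k+1}_{con}(\mathfrak k_P)$. -/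

import Mathlib

open scoped Manifold ContDiff ENNReal
open MeasureTheory Set

noncomputable section

namespace Coulomb

/-! ### Manifolds with boundary: charts, coordinate fields, directional derivatives

Three-manifolds with boundary are modelled on the half-space `{y ∈ ℝ³ | 0 ≤ y 0}`; the boundary is
`y 0 = 0`, the coordinates `y 1`, `y 2` are tangential to the boundary, and `y 0` increases
inwards. -/

/-- The Euclidean space `ℝ³`. -/
abbrev E3 := EuclideanSpace ℝ (Fin 3)

/-- The model with corners of three-manifolds with boundary. -/
abbrev I3 : ModelWithCorners ℝ E3 (EuclideanHalfSpace 3) := 𝓡∂ 3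

/-- The linear endomorphisms of `V = 𝕜ⁿ`, where `𝕜` is `ℝ` or `ℂ`. -/
abbrev EndV (𝕜 : Type*) [RCLike 𝕜] (n : ℕ) :=
  EuclideanSpace 𝕜 (Fin n) →L[𝕜] EuclideanSpace 𝕜 (Fin n)

/-! Shortcuts for instance search. -/

instance {𝕜 : Type*} [RCLike 𝕜] {n : ℕ} : NormedAddCommGroup (EndV 𝕜 n) := inferInstance
instance {𝕜 : Type*} [RCLike 𝕜] {n : ℕ} : AddCommGroup (EndV 𝕜 n) := inferInstance
instance {𝕜 : Type*} [RCLike 𝕜] {n : ℕ} : AddCommMonoid (EndV 𝕜 n) := inferInstance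
instance {𝕜 : Type*} [RCLike 𝕜] {n : ℕ} : NormedSpace ℝ (EndV 𝕜 n) := inferInstance
instance {𝕜 : Type*} [RCLike 𝕜] {n : ℕ} : Module ℝ (EndV 𝕜 n) := inferInstance
instance {𝕜 : Type*} [RCLike 𝕜] {n : ℕ} : ContinuousAdd (EndV 𝕜 n) := inferInstance
instance {𝕜 : Type*} [RCLike 𝕜] {n : ℕ} : IsTopologicalAddGroup (EndV 𝕜 n) := inferInstance
instance {𝕜 : Type*} [RCLike 𝕜] {n : ℕ} : ContinuousConstSMul ℝ (EndV 𝕜 n) := inferInstance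
instance {𝕜 : Type*} [RCLike 𝕜] {n : ℕ} : Ring (EndV 𝕜 n) := inferInstance
instance {𝕜 : Type*} [RCLike 𝕜] {n : ℕ} : Bracket (EndV 𝕜 n) (EndV 𝕜 n) := inferInstance

/-- Composition of endomorphisms is bilinear over `ℝ`. -/
theorem mul_smul_real {𝕜 : Type*} [RCLike 𝕜] {n : ℕ} (c : ℝ) (a b : EndV 𝕜 n) :
    a * (c • b) = c • (a * b) := by
  ext1 v
  change a (c • b v) = c • a (b v)
  rw [RCLike.real_smul_eq_coe_smul (K := 𝕜), map_smul, ← RCLike.real_smul_eq_coe_smul (K := 𝕜)]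

/-- Composition of endomorphisms is bilinear over `ℝ`. -/
theorem smul_mul_real {𝕜 : Type*} [RCLike 𝕜] {n : ℕ} (c : ℝ) (a b : EndV 𝕜 n) :
    (c • a) * b = c • (a * b) := rfl

section Charts

variable {M : Type*} [TopologicalSpace M] [ChartedSpace (EuclideanHalfSpace 3) M]

/-- The charts of `M`. -/
abbrev Chart (M : Type*) [TopologicalSpace M] [ChartedSpace (EuclideanHalfSpace 3) M] :=
  ↥(atlas (EuclideanHalfSpace 3) M)

/-- The boundary `∂M`. -/
abbrev bdry (M : Type*) [TopologicalSpace M] [ChartedSpace (EuclideanHalfSpace 3) M] : Set M :=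
  I3.boundary M

/-- The chart `e` as a map to `ℝ³`. -/
abbrev coord (e : Chart M) : PartialEquiv M E3 := e.1.extend I3

/-- The coordinate vector `∂/∂y_c` of the chart `e` at the point `x` of its domain. -/
def coordVec [IsManifold I3 ∞ M] (e : Chart M) (c : Fin 3) (x : M) : TangentSpace I3 x :=
  (tangentBundleCore I3 M).coordChange e (achart (EuclideanHalfSpace 3) x) x
    (EuclideanSpace.single c (1 : ℝ))

/-- The derivative `dF_x(v)` of a vector-valued function `F` on `M`. -/
def dirDeriv {W : Type*} [NormedAddCommGroup W] [NormedSpace ℝ W]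
    (F : M → W) (x : M) (v : TangentSpace I3 x) : W :=
  mfderiv I3 𝓘(ℝ, W) F x v

/-- The inclusion of `ℝ²` in `ℝ³` as the plane `y 0 = 0`. -/
def planeEmb (z : EuclideanSpace ℝ (Fin 2)) : E3 := WithLp.toLp 2 (Fin.cons 0 z.ofLp)

end Charts

/-! ### Riemannian geometry in charts -/

section Riemannian

variable {M : Type*} [TopologicalSpace M] [ChartedSpace (EuclideanHalfSpace 3) M]
  [IsManifold I3 ∞ M]

/-- Smooth Riemannian metrics on `M`. -/
abbrev Metric (M : Type*) [TopologicalSpace M] [ChartedSpace (EuclideanHalfSpace 3) M]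
    [IsManifold I3 ∞ M] :=
  Bundle.ContMDiffRiemannianMetric (IB := I3) (n := ∞) (F := E3)
    (E := fun x : M => TangentSpace I3 x)

variable (g : Metric M)

/-- The matrix `(g_{bc})` of the metric in the chart `e`. -/
def gram (e : Chart M) (x : M) : Matrix (Fin 3) (Fin 3) ℝ :=
  Matrix.of fun b c => g.inner x (coordVec e b x) (coordVec e c x)

/-- The inverse matrix `(g^{bc})`. -/
def gramInv (e : Chart M) (x : M) : Matrix (Fin 3) (Fin 3) ℝ := (gram g e x)⁻¹

/-- The density `√det(g_{bc})` of the Riemannian volume in the chart `e`. -/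
def density (e : Chart M) (x : M) : ℝ := Real.sqrt (gram g e x).det

/-- The Christoffel symbol `Γ^d_{bc}` of the Levi-Civita connection in the chart `e`. -/
def christoffel (e : Chart M) (d b c : Fin 3) (x : M) : ℝ :=
  (1 / 2) * ∑ k : Fin 3, (dirDeriv (fun y => gram g e y c k) x (coordVec e b x)
    + dirDeriv (fun y => gram g e y b k) x (coordVec e c x)
    - dirDeriv (fun y => gram g e y b c) x (coordVec e k x)) * gramInv g e x k d

/-- The inward pointing unit normal `ν` at a boundary point `x`: the normalized gradient of the
coordinate `y 0`, i.e. `∑_c g^{0c} ∂_c / √g^{00}`. -/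
def inwardNormal (x : M) : TangentSpace I3 x :=
  let e := achart (EuclideanHalfSpace 3) x
  (Real.sqrt (gramInv g e x 0 0))⁻¹ • ∑ c : Fin 3, gramInv g e x 0 c • coordVec e c x

/-- The metric induced on the boundary, in the tangential coordinates `y 1`, `y 2`. -/
def bdryGram (e : Chart M) (x : M) : Matrix (Fin 2) (Fin 2) ℝ :=
  Matrix.of fun b c => gram g e x b.succ c.succ

/-- The second fundamental form `(B(∂_b, ∂_c), η) = (∇_{∂_b} ∂_c, η)` of `∂M` in the tangential
coordinates, for a normal vector `η` at `x`. -/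
def secondFund (e : Chart M) (x : M) (η : TangentSpace I3 x) (b c : Fin 2) : ℝ :=
  ∑ d : Fin 3, christoffel g e d b.succ c.succ x * g.inner x (coordVec e d x) η

/-- The mean curvature `H = (1/2) tr S_{-ν}` of `∂M` with respect to the outward pointing unit
normal `-ν`, where `(S_η v, w) = (B(v, w), η)`. -/
def meanCurvature (x : M) : ℝ :=
  let e := achart (EuclideanHalfSpace 3) x
  (1 / 2) * ∑ b : Fin 2, ∑ c : Fin 2,
    (bdryGram g e x)⁻¹ b c * secondFund g e x (-inwardNormal g x) b c

/-- `τ = 2H`. -/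
def tau (x : M) : ℝ := 2 * meanCurvature g x

end Riemannian

/-! ### Structure group, principal bundle, sections, forms, connections -/

section Bundles

variable {𝕜 : Type*} [RCLike 𝕜] {n : ℕ}

/-- The Lie algebra `𝔨` of a closed group `K` of isometries of `V`. (For closed `K` the set of all
`X` with `exp(tX) ∈ K` for all real `t` is a linear subspace.) -/
def lieAlg (K : Subgroup (unitary (EndV 𝕜 n))) : Submodule ℝ (EndV 𝕜 n) :=
  Submodule.span ℝ {X | ∀ t : ℝ, ∃ k ∈ K, (k : EndV 𝕜 n) = NormedSpace.exp (t • X)}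

variable (M : Type*) [TopologicalSpace M] [ChartedSpace (EuclideanHalfSpace 3) M]

/-- A smooth principal `K`-bundle over `M`, given by an open cover that trivializes it and the
smooth transition functions `g i j : U i ∩ U j → K`. -/
structure PrincipalBundle (K : Subgroup (unitary (EndV 𝕜 n))) (ι : Type*) where
  /-- the trivializing open sets -/
  U : ι → Set M
  /-- the transition functions -/
  g : ι → ι → M → EndV 𝕜 n
  isOpen_U : ∀ i, IsOpen (U i)
  cover : ∀ x, ∃ i, x ∈ U i
  g_mem : ∀ i j, ∀ x ∈ U i ∩ U j, ∃ k ∈ K, (k : EndV 𝕜 n) = g i j x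
  g_smooth : ∀ i j, ContMDiffOn I3 𝓘(ℝ, EndV 𝕜 n) ∞ (g i j) (U i ∩ U j)
  cocycle : ∀ i j l, ∀ x ∈ U i ∩ U j ∩ U l, g i j x * g j l x = g i l x

variable {M} {K : Subgroup (unitary (EndV 𝕜 n))} {ι : Type*}

/-- Smooth sections of the adjoint bundle `𝔨_P`: families of smooth functions `f i : U i → 𝔨` with
`f i = Ad(g i j) (f j)` on overlaps. (The values of `f i` outside `U i` play no role.) -/
def SmoothSec (P : PrincipalBundle M K ι) : Submodule ℝ (ι → M → EndV 𝕜 n) where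
  carrier := {f | (∀ i, ContMDiffOn I3 𝓘(ℝ, EndV 𝕜 n) ∞ (f i) (P.U i)) ∧
    (∀ i, ∀ x ∈ P.U i, f i x ∈ lieAlg K) ∧
    ∀ i j, ∀ x ∈ P.U i ∩ P.U j, f i x = P.g i j x * f j x * star (P.g i j x)}
  zero_mem' := ⟨fun _ => contMDiffOn_const, fun _ _ _ => zero_mem _, fun _ _ _ _ => by simp⟩
  add_mem' := by
    rintro a b ⟨ha, ha', ha''⟩ ⟨hb, hb', hb''⟩
    refine ⟨fun i => (ha i).add (hb i), fun i x hx => add_mem (ha' i x hx) (hb' i x hx), ?_⟩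
    intro i j x hx
    simp only [Pi.add_apply, ha'' i j x hx, hb'' i j x hx, mul_add, add_mul]
  smul_mem' := by
    rintro c a ⟨ha, ha', ha''⟩
    refine ⟨fun i => (contMDiffOn_const : ContMDiffOn I3 𝓘(ℝ, ℝ) ∞ (fun _ : M => c) _).smul (ha i),
      fun i x hx => Submodule.smul_mem _ c (ha' i x hx), ?_⟩
    intro i j x hx
    simp only [Pi.smul_apply, ha'' i j x hx, mul_smul_real, smul_mul_real]

set_option synthInstance.maxHeartbeats 400000 in
/-- Smooth `𝔨_P`-valued one-forms: families of smooth `𝔨`-valued one-forms `α i` on `U i` with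
`α i = Ad(g i j) (α j)` on overlaps. -/
def SmoothForm [IsManifold I3 ∞ M] (P : PrincipalBundle M K ι) :
    Submodule ℝ (ι → ∀ x : M, TangentSpace I3 x →L[ℝ] EndV 𝕜 n) where
  carrier := {α | (∀ i (e : Chart M) c, ContMDiffOn I3 𝓘(ℝ, EndV 𝕜 n) ∞
      (fun x => α i x (coordVec e c x)) (e.1.source ∩ P.U i)) ∧
    (∀ i, ∀ x ∈ P.U i, ∀ v, α i x v ∈ lieAlg K) ∧
    ∀ i j, ∀ x ∈ P.U i ∩ P.U j, ∀ v,
      α i x v = P.g i j x * α j x v * star (P.g i j x)}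
  zero_mem' := ⟨fun _ _ _ => contMDiffOn_const, fun _ _ _ _ => zero_mem _,
    fun _ _ _ _ _ => by simp⟩
  add_mem' := by
    rintro a b ⟨ha, ha', ha''⟩ ⟨hb, hb', hb''⟩
    refine ⟨fun i e c => (ha i e c).add (hb i e c),
      fun i x hx v => add_mem (ha' i x hx v) (hb' i x hx v), ?_⟩
    intro i j x hx v
    simp only [Pi.add_apply, add_apply, ha'' i j x hx, hb'' i j x hx, mul_add,
      add_mul]
  smul_mem' := by
    rintro c a ⟨ha, ha', ha''⟩
    refine ⟨fun i e d => 
      (contMDiffOn_const : ContMDiffOn I3 𝓘(ℝ, ℝ) ∞ (fun _ : M => c) _).smul (ha i e d),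
      fun i x hx v => Submodule.smul_mem _ c (ha' i x hx v), ?_⟩
    intro i j x hx v
    simp only [Pi.smul_apply, smul_apply, ha'' i j x hx, mul_smul_real,
      smul_mul_real]

/-- Continuous sections of the restriction `𝔨_P|_{∂M}` of the adjoint bundle to the boundary. -/
def BdrySec (P : PrincipalBundle M K ι) : Submodule ℝ (ι → M → EndV 𝕜 n) where
  carrier := {w | (∀ i, ContinuousOn (w i) (P.U i ∩ bdry M)) ∧
    (∀ i, ∀ x ∈ P.U i ∩ bdry M, w i x ∈ lieAlg K) ∧
    ∀ i j, ∀ x ∈ P.U i ∩ P.U j ∩ bdry M, w i x = P.g i j x * w j x * star (P.g i j x)}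
  zero_mem' := ⟨fun _ => continuousOn_const, fun _ _ _ => zero_mem _, fun _ _ _ _ => by simp⟩
  add_mem' := by
    rintro a b ⟨ha, ha', ha''⟩ ⟨hb, hb', hb''⟩
    refine ⟨fun i => (ha i).add (hb i), fun i x hx => add_mem (ha' i x hx) (hb' i x hx), ?_⟩
    intro i j x hx
    simp only [Pi.add_apply, ha'' i j x hx, hb'' i j x hx, mul_add, add_mul]
  smul_mem' := by
    rintro c a ⟨ha, ha', ha''⟩
    refine ⟨fun i => (ha i).const_smul c,
      fun i x hx => Submodule.smul_mem _ c (ha' i x hx), ?_⟩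
    intro i j x hx
    simp only [Pi.smul_apply, ha'' i j x hx, mul_smul_real, smul_mul_real]

/-- Smooth `K`-connections on `P`: families of smooth `𝔨`-valued one-forms `A i` on `U i` (so that
`∇_A = d + A i` in the `i`-th trivialization) with
`A j = g⁻¹ (A i) g + g⁻¹ dg`, `g = g i j`, on overlaps. -/
structure SmoothConn [IsManifold I3 ∞ M] (P : PrincipalBundle M K ι) where
  /-- the local connection forms -/
  form : ι → ∀ x : M, TangentSpace I3 x →L[ℝ] EndV 𝕜 n
  smooth : ∀ i (e : Chart M) c, ContMDiffOn I3 𝓘(ℝ, EndV 𝕜 n) ∞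
    (fun x => form i x (coordVec e c x)) (e.1.source ∩ P.U i)
  mem : ∀ i, ∀ x ∈ P.U i, ∀ v, form i x v ∈ lieAlg K
  gauge : ∀ i j, ∀ x ∈ P.U i ∩ P.U j, ∀ v, form j x v =
    star (P.g i j x) * form i x v * P.g i j x + star (P.g i j x) * dirDeriv (P.g i j) x v

/-! #### The differential operators on smooth objects

`A` is a family of local connection forms. -/

/-- `η = d_A f`, i.e. `η = df + [A, f]`. -/
def IsCovDeriv [IsManifold I3 ∞ M] (P : PrincipalBundle M K ι)
    (A : ι → ∀ x : M, TangentSpace I3 x →L[ℝ] EndV 𝕜 n) (f : SmoothSec P) (η : SmoothForm P) :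
    Prop :=
  ∀ i, ∀ x ∈ P.U i, ∀ v : TangentSpace I3 x,
    η.1 i x v = dirDeriv (f.1 i) x v + ⁅A i x v, f.1 i x⁆

/-- `u = d_A^* η`, in charts and trivializations
`u = -a⁻¹ ∑ ∂_b (a g^{bc} η_c) - ∑ g^{bc} [A_b, η_c]` with `a = √det(g_{bc})`. -/
def IsCodiff [IsManifold I3 ∞ M] (P : PrincipalBundle M K ι) (g : Metric M)
    (A : ι → ∀ x : M, TangentSpace I3 x →L[ℝ] EndV 𝕜 n) (η : SmoothForm P) (u : SmoothSec P) :
    Prop :=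
  ∀ i (e : Chart M), ∀ x ∈ e.1.source ∩ P.U i,
    u.1 i x = -((density g e x)⁻¹ • ∑ b : Fin 3, dirDeriv
        (fun y => ∑ c : Fin 3, (density g e y * gramInv g e y b c) • η.1 i y (coordVec e c y))
        x (coordVec e b x))
      - ∑ b : Fin 3, ∑ c : Fin 3,
        gramInv g e x b c • ⁅A i x (coordVec e b x), η.1 i x (coordVec e c x)⁆

/-- `u = [α·β]`, in charts and trivializations `u = ∑ g^{bc} [α_b, β_c]`. -/
def IsBracket [IsManifold I3 ∞ M] (P : PrincipalBundle M K ι) (g : Metric M)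
    (α β : SmoothForm P) (u : SmoothSec P) : Prop :=
  ∀ i (e : Chart M), ∀ x ∈ e.1.source ∩ P.U i,
    u.1 i x = ∑ b : Fin 3, ∑ c : Fin 3,
      gramInv g e x b c • ⁅α.1 i x (coordVec e b x), β.1 i x (coordVec e c x)⁆

/-- `w = d_A u (ν)` on `∂M`. -/
def IsNormalDeriv [IsManifold I3 ∞ M] (P : PrincipalBundle M K ι) (g : Metric M)
    (A : ι → ∀ x : M, TangentSpace I3 x →L[ℝ] EndV 𝕜 n) (u : SmoothSec P) (w : BdrySec P) :
    Prop :=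
  ∀ i, ∀ x ∈ P.U i ∩ bdry M, w.1 i x =
    dirDeriv (u.1 i) x (inwardNormal g x) + ⁅A i x (inwardNormal g x), u.1 i x⁆

/-- `w = τ u` on `∂M`. -/
def IsTauMul [IsManifold I3 ∞ M] (P : PrincipalBundle M K ι) (g : Metric M)
    (u : SmoothSec P) (w : BdrySec P) : Prop :=
  ∀ i, ∀ x ∈ P.U i ∩ bdry M, w.1 i x = tau g x • u.1 i x

/-- The restriction of a smooth section to the boundary. -/
def restrictBdry (P : PrincipalBundle M K ι) : SmoothSec P →ₗ[ℝ] BdrySec P where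
  toFun f := ⟨f.1, fun i => (f.2.1 i).continuousOn.mono inter_subset_left,
    fun i x hx => f.2.2.1 i x hx.1, fun i j x hx => f.2.2.2 i j x hx.1⟩
  map_add' _ _ := rfl
  map_smul' _ _ := rfl

end Bundles

/-! ### Sobolev norms in a compact piece of a chart -/

section Jets

variable {M : Type*} [TopologicalSpace M] [ChartedSpace (EuclideanHalfSpace 3) M]
theorem memLp_of_continuousOn_compact {W X : Type*} [NormedAddCommGroup W] [TopologicalSpace X]
    [MeasurableSpace X]
    [BorelSpace X] [T2Space X] [TopologicalSpace.PseudoMetrizableSpace X] {μ : Measure X}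
    [IsFiniteMeasureOnCompacts μ] {s : Set X} (hs : IsCompact s) {F : X → W}
    (hF : ContinuousOn F s) : MemLp F 2 (μ.restrict s) := by
  have : IsFiniteMeasure (μ.restrict s) := ⟨by simpa using hs.measure_lt_top⟩
  obtain ⟨c, hc⟩ := hs.exists_bound_of_continuousOn hF
  exact MemLp.of_bound (hF.aestronglyMeasurable_of_isCompact hs hs.measurableSet) c
    ((ae_restrict_iff' hs.measurableSet).2 (Filter.Eventually.of_forall hc))

/-- The linear map to `L²` given by a family of square integrable functions that depends linearly
on a parameter. -/
def lpLin {X S Z : Type*} [MeasurableSpace X] (μ : Measure X) [AddCommGroup S] [Module ℝ S]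
    [NormedAddCommGroup Z] [NormedSpace ℝ Z] (φ : S → X → Z) (hm : ∀ s, MemLp (φ s) 2 μ)
    (ha : ∀ s t, ∀ᵐ x ∂μ, φ (s + t) x = φ s x + φ t x)
    (hs : ∀ (c : ℝ) s, ∀ᵐ x ∂μ, φ (c • s) x = c • φ s x) : S →ₗ[ℝ] Lp Z 2 μ where
  toFun s := (hm s).toLp _
  map_add' s t := (MemLp.toLp_congr _ ((hm s).add (hm t)) (ha s t)).trans (MemLp.toLp_add _ _)
  map_smul' c s := (MemLp.toLp_congr _ ((hm s).const_smul c) (hs c s)).trans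
    (MemLp.toLp_const_smul c _)

variable {W : Type*} [NormedAddCommGroup W] [NormedSpace ℝ W]

/-- The `j`-th derivative of `F` in the chart `e`. -/
def jetFun (e : Chart M) (j : ℕ) (F : M → W) (y : E3) : E3 [×j]→L[ℝ] W :=
  iteratedFDerivWithin ℝ j (F ∘ (coord e).symm) (range I3) y

/-- Lebesgue measure on the image of `C` in the chart `e`. -/
def chartMeasure (e : Chart M) (C : Set M) : Measure E3 :=
  (volume : Measure E3).restrict (coord e '' C)

/-- Two-dimensional Lebesgue measure on the image of `C ∩ ∂M` in the chart `e`. -/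
def bdryMeasure (e : Chart M) (C : Set M) : Measure (EuclideanSpace ℝ (Fin 2)) :=
  (volume : Measure (EuclideanSpace ℝ (Fin 2))).restrict (planeEmb ⁻¹' (coord e '' C))

/-- A function on `M` restricted to the boundary and read in the chart `e`. -/
def bdryFun (e : Chart M) (F : M → W) (z : EuclideanSpace ℝ (Fin 2)) : W :=
  F ((coord e).symm (planeEmb z))

/-- The value of a smooth function is `C^∞` in the chart `e` up to the boundary. -/
theorem contDiffWithinAt_chart [IsManifold I3 ∞ M] (e : Chart M) {U : Set M} (hU : IsOpen U)
    {F : M → W} (hF : ContMDiffOn I3 𝓘(ℝ, W) ∞ F (e.1.source ∩ U)) {x : M}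
    (hx : x ∈ e.1.source ∩ U) :
    ContDiffWithinAt ℝ ∞ (F ∘ (coord e).symm) (range I3) (coord e x) := by
  have h1 : ContMDiffAt I3 𝓘(ℝ, W) ∞ F x :=
    hF.contMDiffAt ((e.1.open_source.inter hU).mem_nhds hx)
  have he : e.1 ∈ IsManifold.maximalAtlas I3 ∞ M := IsManifold.subset_maximalAtlas e.2
  have h2 := (contMDiffWithinAt_iff_source_of_mem_maximalAtlas he hx.1).1 h1
  simpa using contMDiffWithinAt_iff_contDiffWithinAt.1 h2

theorem jetFun_add [IsManifold I3 ∞ M] (e : Chart M) {U : Set M} (hU : IsOpen U) (j : ℕ)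
    {F G : M → W} (hF : ContMDiffOn I3 𝓘(ℝ, W) ∞ F (e.1.source ∩ U))
    (hG : ContMDiffOn I3 𝓘(ℝ, W) ∞ G (e.1.source ∩ U)) {x : M} (hx : x ∈ e.1.source ∩ U) :
    jetFun e j (F + G) (coord e x) = jetFun e j F (coord e x) + jetFun e j G (coord e x) :=
  iteratedFDerivWithin_add_apply
    ((contDiffWithinAt_chart e hU hF hx).of_le (mod_cast le_top))
    ((contDiffWithinAt_chart e hU hG hx).of_le (mod_cast le_top)) I3.uniqueDiffOn (mem_range_self _)

theorem jetFun_smul [IsManifold I3 ∞ M] (e : Chart M) {U : Set M} (hU : IsOpen U) (j : ℕ)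
    (c : ℝ) {F : M → W} (hF : ContMDiffOn I3 𝓘(ℝ, W) ∞ F (e.1.source ∩ U)) {x : M}
    (hx : x ∈ e.1.source ∩ U) :
    jetFun e j (c • F) (coord e x) = c • jetFun e j F (coord e x) :=
  iteratedFDerivWithin_const_smul_apply
    ((contDiffWithinAt_chart e hU hF hx).of_le (mod_cast le_top)) I3.uniqueDiffOn (mem_range_self _)

theorem isCompact_coord_image (e : Chart M) {C : Set M} (hC : IsCompact C)
    (hCe : C ⊆ e.1.source) : IsCompact (coord e '' C) :=
  hC.image_of_continuousOn ((e.1.continuousOn_extend (I := I3)).mono (by simpa using hCe))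

theorem ae_chartMeasure (e : Chart M) {U : Set M} {C : Set M} (hC : IsCompact C)
    (hCU : C ⊆ e.1.source ∩ U) {p : E3 → Prop} (h : ∀ x ∈ e.1.source ∩ U, p (coord e x)) :
    ∀ᵐ y ∂(chartMeasure e C), p y := by
  have hc := isCompact_coord_image e hC (hCU.trans inter_subset_left)
  refine (ae_restrict_iff' hc.measurableSet).2 (Filter.Eventually.of_forall ?_)
  rintro _ ⟨x, hx, rfl⟩
  exact h x (hCU hx)

theorem jetFun_memLp [IsManifold I3 ∞ M] (e : Chart M) {U : Set M} (hU : IsOpen U) (j : ℕ)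
    {F : M → W} (hF : ContMDiffOn I3 𝓘(ℝ, W) ∞ F (e.1.source ∩ U)) {C : Set M}
    (hC : IsCompact C) (hCU : C ⊆ e.1.source ∩ U) :
    MemLp (jetFun e j F) 2 (chartMeasure e C) := by
  refine memLp_of_continuousOn_compact
    (isCompact_coord_image e hC (hCU.trans inter_subset_left)) ?_
  rintro _ ⟨x, hx, rfl⟩
  refine ((contDiffWithinAt_chart e hU hF (hCU hx)).continuousWithinAt_iteratedFDerivWithin
    I3.uniqueDiffOn (mod_cast le_top) (mem_range_self _)).mono ?_
  rintro _ ⟨y, -, rfl⟩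
  exact mem_range_self _

/-- The smooth functions on `U`. -/
def SmoothOn (W : Type*) [NormedAddCommGroup W] [NormedSpace ℝ W] (U : Set M) :
    Submodule ℝ (M → W) where
  carrier := {F | ContMDiffOn I3 𝓘(ℝ, W) ∞ F U}
  zero_mem' := contMDiffOn_const
  add_mem' := fun ha hb => ContMDiffOn.add ha hb
  smul_mem' := fun c _ ha =>
    (contMDiffOn_const : ContMDiffOn I3 𝓘(ℝ, ℝ) ∞ (fun _ : M => c) _).smul ha

/-- The local `L²`-space of `j`-th derivatives in a compact piece `C` of the chart `e`. -/
def JetL2 (W : Type*) [NormedAddCommGroup W] [NormedSpace ℝ W] (e : Chart M) (C : Set M) (j : ℕ) :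
    Type _ :=
  ↥(Lp (E3 [×j]→L[ℝ] W) 2 (chartMeasure e C))

instance (W : Type*) [NormedAddCommGroup W] [NormedSpace ℝ W] (e : Chart M) (C : Set M) (j : ℕ) :
    NormedAddCommGroup (JetL2 W e C j) :=
  inferInstanceAs (NormedAddCommGroup ↥(Lp (E3 [×j]→L[ℝ] W) 2 (chartMeasure e C)))

instance (W : Type*) [NormedAddCommGroup W] [NormedSpace ℝ W] (e : Chart M) (C : Set M) (j : ℕ) :
    NormedSpace ℝ (JetL2 W e C j) :=
  inferInstanceAs (NormedSpace ℝ ↥(Lp (E3 [×j]→L[ℝ] W) 2 (chartMeasure e C)))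

/-- The `j`-th derivative of a smooth function in a compact piece `C` of the chart `e`, as an
element of `L²`. -/
def jetLp [IsManifold I3 ∞ M] (W : Type*) [NormedAddCommGroup W] [NormedSpace ℝ W] (e : Chart M)
    {U : Set M} (hU : IsOpen U) {C : Set M}
    (hC : IsCompact C) (hCU : C ⊆ e.1.source ∩ U) (j : ℕ) :
    SmoothOn W (e.1.source ∩ U) →ₗ[ℝ] JetL2 W e C j :=
  lpLin (chartMeasure e C) (fun F => jetFun e j F.1) (fun F => jetFun_memLp e hU j F.2 hC hCU)
    (fun F G => ae_chartMeasure e hC hCU fun _ hx => jetFun_add e hU j F.2 G.2 hx)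
    (fun c F => ae_chartMeasure e hC hCU fun _ hx => jetFun_smul e hU j c F.2 hx)

theorem continuous_planeEmb : Continuous planeEmb := by
  unfold planeEmb
  refine (PiLp.continuous_toLp 2 _).comp (continuous_pi fun k => ?_)
  refine Fin.cases ?_ (fun k => ?_) k
  · simpa using continuous_const
  · simpa using (EuclideanSpace.proj k : EuclideanSpace ℝ (Fin 2) →L[ℝ] ℝ).continuous

/-- The points of a chart on the plane `y 0 = 0` are the boundary points. -/
theorem mem_bdry_of_planeEmb [IsManifold I3 ∞ M] (e : Chart M) {x : M} (hx : x ∈ e.1.source)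
    {z : EuclideanSpace ℝ (Fin 2)} (h : coord e x = planeEmb z) : x ∈ bdry M := by
  rw [bdry, ← I3.compl_interior]
  intro hi
  have h1 := (I3.isInteriorPoint_iff_of_mem_atlas (n := ∞) (by simp) e.2 hx).1 hi
  have h2 := interior_mono (e.1.extend_target_subset_range (I := I3)) h1
  change coord e x ∈ _ at h2
  rw [h, interior_range_modelWithCornersEuclideanHalfSpace] at h2
  simp [planeEmb] at h2

theorem isCompact_planeEmb_preimage {S : Set E3} (hS : IsCompact S) :
    IsCompact (planeEmb ⁻¹' S) := by
  have hi : Isometry planeEmb := by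
    refine Isometry.of_dist_eq fun a b => ?_
    simp [planeEmb, EuclideanSpace.dist_eq, Fin.sum_univ_succ]
  exact hi.isClosedEmbedding.isCompact_preimage hS

theorem bdryFun_memLp [IsManifold I3 ∞ M] (e : Chart M) {U : Set M}
    {F : M → W} (hF : ContinuousOn F (U ∩ bdry M)) {C : Set M}
    (hC : IsCompact C) (hCU : C ⊆ e.1.source ∩ U) :
    MemLp (bdryFun e F) 2 (bdryMeasure e C) := by
  refine memLp_of_continuousOn_compact
    (isCompact_planeEmb_preimage (isCompact_coord_image e hC (hCU.trans inter_subset_left))) ?_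
  refine hF.comp (t := U ∩ bdry M) ?_ ?_
  · refine (e.1.continuousOn_extend_symm (I := I3)).comp continuous_planeEmb.continuousOn ?_
    rintro z ⟨x, hx, hxz⟩
    rw [← hxz]
    exact (coord e).map_source (by simpa using (hCU hx).1)
  · rintro z ⟨x, hx, hxz⟩
    have : (coord e).symm (planeEmb z) = x := by
      rw [← hxz]
      exact (coord e).left_inv (by simpa using (hCU hx).1)
    change (coord e).symm (planeEmb z) ∈ _
    rw [this]
    exact ⟨(hCU hx).2, mem_bdry_of_planeEmb e (hCU hx).1 hxz⟩

/-- The functions on `M` that are continuous on `U ∩ ∂M`. -/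
def ContOnBdry (W : Type*) [NormedAddCommGroup W] [NormedSpace ℝ W] (U : Set M) :
    Submodule ℝ (M → W) where
  carrier := {F | ContinuousOn F (U ∩ bdry M)}
  zero_mem' := continuousOn_const
  add_mem' := fun ha hb => ContinuousOn.add ha hb
  smul_mem' := fun c _ ha => ContinuousOn.const_smul ha c

/-- The local `L²`-space on the boundary part of a compact piece `C` of the chart `e`. -/
def BdryL2 (W : Type*) [NormedAddCommGroup W] (e : Chart M) (C : Set M) : Type _ :=
  ↥(Lp W 2 (bdryMeasure e C))

instance (W : Type*) [NormedAddCommGroup W] (e : Chart M) (C : Set M) :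
    NormedAddCommGroup (BdryL2 W e C) :=
  inferInstanceAs (NormedAddCommGroup ↥(Lp W 2 (bdryMeasure e C)))

instance (W : Type*) [NormedAddCommGroup W] [NormedSpace ℝ W] (e : Chart M) (C : Set M) :
    NormedSpace ℝ (BdryL2 W e C) :=
  inferInstanceAs (NormedSpace ℝ ↥(Lp W 2 (bdryMeasure e C)))

/-- The boundary values of a function in a compact piece `C` of the chart `e`, as an element of
`L²`. -/
def bdryLp [IsManifold I3 ∞ M] (W : Type*) [NormedAddCommGroup W] [NormedSpace ℝ W] (e : Chart M)
    {U : Set M} {C : Set M} (hC : IsCompact C) (hCU : C ⊆ e.1.source ∩ U) :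
    ContOnBdry W U →ₗ[ℝ] BdryL2 W e C :=
  lpLin (bdryMeasure e C) (fun F => bdryFun e F.1) (fun F => bdryFun_memLp e F.2 hC hCU)
    (fun _ _ => Filter.Eventually.of_forall fun _ => rfl)
    (fun _ _ => Filter.Eventually.of_forall fun _ => rfl)

end Jets

/-! ### Sobolev spaces of sections and forms

Sobolev spaces are completions of spaces of smooth objects. The `H^m`-norm is computed in a finite
family of charts and trivializations: it is built from the `L²`-norms of all derivatives of order at
most `m` on compact sets that cover `M`. The completion is realized as the closure of the smooth
objects in the product of the `L²`-spaces of their derivatives. -/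

section Sobolev

variable {𝕜 : Type*} [RCLike 𝕜] {n : ℕ} {K : Subgroup (unitary (EndV 𝕜 n))} {ι : Type*}
variable {M : Type*} [TopologicalSpace M] [ChartedSpace (EuclideanHalfSpace 3) M]

/-- A finite cover of `M` by compact sets, each with a chart and a trivialization around it. -/
structure PatchCover (P : PrincipalBundle M K ι) where
  /-- the number of sets -/
  N : ℕ
  /-- the charts -/
  chart : Fin N → Chart M
  /-- the trivializations -/
  triv : Fin N → ι
  /-- the compact sets -/
  C : Fin N → Set M
  isCompact : ∀ a, IsCompact (C a)
  subset : ∀ a, C a ⊆ (chart a).1.source ∩ P.U (triv a)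
  cover : ∀ x, ∃ a, x ∈ C a

variable {P : PrincipalBundle M K ι} (𝒰 : PatchCover P)

/-- The `L²`-spaces of the derivatives of order at most `m` on all sets of the cover. -/
abbrev JetSpace (W : Type*) [NormedAddCommGroup W] [NormedSpace ℝ W] (m : ℕ) :=
  (a : Fin 𝒰.N) → (j : Fin (m + 1)) → JetL2 W (𝒰.chart a) (𝒰.C a) j

/-- The `L²`-spaces on the boundary parts of all sets of the cover. -/
abbrev BdryJetSpace (W : Type*) [NormedAddCommGroup W] :=
  (a : Fin 𝒰.N) → BdryL2 W (𝒰.chart a) (𝒰.C a)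

variable [IsManifold I3 ∞ M]

/-- The local representative of a smooth section in the `i`-th trivialization. -/
def secLoc (i : ι) (e : Chart M) : SmoothSec P →ₗ[ℝ] SmoothOn (EndV 𝕜 n) (e.1.source ∩ P.U i) where
  toFun f := ⟨f.1 i, (f.2.1 i).mono inter_subset_right⟩
  map_add' _ _ := rfl
  map_smul' _ _ := rfl

/-- The components of a smooth form in the `i`-th trivialization and the chart `e`. -/
def formLoc (i : ι) (e : Chart M) :
    SmoothForm P →ₗ[ℝ] SmoothOn (Fin 3 → EndV 𝕜 n) (e.1.source ∩ P.U i) where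
  toFun α := ⟨fun x c => α.1 i x (coordVec e c x),
    contMDiffOn_pi_space.2 fun c => α.2.1 i e c⟩
  map_add' _ _ := rfl
  map_smul' _ _ := rfl

/-- The local representative of a section over the boundary in the `i`-th trivialization. -/
def bdryLoc (i : ι) : BdrySec P →ₗ[ℝ] ContOnBdry (EndV 𝕜 n) (P.U i) where
  toFun w := ⟨w.1 i, w.2.1 i⟩
  map_add' _ _ := rfl
  map_smul' _ _ := rfl

/-- The tangential components `α_1`, `α_2` along the boundary, i.e. the components of `ι^*α`. -/
def tangLoc (i : ι) (e : Chart M) :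
    SmoothForm P →ₗ[ℝ] ContOnBdry (Fin 2 → EndV 𝕜 n) (e.1.source ∩ P.U i) where
  toFun α := ⟨fun x c => α.1 i x (coordVec e c.succ x),
    continuousOn_pi.2 fun c => (α.2.1 i e (Fin.succ c)).continuousOn.mono inter_subset_left⟩
  map_add' _ _ := rfl
  map_smul' _ _ := rfl

/-- The derivatives of order at most `m` of a smooth section. -/
def secJet (m : ℕ) : SmoothSec P →ₗ[ℝ] JetSpace 𝒰 (EndV 𝕜 n) m :=
  LinearMap.pi fun a => LinearMap.pi fun j =>
    (jetLp (EndV 𝕜 n) (𝒰.chart a) (P.isOpen_U (𝒰.triv a)) (𝒰.isCompact a) (𝒰.subset a) j).comp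
      (secLoc (𝒰.triv a) (𝒰.chart a))

/-- The derivatives of order at most `m` of the components of a smooth form. -/
def formJet (m : ℕ) : SmoothForm P →ₗ[ℝ] JetSpace 𝒰 (Fin 3 → EndV 𝕜 n) m :=
  LinearMap.pi fun a => LinearMap.pi fun j =>
    (jetLp (Fin 3 → EndV 𝕜 n) (𝒰.chart a) (P.isOpen_U (𝒰.triv a)) (𝒰.isCompact a) (𝒰.subset a)
      j).comp (formLoc (𝒰.triv a) (𝒰.chart a))

/-- The local representatives of a continuous section over the boundary. -/
def bdryJet : BdrySec P →ₗ[ℝ] BdryJetSpace 𝒰 (EndV 𝕜 n) :=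
  LinearMap.pi fun a =>
    (bdryLp (EndV 𝕜 n) (𝒰.chart a) (𝒰.isCompact a) (𝒰.subset a)).comp (bdryLoc (𝒰.triv a))

/-- The pull-back `ι^*α` of a smooth form to the boundary. -/
def formPullback : SmoothForm P →ₗ[ℝ] BdryJetSpace 𝒰 (Fin 2 → EndV 𝕜 n) :=
  LinearMap.pi fun a =>
    (bdryLp (Fin 2 → EndV 𝕜 n) (𝒰.chart a) (𝒰.isCompact a)
      (fun _ hx => ⟨(𝒰.subset a hx).1, 𝒰.subset a hx⟩)).comp (tangLoc (𝒰.triv a) (𝒰.chart a))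

/-- The Sobolev space `H^m(𝔨_P)`. -/
def HSec (m : ℕ) : Submodule ℝ (JetSpace 𝒰 (EndV 𝕜 n) m) :=
  (LinearMap.range (secJet 𝒰 m)).topologicalClosure

/-- The Sobolev space `H^m(Ω¹(𝔨_P))`. -/
def HForm (m : ℕ) : Submodule ℝ (JetSpace 𝒰 (Fin 3 → EndV 𝕜 n) m) :=
  (LinearMap.range (formJet 𝒰 m)).topologicalClosure

/-- The space `L²(𝔨_P|_{∂M})`. -/
def L2Bdry : Submodule ℝ (BdryJetSpace 𝒰 (EndV 𝕜 n)) :=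
  (LinearMap.range (bdryJet 𝒰)).topologicalClosure

/-- A smooth section as an element of `H^m(𝔨_P)`. -/
def toHSec (m : ℕ) : SmoothSec P →ₗ[ℝ] HSec 𝒰 m :=
  (secJet 𝒰 m).codRestrict _ fun f =>
    Submodule.le_topologicalClosure _ (LinearMap.mem_range_self (secJet 𝒰 m) f)

/-- A smooth form as an element of `H^m(Ω¹(𝔨_P))`. -/
def toHForm (m : ℕ) : SmoothForm P →ₗ[ℝ] HForm 𝒰 m :=
  (formJet 𝒰 m).codRestrict _ fun f =>
    Submodule.le_topologicalClosure _ (LinearMap.mem_range_self (formJet 𝒰 m) f)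

/-- A continuous section over the boundary as an element of `L²(𝔨_P|_{∂M})`. -/
def toL2Bdry : BdrySec P →ₗ[ℝ] L2Bdry 𝒰 :=
  (bdryJet 𝒰).codRestrict _ fun f =>
    Submodule.le_topologicalClosure _ (LinearMap.mem_range_self (bdryJet 𝒰) f)

/-- The conductor Sobolev space `H^m_con(𝔨_P)`, `m ≥ 1`: the elements of `H^m(𝔨_P)` with vanishing
trace on `∂M`. The graph of the trace operator is the closure of the graph of the restriction of
smooth sections. -/
def HSecCon (m : ℕ) : Submodule ℝ (HSec 𝒰 m) :=
  (LinearMap.range ((toHSec 𝒰 m).prod (toL2Bdry 𝒰 ∘ₗ restrictBdry P))).topologicalClosure.comap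
    (LinearMap.inl ℝ (HSec 𝒰 m) (L2Bdry 𝒰))

/-- The conductor Sobolev space `H^m_con(Ω¹(𝔨_P))`, `m ≥ 1`: the forms `α` in `H^m(Ω¹(𝔨_P))` with
`ι^*α = 0` in the trace sense, where `ι : ∂M → M` is the inclusion. -/
def HFormCon (m : ℕ) : Submodule ℝ (HForm 𝒰 m) :=
  (LinearMap.range ((toHForm 𝒰 m).prod (formPullback 𝒰))).topologicalClosure.comap
    (LinearMap.inl ℝ (HForm 𝒰 m) (BdryJetSpace 𝒰 (Fin 2 → EndV 𝕜 n)))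

/-! #### The differential operators on Sobolev spaces

The operators are the continuous extensions of the operators on smooth objects: the graph of the
extension is the closure of the graph of the smooth operator. Throughout, the connection is
`A = A₀ + h` with `A₀` smooth and `h` a Sobolev form. -/

variable (g : Metric M) (A₀ : SmoothConn P)

/-- `η = d_A f` for `A = A₀ + h`. -/
def SobCovDeriv {l s r : ℕ} (h : HForm 𝒰 l) (f : HSec 𝒰 s) (η : HForm 𝒰 r) : Prop :=
  (h, f, η) ∈ closure {q : HForm 𝒰 l × HSec 𝒰 s × HForm 𝒰 r | ∃ h' f' η',
    IsCovDeriv P (A₀.form + h'.1) f' η' ∧ q = (toHForm 𝒰 l h', toHSec 𝒰 s f', toHForm 𝒰 r η')}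

/-- `u = d_A^* η` for `A = A₀ + h`. -/
def SobCodiff {l s r : ℕ} (h : HForm 𝒰 l) (η : HForm 𝒰 s) (u : HSec 𝒰 r) : Prop :=
  (h, η, u) ∈ closure {q : HForm 𝒰 l × HForm 𝒰 s × HSec 𝒰 r | ∃ h' η' u',
    IsCodiff P g (A₀.form + h'.1) η' u' ∧ q = (toHForm 𝒰 l h', toHForm 𝒰 s η', toHSec 𝒰 r u')}

/-- `u = [α·β]`. -/
def SobBracket {s r : ℕ} (α β : HForm 𝒰 s) (u : HSec 𝒰 r) : Prop :=
  (α, β, u) ∈ closure {q : HForm 𝒰 s × HForm 𝒰 s × HSec 𝒰 r | ∃ α' β' u',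
    IsBracket P g α' β' u' ∧ q = (toHForm 𝒰 s α', toHForm 𝒰 s β', toHSec 𝒰 r u')}

/-- `w = d_A u (ν)` on `∂M`, for `A = A₀ + h`. -/
def SobNormalDeriv {l s : ℕ} (h : HForm 𝒰 l) (u : HSec 𝒰 s) (w : L2Bdry 𝒰) : Prop :=
  (h, u, w) ∈ closure {q : HForm 𝒰 l × HSec 𝒰 s × L2Bdry 𝒰 | ∃ h' u' w',
    IsNormalDeriv P g (A₀.form + h'.1) u' w' ∧ q = (toHForm 𝒰 l h', toHSec 𝒰 s u', toL2Bdry 𝒰 w')}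

/-- `w = τ u` on `∂M`. -/
def SobTauMul {s : ℕ} (u : HSec 𝒰 s) (w : L2Bdry 𝒰) : Prop :=
  (u, w) ∈ closure {q : HSec 𝒰 s × L2Bdry 𝒰 | ∃ u' w',
    IsTauMul P g u' w' ∧ q = (toHSec 𝒰 s u', toL2Bdry 𝒰 w')}

/-- The horizontal space of the Coulomb connection in Sobolev order `s`: the `α` in
`H^s_con(Ω¹(𝔨_P))` with `d_A^* α = 0`. -/
def Horizontal {l : ℕ} (h : HForm 𝒰 l) (s : ℕ) : Set (HForm 𝒰 s) :=
  {α | α ∈ HFormCon 𝒰 s ∧ SobCodiff 𝒰 g A₀ h α (0 : HSec 𝒰 0)}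

/-- `u = Δ_A f = d_A^* d_A f`, as an operator from `H^{k+1}(𝔨_P)` to `H^{k-1}(𝔨_P)`, for
`A = A₀ + h` with `h` of order `k`. -/
def SobLaplacian {k : ℕ} (h : HForm 𝒰 k) (f : HSec 𝒰 (k + 1)) (u : HSec 𝒰 (k - 1)) : Prop :=
  ∃ η : HForm 𝒰 k, SobCovDeriv 𝒰 A₀ h f η ∧ SobCodiff 𝒰 g A₀ h η u

/-- `w = T_A f = d_A Δ_A f (ν) + 2 τ Δ_A f` on `∂M`. -/
def IsTA {k : ℕ} (h : HForm 𝒰 k) (f : HSec 𝒰 (k + 1)) (w : L2Bdry 𝒰) : Prop :=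
  ∃ (u : HSec 𝒰 (k - 1)) (w₁ w₂ : L2Bdry 𝒰), SobLaplacian 𝒰 g A₀ h f u ∧
    SobNormalDeriv 𝒰 g A₀ h u w₁ ∧ SobTauMul 𝒰 g u w₂ ∧ w = w₁ + (2 : ℝ) • w₂

/-- `f = G_A b`, where the Green operator `G_A : H^{k-1}(𝔨_P) → H^{k+1}_con(𝔨_P)` is the inverse of
the restriction of `Δ_A` to `H^{k+1}_con(𝔨_P)`. -/
def IsGreen {k : ℕ} (h : HForm 𝒰 k) (b : HSec 𝒰 (k - 1)) (f : HSecCon 𝒰 (k + 1)) : Prop :=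
  SobLaplacian 𝒰 g A₀ h f.1 b

/-- `f = R_A(α, β) = -2 G_A [α·β]`, the curvature of the Coulomb connection at `A`. -/
def IsCoulombCurvature {k : ℕ} (h : HForm 𝒰 k) (α β : HForm 𝒰 k) (f : HSecCon 𝒰 (k + 1)) :
    Prop :=
  ∃ (b : HSec 𝒰 (k - 1)) (f₀ : HSecCon 𝒰 (k + 1)),
    SobBracket 𝒰 g α β b ∧ IsGreen 𝒰 g A₀ h b f₀ ∧ f = (-2 : ℝ) • f₀

/-- `L_A`, the span of all `R_A(α, β)` with `α`, `β` horizontal, in the Lie algebra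
`H^{k+1}_con(𝔨_P)` of the gauge group. -/
def LA {k : ℕ} (h : HForm 𝒰 k) : Submodule ℝ (HSecCon 𝒰 (k + 1)) :=
  Submodule.span ℝ {f | ∃ α ∈ Horizontal 𝒰 g A₀ h k, ∃ β ∈ Horizontal 𝒰 g A₀ h k,
    IsCoulombCurvature 𝒰 g A₀ h α β f}

end Sobolev

end Coulomb

end

noncomputable section

namespace Coulomb

section Kernel

/-- The Cauchy–Schwarz inequality for lower integrals. -/
theorem sq_lintegral_mul_le {X : Type*} [MeasurableSpace X] (μ : Measure X) {f g : X → ℝ≥0∞}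
    (hf : AEMeasurable f μ) (hg : AEMeasurable g μ) :
    (∫⁻ x, f x * g x ∂μ) ^ 2 ≤ (∫⁻ x, f x ^ 2 ∂μ) * ∫⁻ x, g x ^ 2 ∂μ := by
  have h := ENNReal.lintegral_mul_le_Lp_mul_Lq μ Real.HolderConjugate.two_two hf hg
  simp only [Pi.mul_apply, ENNReal.rpow_ofNat] at h
  calc _ ≤ _ := pow_le_pow_left' h 2
    _ = _ := by
      rw [mul_pow, ← ENNReal.rpow_natCast, ← ENNReal.rpow_natCast, ← ENNReal.rpow_mul,
        ← ENNReal.rpow_mul]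
      norm_num

theorem sq_setLIntegral_le {X : Type*} [MeasurableSpace X] (μ : Measure X) {s : Set X}
    {f : X → ℝ≥0∞} (hf : AEMeasurable f (μ.restrict s)) :
    (∫⁻ x in s, f x ∂μ) ^ 2 ≤ μ s * ∫⁻ x in s, f x ^ 2 ∂μ := by
  simpa using sq_lintegral_mul_le (μ.restrict s) (f := fun _ => 1) aemeasurable_const hf

theorem lintegral_homothety_le {Q : Set E3} (hQ : Convex ℝ Q) (hQm : MeasurableSet Q) {x : E3}
    (hx : x ∈ Q) {t : ℝ} (ht0 : 0 < t) (ht1 : t ≤ 1) (w : E3 → ℝ≥0∞) :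
    ∫⁻ y in Q, w (x + t • (y - x)) ≤ ENNReal.ofReal (t ^ (-3 : ℝ)) * ∫⁻ y in Q, w y := by
  have h1 : ∫⁻ y in Q, w (x + t • (y - x)) ≤ ∫⁻ y, Q.indicator w (x + t • (y - x)) := by
    rw [← lintegral_indicator hQm]
    refine lintegral_mono fun y => ?_
    by_cases hy : y ∈ Q
    · have : x + t • (y - x) ∈ Q := by
        have := hQ hx hy (sub_nonneg.2 ht1) ht0.le (by ring)
        convert this using 1
        module
      simp [hy, this]
    · simp [hy]
  refine h1.trans (le_of_eq ?_)
  rw [lintegral_sub_right_eq_self (μ := volume) (fun y => Q.indicator w (x + t • y)) x]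
  have h2 : ∫⁻ y : E3, Q.indicator w (x + t • y)
      = ∫⁻ y, Q.indicator w (x + y) ∂(Measure.map (fun y : E3 => t • y) volume) :=
    (lintegral_map_equiv (fun y => Q.indicator w (x + y))
      (Homeomorph.smulOfNeZero t ht0.ne').toMeasurableEquiv).symm
  rw [h2, Measure.map_addHaar_smul _ ht0.ne', lintegral_smul_measure,
    lintegral_add_left_eq_self (μ := volume) (fun y => Q.indicator w y) x, lintegral_indicator hQm]
  simp only [finrank_euclideanSpace, Fintype.card_fin, smul_eq_mul]
  rw [abs_of_pos (by positivity), Real.rpow_neg ht0.le]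
  norm_cast

theorem lintegral_Ioc_rpow {a : ℝ} (ha : -1 < a) :
    ∫⁻ t in Ioc (0 : ℝ) 1, ENNReal.ofReal (t ^ a) = ENNReal.ofReal (a + 1)⁻¹ := by
  rw [← ofReal_integral_eq_lintegral_ofReal]
  · rw [← intervalIntegral.integral_of_le zero_le_one, integral_rpow (Or.inl ha)]
    rw [Real.one_rpow, Real.zero_rpow (by linarith), sub_zero, one_div]
  · exact (intervalIntegrable_iff_integrableOn_Ioc_of_le zero_le_one).1
      (intervalIntegral.intervalIntegrable_rpow' ha)
  · exact (ae_restrict_iff' measurableSet_Ioc).2 (Filter.Eventually.of_forall fun t ht =>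
      Real.rpow_nonneg ht.1.le _)

theorem measurable_ofReal_rpow (a : ℝ) : Measurable fun t : ℝ => ENNReal.ofReal (t ^ a) :=
  (measurable_id.pow_const a).ennreal_ofReal

theorem ofReal_rpow_mul {t : ℝ} (ht : 0 < t) (a b : ℝ) :
    ENNReal.ofReal (t ^ a) * ENNReal.ofReal (t ^ b) = ENNReal.ofReal (t ^ (a + b)) := by
  rw [← ENNReal.ofReal_mul (Real.rpow_nonneg ht.le _), Real.rpow_add ht]

theorem ofReal_rpow_pow {t : ℝ} (ht : 0 < t) (a : ℝ) (n : ℕ) :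
    ENNReal.ofReal (t ^ a) ^ n = ENNReal.ofReal (t ^ (a * n)) := by
  rw [← ENNReal.ofReal_pow (Real.rpow_nonneg ht.le _), Real.rpow_mul ht.le, Real.rpow_natCast]

variable {Q : Set E3} (hQ : Convex ℝ Q) (hQm : MeasurableSet Q) {w : E3 → ℝ≥0∞}
  (hw : Measurable w)

include hw in
theorem measurable_segment_comp :
    Measurable fun p : (E3 × ℝ) × E3 => w (p.1.1 + p.1.2 • (p.2 - p.1.1)) :=
  hw.comp (by fun_prop)

include hQ hQm hw in
theorem sq_segment_lintegral_le {x : E3} (hx : x ∈ Q) {t : ℝ} (ht0 : 0 < t) (ht1 : t ≤ 1) :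
    (∫⁻ y in Q, w (x + t • (y - x))) ^ 2
      ≤ volume Q * (ENNReal.ofReal (t ^ (-3 : ℝ)) * ∫⁻ y in Q, w y ^ 2) := by
  refine (sq_setLIntegral_le volume (hw.comp (by fun_prop)).aemeasurable).trans ?_
  gcongr
  exact lintegral_homothety_le hQ hQm hx ht0 ht1 (fun y => w y ^ 2)

include hQ hQm hw in
/-- Integration against the kernel of second order is bounded from `L²` to `L^∞`. -/
theorem sq_lintegral_mul_segment_le {x : E3} (hx : x ∈ Q) :
    (∫⁻ t in Ioc (0 : ℝ) 1, ENNReal.ofReal t * ∫⁻ y in Q, w (x + t • (y - x))) ^ 2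
      ≤ 4 * volume Q * ∫⁻ y in Q, w y ^ 2 := by
  have hm : Measurable fun t : ℝ => ∫⁻ y in Q, w (x + t • (y - x)) :=
    Measurable.lintegral_prod_right' (f := fun p : ℝ × E3 => w (x + p.1 • (p.2 - x)))
      (hw.comp (by fun_prop))
  have h0 : ∫⁻ t in Ioc (0 : ℝ) 1, ENNReal.ofReal t * ∫⁻ y in Q, w (x + t • (y - x))
      = ∫⁻ t in Ioc (0 : ℝ) 1, ENNReal.ofReal (t ^ (-1/4 : ℝ)) *
        (ENNReal.ofReal (t ^ (5/4 : ℝ)) * ∫⁻ y in Q, w (x + t • (y - x))) := by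
    refine setLIntegral_congr_fun measurableSet_Ioc fun t ht => ?_
    rw [← mul_assoc, ofReal_rpow_mul ht.1]
    norm_num
  rw [h0]
  refine (sq_lintegral_mul_le _ (measurable_ofReal_rpow _).aemeasurable
    ((measurable_ofReal_rpow _).mul hm).aemeasurable).trans ?_
  have h1 : ∫⁻ t in Ioc (0 : ℝ) 1, ENNReal.ofReal (t ^ (-1/4 : ℝ)) ^ 2 = 2 := by
    rw [setLIntegral_congr_fun (g := fun t => ENNReal.ofReal (t ^ (-1/2 : ℝ))) measurableSet_Ioc
      fun t ht => by rw [ofReal_rpow_pow ht.1]; norm_num, lintegral_Ioc_rpow (by norm_num)]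
    norm_num
  have h2 : ∫⁻ t in Ioc (0 : ℝ) 1,
      (ENNReal.ofReal (t ^ (5/4 : ℝ)) * ∫⁻ y in Q, w (x + t • (y - x))) ^ 2
      ≤ ∫⁻ t in Ioc (0 : ℝ) 1, ENNReal.ofReal (t ^ (-1/2 : ℝ)) *
        (volume Q * ∫⁻ y in Q, w y ^ 2) := by
    refine setLIntegral_mono' measurableSet_Ioc fun t ht => ?_
    rw [mul_pow, ofReal_rpow_pow ht.1]
    refine (mul_le_mul_right (sq_segment_lintegral_le hQ hQm hw hx ht.1 ht.2) _).trans ?_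
    rw [mul_left_comm (volume Q), ← mul_assoc, ofReal_rpow_mul ht.1]
    norm_num
  rw [lintegral_mul_const _ (measurable_ofReal_rpow _), lintegral_Ioc_rpow (by norm_num)] at h2
  rw [h1]
  calc _ ≤ _ := mul_le_mul_right h2 2
    _ = _ := by
      rw [← mul_assoc, ← mul_assoc]
      norm_num

include hQ hQm hw in
theorem lintegral_lintegral_segment_le {t : ℝ} (ht0 : 0 < t) (ht1 : t ≤ 1) :
    ∫⁻ x in Q, ∫⁻ y in Q, w (x + t • (y - x)) ≤ 8 * (volume Q * ∫⁻ y in Q, w y) := by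
  have key : ∀ {s : ℝ}, 1 / 2 ≤ s → s ≤ 1 →
      ∫⁻ x in Q, ∫⁻ y in Q, w (x + s • (y - x)) ≤ 8 * (volume Q * ∫⁻ y in Q, w y) := by
    intro s hs hs1
    have hs0 : 0 < s := by linarith
    have : ENNReal.ofReal (s ^ (-3 : ℝ)) ≤ 8 := by
      rw [show (8 : ℝ≥0∞) = ENNReal.ofReal 8 by norm_num]
      refine ENNReal.ofReal_le_ofReal ?_
      have := Real.rpow_le_rpow_of_nonpos (by norm_num) hs (show (-3 : ℝ) ≤ 0 by norm_num)
      refine this.trans (le_of_eq ?_)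
      rw [Real.rpow_neg (by norm_num)]
      norm_num
    calc _ ≤ ∫⁻ _ in Q, 8 * ∫⁻ y in Q, w y :=
          setLIntegral_mono' hQm fun x hx =>
            (lintegral_homothety_le hQ hQm hx hs0 hs1 w).trans (by gcongr)
      _ = _ := by rw [setLIntegral_const]; ring
  rcases le_total (1 / 2) t with h | h
  · exact key h ht1
  · rw [lintegral_lintegral_swap]
    · have := key (s := 1 - t) (by linarith) (by linarith)
      convert this using 6
      module
    · exact (hw.comp (by fun_prop)).aemeasurable

include hQ hQm hw in
/-- Integration against the kernel of first order is bounded from `L²` to `L⁴`. -/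
theorem lintegral_segment_pow_four_le :
    ∫⁻ x in Q, (∫⁻ t in Ioc (0 : ℝ) 1, ∫⁻ y in Q, w (x + t • (y - x))) ^ 4
      ≤ 2048 * volume Q ^ 3 * (∫⁻ y in Q, w y ^ 2) ^ 2 := by
  set G := ∫⁻ y in Q, w y ^ 2 with hG
  set p : E3 → ℝ → ℝ≥0∞ := fun x t => ∫⁻ y in Q, w (x + t • (y - x)) with hp
  have hpm : Measurable (Function.uncurry p) :=
    Measurable.lintegral_prod_right' (f := fun q : (E3 × ℝ) × E3 =>
      w (q.1.1 + q.1.2 • (q.2 - q.1.1))) (measurable_segment_comp hw)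
  have hpx : ∀ x, Measurable (p x) := fun x => hpm.comp (measurable_const.prodMk measurable_id)
  have hpt : ∀ t, Measurable fun x => p x t := fun t => hpm.comp (measurable_id.prodMk measurable_const)
  have h34 : ∫⁻ t in Ioc (0 : ℝ) 1, ENNReal.ofReal (t ^ (-3/4 : ℝ)) = 4 := by
    rw [lintegral_Ioc_rpow (by norm_num)]; norm_num
  -- two applications of the Cauchy–Schwarz inequality in `t`
  have hcs : ∀ (f : ℝ → ℝ≥0∞) (hf : Measurable f),
      (∫⁻ t in Ioc (0 : ℝ) 1, f t) ^ 2
        ≤ 4 * ∫⁻ t in Ioc (0 : ℝ) 1, ENNReal.ofReal (t ^ (3/4 : ℝ)) * f t ^ 2 := by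
    intro f hf
    have h0 : ∫⁻ t in Ioc (0 : ℝ) 1, f t
        = ∫⁻ t in Ioc (0 : ℝ) 1, ENNReal.ofReal (t ^ (-3/8 : ℝ)) *
          (ENNReal.ofReal (t ^ (3/8 : ℝ)) * f t) := by
      refine setLIntegral_congr_fun measurableSet_Ioc fun t ht => ?_
      rw [← mul_assoc, ofReal_rpow_mul ht.1]
      norm_num
    rw [h0]
    refine (sq_lintegral_mul_le _ (measurable_ofReal_rpow _).aemeasurable
      ((measurable_ofReal_rpow _).mul hf).aemeasurable).trans (le_of_eq ?_)
    congr 1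
    · rw [← h34]
      refine setLIntegral_congr_fun measurableSet_Ioc fun t ht => ?_
      rw [ofReal_rpow_pow ht.1]; norm_num
    · refine setLIntegral_congr_fun measurableSet_Ioc fun t ht => ?_
      rw [Pi.mul_apply, mul_pow, ofReal_rpow_pow ht.1]; norm_num
  have h4 : ∀ x, (∫⁻ t in Ioc (0 : ℝ) 1, p x t) ^ 4
      ≤ 64 * ∫⁻ t in Ioc (0 : ℝ) 1, ENNReal.ofReal (t ^ (9/4 : ℝ)) * p x t ^ 4 := by
    intro x
    have h1 := hcs _ (hpx x)
    have h2 := hcs _ ((measurable_ofReal_rpow (3/4)).mul ((hpx x).pow_const 2))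
    calc _ = ((∫⁻ t in Ioc (0 : ℝ) 1, p x t) ^ 2) ^ 2 := by ring
      _ ≤ (4 * ∫⁻ t in Ioc (0 : ℝ) 1, ENNReal.ofReal (t ^ (3/4 : ℝ)) * p x t ^ 2) ^ 2 := by
        gcongr
      _ ≤ 16 * (4 * ∫⁻ t in Ioc (0 : ℝ) 1, ENNReal.ofReal (t ^ (3/4 : ℝ)) *
          (ENNReal.ofReal (t ^ (3/4 : ℝ)) * p x t ^ 2) ^ 2) := by
        rw [mul_pow, show (4 : ℝ≥0∞) ^ 2 = 16 by norm_num]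
        gcongr
        exact h2
      _ = 64 * ∫⁻ t in Ioc (0 : ℝ) 1, ENNReal.ofReal (t ^ (3/4 : ℝ)) *
          (ENNReal.ofReal (t ^ (3/4 : ℝ)) * p x t ^ 2) ^ 2 := by
        rw [← mul_assoc]; norm_num
      _ = _ := by
        congr 1
        refine setLIntegral_congr_fun measurableSet_Ioc fun t ht => ?_
        rw [mul_pow, ← mul_assoc, ofReal_rpow_pow ht.1, ofReal_rpow_mul ht.1, ← pow_mul]
        norm_num
  have h5 : ∀ t ∈ Ioc (0 : ℝ) 1, ∫⁻ x in Q, p x t ^ 4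
      ≤ ENNReal.ofReal (t ^ (-3 : ℝ)) * (8 * volume Q ^ 3 * G ^ 2) := by
    intro t ht
    calc ∫⁻ x in Q, p x t ^ 4
        ≤ ∫⁻ x in Q, (volume Q * (ENNReal.ofReal (t ^ (-3 : ℝ)) * G)) *
          (volume Q * ∫⁻ y in Q, w (x + t • (y - x)) ^ 2) := by
          refine setLIntegral_mono' hQm fun x hx => ?_
          rw [show 4 = 2 + 2 from rfl, pow_add]
          gcongr
          · exact sq_segment_lintegral_le hQ hQm hw hx ht.1 ht.2
          · exact sq_setLIntegral_le volume (hw.comp (by fun_prop)).aemeasurable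
      _ = (volume Q * (ENNReal.ofReal (t ^ (-3 : ℝ)) * G)) * (volume Q *
          ∫⁻ x in Q, ∫⁻ y in Q, w (x + t • (y - x)) ^ 2) := by
          have hm2 : Measurable fun x => ∫⁻ y in Q, w (x + t • (y - x)) ^ 2 :=
            Measurable.lintegral_prod_right' (f := fun q : E3 × E3 =>
              w (q.1 + t • (q.2 - q.1)) ^ 2) ((hw.comp (by fun_prop)).pow_const 2)
          rw [lintegral_const_mul _ (hm2.const_mul _), lintegral_const_mul _ hm2]
      _ ≤ (volume Q * (ENNReal.ofReal (t ^ (-3 : ℝ)) * G)) * (volume Q *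
          (8 * (volume Q * G))) := by
          gcongr
          exact lintegral_lintegral_segment_le hQ hQm (hw.pow_const 2) ht.1 ht.2
      _ = _ := by ring
  calc _ ≤ ∫⁻ x in Q, 64 * ∫⁻ t in Ioc (0 : ℝ) 1, ENNReal.ofReal (t ^ (9/4 : ℝ)) * p x t ^ 4 :=
        lintegral_mono fun x => h4 x
    _ = 64 * ∫⁻ t in Ioc (0 : ℝ) 1, ∫⁻ x in Q, ENNReal.ofReal (t ^ (9/4 : ℝ)) * p x t ^ 4 := by
        have hm3 : Measurable fun q : E3 × ℝ => ENNReal.ofReal (q.2 ^ (9/4 : ℝ)) * p q.1 q.2 ^ 4 :=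
          ((measurable_ofReal_rpow _).comp measurable_snd).mul (hpm.pow_const 4)
        rw [lintegral_const_mul _ hm3.lintegral_prod_right', lintegral_lintegral_swap]
        exact hm3.aemeasurable
    _ ≤ 64 * ∫⁻ t in Ioc (0 : ℝ) 1, ENNReal.ofReal (t ^ (-3/4 : ℝ)) *
          (8 * volume Q ^ 3 * G ^ 2) := by
        gcongr 64 * ?_
        refine setLIntegral_mono' measurableSet_Ioc fun t ht => ?_
        rw [lintegral_const_mul _ ((hpt t).pow_const 4)]
        refine (mul_le_mul_right (h5 t ht) _).trans (le_of_eq ?_)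
        rw [← mul_assoc, ofReal_rpow_mul ht.1]
        norm_num
    _ = _ := by
        rw [lintegral_mul_const _ (measurable_ofReal_rpow _), h34]
        ring

end Kernel

section Segments

theorem ennreal_add_pow_le (a b : ℝ≥0∞) (n : ℕ) : (a + b) ^ n ≤ 2 ^ n * (a ^ n + b ^ n) := by
  rcases le_total a b with h | h
  · calc (a + b) ^ n ≤ (2 * b) ^ n := pow_le_pow_left' (by rw [two_mul]; gcongr) n
      _ ≤ _ := by rw [mul_pow]; gcongr; exact le_add_self
  · calc (a + b) ^ n ≤ (2 * a) ^ n := pow_le_pow_left' (by rw [two_mul]; gcongr) n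
      _ ≤ _ := by rw [mul_pow]; gcongr; exact le_self_add

variable {W : Type*} [NormedAddCommGroup W] [NormedSpace ℝ W] [CompleteSpace W]

theorem enorm_sub_le_lintegral {a b : ℝ} (hab : a ≤ b) {f f' : ℝ → W}
    (hf : ∀ t ∈ Icc a b, HasDerivWithinAt f (f' t) (Icc a b) t) (hf' : ContinuousOn f' (Icc a b)) :
    ‖f b - f a‖ₑ ≤ ∫⁻ t in Ioc a b, ‖f' t‖ₑ := by
  rw [← intervalIntegral.integral_eq_sub_of_hasDeriv_right_of_le hab
    (fun t ht => (hf t ht).continuousWithinAt)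
    (fun t ht => ((hf t (Ioo_subset_Icc_self ht)).hasDerivAt
      (Icc_mem_nhds ht.1 ht.2)).hasDerivWithinAt)
    (hf'.intervalIntegrable_of_Icc hab), intervalIntegral.integral_of_le hab]
  exact enorm_integral_le_lintegral_enorm _

theorem exists_measurable_eq_enorm {X : Type*} [TopologicalSpace X] [MeasurableSpace X]
    [BorelSpace X] {W : Type*} [NormedAddCommGroup W] {Q : Set X} (hQ : MeasurableSet Q) {v : X → W}
    (hv : ContinuousOn v Q) : ∃ w : X → ℝ≥0∞, Measurable w ∧ ∀ y ∈ Q, w y = ‖v y‖ₑ := by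
  classical
  exact ⟨Q.piecewise (fun y => ‖v y‖ₑ) 0,
    ContinuousOn.measurable_piecewise hv.enorm continuousOn_const hQ,
    fun y hy => piecewise_eq_of_mem _ _ _ hy⟩

theorem exists_enorm_sub_le {Q : Set E3} (hQ : IsCompact Q) :
    ∃ D : NNReal, ∀ x ∈ Q, ∀ y ∈ Q, ‖y - x‖ₑ ≤ D := by
  obtain ⟨D, hD⟩ := Metric.isBounded_iff.1 hQ.isBounded
  refine ⟨D.toNNReal, fun x hx y hy => ?_⟩
  rw [← edist_eq_enorm_sub, edist_dist]
  exact ENNReal.ofReal_le_ofReal (hD hy hx)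

variable {Q : Set E3} (hQ : Convex ℝ Q) {v : E3 → W} {v' : E3 → E3 →L[ℝ] W}

include hQ in
theorem segment_mem {x y : E3} (hx : x ∈ Q) (hy : y ∈ Q) {t : ℝ} (ht : t ∈ Icc (0 : ℝ) 1) :
    x + t • (y - x) ∈ Q := by
  have := hQ hx hy (sub_nonneg.2 ht.2) ht.1 (by ring)
  convert this using 1
  module

include hQ in
omit [CompleteSpace W] in
theorem hasDerivWithinAt_segment (hv : ∀ y ∈ Q, HasFDerivWithinAt v (v' y) Q y) {x y : E3}
    (hx : x ∈ Q) (hy : y ∈ Q) {t : ℝ} (ht : t ∈ Icc (0 : ℝ) 1) :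
    HasDerivWithinAt (fun t : ℝ => v (x + t • (y - x))) (v' (x + t • (y - x)) (y - x))
      (Icc 0 1) t := by
  have h1 : HasDerivWithinAt (fun t : ℝ => x + t • (y - x)) (y - x) (Icc 0 1) t := by
    simpa using ((hasDerivWithinAt_id t (Icc (0 : ℝ) 1)).smul_const (y - x)).const_add x
  exact (hv _ (segment_mem hQ hx hy ht)).comp_hasDerivWithinAt t h1
    fun s hs => segment_mem hQ hx hy hs

include hQ in
omit [CompleteSpace W] in
theorem continuousOn_segment {Z : Type*} [TopologicalSpace Z] {f : E3 → Z} (hf : ContinuousOn f Q)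
    {x y : E3} (hx : x ∈ Q) (hy : y ∈ Q) :
    ContinuousOn (fun t : ℝ => f (x + t • (y - x))) (Icc 0 1) :=
  hf.comp (by fun_prop) fun _ hs => segment_mem hQ hx hy hs

include hQ in
theorem enorm_le_add_lintegral_segment (hv : ∀ y ∈ Q, HasFDerivWithinAt v (v' y) Q y)
    (hv' : ContinuousOn v' Q) {D : NNReal} (hD : ∀ x ∈ Q, ∀ y ∈ Q, ‖y - x‖ₑ ≤ D) {x y : E3}
    (hx : x ∈ Q) (hy : y ∈ Q) {w : E3 → ℝ≥0∞} (hw : ∀ y ∈ Q, w y = ‖v' y‖ₑ) :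
    ‖v x‖ₑ ≤ ‖v y‖ₑ + D * ∫⁻ t in Ioc (0 : ℝ) 1, w (x + t • (y - x)) := by
  have h1 := enorm_sub_le_lintegral zero_le_one
    (fun t ht => hasDerivWithinAt_segment hQ hv hx hy ht)
    ((continuousOn_segment hQ hv' hx hy).clm_apply continuousOn_const)
  simp only [one_smul, zero_smul, add_zero, add_sub_cancel] at h1
  have h2 : ∫⁻ t in Ioc (0 : ℝ) 1, ‖v' (x + t • (y - x)) (y - x)‖ₑ
      ≤ ∫⁻ t in Ioc (0 : ℝ) 1, D * w (x + t • (y - x)) := by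
    refine setLIntegral_mono' measurableSet_Ioc fun t ht => ?_
    rw [hw _ (segment_mem hQ hx hy (Ioc_subset_Icc_self ht)), mul_comm]
    exact ((v' _).le_opENorm _).trans (by gcongr; exact hD x hx y hy)
  rw [lintegral_const_mul' _ _ ENNReal.coe_ne_top] at h2
  calc ‖v x‖ₑ = ‖v y - (v y - v x)‖ₑ := by simp
    _ ≤ ‖v y‖ₑ + ‖v y - v x‖ₑ := enorm_sub_le
    _ ≤ _ := by gcongr; exact h1.trans h2

include hQ in
theorem enorm_le_add_lintegral_segment₂ {v'' : E3 → E3 →L[ℝ] E3 →L[ℝ] W}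
    (hv : ∀ y ∈ Q, HasFDerivWithinAt v (v' y) Q y)
    (hv' : ∀ y ∈ Q, HasFDerivWithinAt v' (v'' y) Q y)
    (hv'' : ContinuousOn v'' Q) {D : NNReal} (hD : ∀ x ∈ Q, ∀ y ∈ Q, ‖y - x‖ₑ ≤ D) {x y : E3}
    (hx : x ∈ Q) (hy : y ∈ Q) {w : E3 → ℝ≥0∞} (hw : ∀ y ∈ Q, w y = ‖v'' y‖ₑ) :
    ‖v x‖ₑ ≤ ‖v y‖ₑ + D * ‖v' y‖ₑ + (D ^ 2 : NNReal) * ∫⁻ t in Ioc (0 : ℝ) 1,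
      ENNReal.ofReal t * w (x + t • (y - x)) := by
  have hd : ∀ t ∈ Icc (0 : ℝ) 1, HasDerivWithinAt
      (fun t : ℝ => t • v' (x + t • (y - x)) (y - x) - v (x + t • (y - x)))
      (t • v'' (x + t • (y - x)) (y - x) (y - x)) (Icc 0 1) t := by
    intro t ht
    have h1 := (hasDerivWithinAt_segment hQ hv' hx hy ht).clm_apply
      (hasDerivWithinAt_const t (Icc (0 : ℝ) 1) (y - x))
    have h2 := ((hasDerivWithinAt_id t (Icc (0 : ℝ) 1)).smul h1).sub
      (hasDerivWithinAt_segment hQ hv hx hy ht)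
    exact h2.congr_deriv (by simp)
  have h1 := enorm_sub_le_lintegral zero_le_one hd (continuousOn_id.smul
    (((continuousOn_segment hQ hv'' hx hy).clm_apply continuousOn_const).clm_apply
      continuousOn_const))
  simp only [one_smul, zero_smul, add_zero, add_sub_cancel] at h1
  have h2 : ∫⁻ t in Ioc (0 : ℝ) 1, ‖t • v'' (x + t • (y - x)) (y - x) (y - x)‖ₑ
      ≤ ∫⁻ t in Ioc (0 : ℝ) 1, (D ^ 2 : NNReal) *
        (ENNReal.ofReal t * w (x + t • (y - x))) := by
    refine setLIntegral_mono' measurableSet_Ioc fun t ht => ?_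
    rw [hw _ (segment_mem hQ hx hy (Ioc_subset_Icc_self ht)), enorm_smul,
      Real.enorm_of_nonneg ht.1.le, mul_left_comm]
    gcongr
    calc _ ≤ ‖v'' (x + t • (y - x)) (y - x)‖ₑ * ‖y - x‖ₑ := ContinuousLinearMap.le_opENorm _ _
      _ ≤ (‖v'' (x + t • (y - x))‖ₑ * ‖y - x‖ₑ) * ‖y - x‖ₑ := by
        gcongr; exact ContinuousLinearMap.le_opENorm _ _
      _ ≤ (‖v'' (x + t • (y - x))‖ₑ * D) * D := by gcongr <;> exact hD x hx y hy
      _ = _ := by push_cast; ring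
  rw [lintegral_const_mul' _ _ ENNReal.coe_ne_top] at h2
  calc ‖v x‖ₑ = ‖v y - v' y (y - x) + (v' y (y - x) - v y - (0 - v x))‖ₑ := by
        congr 1; abel
    _ ≤ ‖v y - v' y (y - x)‖ₑ + ‖v' y (y - x) - v y - (0 - v x)‖ₑ := enorm_add_le _ _
    _ ≤ (‖v y‖ₑ + D * ‖v' y‖ₑ) + _ := by
        gcongr
        · refine enorm_sub_le.trans ?_
          gcongr
          rw [mul_comm]
          exact ((v' _).le_opENorm _).trans (by gcongr; exact hD x hx y hy)
        · exact h1.trans h2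

theorem ennreal_le_of_mul_le {V a b : ℝ≥0∞} (h0 : V ≠ 0) (h1 : V ≠ ⊤) (h : V * a ≤ b) :
    a ≤ V⁻¹ * b := by
  calc a = V⁻¹ * (V * a) := by rw [← mul_assoc, ENNReal.inv_mul_cancel h0 h1, one_mul]
    _ ≤ _ := by gcongr

theorem sq_mul_sq_le_of_le_add {V a b c N N' N'' x : ℝ≥0∞} {D : NNReal}
    (h1 : V * x ≤ a + D * b + (D ^ 2 : NNReal) * c) (ha : a ^ 2 ≤ V * N) (hb : b ^ 2 ≤ V * N')
    (hc : c ^ 2 ≤ 4 * V * N'') :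
    V ^ 2 * x ^ 2 ≤ 16 * V * (1 + D ^ 2 + 4 * (D ^ 2) ^ 2) * (N + N' + N'') := by
  push_cast at h1
  generalize (D : ℝ≥0∞) = E at *
  have h2 : (a + E * b) ^ 2 ≤ 2 ^ 2 * (V * N + E ^ 2 * (V * N')) := by
    refine (ennreal_add_pow_le _ _ 2).trans ?_
    rw [mul_pow]
    gcongr
  have h3 : (E ^ 2 * c) ^ 2 ≤ (E ^ 2) ^ 2 * (4 * V * N'') := by
    rw [mul_pow]
    gcongr
  rw [← mul_pow]
  calc (V * x) ^ 2 ≤ (a + E * b + E ^ 2 * c) ^ 2 := pow_le_pow_left' h1 2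
    _ ≤ 2 ^ 2 * ((a + E * b) ^ 2 + (E ^ 2 * c) ^ 2) := ennreal_add_pow_le _ _ 2
    _ ≤ 2 ^ 2 * (2 ^ 2 * (V * N + E ^ 2 * (V * N')) + (E ^ 2) ^ 2 * (4 * V * N'')) := by gcongr
    _ = 16 * V * (N + E ^ 2 * N') + 4 * V * (4 * (E ^ 2) ^ 2 * N'') := by ring
    _ ≤ 16 * V * (N + E ^ 2 * N') + 16 * V * (4 * (E ^ 2) ^ 2 * N'') := by gcongr; norm_num
    _ = 16 * V * (N + E ^ 2 * N' + 4 * (E ^ 2) ^ 2 * N'') := by ring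
    _ ≤ 16 * V * ((1 + E ^ 2 + 4 * (E ^ 2) ^ 2) * N + (1 + E ^ 2 + 4 * (E ^ 2) ^ 2) * N' +
          (1 + E ^ 2 + 4 * (E ^ 2) ^ 2) * N'') := by
      gcongr
      · calc N = 1 * N := (one_mul N).symm
          _ ≤ _ := by gcongr; rw [add_assoc]; exact le_self_add
      · rw [add_right_comm]; exact le_add_self
      · exact le_add_self
    _ = _ := by ring

theorem measurable_ofReal_mul_segment {w : E3 → ℝ≥0∞} (hw : Measurable w) (x : E3) :
    Measurable fun q : ℝ × E3 => ENNReal.ofReal q.1 * w (x + q.1 • (q.2 - x)) :=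
  Measurable.mul (by fun_prop) (hw.comp (by fun_prop))

include hQ in
/-- The Sobolev inequality `H² ⊂ L^∞` on a convex body. -/
theorem exists_sup_bound (hQc : IsCompact Q) (hV : volume Q ≠ 0) :
    ∃ C : NNReal, ∀ (v : E3 → W) (v' : E3 → E3 →L[ℝ] W) (v'' : E3 → E3 →L[ℝ] E3 →L[ℝ] W),
      (∀ y ∈ Q, HasFDerivWithinAt v (v' y) Q y) → (∀ y ∈ Q, HasFDerivWithinAt v' (v'' y) Q y) →
      ContinuousOn v'' Q → ∀ x ∈ Q, ‖v x‖ₑ ^ 2 ≤ C * ((∫⁻ y in Q, ‖v y‖ₑ ^ 2) +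
        (∫⁻ y in Q, ‖v' y‖ₑ ^ 2) + ∫⁻ y in Q, ‖v'' y‖ₑ ^ 2) := by
  obtain ⟨D, hD⟩ := exists_enorm_sub_le hQc
  have hVt : volume Q ≠ ⊤ := hQc.measure_lt_top.ne
  have hQm := hQc.measurableSet
  set V := (volume Q).toNNReal with hVd
  have hVV : volume Q = V := (ENNReal.coe_toNNReal hVt).symm
  refine ⟨(V ^ 2)⁻¹ * (16 * V * (1 + D ^ 2 + 4 * (D ^ 2) ^ 2)), fun v v' v'' hv hv' hv'' x hx => ?_⟩
  have hvc : ContinuousOn v Q := fun y hy => (hv y hy).continuousWithinAt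
  have hvc' : ContinuousOn v' Q := fun y hy => (hv' y hy).continuousWithinAt
  obtain ⟨w, hw, hwd⟩ := exists_measurable_eq_enorm (W := E3 →L[ℝ] E3 →L[ℝ] W)
    (v := v'') hQm hv''
  have hw2 : ∫⁻ y in Q, w y ^ 2 = ∫⁻ y in Q, ‖v'' y‖ₑ ^ 2 :=
    setLIntegral_congr_fun hQm fun y hy => by rw [hwd y hy]
  have hma : AEMeasurable (fun y => ‖v y‖ₑ) (volume.restrict Q) := hvc.enorm.aemeasurable hQm
  have hmb : AEMeasurable (fun y => ‖v' y‖ₑ) (volume.restrict Q) := hvc'.enorm.aemeasurable hQm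
  have hm3 : Measurable fun q : ℝ × E3 => ENNReal.ofReal q.1 * w (x + q.1 • (q.2 - x)) :=
    measurable_ofReal_mul_segment hw x
  have h1 : volume Q * ‖v x‖ₑ ≤ (∫⁻ y in Q, ‖v y‖ₑ) + D * (∫⁻ y in Q, ‖v' y‖ₑ) + (D ^ 2 : NNReal) *
      ∫⁻ t in Ioc (0 : ℝ) 1, ENNReal.ofReal t * ∫⁻ y in Q, w (x + t • (y - x)) := by
    calc volume Q * ‖v x‖ₑ = ∫⁻ _ in Q, ‖v x‖ₑ := by rw [setLIntegral_const, mul_comm]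
      _ ≤ ∫⁻ y in Q, (‖v y‖ₑ + D * ‖v' y‖ₑ + (D ^ 2 : NNReal) * ∫⁻ t in Ioc (0 : ℝ) 1,
          ENNReal.ofReal t * w (x + t • (y - x))) := setLIntegral_mono' hQm fun y hy =>
            enorm_le_add_lintegral_segment₂ hQ hv hv' hv'' hD hx hy hwd
      _ = _ := by
        have hmab : AEMeasurable (fun y => ‖v y‖ₑ + D * ‖v' y‖ₑ) (volume.restrict Q) :=
          hma.add (hmb.const_mul _)
        rw [lintegral_add_left' hmab, lintegral_add_left' hma,
          lintegral_const_mul' _ _ ENNReal.coe_ne_top, lintegral_const_mul' _ _ ENNReal.coe_ne_top,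
          lintegral_lintegral_swap (f := fun y t => ENNReal.ofReal t * w (x + t • (y - x)))
          (hm3.comp measurable_swap).aemeasurable]
        congr 3 with t
        rw [lintegral_const_mul' _ _ ENNReal.ofReal_ne_top]
  have hc := sq_lintegral_mul_segment_le hQ hQm hw hx
  rw [hw2] at hc
  have h2 := sq_mul_sq_le_of_le_add h1 (sq_setLIntegral_le volume hma)
    (sq_setLIntegral_le volume hmb) hc
  have h3 := ennreal_le_of_mul_le (pow_ne_zero 2 hV) (ENNReal.pow_ne_top hVt) h2
  refine h3.trans (le_of_eq ?_)
  have hV0 : V ^ 2 ≠ 0 := by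
    refine pow_ne_zero 2 fun h => hV ?_
    rw [hVV, h]; rfl
  rw [hVV, ENNReal.coe_mul, ENNReal.coe_inv hV0]
  push_cast
  ring

include hQ in
/-- The Sobolev inequality `H¹ ⊂ L⁴` on a convex body. -/
theorem exists_L4_bound (hQc : IsCompact Q) (hV : volume Q ≠ 0) :
    ∃ C : NNReal, ∀ (v : E3 → W) (v' : E3 → E3 →L[ℝ] W),
      (∀ y ∈ Q, HasFDerivWithinAt v (v' y) Q y) → ContinuousOn v' Q →
      ∫⁻ x in Q, ‖v x‖ₑ ^ 4 ≤ C * ((∫⁻ y in Q, ‖v y‖ₑ ^ 2) + ∫⁻ y in Q, ‖v' y‖ₑ ^ 2) ^ 2 := by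
  obtain ⟨D, hD⟩ := exists_enorm_sub_le hQc
  have hVt : volume Q ≠ ⊤ := hQc.measure_lt_top.ne
  have hQm := hQc.measurableSet
  set V := (volume Q).toNNReal with hVd
  have hVV : volume Q = V := (ENNReal.coe_toNNReal hVt).symm
  refine ⟨(V ^ 4)⁻¹ * (2 ^ 4 * (V ^ 3 + D ^ 4 * (2048 * V ^ 3))), fun v v' hv hv' => ?_⟩
  have hvc : ContinuousOn v Q := fun y hy => (hv y hy).continuousWithinAt
  obtain ⟨w, hw, hwd⟩ := exists_measurable_eq_enorm hQm hv'
  have hw2 : ∫⁻ y in Q, w y ^ 2 = ∫⁻ y in Q, ‖v' y‖ₑ ^ 2 :=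
    setLIntegral_congr_fun hQm fun y hy => by rw [hwd y hy]
  have hma : AEMeasurable (fun y => ‖v y‖ₑ) (volume.restrict Q) := hvc.enorm.aemeasurable hQm
  have h1 : ∀ x ∈ Q, volume Q * ‖v x‖ₑ ≤ (∫⁻ y in Q, ‖v y‖ₑ) + D *
      ∫⁻ t in Ioc (0 : ℝ) 1, ∫⁻ y in Q, w (x + t • (y - x)) := by
    intro x hx
    have hm3 : Measurable fun q : ℝ × E3 => w (x + q.1 • (q.2 - x)) := hw.comp (by fun_prop)
    calc volume Q * ‖v x‖ₑ = ∫⁻ _ in Q, ‖v x‖ₑ := by rw [setLIntegral_const, mul_comm]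
      _ ≤ ∫⁻ y in Q, (‖v y‖ₑ + D * ∫⁻ t in Ioc (0 : ℝ) 1, w (x + t • (y - x))) :=
          setLIntegral_mono' hQm fun y hy => enorm_le_add_lintegral_segment hQ hv hv' hD hx hy hwd
      _ = _ := by
        rw [lintegral_add_left' hma, lintegral_const_mul' _ _ ENNReal.coe_ne_top,
          lintegral_lintegral_swap (f := fun y t => w (x + t • (y - x)))
          (hm3.comp measurable_swap).aemeasurable]
  have h2 : volume Q ^ 4 * ∫⁻ x in Q, ‖v x‖ₑ ^ 4 ≤ 2 ^ 4 * (volume Q ^ 3 + D ^ 4 *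
      (2048 * volume Q ^ 3)) * ((∫⁻ y in Q, ‖v y‖ₑ ^ 2) + ∫⁻ y in Q, ‖v' y‖ₑ ^ 2) ^ 2 := by
    have ha := sq_setLIntegral_le volume hma
    have hc := lintegral_segment_pow_four_le hQ hQm hw
    rw [hw2] at hc
    set N := ∫⁻ y in Q, ‖v y‖ₑ ^ 2
    set N' := ∫⁻ y in Q, ‖v' y‖ₑ ^ 2
    calc volume Q ^ 4 * ∫⁻ x in Q, ‖v x‖ₑ ^ 4 = ∫⁻ x in Q, (volume Q * ‖v x‖ₑ) ^ 4 := by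
          rw [← lintegral_const_mul' _ _ (ENNReal.pow_ne_top hVt)]
          simp only [mul_pow]
      _ ≤ ∫⁻ x in Q, 2 ^ 4 * ((∫⁻ y in Q, ‖v y‖ₑ) ^ 4 + D ^ 4 *
          (∫⁻ t in Ioc (0 : ℝ) 1, ∫⁻ y in Q, w (x + t • (y - x))) ^ 4) := by
          refine setLIntegral_mono' hQm fun x hx => ?_
          refine (pow_le_pow_left' (h1 x hx) 4).trans ((ennreal_add_pow_le _ _ 4).trans ?_)
          rw [mul_pow]
      _ = 2 ^ 4 * (volume Q * ((∫⁻ y in Q, ‖v y‖ₑ) ^ 2) ^ 2 + D ^ 4 * ∫⁻ x in Q,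
          (∫⁻ t in Ioc (0 : ℝ) 1, ∫⁻ y in Q, w (x + t • (y - x))) ^ 4) := by
          rw [lintegral_const_mul' _ _ (by norm_num), lintegral_add_left measurable_const,
            setLIntegral_const, lintegral_const_mul' _ _ (ENNReal.pow_ne_top ENNReal.coe_ne_top)]
          ring
      _ ≤ 2 ^ 4 * (volume Q * (volume Q * N) ^ 2 + D ^ 4 *
          (2048 * volume Q ^ 3 * N' ^ 2)) := by gcongr
      _ ≤ 2 ^ 4 * (volume Q ^ 3 * (N + N') ^ 2 + D ^ 4 * (2048 * volume Q ^ 3 * (N + N') ^ 2)) := by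
          rw [mul_pow, ← mul_assoc, ← pow_succ' (volume Q) 2]
          gcongr
          · exact le_self_add
          · exact le_add_self
      _ = _ := by ring
  have h3 := ennreal_le_of_mul_le (pow_ne_zero 4 hV) (ENNReal.pow_ne_top hVt) h2
  refine h3.trans (le_of_eq ?_)
  have hV0 : V ^ 4 ≠ 0 := by
    refine pow_ne_zero 4 fun h => hV ?_
    rw [hVV, h]; rfl
  rw [hVV, ENNReal.coe_mul, ENNReal.coe_inv hV0]
  push_cast
  ring

end Segments

section Trace

variable {W : Type*} [NormedAddCommGroup W] [NormedSpace ℝ W] [CompleteSpace W]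

/-- The vector `e_0` that points into the half-space. -/
def inVec : E3 := EuclideanSpace.single 0 1

theorem planeEmb_add_smul (z : EuclideanSpace ℝ (Fin 2)) (t : ℝ) :
    planeEmb z + t • inVec = WithLp.toLp 2 (Fin.cons t z.ofLp) := by
  ext i
  refine Fin.cases ?_ (fun j => ?_) i <;> simp [planeEmb, inVec]

theorem lintegral_plane_prod {f : E3 → ℝ≥0∞} (hf : Measurable f) :
    ∫⁻ z : EuclideanSpace ℝ (Fin 2), ∫⁻ t : ℝ, f (planeEmb z + t • inVec) = ∫⁻ y, f y := by
  have h1 := (volume_preserving_piFinSuccAbove (fun _ : Fin 3 => ℝ) 0).symm.comp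
    ((MeasurePreserving.id (volume : Measure ℝ)).prod
      (EuclideanSpace.volume_preserving_symm_measurableEquiv_toLp (Fin 2)))
  have h2 := (EuclideanSpace.volume_preserving_symm_measurableEquiv_toLp (Fin 3)).symm.comp h1
  rw [← h2.lintegral_comp hf, lintegral_prod_symm']
  · refine lintegral_congr fun z => lintegral_congr fun t => ?_
    rw [planeEmb_add_smul]
    congr 1
    ext i
    refine Fin.cases ?_ (fun j => ?_) i <;> simp [MeasurableEquiv.piFinSuccAbove]
  · exact hf.comp h2.measurable

theorem sq_le_of_mul_le_add {E x a b N N' : ℝ≥0∞} (h0 : E ≠ 0) (hE : E ≠ ⊤)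
    (h : E * x ≤ a + E * b) (ha : a ^ 2 ≤ E * N) (hb : b ^ 2 ≤ E * N') :
    x ^ 2 ≤ 4 * (E⁻¹ * N + E * N') := by
  have h1 : E ^ 2 * x ^ 2 ≤ 4 * (E * N + E ^ 2 * (E * N')) := by
    rw [← mul_pow]
    calc (E * x) ^ 2 ≤ (a + E * b) ^ 2 := pow_le_pow_left' h 2
      _ ≤ 2 ^ 2 * (a ^ 2 + (E * b) ^ 2) := ennreal_add_pow_le _ _ 2
      _ ≤ 4 * (E * N + E ^ 2 * (E * N')) := by
        rw [mul_pow]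
        gcongr
        norm_num
  have h2 := ennreal_le_of_mul_le (pow_ne_zero 2 h0) (ENNReal.pow_ne_top hE) h1
  refine h2.trans (le_of_eq ?_)
  have hi : (E ^ 2)⁻¹ * (E * E) = 1 := by
    rw [← sq, ENNReal.inv_mul_cancel (pow_ne_zero 2 h0) (ENNReal.pow_ne_top hE)]
  have hi2 : (E ^ 2)⁻¹ * E = E⁻¹ := by
    rw [ENNReal.inv_pow, sq, mul_assoc, ENNReal.inv_mul_cancel h0 hE, mul_one]
  calc _ = 4 * ((E ^ 2)⁻¹ * E * N + (E ^ 2)⁻¹ * (E * E) * (E * N')) := by ring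
    _ = _ := by rw [hi, hi2, one_mul]

theorem lintegral_plane_prod_le {D : Set (EuclideanSpace ℝ (Fin 2))} (hD : MeasurableSet D)
    {B : Set E3} (hB : MeasurableSet B) {ε : ℝ}
    (hDB : ∀ z ∈ D, ∀ t ∈ Icc (0 : ℝ) ε, planeEmb z + t • inVec ∈ B) {w : E3 → ℝ≥0∞}
    (hw : Measurable w) :
    ∫⁻ z in D, ∫⁻ t in Ioc (0 : ℝ) ε, w (planeEmb z + t • inVec) ≤ ∫⁻ y in B, w y := by
  rw [← lintegral_indicator hB, ← lintegral_plane_prod (hw.indicator hB)]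
  refine (setLIntegral_mono' hD fun z hz => ?_).trans (setLIntegral_le_lintegral _ _)
  refine (setLIntegral_mono' measurableSet_Ioc fun t ht => ?_).trans (setLIntegral_le_lintegral _ _)
  rw [indicator_of_mem (hDB z hz t (Ioc_subset_Icc_self ht))]

/-- The trace inequality with a parameter. -/
theorem lintegral_trace_le {D : Set (EuclideanSpace ℝ (Fin 2))} (hD : MeasurableSet D)
    {B : Set E3} (hB : MeasurableSet B) {ε : ℝ} (hε : 0 < ε)
    (hDB : ∀ z ∈ D, ∀ t ∈ Icc (0 : ℝ) ε, planeEmb z + t • inVec ∈ B) {v : E3 → W}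
    {v' : E3 → E3 →L[ℝ] W} (hv : ∀ y ∈ B, HasFDerivWithinAt v (v' y) B y)
    (hv' : ContinuousOn v' B) :
    ∫⁻ z in D, ‖v (planeEmb z)‖ₑ ^ 2 ≤ 4 * (ENNReal.ofReal ε⁻¹ * (∫⁻ y in B, ‖v y‖ₑ ^ 2)
      + ENNReal.ofReal ε * ∫⁻ y in B, ‖v' y‖ₑ ^ 2) := by
  have hvc : ContinuousOn v B := fun y hy => (hv y hy).continuousWithinAt
  obtain ⟨a, ha, hav⟩ := exists_measurable_eq_enorm hB hvc
  obtain ⟨b, hb, hbv⟩ := exists_measurable_eq_enorm (W := E3 →L[ℝ] W) (v := v') hB hv'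
  have hpm : Measurable fun p : EuclideanSpace ℝ (Fin 2) × ℝ => planeEmb p.1 + p.2 • inVec :=
    ((continuous_planeEmb.comp continuous_fst).add
      (continuous_snd.smul continuous_const)).measurable
  have hzm : ∀ z, Measurable fun t : ℝ => planeEmb z + t • inVec := fun z =>
    hpm.comp (measurable_const.prodMk measurable_id)
  have key : ∀ z ∈ D, ‖v (planeEmb z)‖ₑ ^ 2 ≤ 4 * (ENNReal.ofReal ε⁻¹ *
      (∫⁻ t in Ioc (0 : ℝ) ε, a (planeEmb z + t • inVec) ^ 2) + ENNReal.ofReal ε *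
        ∫⁻ t in Ioc (0 : ℝ) ε, b (planeEmb z + t • inVec) ^ 2) := by
    intro z hz
    have hd : ∀ t ∈ Icc (0 : ℝ) ε, HasDerivWithinAt (fun t : ℝ => v (planeEmb z + t • inVec))
        (v' (planeEmb z + t • inVec) inVec) (Icc 0 ε) t := by
      intro t ht
      have h1 : HasDerivWithinAt (fun t : ℝ => planeEmb z + t • inVec) inVec (Icc 0 ε) t := by
        simpa using ((hasDerivWithinAt_id t (Icc (0 : ℝ) ε)).smul_const inVec).const_add (planeEmb z)
      exact (hv _ (hDB z hz t ht)).comp_hasDerivWithinAt t h1 fun s hs => hDB z hz s hs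
    have hc : ContinuousOn (fun t : ℝ => v' (planeEmb z + t • inVec) inVec) (Icc 0 ε) :=
      (hv'.comp (by fun_prop) fun s hs => hDB z hz s hs).clm_apply continuousOn_const
    have h1 : ∀ t ∈ Ioc (0 : ℝ) ε, ‖v (planeEmb z)‖ₑ ≤ a (planeEmb z + t • inVec) +
        ∫⁻ t in Ioc (0 : ℝ) ε, b (planeEmb z + t • inVec) := by
      intro t ht
      have hsub : Icc (0 : ℝ) t ⊆ Icc 0 ε := Icc_subset_Icc_right ht.2
      have h2 := enorm_sub_le_lintegral ht.1.le (fun s hs => (hd s (hsub hs)).mono hsub)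
        (hc.mono hsub)
      simp only [zero_smul, add_zero] at h2
      calc ‖v (planeEmb z)‖ₑ = ‖v (planeEmb z + t • inVec) -
            (v (planeEmb z + t • inVec) - v (planeEmb z))‖ₑ := by simp
        _ ≤ ‖v (planeEmb z + t • inVec)‖ₑ + ‖v (planeEmb z + t • inVec) - v (planeEmb z)‖ₑ :=
            enorm_sub_le
        _ ≤ _ := by
          rw [hav _ (hDB z hz t (Ioc_subset_Icc_self ht))]
          gcongr
          refine h2.trans ((setLIntegral_mono' measurableSet_Ioc fun s hs => ?_).trans
            (lintegral_mono_set (Ioc_subset_Ioc_right ht.2)))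
          have hs' := hDB z hz s (hsub (Ioc_subset_Icc_self hs))
          rw [hbv _ hs']
          refine ((v' _).le_opENorm _).trans (le_of_eq ?_)
          rw [show ‖inVec‖ₑ = 1 by simp [inVec, ← ofReal_norm], mul_one]
    have h3 : ENNReal.ofReal ε * ‖v (planeEmb z)‖ₑ ≤
        (∫⁻ t in Ioc (0 : ℝ) ε, a (planeEmb z + t • inVec)) + ENNReal.ofReal ε *
        ∫⁻ t in Ioc (0 : ℝ) ε, b (planeEmb z + t • inVec) := by
      calc _ = ∫⁻ _ in Ioc (0 : ℝ) ε, ‖v (planeEmb z)‖ₑ := by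
            rw [setLIntegral_const, Real.volume_Ioc, sub_zero, mul_comm]
        _ ≤ ∫⁻ t in Ioc (0 : ℝ) ε, (a (planeEmb z + t • inVec) +
            ∫⁻ t in Ioc (0 : ℝ) ε, b (planeEmb z + t • inVec)) :=
          setLIntegral_mono' measurableSet_Ioc h1
        _ = _ := by
          rw [lintegral_add_right _ measurable_const, setLIntegral_const, Real.volume_Ioc,
            sub_zero, mul_comm (ENNReal.ofReal ε)]
    have ha2 := sq_setLIntegral_le volume (s := Ioc (0 : ℝ) ε) (ha.comp (hzm z)).aemeasurable
    have hb2 := sq_setLIntegral_le volume (s := Ioc (0 : ℝ) ε) (hb.comp (hzm z)).aemeasurable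
    rw [Real.volume_Ioc, sub_zero] at ha2 hb2
    simp only [Function.comp_apply] at ha2 hb2
    have h0 : ENNReal.ofReal ε ≠ 0 := (ENNReal.ofReal_pos.2 hε).ne'
    rw [ENNReal.ofReal_inv_of_pos hε]
    have hE : ENNReal.ofReal ε ≠ ⊤ := ENNReal.ofReal_ne_top
    exact sq_le_of_mul_le_add h0 hE h3 ha2 hb2
  have hia : Measurable fun z => ∫⁻ t in Ioc (0 : ℝ) ε, a (planeEmb z + t • inVec) ^ 2 :=
    Measurable.lintegral_prod_right' (f := fun p : EuclideanSpace ℝ (Fin 2) × ℝ =>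
      a (planeEmb p.1 + p.2 • inVec) ^ 2) ((ha.comp hpm).pow_const 2)
  have hib : Measurable fun z => ∫⁻ t in Ioc (0 : ℝ) ε, b (planeEmb z + t • inVec) ^ 2 :=
    Measurable.lintegral_prod_right' (f := fun p : EuclideanSpace ℝ (Fin 2) × ℝ =>
      b (planeEmb p.1 + p.2 • inVec) ^ 2) ((hb.comp hpm).pow_const 2)
  refine (setLIntegral_mono' hD key).trans ?_
  rw [lintegral_const_mul' _ _ (by norm_num),
    lintegral_add_left (hia.const_mul _), lintegral_const_mul _ hia, lintegral_const_mul _ hib]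
  have h1 := lintegral_plane_prod_le hD hB hDB (ha.pow_const 2)
  have h2 := lintegral_plane_prod_le hD hB hDB (hb.pow_const 2)
  rw [setLIntegral_congr_fun (g := fun y => ‖v y‖ₑ ^ 2) hB fun y hy => by rw [hav y hy]] at h1
  rw [setLIntegral_congr_fun (g := fun y => ‖v' y‖ₑ ^ 2) hB fun y hy => by rw [hbv y hy]] at h2
  gcongr

end Trace

end Coulomb

namespace Coulomb

section Extension

variable {S₁ S₂ E₁ E₂ F : Type*} [AddCommGroup S₁] [Module ℝ S₁] [AddCommGroup S₂] [Module ℝ S₂]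
  [NormedAddCommGroup E₁] [NormedSpace ℝ E₁] [NormedAddCommGroup E₂] [NormedSpace ℝ E₂]
  [NormedAddCommGroup F] [NormedSpace ℝ F] [CompleteSpace F]

/-- A bounded linear map on a dense subspace extends continuously. -/
theorem exists_extension {e : S₁ →ₗ[ℝ] E₁} (he : DenseRange e) (f : S₁ →ₗ[ℝ] F) {C : ℝ}
    (hf : ∀ x, ‖f x‖ ≤ C * ‖e x‖) : ∃ T : E₁ →L[ℝ] F, ∀ x, T (e x) = f x :=
  ⟨f.extendOfNorm e, LinearMap.extendOfNorm_eq he ⟨C, hf⟩⟩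

/-- A bounded bilinear map on dense subspaces extends continuously. -/
theorem exists_extension₂ {e₁ : S₁ →ₗ[ℝ] E₁} (he₁ : DenseRange e₁) {e₂ : S₂ →ₗ[ℝ] E₂}
    (he₂ : DenseRange e₂) (B : S₁ →ₗ[ℝ] S₂ →ₗ[ℝ] F) {C : ℝ}
    (hB : ∀ x y, ‖B x y‖ ≤ C * ‖e₁ x‖ * ‖e₂ y‖) :
    ∃ T : E₁ →L[ℝ] E₂ →L[ℝ] F, ∀ x y, T (e₁ x) (e₂ y) = B x y := by
  have h1 : ∀ x y, (B x).extendOfNorm e₂ (e₂ y) = B x y := fun x =>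
    LinearMap.extendOfNorm_eq he₂ ⟨_, hB x⟩
  have hext : ∀ {T T' : E₂ →L[ℝ] F}, (∀ y, T (e₂ y) = T' (e₂ y)) → T = T' := fun h =>
    ContinuousLinearMap.coeFn_injective
      (he₂.equalizer (ContinuousLinearMap.continuous _) (ContinuousLinearMap.continuous _)
        (funext h))
  let f : S₁ →ₗ[ℝ] (E₂ →L[ℝ] F) :=
    { toFun := fun x => (B x).extendOfNorm e₂
      map_add' := fun x x' => hext fun y => by rw [h1, map_add]; simp [h1]
      map_smul' := fun c x => hext fun y => by rw [h1, map_smul]; simp [h1] }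
  have hf : ∀ x, ‖f x‖ ≤ max C 0 * ‖e₁ x‖ := by
    intro x
    refine ContinuousLinearMap.opNorm_le_bound _ (by positivity) fun y => ?_
    refine he₂.induction_on (p := fun y => ‖f x y‖ ≤ max C 0 * ‖e₁ x‖ * ‖y‖) y
      (isClosed_le (f x).continuous.norm (continuous_const.mul continuous_norm)) fun y => ?_
    change ‖(B x).extendOfNorm e₂ (e₂ y)‖ ≤ _
    rw [h1]
    refine (hB x y).trans ?_
    gcongr
    exact le_max_left _ _
  obtain ⟨T, hT⟩ := exists_extension he₁ f hf
  exact ⟨T, fun x y => by rw [hT]; exact h1 x y⟩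

end Extension

section Graph

variable {A B C SA SB SC : Type*} [TopologicalSpace A] [TopologicalSpace B] [TopologicalSpace C]
  [T2Space C]

/-- The closure of the graph of a densely defined map is the graph of its continuous extension. -/
theorem mem_closure_graph {a : SA → A} (ha : DenseRange a) {c : SC → C} {R : SA → SC → Prop}
    {F : A → C} (hF : Continuous F) (hex : ∀ x, ∃ z, R x z) (hR : ∀ x z, R x z → c z = F (a x))
    (p : A) (r : C) :
    (p, r) ∈ closure {q : A × C | ∃ x z, R x z ∧ q = (a x, c z)} ↔ r = F p := by
  constructor
  · intro h
    have hc : IsClosed {q : A × C | q.2 = F q.1} :=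
      isClosed_eq continuous_snd (hF.comp continuous_fst)
    refine closure_minimal ?_ hc h
    rintro _ ⟨x, z, hxz, rfl⟩
    exact hR x z hxz
  · rintro rfl
    refine ha.induction_on (p := fun p => (p, F p) ∈ closure {q : A × C | ∃ x z, R x z ∧
      q = (a x, c z)}) p (isClosed_closure.preimage (continuous_id.prodMk hF)) fun x => ?_
    obtain ⟨z, hz⟩ := hex x
    exact subset_closure ⟨x, z, hz, by rw [hR x z hz]⟩

theorem mem_closure_graph₂ {a : SA → A} (ha : DenseRange a) {b : SB → B} (hb : DenseRange b)
    {c : SC → C} {R : SA → SB → SC → Prop} {F : A × B → C} (hF : Continuous F)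
    (hex : ∀ x y, ∃ z, R x y z) (hR : ∀ x y z, R x y z → c z = F (a x, b y))
    (p : A) (q : B) (r : C) :
    (p, q, r) ∈ closure {s : A × B × C | ∃ x y z, R x y z ∧ s = (a x, b y, c z)} ↔
      r = F (p, q) := by
  rw [← mem_closure_graph (ha.prodMap hb) (c := c) (R := fun x z => R x.1 x.2 z) hF
    (fun x => hex x.1 x.2) (fun x z h => hR x.1 x.2 z h) (p, q) r]
  rw [show (p, q, r) = Homeomorph.prodAssoc A B C ((p, q), r) from rfl,
    ← mem_preimage, (Homeomorph.prodAssoc A B C).preimage_closure]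
  refine Iff.of_eq (congrArg (fun S => ((p, q), r) ∈ closure S) ?_)
  ext ⟨⟨x, y⟩, z⟩
  simp [Prod.ext_iff, and_assoc]
  rfl

end Graph

end Coulomb

namespace Coulomb

section JetBounds

variable {E E' W W₁ W₂ W₃ : Type*} [NormedAddCommGroup E] [NormedSpace ℝ E]
  [NormedAddCommGroup E'] [NormedSpace ℝ E']
  [NormedAddCommGroup W] [NormedSpace ℝ W]
  [NormedAddCommGroup W₁] [NormedSpace ℝ W₁] [NormedAddCommGroup W₂] [NormedSpace ℝ W₂]
  [NormedAddCommGroup W₃] [NormedSpace ℝ W₃] {Ω : Set E} (hΩ : UniqueDiffOn ℝ Ω)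

include hΩ in
theorem exists_jet_bound {F : E → W} (hF : ContDiffOn ℝ ∞ F Ω) {B : Set E} (hB : IsCompact B)
    (hBΩ : B ⊆ Ω) (m : ℕ) :
    ∃ C : ℝ, 0 ≤ C ∧ ∀ i ≤ m, ∀ y ∈ B, ‖iteratedFDerivWithin ℝ i F Ω y‖ ≤ C := by
  have h1 : ∀ i : ℕ, ∃ C : ℝ, 0 ≤ C ∧ ∀ y ∈ B, ‖iteratedFDerivWithin ℝ i F Ω y‖ ≤ C := by
    intro i
    obtain ⟨C, hC⟩ := hB.exists_bound_of_continuousOn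
      ((hF.continuousOn_iteratedFDerivWithin (m := i) (mod_cast le_top) hΩ).mono hBΩ)
    exact ⟨max C 0, le_max_right _ _, fun y hy => (hC y hy).trans (le_max_left _ _)⟩
  choose C hC0 hC using h1
  exact ⟨∑ i ∈ Finset.range (m + 1), C i, Finset.sum_nonneg fun i _ => hC0 i, fun i hi y hy =>
    (hC i y hy).trans (Finset.single_le_sum (f := C) (fun i _ => hC0 i)
      (Finset.mem_range.2 (Nat.lt_succ_of_le hi)))⟩

include hΩ in
/-- The derivatives of `Ψ F` are bounded by those of `F`, for a smooth linear coefficient `Ψ`. -/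
theorem exists_jet_clm_apply_le {Ψ : E → W₁ →L[ℝ] W₂} (hΨ : ContDiffOn ℝ ∞ Ψ Ω) {B : Set E}
    (hB : IsCompact B) (hBΩ : B ⊆ Ω) (j : ℕ) :
    ∃ C : ℝ, 0 ≤ C ∧ ∀ F : E → W₁, ContDiffOn ℝ ∞ F Ω → ∀ y ∈ B,
      ‖iteratedFDerivWithin ℝ j (fun y => Ψ y (F y)) Ω y‖
        ≤ C * ∑ p ∈ Finset.range (j + 1), ‖iteratedFDerivWithin ℝ p F Ω y‖ := by
  obtain ⟨C, hC0, hC⟩ := exists_jet_bound hΩ hΨ hB hBΩ j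
  refine ⟨2 ^ j * C, by positivity, fun F hF y hy => ?_⟩
  have h1 := (ContinuousLinearMap.id ℝ (W₁ →L[ℝ] W₂)).norm_iteratedFDerivWithin_le_of_bilinear_of_le_one
    hΨ hF hΩ (hBΩ hy) (n := j) (mod_cast le_top) ContinuousLinearMap.norm_id_le
  refine h1.trans ?_
  rw [← Finset.sum_range_reflect, Finset.mul_sum]
  refine Finset.sum_le_sum fun p hp => ?_
  have hp' : p ≤ j := Nat.lt_succ_iff.1 (Finset.mem_range.1 hp)
  have e1 : j + 1 - 1 - p = j - p := by omega
  rw [e1, Nat.sub_sub_self hp']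
  gcongr
  · have : j.choose (j - p) ≤ 2 ^ j := by
      rw [← Nat.sum_range_choose j]
      exact Finset.single_le_sum (f := fun i => j.choose i) (fun _ _ => Nat.zero_le _)
        (Finset.mem_range.2 (by omega))
    exact_mod_cast this
  · exact hC _ (Nat.sub_le _ _) y hy

include hΩ in
/-- The derivatives of `Ψ(F, G)` are bounded by products of derivatives of `F` and `G`, for a
smooth bilinear coefficient `Ψ`. -/
theorem exists_jet_clm_apply₂_le {Ψ : E → W₁ →L[ℝ] W₂ →L[ℝ] W₃} (hΨ : ContDiffOn ℝ ∞ Ψ Ω)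
    {B : Set E} (hB : IsCompact B) (hBΩ : B ⊆ Ω) (j : ℕ) :
    ∃ C : ℝ, 0 ≤ C ∧ ∀ (F : E → W₁) (G : E → W₂), ContDiffOn ℝ ∞ F Ω → ContDiffOn ℝ ∞ G Ω →
      ∀ y ∈ B, ‖iteratedFDerivWithin ℝ j (fun y => Ψ y (F y) (G y)) Ω y‖
        ≤ C * ∑ i ∈ Finset.range (j + 1), ∑ p ∈ Finset.range (i + 1),
          ‖iteratedFDerivWithin ℝ p F Ω y‖ * ‖iteratedFDerivWithin ℝ (j - i) G Ω y‖ := by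
  choose C hC0 hC using fun i => exists_jet_clm_apply_le hΩ hΨ hB hBΩ i
  refine ⟨∑ i ∈ Finset.range (j + 1), 2 ^ j * C i,
    Finset.sum_nonneg fun i _ => mul_nonneg (by positivity) (hC0 i), fun F G hF hG y hy => ?_⟩
  have h1 := (ContinuousLinearMap.id ℝ (W₂ →L[ℝ] W₃)).norm_iteratedFDerivWithin_le_of_bilinear_of_le_one
    (hΨ.clm_apply hF) hG hΩ (hBΩ hy) (n := j) (mod_cast le_top) ContinuousLinearMap.norm_id_le
  refine h1.trans ?_
  rw [Finset.mul_sum]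
  refine Finset.sum_le_sum fun i hi => ?_
  have hc : (j.choose i : ℝ) ≤ 2 ^ j := by
    have : j.choose i ≤ 2 ^ j := by
      rw [← Nat.sum_range_choose j]
      exact Finset.single_le_sum (f := fun i => j.choose i) (fun _ _ => Nat.zero_le _) hi
    exact_mod_cast this
  rw [← Finset.sum_mul, ← mul_assoc]
  refine mul_le_mul_of_nonneg_right ?_ (norm_nonneg _)
  calc (j.choose i : ℝ) * ‖iteratedFDerivWithin ℝ i (fun y => Ψ y (F y)) Ω y‖
      ≤ 2 ^ j * (C i * ∑ p ∈ Finset.range (i + 1), ‖iteratedFDerivWithin ℝ p F Ω y‖) := by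
        gcongr
        exact hC i F hF y hy
    _ = (2 ^ j * C i) * ∑ p ∈ Finset.range (i + 1), ‖iteratedFDerivWithin ℝ p F Ω y‖ := by ring
    _ ≤ _ := by
        gcongr
        exact Finset.single_le_sum (f := fun i => 2 ^ j * C i)
          (fun i _ => mul_nonneg (by positivity) (hC0 i)) hi

include hΩ in
/-- The derivatives of `F ∘ φ` are bounded by those of `F`, for a smooth map `φ`. -/
theorem exists_jet_comp_le {Ω' : Set E'} (hΩ' : UniqueDiffOn ℝ Ω') {φ : E → E'}
    (hφ : ContDiffOn ℝ ∞ φ Ω) (hm : MapsTo φ Ω Ω') {B : Set E} (hB : IsCompact B) (hBΩ : B ⊆ Ω)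
    (j : ℕ) :
    ∃ C : ℝ, 0 ≤ C ∧ ∀ F : E' → W, ContDiffOn ℝ ∞ F Ω' → ∀ y ∈ B,
      ‖iteratedFDerivWithin ℝ j (F ∘ φ) Ω y‖
        ≤ C * ∑ p ∈ Finset.range (j + 1), ‖iteratedFDerivWithin ℝ p F Ω' (φ y)‖ := by
  obtain ⟨D, hD0, hD⟩ := exists_jet_bound hΩ hφ hB hBΩ j
  refine ⟨j.factorial * (D + 1) ^ j, by positivity, fun F hF y hy => ?_⟩
  have h1 := norm_iteratedFDerivWithin_comp_le hF hφ (n := j) (mod_cast le_top) hΩ' hΩ hm (hBΩ hy)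
    (C := ∑ p ∈ Finset.range (j + 1), ‖iteratedFDerivWithin ℝ p F Ω' (φ y)‖) (D := D + 1)
    (fun i hi => Finset.single_le_sum (f := fun p => ‖iteratedFDerivWithin ℝ p F Ω' (φ y)‖)
      (fun _ _ => norm_nonneg _) (Finset.mem_range.2 (Nat.lt_succ_of_le hi)))
    (fun i h1 hi => (hD i hi y hy).trans ((le_add_of_nonneg_right zero_le_one).trans
      (le_self_pow₀ (by linarith) (by omega))))
  refine h1.trans (le_of_eq (by ring))

end JetBounds

section ChangeOfVariables

variable {E : Type*} [NormedAddCommGroup E] [NormedSpace ℝ E] [FiniteDimensional ℝ E]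
  [MeasurableSpace E] [BorelSpace E] (μ : Measure E) [μ.IsAddHaarMeasure]

theorem exists_lintegral_comp_le {S : Set E} (hS : IsCompact S) {φ : E → E} {φ' : E → E →L[ℝ] E}
    (hφ : ∀ y ∈ S, HasFDerivWithinAt φ (φ' y) S y) (hφ' : ContinuousOn φ' S)
    (hdet : ∀ y ∈ S, (φ' y).det ≠ 0) (hinj : InjOn φ S) :
    ∃ C : NNReal, ∀ w : E → ℝ≥0∞, ∫⁻ y in S, w (φ y) ∂μ ≤ C * ∫⁻ y in φ '' S, w y ∂μ := by
  have hc : ContinuousOn (fun y => |(φ' y).det|⁻¹) S :=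
    ((ContinuousLinearMap.continuous_det.comp_continuousOn hφ').abs).inv₀
      fun y hy => abs_ne_zero.2 (hdet y hy)
  obtain ⟨C, hC⟩ := hS.exists_bound_of_continuousOn hc
  refine ⟨C.toNNReal, fun w => ?_⟩
  rw [lintegral_image_eq_lintegral_abs_det_fderiv_mul μ hS.measurableSet hφ hinj,
    ← lintegral_const_mul' _ _ ENNReal.coe_ne_top]
  refine setLIntegral_mono' hS.measurableSet fun y hy => ?_
  have hd : 0 < |(φ' y).det| := abs_pos.2 (hdet y hy)
  have h1 : (1 : ℝ≥0∞) ≤ (C.toNNReal : ℝ≥0∞) * ENNReal.ofReal |(φ' y).det| := by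
    change _ ≤ ENNReal.ofReal C * _
    have h2 : |(φ' y).det|⁻¹ ≤ C := (le_abs_self _).trans (hC y hy)
    have h3 : 0 ≤ C := (inv_nonneg.2 hd.le).trans h2
    rw [← ENNReal.ofReal_mul h3, ← ENNReal.ofReal_one]
    refine ENNReal.ofReal_le_ofReal ?_
    calc (1 : ℝ) = |(φ' y).det|⁻¹ * |(φ' y).det| := (inv_mul_cancel₀ hd.ne').symm
      _ ≤ _ := by gcongr
  calc w (φ y) = 1 * w (φ y) := (one_mul _).symm
    _ ≤ _ := by rw [← mul_assoc]; gcongr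

end ChangeOfVariables

section ChartDomains

variable {M : Type*} [TopologicalSpace M] [ChartedSpace (EuclideanHalfSpace 3) M]

/-- The image of an open set in the chart `e`. -/
def chartDom (e : Chart M) (V : Set M) : Set E3 := coord e '' (e.1.source ∩ V)

theorem chartDom_subset_range (e : Chart M) (V : Set M) : chartDom e V ⊆ range I3 := by
  rintro _ ⟨x, -, rfl⟩
  exact mem_range_self _

theorem chartDom_mono (e : Chart M) {V V' : Set M} (h : V ⊆ V') : chartDom e V ⊆ chartDom e V' :=
  image_mono (inter_subset_inter_right _ h)

theorem mem_chartDom (e : Chart M) {V : Set M} {x : M} (hx : x ∈ e.1.source) (hV : x ∈ V) :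
    coord e x ∈ chartDom e V := ⟨x, ⟨hx, hV⟩, rfl⟩

theorem coord_symm_coord (e : Chart M) {x : M} (hx : x ∈ e.1.source) :
    (coord e).symm (coord e x) = x :=
  (coord e).left_inv (by simpa using hx)

theorem coord_symm_mem (e : Chart M) {V : Set M} {y : E3} (hy : y ∈ chartDom e V) :
    (coord e).symm y ∈ e.1.source ∩ V ∧ coord e ((coord e).symm y) = y := by
  obtain ⟨x, hx, rfl⟩ := hy
  rw [coord_symm_coord e hx.1]
  exact ⟨hx, rfl⟩

theorem exists_chartDom_eq (e : Chart M) {V : Set M} (hV : IsOpen V) :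
    ∃ O : Set E3, IsOpen O ∧ chartDom e V = range I3 ∩ O := by
  have h1 : IsOpen (e.1 '' (e.1.source ∩ V)) := e.1.isOpen_image_source_inter hV
  obtain ⟨O, hO, hO'⟩ := I3.isClosedEmbedding.isInducing.isOpen_iff.1 h1
  refine ⟨O, hO, ?_⟩
  have : chartDom e V = I3 '' (e.1 '' (e.1.source ∩ V)) := by
    rw [chartDom, image_image]
    rfl
  rw [this, ← hO', image_preimage_eq_range_inter]

theorem chartDom_mem_nhdsWithin (e : Chart M) {V : Set M} (hV : IsOpen V) {y : E3}
    (hy : y ∈ chartDom e V) : chartDom e V ∈ nhdsWithin y (range I3) := by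
  obtain ⟨O, hO, h⟩ := exists_chartDom_eq e hV
  rw [h] at hy ⊢
  exact Filter.inter_mem self_mem_nhdsWithin (mem_nhdsWithin_of_mem_nhds (hO.mem_nhds hy.2))

theorem uniqueDiffOn_chartDom (e : Chart M) {V : Set M} (hV : IsOpen V) :
    UniqueDiffOn ℝ (chartDom e V) := by
  obtain ⟨O, hO, h⟩ := exists_chartDom_eq e hV
  rw [h]
  exact I3.uniqueDiffOn.inter hO

theorem chartDom_eventuallyEq (e : Chart M) {V : Set M} (hV : IsOpen V) {y : E3}
    (hy : y ∈ chartDom e V) : range I3 =ᶠ[nhds y] chartDom e V := by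
  obtain ⟨O, hO, h⟩ := exists_chartDom_eq e hV
  rw [h] at hy ⊢
  exact (Filter.eventuallyEq_set.2 (by
    filter_upwards [hO.mem_nhds hy.2] with z hz
    simp [hz]))

variable {W : Type*} [NormedAddCommGroup W] [NormedSpace ℝ W]

theorem jetFun_eq (e : Chart M) {V : Set M} (hV : IsOpen V) (j : ℕ) (F : M → W) {y : E3}
    (hy : y ∈ chartDom e V) :
    jetFun e j F y = iteratedFDerivWithin ℝ j (F ∘ (coord e).symm) (chartDom e V) y :=
  iteratedFDerivWithin_congr_set (chartDom_eventuallyEq e hV hy) j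

variable [IsManifold I3 ∞ M]

theorem contDiffOn_chart (e : Chart M) {V : Set M} (hV : IsOpen V) {F : M → W}
    (hF : ContMDiffOn I3 𝓘(ℝ, W) ∞ F (e.1.source ∩ V)) :
    ContDiffOn ℝ ∞ (F ∘ (coord e).symm) (chartDom e V) := by
  rintro _ ⟨x, hx, rfl⟩
  exact (contDiffWithinAt_chart e hV hF hx).mono (chartDom_subset_range e V)

theorem contMDiffOn_chart (e : Chart M) {V : Set M} {F : M → W}
    (hF : ContDiffOn ℝ ∞ (F ∘ (coord e).symm) (chartDom e V)) :
    ContMDiffOn I3 𝓘(ℝ, W) ∞ F (e.1.source ∩ V) := by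
  have he : e.1 ∈ IsManifold.maximalAtlas I3 ∞ M := IsManifold.subset_maximalAtlas e.2
  refine (contMDiffOn_iff_of_mem_maximalAtlas' (e' := OpenPartialHomeomorph.refl W) he
    (IsManifold.chart_mem_maximalAtlas (I := 𝓘(ℝ, W)) (0 : W)) inter_subset_left (mapsTo_univ _ _)).2 ?_
  exact hF

/-- The coordinate change between two charts. -/
def chartTrans (e e' : Chart M) (y : E3) : E3 := coord e' ((coord e).symm y)

theorem contDiffOn_chartTrans (e e' : Chart M) (V : Set M) :
    ContDiffOn ℝ ∞ (chartTrans e e') (chartDom e (e'.1.source ∩ V)) := by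
  have he : e.1 ∈ IsManifold.maximalAtlas I3 ∞ M := IsManifold.subset_maximalAtlas e.2
  have he' : e'.1 ∈ IsManifold.maximalAtlas I3 ∞ M := IsManifold.subset_maximalAtlas e'.2
  refine (I3.contDiffOn_extendCoordChange he he').mono ?_
  rintro _ ⟨x, hx, rfl⟩
  rw [I3.extendCoordChange_source]
  refine ⟨e.1 x, ?_, rfl⟩
  simp [hx.1, hx.2.1]

omit [IsManifold I3 ∞ M] in
theorem mapsTo_chartTrans (e e' : Chart M) (V : Set M) :
    MapsTo (chartTrans e e') (chartDom e (e'.1.source ∩ V)) (chartDom e' (e.1.source ∩ V)) := by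
  rintro _ ⟨x, hx, rfl⟩
  rw [chartTrans, coord_symm_coord e hx.1]
  exact mem_chartDom e' hx.2.1 ⟨hx.1, hx.2.2⟩

omit [IsManifold I3 ∞ M] in
theorem chartTrans_chartTrans (e e' : Chart M) {V : Set M} {y : E3}
    (hy : y ∈ chartDom e (e'.1.source ∩ V)) : chartTrans e' e (chartTrans e e' y) = y := by
  obtain ⟨x, hx, rfl⟩ := hy
  rw [chartTrans, chartTrans, coord_symm_coord e hx.1, coord_symm_coord e' hx.2.1]

/-- The derivative of the coordinate change is invertible. -/
theorem det_fderivWithin_chartTrans_ne_zero (e e' : Chart M) {V : Set M} (hV : IsOpen V) {y : E3}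
    (hy : y ∈ chartDom e (e'.1.source ∩ V)) :
    (fderivWithin ℝ (chartTrans e e') (chartDom e (e'.1.source ∩ V)) y).det ≠ 0 := by
  have hu := uniqueDiffOn_chartDom e (e'.1.open_source.inter hV)
  have h1 := ((contDiffOn_chartTrans e e' V).differentiableOn (by simp) y hy).hasFDerivWithinAt
  have h2 := ((contDiffOn_chartTrans e' e V).differentiableOn (by simp) _
    (mapsTo_chartTrans e e' V hy)).hasFDerivWithinAt
  have h3 := h2.comp y h1 (mapsTo_chartTrans e e' V)
  have h4 : HasFDerivWithinAt (chartTrans e' e ∘ chartTrans e e') (ContinuousLinearMap.id ℝ E3)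
      (chartDom e (e'.1.source ∩ V)) y :=
    (hasFDerivWithinAt_id y _).congr (fun z hz => chartTrans_chartTrans e e' hz)
      (chartTrans_chartTrans e e' hy)
  have h5 := (hu y hy).eq h3 h4
  intro h0
  have h6 := congrArg ContinuousLinearMap.det h5
  rw [ContinuousLinearMap.det, ContinuousLinearMap.det, ContinuousLinearMap.toLinearMap_comp,
    LinearMap.det_comp] at h6
  change _ * ContinuousLinearMap.det _ = _ at h6
  rw [h0, mul_zero] at h6
  simp at h6

end ChartDomains

end Coulomb

namespace Coulomb

section Enorm

theorem enorm_toLp_sq {X Z : Type*} [MeasurableSpace X] {μ : Measure X} [NormedAddCommGroup Z]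
    {f : X → Z} (hf : MemLp f 2 μ) : ‖hf.toLp f‖ₑ ^ 2 = ∫⁻ x, ‖f x‖ₑ ^ 2 ∂μ := by
  rw [Lp.enorm_toLp, eLpNorm_eq_lintegral_rpow_enorm_toReal (by simp) (by simp),
    ← ENNReal.rpow_natCast, ← ENNReal.rpow_mul]
  simp

theorem enorm_le_pi_enorm {ι : Type*} [Fintype ι] {Z : ι → Type*}
    [∀ i, NormedAddCommGroup (Z i)] (f : ∀ i, Z i) (i : ι) : ‖f i‖ₑ ≤ ‖f‖ₑ := by
  rw [← ofReal_norm, ← ofReal_norm]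
  exact ENNReal.ofReal_le_ofReal (norm_le_pi_norm f i)

theorem pi_enorm_le {ι : Type*} [Fintype ι] {Z : ι → Type*}
    [∀ i, NormedAddCommGroup (Z i)] {f : ∀ i, Z i} {c : ℝ≥0∞} (h : ∀ i, ‖f i‖ₑ ≤ c) :
    ‖f‖ₑ ≤ c := by
  induction c with
  | top => exact le_top
  | coe c =>
    simp only [enorm_eq_nnnorm, ENNReal.coe_le_coe] at h ⊢
    exact (pi_nnnorm_le_iff (r := c)).2 h

theorem ennreal_sq_le_sq {a b : ℝ≥0∞} (h : a ^ 2 ≤ b ^ 2) : a ≤ b :=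
  (ENNReal.pow_le_pow_left_iff (by norm_num)).1 h

/-- Squares of sums are bounded by sums of squares. -/
theorem enorm_sq_le_of_norm_le_sum {Z κ : Type*} [NormedAddCommGroup Z] {z : Z} {t : Finset κ}
    {b : κ → ℝ} (hb : ∀ q ∈ t, 0 ≤ b q) {C : ℝ} (h : ‖z‖ ≤ C * ∑ q ∈ t, b q) :
    ‖z‖ₑ ^ 2 ≤ ENNReal.ofReal (C ^ 2 * t.card) * ∑ q ∈ t, ENNReal.ofReal (b q) ^ 2 := by
  have h1 : ‖z‖ ^ 2 ≤ (C ^ 2 * t.card) * ∑ q ∈ t, b q ^ 2 := by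
    calc ‖z‖ ^ 2 ≤ (C * ∑ q ∈ t, b q) ^ 2 := pow_le_pow_left₀ (norm_nonneg _) h 2
      _ = C ^ 2 * (∑ q ∈ t, b q) ^ 2 := by ring
      _ ≤ C ^ 2 * (t.card * ∑ q ∈ t, b q ^ 2) := by
        gcongr
        exact sq_sum_le_card_mul_sum_sq
      _ = _ := by ring
  have h2 := ENNReal.ofReal_le_ofReal h1
  rw [ENNReal.ofReal_mul (by positivity), ENNReal.ofReal_pow (norm_nonneg _), ofReal_norm,
    ENNReal.ofReal_sum_of_nonneg fun q _ => sq_nonneg _] at h2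
  refine h2.trans (le_of_eq ?_)
  congr 1
  exact Finset.sum_congr rfl fun q hq => ENNReal.ofReal_pow (hb q hq) 2

end Enorm

section Models

variable {𝕜 : Type*} [RCLike 𝕜] {n : ℕ} {K : Subgroup (unitary (EndV 𝕜 n))} {ι : Type*}
variable {M : Type*} [TopologicalSpace M] [ChartedSpace (EuclideanHalfSpace 3) M]
variable [IsManifold I3 ∞ M] {P : PrincipalBundle M K ι} (𝒰 : PatchCover P)

/-- The spaces of local representatives on the patches. -/
abbrev LocalReps (S W : Type*) [AddCommGroup S] [Module ℝ S] [NormedAddCommGroup W]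
    [NormedSpace ℝ W] :=
  ∀ a : Fin 𝒰.N, S →ₗ[ℝ] SmoothOn W ((𝒰.chart a).1.source ∩ P.U (𝒰.triv a))

variable {S W : Type*} [AddCommGroup S] [Module ℝ S] [NormedAddCommGroup W] [NormedSpace ℝ W]
  (loc : LocalReps 𝒰 S W)

/-- The derivatives of order at most `m` of the local representatives. -/
def modelJet (m : ℕ) : S →ₗ[ℝ] JetSpace 𝒰 W m :=
  LinearMap.pi fun a => LinearMap.pi fun j =>
    (jetLp W (𝒰.chart a) (P.isOpen_U (𝒰.triv a)) (𝒰.isCompact a) (𝒰.subset a) j).comp (loc a)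

/-- Local representatives with smooth linear transition functions. -/
def IsModel : Prop :=
  ∀ a b, ∃ L : M → W →L[ℝ] W,
    ContMDiffOn I3 𝓘(ℝ, W →L[ℝ] W) ∞ L ((𝒰.chart a).1.source ∩
      ((𝒰.chart b).1.source ∩ (P.U (𝒰.triv a) ∩ P.U (𝒰.triv b)))) ∧
    ∀ s, ∀ x ∈ (𝒰.chart a).1.source ∩
      ((𝒰.chart b).1.source ∩ (P.U (𝒰.triv a) ∩ P.U (𝒰.triv b))),
      (loc a s).1 x = L x ((loc b s).1 x)

/-- The domain of the `a`-th chart and trivialization. -/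
def patchDom (a : Fin 𝒰.N) : Set E3 := chartDom (𝒰.chart a) (P.U (𝒰.triv a))

omit [IsManifold I3 ∞ M] in
theorem coord_image_subset (a : Fin 𝒰.N) : coord (𝒰.chart a) '' 𝒰.C a ⊆ patchDom 𝒰 a :=
  image_mono (𝒰.subset a)

omit [IsManifold I3 ∞ M] in
theorem isCompact_coord_patch (a : Fin 𝒰.N) : IsCompact (coord (𝒰.chart a) '' 𝒰.C a) :=
  isCompact_coord_image _ (𝒰.isCompact a) fun _ hx => (𝒰.subset a hx).1

variable {𝒰}

theorem enorm_modelJet_apply_sq (m : ℕ) (s : S) (a : Fin 𝒰.N) (j : Fin (m + 1)) :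
    ‖modelJet 𝒰 loc m s a j‖ₑ ^ 2 = ∫⁻ y in coord (𝒰.chart a) '' 𝒰.C a,
      ‖jetFun (𝒰.chart a) j (loc a s).1 y‖ₑ ^ 2 :=
  enorm_toLp_sq (jetFun_memLp (𝒰.chart a) (P.isOpen_U (𝒰.triv a)) j (loc a s).2 (𝒰.isCompact a)
    (𝒰.subset a))

theorem lintegral_jet_patch_le (m : ℕ) (s : S) (a : Fin 𝒰.N) {j : ℕ} (hj : j ≤ m) :
    ∫⁻ y in coord (𝒰.chart a) '' 𝒰.C a, ‖jetFun (𝒰.chart a) j (loc a s).1 y‖ₑ ^ 2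
      ≤ ‖modelJet 𝒰 loc m s‖ₑ ^ 2 := by
  rw [← enorm_modelJet_apply_sq loc m s a ⟨j, Nat.lt_succ_of_le hj⟩]
  exact pow_le_pow_left' ((enorm_le_pi_enorm _ _).trans (enorm_le_pi_enorm _ a)) 2

theorem enorm_modelJet_sq_le (m : ℕ) (s : S) {c : ℝ≥0∞}
    (h : ∀ (a : Fin 𝒰.N), ∀ j ≤ m, ∫⁻ y in coord (𝒰.chart a) '' 𝒰.C a,
      ‖jetFun (𝒰.chart a) j (loc a s).1 y‖ₑ ^ 2 ≤ c) :
    ‖modelJet 𝒰 loc m s‖ₑ ^ 2 ≤ c := by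
  have hc : c = (c ^ (1 / 2 : ℝ)) ^ 2 := by
    rw [← ENNReal.rpow_natCast, ← ENNReal.rpow_mul]
    simp
  rw [hc]
  refine pow_le_pow_left' (pi_enorm_le fun a => pi_enorm_le fun j => ennreal_sq_le_sq ?_) 2
  rw [← hc, enorm_modelJet_apply_sq]
  exact h a j (Nat.lt_succ_iff.1 j.2)

theorem enorm_modelJet_mono {m m' : ℕ} (h : m ≤ m') (s : S) :
    ‖modelJet 𝒰 loc m s‖ₑ ^ 2 ≤ ‖modelJet 𝒰 loc m' s‖ₑ ^ 2 :=
  enorm_modelJet_sq_le loc m s fun a _ hj => lintegral_jet_patch_le loc m' s a (hj.trans h)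

variable {loc}

/-- Comparison of derivatives in two patches. -/
theorem exists_jetFun_trans_le (hloc : IsModel 𝒰 loc) (a b : Fin 𝒰.N) {B : Set E3}
    (hB : IsCompact B) (hBΩ : B ⊆ chartDom (𝒰.chart a)
      ((𝒰.chart b).1.source ∩ (P.U (𝒰.triv a) ∩ P.U (𝒰.triv b)))) (j : ℕ) :
    ∃ C : ℝ, ∀ s, ∀ y ∈ B, ‖jetFun (𝒰.chart a) j (loc a s).1 y‖ ≤ C *
      ∑ q ∈ Finset.range (j + 1), ‖jetFun (𝒰.chart b) q (loc b s).1
        (chartTrans (𝒰.chart a) (𝒰.chart b) y)‖ := by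
  obtain ⟨L, hL, hL'⟩ := hloc a b
  set V := P.U (𝒰.triv a) ∩ P.U (𝒰.triv b) with hVd
  have hV : IsOpen V := (P.isOpen_U _).inter (P.isOpen_U _)
  set e := 𝒰.chart a
  set e' := 𝒰.chart b
  set Ω := chartDom e (e'.1.source ∩ V) with hΩd
  set Ω' := chartDom e' (e.1.source ∩ V) with hΩd'
  have hVb : IsOpen (e'.1.source ∩ V) := e'.1.open_source.inter hV
  have hVa : IsOpen (e.1.source ∩ V) := e.1.open_source.inter hV
  have hΩ : UniqueDiffOn ℝ Ω := uniqueDiffOn_chartDom e hVb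
  have hΩ' : UniqueDiffOn ℝ Ω' := uniqueDiffOn_chartDom e' hVa
  have hφ := contDiffOn_chartTrans e e' V
  have hm := mapsTo_chartTrans e e' V
  obtain ⟨C₁, hC₁, h1⟩ := exists_jet_clm_apply_le hΩ (contDiffOn_chart e hVb hL) hB hBΩ j
  choose C₂ hC₂ h2 using fun p => exists_jet_comp_le (W := W) hΩ hΩ' hφ hm hB hBΩ p
  refine ⟨C₁ * ∑ p ∈ Finset.range (j + 1), C₂ p, fun s y hy => ?_⟩
  have hG : ContDiffOn ℝ ∞ ((loc b s).1 ∘ (coord e').symm) Ω' :=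
    contDiffOn_chart e' hVa ((loc b s).2.mono fun x hx => ⟨hx.1, hx.2.2.2⟩)
  have e1 : jetFun e j (loc a s).1 y = iteratedFDerivWithin ℝ j
      (fun y => (L ∘ (coord e).symm) y ((((loc b s).1 ∘ (coord e').symm) ∘ chartTrans e e') y))
        Ω y := by
    rw [jetFun_eq e hVb j _ (hBΩ hy)]
    refine iteratedFDerivWithin_congr (fun z hz => ?_) (hBΩ hy) j
    have hz' := (coord_symm_mem e hz).1
    change (loc a s).1 ((coord e).symm z) = L _ ((loc b s).1 ((coord e').symm (coord e' _)))
    rw [coord_symm_coord e' hz'.2.1]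
    exact hL' s _ hz'
  rw [e1]
  refine (h1 _ (hG.comp hφ hm) y hy).trans ?_
  rw [mul_assoc]
  refine mul_le_mul_of_nonneg_left ?_ hC₁
  rw [Finset.sum_mul]
  refine Finset.sum_le_sum fun p hp => ?_
  refine (h2 p _ hG y hy).trans (mul_le_mul_of_nonneg_left ?_ (hC₂ p))
  refine (Finset.sum_le_sum fun q _ => ?_).trans (Finset.sum_le_sum_of_subset_of_nonneg
    (Finset.range_mono (Nat.succ_le_of_lt (Finset.mem_range.1 hp))) fun _ _ _ => norm_nonneg _)
  rw [jetFun_eq e' hVa q _ (hm (hBΩ hy))]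

variable [T2Space M]

/-- The `L²`-norms of the derivatives on a compact part of a patch are bounded by the Sobolev
norm. -/
theorem exists_lintegral_jet_le (hloc : IsModel 𝒰 loc) (a : Fin 𝒰.N) {B : Set E3}
    (hB : IsCompact B) (hBΩ : B ⊆ patchDom 𝒰 a) {m j : ℕ} (hj : j ≤ m) :
    ∃ C : NNReal, ∀ s, ∫⁻ y in B, ‖jetFun (𝒰.chart a) j (loc a s).1 y‖ₑ ^ 2
      ≤ C * ‖modelJet 𝒰 loc m s‖ₑ ^ 2 := by
  set e := 𝒰.chart a with he
  have hBs : B ⊆ (coord e).target := by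
    intro y hy
    obtain ⟨x, hx, rfl⟩ := hBΩ hy
    exact (coord e).map_source (by simpa using hx.1)
  have hBc : IsCompact ((coord e).symm '' B) :=
    hB.image_of_continuousOn ((e.1.continuousOn_extend_symm (I := I3)).mono hBs)
  let T : Fin 𝒰.N → Set M := fun b => (coord e).symm '' B ∩ 𝒰.C b
  let Sb : Fin 𝒰.N → Set E3 := fun b => coord e '' T b
  have hT : ∀ b, T b ⊆ e.1.source ∩ ((𝒰.chart b).1.source ∩
      (P.U (𝒰.triv a) ∩ P.U (𝒰.triv b))) := by
    rintro b _ ⟨⟨y, hy, rfl⟩, hb⟩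
    have h1 := (coord_symm_mem e (hBΩ hy)).1
    have h2 := 𝒰.subset b hb
    exact ⟨h1.1, h2.1, h1.2, h2.2⟩
  have hSc : ∀ b, IsCompact (Sb b) := fun b =>
    isCompact_coord_image e (hBc.inter_right (𝒰.isCompact b).isClosed) fun x hx => (hT b hx).1
  have hcover : B ⊆ ⋃ b, Sb b := by
    intro y hy
    obtain ⟨b, hb⟩ := 𝒰.cover ((coord e).symm y)
    refine mem_iUnion.2 ⟨b, (coord e).symm y, ⟨⟨y, hy, rfl⟩, hb⟩, ?_⟩
    exact (coord_symm_mem e (hBΩ hy)).2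
  have key : ∀ b, ∃ C : NNReal, ∀ s, ∫⁻ y in Sb b, ‖jetFun e j (loc a s).1 y‖ₑ ^ 2
      ≤ C * ‖modelJet 𝒰 loc m s‖ₑ ^ 2 := by
    intro b
    set e' := 𝒰.chart b with he'
    set V := P.U (𝒰.triv a) ∩ P.U (𝒰.triv b) with hVd
    have hV : IsOpen V := (P.isOpen_U _).inter (P.isOpen_U _)
    have hSΩ : Sb b ⊆ chartDom e (e'.1.source ∩ V) := image_mono (hT b)
    obtain ⟨C₁, h1⟩ := exists_jetFun_trans_le hloc a b (hSc b) hSΩ j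
    have hu := uniqueDiffOn_chartDom e (e'.1.open_source.inter hV)
    have hφ := contDiffOn_chartTrans e e' V
    obtain ⟨C₂, h2⟩ := exists_lintegral_comp_le (volume : Measure E3) (hSc b)
      (fun y hy => ((hφ.differentiableOn (by simp) y (hSΩ hy)).hasFDerivWithinAt).mono hSΩ)
      ((hφ.continuousOn_fderivWithin hu (by simp)).mono hSΩ)
      (fun y hy => det_fderivWithin_chartTrans_ne_zero e e' hV (hSΩ hy))
      (fun y hy z hz hyz => by
        rw [← chartTrans_chartTrans e e' (hSΩ hy), hyz, chartTrans_chartTrans e e' (hSΩ hz)])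
    refine ⟨(C₁ ^ 2 * (Finset.range (j + 1)).card).toNNReal * C₂ * (j + 1 : ℕ), fun s => ?_⟩
    have himg : chartTrans e e' '' Sb b ⊆ coord e' '' 𝒰.C b := by
      rintro _ ⟨_, ⟨x, hx, rfl⟩, rfl⟩
      refine ⟨x, hx.2, ?_⟩
      rw [chartTrans, coord_symm_coord e (hT b hx).1]
    calc ∫⁻ y in Sb b, ‖jetFun e j (loc a s).1 y‖ₑ ^ 2
        ≤ ∫⁻ y in Sb b, ENNReal.ofReal (C₁ ^ 2 * (Finset.range (j + 1)).card) *
          ∑ q ∈ Finset.range (j + 1), ‖jetFun e' q (loc b s).1 (chartTrans e e' y)‖ₑ ^ 2 := by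
          refine setLIntegral_mono' (hSc b).measurableSet fun y hy => ?_
          simpa only [ofReal_norm] using
            enorm_sq_le_of_norm_le_sum (fun _ _ => norm_nonneg _) (h1 s y hy)
      _ ≤ ENNReal.ofReal (C₁ ^ 2 * (Finset.range (j + 1)).card) * (C₂ *
          ∫⁻ y in coord e' '' 𝒰.C b, ∑ q ∈ Finset.range (j + 1),
            ‖jetFun e' q (loc b s).1 y‖ₑ ^ 2) := by
          rw [lintegral_const_mul' _ _ ENNReal.ofReal_ne_top]
          gcongr
          refine (h2 fun y => ∑ q ∈ Finset.range (j + 1), ‖jetFun e' q (loc b s).1 y‖ₑ ^ 2).trans ?_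
          gcongr
      _ = ENNReal.ofReal (C₁ ^ 2 * (Finset.range (j + 1)).card) * (C₂ *
          ∑ q ∈ Finset.range (j + 1), ∫⁻ y in coord e' '' 𝒰.C b,
            ‖jetFun e' q (loc b s).1 y‖ₑ ^ 2) := by
          rw [lintegral_finsetSum' _ fun q _ => ?_]
          exact ((jetFun_memLp e' (P.isOpen_U (𝒰.triv b)) q (loc b s).2 (𝒰.isCompact b)
            (𝒰.subset b)).1.enorm).pow_const 2
      _ ≤ ENNReal.ofReal (C₁ ^ 2 * (Finset.range (j + 1)).card) * (C₂ *
          ∑ _q ∈ Finset.range (j + 1), ‖modelJet 𝒰 loc m s‖ₑ ^ 2) := by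
          gcongr with q hq
          exact lintegral_jet_patch_le loc m s b
            ((Nat.lt_succ_iff.1 (Finset.mem_range.1 hq)).trans hj)
      _ = _ := by
          rw [Finset.sum_const, Finset.card_range, nsmul_eq_mul]
          push_cast
          rw [ENNReal.ofReal]
          ring
  choose C hC using key
  refine ⟨∑ b, C b, fun s => ?_⟩
  calc _ ≤ ∫⁻ y in ⋃ b, Sb b, ‖jetFun e j (loc a s).1 y‖ₑ ^ 2 := lintegral_mono_set hcover
    _ ≤ ∑' b, ∫⁻ y in Sb b, ‖jetFun e j (loc a s).1 y‖ₑ ^ 2 := lintegral_iUnion_le _ _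
    _ ≤ ∑ b, C b * ‖modelJet 𝒰 loc m s‖ₑ ^ 2 := by
      rw [tsum_fintype]
      exact Finset.sum_le_sum fun b _ => hC b s
    _ = _ := by rw [← Finset.sum_mul]; push_cast; rfl

end Models

end Coulomb

namespace Coulomb

/-- `w₁` and `w₂` are the norms of the first and second derivatives of `v` on `Ω`. -/
def HasDerivsWithNorms {Z : Type*} [NormedAddCommGroup Z] [NormedSpace ℝ Z] (Ω : Set E3)
    (v : E3 → Z) (w₁ w₂ : E3 → ℝ≥0∞) : Prop :=
  ∃ (v' : E3 → E3 →L[ℝ] Z) (v'' : E3 → E3 →L[ℝ] E3 →L[ℝ] Z),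
    (∀ y ∈ Ω, HasFDerivWithinAt v (v' y) Ω y) ∧ (∀ y ∈ Ω, HasFDerivWithinAt v' (v'' y) Ω y) ∧
    ContinuousOn v' Ω ∧ ContinuousOn v'' Ω ∧ (∀ y ∈ Ω, ‖v' y‖ₑ = w₁ y) ∧ ∀ y ∈ Ω, ‖v'' y‖ₑ = w₂ y

section Estimates

variable {𝕜 : Type*} [RCLike 𝕜] {n : ℕ} {K : Subgroup (unitary (EndV 𝕜 n))} {ι : Type*}
variable {M : Type*} [TopologicalSpace M] [ChartedSpace (EuclideanHalfSpace 3) M]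
variable [IsManifold I3 ∞ M] {P : PrincipalBundle M K ι} {𝒰 : PatchCover P}

variable {S W : Type*} [AddCommGroup S] [Module ℝ S] [NormedAddCommGroup W] [NormedSpace ℝ W]
  [CompleteSpace W] {loc : LocalReps 𝒰 S W}

theorem range_I3 : range I3 = {y : E3 | 0 ≤ y 0} := range_modelWithCornersEuclideanHalfSpace 3

/-- The half ball of radius `r` about `y`. -/
def halfBall (y : E3) (r : ℝ) : Set E3 := Metric.closedBall y r ∩ range I3

theorem convex_halfBall (y : E3) (r : ℝ) : Convex ℝ (halfBall y r) :=
  (convex_closedBall y r).inter I3.convex_range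

theorem isCompact_halfBall (y : E3) (r : ℝ) : IsCompact (halfBall y r) :=
  (isCompact_closedBall y r).inter_right I3.isClosed_range

theorem volume_halfBall_ne_zero {y : E3} (hy : y ∈ range I3) {r : ℝ} (hr : 0 < r) :
    volume (halfBall y r) ≠ 0 := by
  have h1 : Metric.ball (y + (r / 2) • inVec) (r / 4) ⊆ halfBall y r := by
    intro z hz
    rw [Metric.mem_ball, dist_eq_norm] at hz
    have hn : ‖inVec‖ = 1 := by simp [inVec]
    refine ⟨?_, ?_⟩
    · rw [Metric.mem_closedBall, dist_eq_norm]
      calc ‖z - y‖ = ‖(z - (y + (r / 2) • inVec)) + (r / 2) • inVec‖ := by congr 1; abel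
        _ ≤ ‖z - (y + (r / 2) • inVec)‖ + ‖(r / 2) • inVec‖ := norm_add_le _ _
        _ ≤ r / 4 + r / 2 := by
          rw [norm_smul, hn, mul_one, Real.norm_of_nonneg (by positivity)]
          gcongr
        _ ≤ r := by linarith
    · rw [range_I3] at hy ⊢
      have h2 : |(z - (y + (r / 2) • inVec)) 0| ≤ ‖z - (y + (r / 2) • inVec)‖ := by
        simpa using PiLp.norm_apply_le (z - (y + (r / 2) • inVec)) 0
      have h3 : (z - (y + (r / 2) • inVec)) 0 = z 0 - y 0 - r / 2 := by
        simp [inVec]; ring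
      rw [h3] at h2
      have h4 := abs_lt.1 (h2.trans_lt hz)
      have hy' : (0 : ℝ) ≤ y 0 := hy
      change (0 : ℝ) ≤ z 0
      linarith [h4.1]
  intro h0
  exact (Metric.measure_ball_pos volume _ (by positivity : (0 : ℝ) < r / 4)).ne'
    (measure_mono_null h1 h0)

omit [IsManifold I3 ∞ M] in
theorem exists_halfBall_subset (a : Fin 𝒰.N) {y : E3} (hy : y ∈ patchDom 𝒰 a) :
    ∃ r > 0, halfBall y r ⊆ patchDom 𝒰 a := by
  obtain ⟨O, hO, h⟩ := exists_chartDom_eq (𝒰.chart a) (P.isOpen_U (𝒰.triv a))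
  rw [patchDom, h] at hy ⊢
  obtain ⟨r, hr, hrO⟩ := Metric.nhds_basis_closedBall.mem_iff.1 (hO.mem_nhds hy.2)
  exact ⟨r, hr, fun z hz => ⟨hz.2, hrO hz.1⟩⟩

omit [IsManifold I3 ∞ M] in
theorem uniqueDiffOn_patchDom (a : Fin 𝒰.N) : UniqueDiffOn ℝ (patchDom 𝒰 a) :=
  uniqueDiffOn_chartDom _ (P.isOpen_U _)

omit [CompleteSpace W] in
theorem contDiffOn_loc (a : Fin 𝒰.N) (s : S) :
    ContDiffOn ℝ ∞ ((loc a s).1 ∘ (coord (𝒰.chart a)).symm) (patchDom 𝒰 a) :=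
  contDiffOn_chart _ (P.isOpen_U _) (loc a s).2

omit [CompleteSpace W] in
theorem hasDerivsWithNorms_jet (a : Fin 𝒰.N) (s : S) (j : ℕ) :
    HasDerivsWithNorms (patchDom 𝒰 a) (jetFun (𝒰.chart a) j (loc a s).1)
      (fun y => ‖jetFun (𝒰.chart a) (j + 1) (loc a s).1 y‖ₑ)
      (fun y => ‖jetFun (𝒰.chart a) (j + 2) (loc a s).1 y‖ₑ) := by
  have hΩ := uniqueDiffOn_patchDom (𝒰 := 𝒰) a
  set Ω := patchDom 𝒰 a
  set G := (loc a s).1 ∘ (coord (𝒰.chart a)).symm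
  have hG : ContDiffOn ℝ ∞ G Ω := contDiffOn_loc a s
  have e : ∀ i, ∀ y ∈ Ω, jetFun (𝒰.chart a) i (loc a s).1 y = iteratedFDerivWithin ℝ i G Ω y :=
    fun i y hy => jetFun_eq (𝒰.chart a) (P.isOpen_U _) i _ hy
  have h0 : ContDiffOn ℝ ∞ (iteratedFDerivWithin ℝ j G Ω) Ω := fun y hy =>
    (hG y hy).iteratedFDerivWithin_right hΩ (mod_cast le_top) hy
  have h1 : ContDiffOn ℝ ∞ (fderivWithin ℝ (iteratedFDerivWithin ℝ j G Ω) Ω) Ω :=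
    h0.fderivWithin hΩ (mod_cast le_top)
  refine ⟨fderivWithin ℝ (iteratedFDerivWithin ℝ j G Ω) Ω,
    fderivWithin ℝ (fderivWithin ℝ (iteratedFDerivWithin ℝ j G Ω) Ω) Ω,
    fun y hy => ((h0.differentiableOn (by simp) y hy).hasFDerivWithinAt).congr (e j) (e j y hy),
    fun y hy => (h1.differentiableOn (by simp) y hy).hasFDerivWithinAt, h1.continuousOn,
    h1.continuousOn_fderivWithin hΩ (by simp), fun y hy => ?_, fun y hy => ?_⟩
  · beta_reduce
    rw [e (j + 1) y hy, ← ofReal_norm, ← ofReal_norm, norm_fderivWithin_iteratedFDerivWithin]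
  · beta_reduce
    rw [e (j + 2) y hy, ← ofReal_norm, ← ofReal_norm, ← norm_iteratedFDerivWithin_one _ (hΩ y hy),
      fderivWithin_iteratedFDerivWithin, LinearIsometryEquiv.norm_iteratedFDerivWithin_comp_left
      _ _ hΩ hy, norm_iteratedFDerivWithin_one _ (hΩ y hy), norm_fderivWithin_iteratedFDerivWithin]

variable [T2Space M]

omit [T2Space M] [CompleteSpace W] in
theorem aemeasurable_jet_sq (a : Fin 𝒰.N) (s : S) (j : ℕ) {B : Set E3} (hB : MeasurableSet B)
    (hBΩ : B ⊆ patchDom 𝒰 a) :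
    AEMeasurable (fun y => ‖jetFun (𝒰.chart a) j (loc a s).1 y‖ₑ ^ 2) (volume.restrict B) := by
  obtain ⟨v', v'', hv, -⟩ := hasDerivsWithNorms_jet (loc := loc) a s j
  have h1 : ContinuousOn (jetFun (𝒰.chart a) j (loc a s).1) B := fun y hy =>
    ((hv y (hBΩ hy)).continuousWithinAt).mono hBΩ
  exact (h1.enorm.aemeasurable hB).pow_const 2

/-- `H²` is contained in `L^∞`, locally in a patch. -/
theorem exists_sup_jet_le (hloc : IsModel 𝒰 loc) (a : Fin 𝒰.N) {B : Set E3}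
    (hB : IsCompact B) (hBΩ : B ⊆ patchDom 𝒰 a) {m j : ℕ} (hj : j + 2 ≤ m) :
    ∃ C : NNReal, ∀ s, ∀ y ∈ B, ‖jetFun (𝒰.chart a) j (loc a s).1 y‖ₑ ^ 2
      ≤ C * ‖modelJet 𝒰 loc m s‖ₑ ^ 2 := by
  refine hB.induction_on (p := fun B => ∃ C : NNReal, ∀ s, ∀ y ∈ B,
    ‖jetFun (𝒰.chart a) j (loc a s).1 y‖ₑ ^ 2 ≤ C * ‖modelJet 𝒰 loc m s‖ₑ ^ 2)
    ⟨0, fun s y hy => hy.elim⟩ ?_ ?_ ?_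
  · rintro s t hst ⟨C, hC⟩
    exact ⟨C, fun u y hy => hC u y (hst hy)⟩
  · rintro s t ⟨C, hC⟩ ⟨C', hC'⟩
    refine ⟨C + C', fun u y hy => ?_⟩
    push_cast
    rw [add_mul]
    rcases hy with hy | hy
    · exact (hC u y hy).trans le_self_add
    · exact (hC' u y hy).trans le_add_self
  · intro y hy
    obtain ⟨r, hr, hrΩ⟩ := exists_halfBall_subset a (hBΩ hy)
    have hyr : y ∈ range I3 := chartDom_subset_range _ _ (hBΩ hy)
    refine ⟨Metric.closedBall y r ∩ B,
      Filter.inter_mem (mem_nhdsWithin_of_mem_nhds (Metric.closedBall_mem_nhds y hr))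
        self_mem_nhdsWithin, ?_⟩
    obtain ⟨C, hC⟩ := exists_sup_bound (W := E3 [×j]→L[ℝ] W) (convex_halfBall y r)
      (isCompact_halfBall y r) (volume_halfBall_ne_zero hyr hr)
    obtain ⟨C₀, h0⟩ := exists_lintegral_jet_le hloc a (isCompact_halfBall y r) hrΩ
      (show j ≤ m by omega)
    obtain ⟨C₁, h1⟩ := exists_lintegral_jet_le hloc a (isCompact_halfBall y r) hrΩ
      (show j + 1 ≤ m by omega)
    obtain ⟨C₂, h2⟩ := exists_lintegral_jet_le hloc a (isCompact_halfBall y r) hrΩ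
      (show j + 2 ≤ m by omega)
    refine ⟨C * (C₀ + C₁ + C₂), fun s z hz => ?_⟩
    obtain ⟨v', v'', hv, hv', -, hc, hn, hn'⟩ := hasDerivsWithNorms_jet (loc := loc) a s j
    have hz' : z ∈ halfBall y r := ⟨hz.1, chartDom_subset_range _ _ (hBΩ hz.2)⟩
    have h3 := hC _ v' v'' (fun y hy => (hv y (hrΩ hy)).mono hrΩ)
      (fun y hy => (hv' y (hrΩ hy)).mono hrΩ) (hc.mono hrΩ) z hz'
    have hm := (isCompact_halfBall y r).measurableSet
    have e1 : ∫⁻ y in halfBall y r, ‖v' y‖ₑ ^ 2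
        = ∫⁻ y in halfBall y r, ‖jetFun (𝒰.chart a) (j + 1) (loc a s).1 y‖ₑ ^ 2 :=
      setLIntegral_congr_fun hm fun y hy => by simp only [hn y (hrΩ hy)]
    have e2 : ∫⁻ y in halfBall y r, ‖v'' y‖ₑ ^ 2
        = ∫⁻ y in halfBall y r, ‖jetFun (𝒰.chart a) (j + 2) (loc a s).1 y‖ₑ ^ 2 :=
      setLIntegral_congr_fun hm fun y hy => by simp only [hn' y (hrΩ hy)]
    rw [e1, e2] at h3
    refine h3.trans ?_
    push_cast
    rw [mul_assoc, add_mul, add_mul]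
    gcongr
    exacts [h0 s, h1 s, h2 s]

/-- `H¹` is contained in `L⁴`, locally in a patch. -/
theorem exists_L4_jet_le (hloc : IsModel 𝒰 loc) (a : Fin 𝒰.N) {B : Set E3}
    (hB : IsCompact B) (hBΩ : B ⊆ patchDom 𝒰 a) {m j : ℕ} (hj : j + 1 ≤ m) :
    ∃ C : NNReal, ∀ s, ∫⁻ y in B, ‖jetFun (𝒰.chart a) j (loc a s).1 y‖ₑ ^ 4
      ≤ C * (‖modelJet 𝒰 loc m s‖ₑ ^ 2) ^ 2 := by
  suffices h : ∃ C : NNReal, ∀ s, ∫⁻ y in B, ‖jetFun (𝒰.chart a) j (loc a s).1 y‖ₑ ^ 4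
      ≤ C * (‖modelJet 𝒰 loc m s‖ₑ ^ 2) ^ 2 by exact h
  refine hB.induction_on (p := fun B => ∃ C : NNReal, ∀ s, ∫⁻ y in B,
    ‖jetFun (𝒰.chart a) j (loc a s).1 y‖ₑ ^ 4 ≤ C * (‖modelJet 𝒰 loc m s‖ₑ ^ 2) ^ 2)
    ⟨0, fun s => by simp⟩ ?_ ?_ ?_
  · rintro s t hst ⟨C, hC⟩
    exact ⟨C, fun u => (lintegral_mono_set hst).trans (hC u)⟩
  · rintro s t ⟨C, hC⟩ ⟨C', hC'⟩
    refine ⟨C + C', fun u => (lintegral_union_le _ _ _).trans ?_⟩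
    push_cast
    rw [add_mul]
    exact add_le_add (hC u) (hC' u)
  · intro y hy
    obtain ⟨r, hr, hrΩ⟩ := exists_halfBall_subset a (hBΩ hy)
    have hyr : y ∈ range I3 := chartDom_subset_range _ _ (hBΩ hy)
    refine ⟨Metric.closedBall y r ∩ B,
      Filter.inter_mem (mem_nhdsWithin_of_mem_nhds (Metric.closedBall_mem_nhds y hr))
        self_mem_nhdsWithin, ?_⟩
    obtain ⟨C, hC⟩ := exists_L4_bound (W := E3 [×j]→L[ℝ] W) (convex_halfBall y r)
      (isCompact_halfBall y r) (volume_halfBall_ne_zero hyr hr)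
    obtain ⟨C₀, h0⟩ := exists_lintegral_jet_le hloc a (isCompact_halfBall y r) hrΩ
      (show j ≤ m by omega)
    obtain ⟨C₁, h1⟩ := exists_lintegral_jet_le hloc a (isCompact_halfBall y r) hrΩ
      (show j + 1 ≤ m by omega)
    refine ⟨C * (C₀ + C₁) ^ 2, fun s => ?_⟩
    obtain ⟨v', v'', hv, -, hc, -, hn, -⟩ := hasDerivsWithNorms_jet (loc := loc) a s j
    have h3 := hC _ v' (fun y hy => (hv y (hrΩ hy)).mono hrΩ) (hc.mono hrΩ)
    have hm := (isCompact_halfBall y r).measurableSet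
    have e1 : ∫⁻ y in halfBall y r, ‖v' y‖ₑ ^ 2
        = ∫⁻ y in halfBall y r, ‖jetFun (𝒰.chart a) (j + 1) (loc a s).1 y‖ₑ ^ 2 :=
      setLIntegral_congr_fun hm fun y hy => by simp only [hn y (hrΩ hy)]
    rw [e1] at h3
    have hsub : Metric.closedBall y r ∩ B ⊆ halfBall y r :=
      fun z hz => ⟨hz.1, chartDom_subset_range _ _ (hBΩ hz.2)⟩
    refine (lintegral_mono_set hsub).trans (h3.trans ?_)
    push_cast
    rw [mul_assoc, ← mul_pow, add_mul]
    gcongr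
    exacts [h0 s, h1 s]

omit [IsManifold I3 ∞ M] [T2Space M] in
theorem planeEmb_apply_zero (z : EuclideanSpace ℝ (Fin 2)) : planeEmb z 0 = 0 := by
  simp [planeEmb]

/-- The trace inequality with a parameter, locally in a patch. -/
theorem exists_trace_jet_le_param (hloc : IsModel 𝒰 loc) (a : Fin 𝒰.N) {B : Set E3}
    (hB : IsCompact B) (hBΩ : B ⊆ patchDom 𝒰 a) (j : ℕ) :
    ∃ C : NNReal, ∀ ε : ℝ, 0 < ε → ε ≤ 1 → ∀ s, ∫⁻ z in planeEmb ⁻¹' B,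
      ‖jetFun (𝒰.chart a) j (loc a s).1 (planeEmb z)‖ₑ ^ 2
        ≤ C * (ENNReal.ofReal ε⁻¹ * ‖modelJet 𝒰 loc j s‖ₑ ^ 2
          + ENNReal.ofReal ε * ‖modelJet 𝒰 loc (j + 1) s‖ₑ ^ 2) := by
  refine hB.induction_on (p := fun B => ∃ C : NNReal, ∀ ε : ℝ, 0 < ε → ε ≤ 1 → ∀ s,
    ∫⁻ z in planeEmb ⁻¹' B, ‖jetFun (𝒰.chart a) j (loc a s).1 (planeEmb z)‖ₑ ^ 2
        ≤ C * (ENNReal.ofReal ε⁻¹ * ‖modelJet 𝒰 loc j s‖ₑ ^ 2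
          + ENNReal.ofReal ε * ‖modelJet 𝒰 loc (j + 1) s‖ₑ ^ 2))
    ⟨0, fun ε _ _ s => by simp⟩ ?_ ?_ ?_
  · rintro s t hst ⟨C, hC⟩
    exact ⟨C, fun ε h0 h1 u => (lintegral_mono_set (preimage_mono hst)).trans (hC ε h0 h1 u)⟩
  · rintro s t ⟨C, hC⟩ ⟨C', hC'⟩
    refine ⟨C + C', fun ε h0 h1 u => (lintegral_union_le _ _ _).trans ?_⟩
    rw [ENNReal.coe_add, add_mul]
    exact add_le_add (hC ε h0 h1 u) (hC' ε h0 h1 u)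
  · intro y hy
    obtain ⟨r, hr, hrΩ⟩ := exists_halfBall_subset a (hBΩ hy)
    refine ⟨Metric.closedBall y (r / 2) ∩ B,
      Filter.inter_mem (mem_nhdsWithin_of_mem_nhds (Metric.closedBall_mem_nhds y (by positivity)))
        self_mem_nhdsWithin, ?_⟩
    obtain ⟨C₀, h0⟩ := exists_lintegral_jet_le hloc a (isCompact_halfBall y r) hrΩ (le_refl j)
    obtain ⟨C₁, h1⟩ := exists_lintegral_jet_le hloc a (isCompact_halfBall y r) hrΩ
      (le_refl (j + 1))
    set ρ := min 1 (r / 2) with hρ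
    have hρ0 : 0 < ρ := by positivity
    refine ⟨4 * (ρ⁻¹.toNNReal * C₀ + C₁), fun ε hε0 hε1 s => ?_⟩
    obtain ⟨v', v'', hv, -, hc, -, hn, -⟩ := hasDerivsWithNorms_jet (loc := loc) a s j
    have hm := (isCompact_halfBall y r).measurableSet
    have hBm : IsCompact (Metric.closedBall y (r / 2) ∩ B) := hB.inter_left Metric.isClosed_closedBall
    have hDm := (isCompact_planeEmb_preimage hBm).measurableSet
    have hD : ∀ z ∈ planeEmb ⁻¹' (Metric.closedBall y (r / 2) ∩ B), ∀ t ∈ Icc (0 : ℝ) (ε * ρ),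
        planeEmb z + t • inVec ∈ halfBall y r := by
      intro z hz t ht
      have ht2 : t ≤ r / 2 := ht.2.trans ((mul_le_of_le_one_left hρ0.le hε1).trans (min_le_right _ _))
      refine ⟨?_, ?_⟩
      · have h3 := hz.1
        rw [Metric.mem_closedBall, dist_eq_norm] at h3 ⊢
        calc ‖planeEmb z + t • inVec - y‖ = ‖(planeEmb z - y) + t • inVec‖ := by congr 1; abel
          _ ≤ ‖planeEmb z - y‖ + ‖t • inVec‖ := norm_add_le _ _
          _ ≤ r / 2 + r / 2 := by
            gcongr
            rw [norm_smul, show ‖inVec‖ = 1 by simp [inVec], mul_one, Real.norm_of_nonneg ht.1]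
            exact ht2
          _ = r := by ring
      · rw [range_I3]
        change (0 : ℝ) ≤ planeEmb z 0 + t * inVec 0
        rw [planeEmb_apply_zero]
        simpa [inVec] using ht.1
    have h3 := lintegral_trace_le hDm hm (by positivity : 0 < ε * ρ) hD
      (fun y hy => (hv y (hrΩ hy)).mono hrΩ) (hc.mono hrΩ)
    have e1 : ∫⁻ y in halfBall y r, ‖v' y‖ₑ ^ 2
        = ∫⁻ y in halfBall y r, ‖jetFun (𝒰.chart a) (j + 1) (loc a s).1 y‖ₑ ^ 2 :=
      setLIntegral_congr_fun hm fun y hy => by simp only [hn y (hrΩ hy)]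
    rw [e1] at h3
    refine h3.trans ?_
    have e3 : ENNReal.ofReal (ε * ρ)⁻¹ = ENNReal.ofReal ε⁻¹ * (ρ⁻¹.toNNReal : ℝ≥0∞) := by
      rw [mul_inv, ENNReal.ofReal_mul (inv_nonneg.2 hε0.le)]
      rfl
    have e2 : ENNReal.ofReal (ε * ρ) ≤ ENNReal.ofReal ε :=
      ENNReal.ofReal_le_ofReal (mul_le_of_le_one_right hε0.le (min_le_left _ _))
    rw [e3]
    set N := ‖modelJet 𝒰 loc j s‖ₑ ^ 2
    set N' := ‖modelJet 𝒰 loc (j + 1) s‖ₑ ^ 2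
    calc _ ≤ 4 * (ENNReal.ofReal ε⁻¹ * (ρ⁻¹.toNNReal : ℝ≥0∞) * (C₀ * N)
          + ENNReal.ofReal ε * (C₁ * N')) := by
          gcongr
          exacts [h0 s, h1 s]
      _ = 4 * ((ρ⁻¹.toNNReal * C₀) * (ENNReal.ofReal ε⁻¹ * N)
          + C₁ * (ENNReal.ofReal ε * N')) := by ring
      _ ≤ 4 * ((ρ⁻¹.toNNReal * C₀ + C₁) * (ENNReal.ofReal ε⁻¹ * N)
          + (ρ⁻¹.toNNReal * C₀ + C₁) * (ENNReal.ofReal ε * N')) := by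
          gcongr
          · exact le_self_add
          · exact le_add_self
      _ = _ := by push_cast; ring

/-- The trace inequality, locally in a patch. -/
theorem exists_trace_jet_le (hloc : IsModel 𝒰 loc) (a : Fin 𝒰.N) {B : Set E3}
    (hB : IsCompact B) (hBΩ : B ⊆ patchDom 𝒰 a) {m j : ℕ} (hj : j + 1 ≤ m) :
    ∃ C : NNReal, ∀ s, ∫⁻ z in planeEmb ⁻¹' B,
      ‖jetFun (𝒰.chart a) j (loc a s).1 (planeEmb z)‖ₑ ^ 2 ≤ C * ‖modelJet 𝒰 loc m s‖ₑ ^ 2 := by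
  obtain ⟨C, hC⟩ := exists_trace_jet_le_param hloc a hB hBΩ j
  refine ⟨C * 2, fun s => (hC 1 one_pos le_rfl s).trans ?_⟩
  rw [ENNReal.coe_mul, mul_assoc]
  gcongr
  rw [inv_one, ENNReal.ofReal_one, one_mul, one_mul]
  calc _ ≤ ‖modelJet 𝒰 loc m s‖ₑ ^ 2 + ‖modelJet 𝒰 loc m s‖ₑ ^ 2 :=
        add_le_add (enorm_modelJet_mono loc (by omega) s) (enorm_modelJet_mono loc hj s)
    _ = _ := by push_cast; ring

section Product

variable {S' W' : Type*} [AddCommGroup S'] [Module ℝ S'] [NormedAddCommGroup W']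
  [NormedSpace ℝ W'] [CompleteSpace W'] {loc' : LocalReps 𝒰 S' W'}

/-- The products of a derivative of order `p` of an `H^m`-function and a derivative of order `q` of
an `H^{m'}`-function are square integrable. -/
def ProductOrders (m m' p q : ℕ) : Prop :=
  (p + 2 ≤ m ∧ q ≤ m') ∨ (p ≤ m ∧ q + 2 ≤ m') ∨ (p + 1 ≤ m ∧ q + 1 ≤ m')

theorem exists_product_jet_le (hloc : IsModel 𝒰 loc) (hloc' : IsModel 𝒰 loc') (a : Fin 𝒰.N)
    {B : Set E3} (hB : IsCompact B) (hBΩ : B ⊆ patchDom 𝒰 a) {m m' p q : ℕ}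
    (hpq : ProductOrders m m' p q) :
    ∃ C : NNReal, ∀ s t, ∫⁻ y in B, (‖jetFun (𝒰.chart a) p (loc a s).1 y‖ₑ *
      ‖jetFun (𝒰.chart a) q (loc' a t).1 y‖ₑ) ^ 2
        ≤ C * (‖modelJet 𝒰 loc m s‖ₑ ^ 2 * ‖modelJet 𝒰 loc' m' t‖ₑ ^ 2) := by
  have hBm := hB.measurableSet
  have hfin : ∀ s, ‖modelJet 𝒰 loc m s‖ₑ ^ 2 ≠ ⊤ := fun s => ENNReal.pow_ne_top enorm_ne_top
  have hfin' : ∀ t, ‖modelJet 𝒰 loc' m' t‖ₑ ^ 2 ≠ ⊤ := fun s => ENNReal.pow_ne_top enorm_ne_top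
  rcases hpq with ⟨h1, h2⟩ | ⟨h1, h2⟩ | ⟨h1, h2⟩
  · obtain ⟨C, hC⟩ := exists_sup_jet_le hloc a hB hBΩ h1
    obtain ⟨C', hC'⟩ := exists_lintegral_jet_le hloc' a hB hBΩ h2
    refine ⟨C * C', fun s t => ?_⟩
    calc _ ≤ ∫⁻ y in B, (C * ‖modelJet 𝒰 loc m s‖ₑ ^ 2) *
          ‖jetFun (𝒰.chart a) q (loc' a t).1 y‖ₑ ^ 2 := by
          refine setLIntegral_mono' hBm fun y hy => ?_
          rw [mul_pow]
          gcongr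
          exact hC s y hy
      _ ≤ (C * ‖modelJet 𝒰 loc m s‖ₑ ^ 2) * (C' * ‖modelJet 𝒰 loc' m' t‖ₑ ^ 2) := by
          rw [lintegral_const_mul' _ _ (ENNReal.mul_ne_top ENNReal.coe_ne_top (hfin s))]
          gcongr
          exact hC' t
      _ = _ := by push_cast; ring
  · obtain ⟨C, hC⟩ := exists_lintegral_jet_le hloc a hB hBΩ h1
    obtain ⟨C', hC'⟩ := exists_sup_jet_le hloc' a hB hBΩ h2
    refine ⟨C * C', fun s t => ?_⟩
    calc _ ≤ ∫⁻ y in B, ‖jetFun (𝒰.chart a) p (loc a s).1 y‖ₑ ^ 2 *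
          (C' * ‖modelJet 𝒰 loc' m' t‖ₑ ^ 2) := by
          refine setLIntegral_mono' hBm fun y hy => ?_
          rw [mul_pow]
          gcongr
          exact hC' t y hy
      _ ≤ (C * ‖modelJet 𝒰 loc m s‖ₑ ^ 2) * (C' * ‖modelJet 𝒰 loc' m' t‖ₑ ^ 2) := by
          rw [lintegral_mul_const' _ _ (ENNReal.mul_ne_top ENNReal.coe_ne_top (hfin' t))]
          gcongr
          exact hC s
      _ = _ := by push_cast; ring
  · obtain ⟨C, hC⟩ := exists_L4_jet_le hloc a hB hBΩ h1
    obtain ⟨C', hC'⟩ := exists_L4_jet_le hloc' a hB hBΩ h2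
    have h3 := fun s t => sq_lintegral_mul_le (volume.restrict B)
      ((aemeasurable_jet_sq (loc := loc) a s p hBm hBΩ))
      ((aemeasurable_jet_sq (loc := loc') a t q hBm hBΩ))
    refine ⟨NNReal.sqrt (C * C'), fun s t => ennreal_sq_le_sq ?_⟩
    have h3 := h3 s t
    simp only [← pow_mul, mul_pow] at h3 ⊢
    refine h3.trans ((mul_le_mul' (hC s) (hC' t)).trans (le_of_eq ?_))
    rw [← ENNReal.coe_pow, NNReal.sq_sqrt]
    push_cast
    ring

end Product

end Estimates

end Coulomb

namespace Coulomb

set_option linter.unusedSectionVars false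

section PartialDerivatives

variable {M : Type*} [TopologicalSpace M] [ChartedSpace (EuclideanHalfSpace 3) M]
  [IsManifold I3 ∞ M]
variable {W W₁ W₂ W₃ : Type*} [NormedAddCommGroup W] [NormedSpace ℝ W]
  [NormedAddCommGroup W₁] [NormedSpace ℝ W₁] [NormedAddCommGroup W₂] [NormedSpace ℝ W₂]
  [NormedAddCommGroup W₃] [NormedSpace ℝ W₃]

/-- The partial derivative `∂F/∂y_c` in the chart `e`. -/
def pd (e : Chart M) (c : Fin 3) (F : M → W) (x : M) : W := dirDeriv F x (coordVec e c x)

theorem exists_hasFDerivWithinAt_coord (e : Chart M) {x : M} (hx : x ∈ e.1.source) {F : M → W}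
    (hF : MDifferentiableAt I3 𝓘(ℝ, W) F x) :
    ∃ D : E3 →L[ℝ] W, HasFDerivWithinAt (F ∘ (coord e).symm) D (range I3) (coord e x) ∧
      ∀ c, D (EuclideanSpace.single c 1) = pd e c F x := by
  set e₀ : Chart M := achart (EuclideanHalfSpace 3) x
  have hx₀ : x ∈ e₀.1.source := mem_chart_source _ x
  obtain ⟨D₀, hD₀⟩ : ∃ D₀ : E3 →L[ℝ] W, D₀ = mfderiv I3 𝓘(ℝ, W) F x := ⟨_, rfl⟩
  have h1 : HasFDerivWithinAt (F ∘ (coord e₀).symm) D₀ (range I3) (coord e₀ x) := by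
    rw [hD₀]
    exact hF.hasMFDerivAt.2
  have h2 : HasFDerivWithinAt (chartTrans e e₀) ((tangentBundleCore I3 M).coordChange e e₀ x)
      (range I3) (coord e x) := by
    have hy := mem_chartDom e (V := e₀.1.source ∩ univ) hx ⟨hx₀, mem_univ _⟩
    have h3 := (contDiffOn_chartTrans e e₀ univ).differentiableOn (by simp) _ hy
    have h4 := h3.mono_of_mem_nhdsWithin (chartDom_mem_nhdsWithin e
      (e₀.1.open_source.inter isOpen_univ) hy)
    exact h4.hasFDerivWithinAt
  have h5 : chartTrans e e₀ (coord e x) = coord e₀ x := by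
    rw [chartTrans, coord_symm_coord e hx]
  rw [← h5] at h1
  have h6 := h1.comp (coord e x) h2 (fun y _ => mem_range_self _)
  refine ⟨_, h6.congr_of_eventuallyEq ?_ ?_, fun c => ?_⟩
  · have hy := mem_chartDom e (V := e₀.1.source) hx hx₀
    filter_upwards [chartDom_mem_nhdsWithin e e₀.1.open_source hy] with y hy
    have := (coord_symm_mem e hy).1
    simp only [Function.comp_apply, chartTrans]
    rw [coord_symm_coord e₀ this.2]
  · simp only [Function.comp_apply, chartTrans]
    rw [coord_symm_coord e hx, coord_symm_coord e₀ hx₀]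
  · rw [hD₀]
    rfl

theorem uniqueDiffWithinAt_coord (e : Chart M) (x : M) :
    UniqueDiffWithinAt ℝ (range I3) (coord e x) :=
  I3.uniqueDiffOn.uniqueDiffWithinAt (mem_range_self _)

/-- Partial derivatives are the partial derivatives of the coordinate expression. -/
theorem pd_eq (e : Chart M) (c : Fin 3) {x : M} (hx : x ∈ e.1.source) {F : M → W}
    (hF : MDifferentiableAt I3 𝓘(ℝ, W) F x) :
    pd e c F x = fderivWithin ℝ (F ∘ (coord e).symm) (range I3) (coord e x)
      (EuclideanSpace.single c 1) := by
  obtain ⟨D, hD, h⟩ := exists_hasFDerivWithinAt_coord e hx hF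
  rw [hD.fderivWithin (uniqueDiffWithinAt_coord e x), h]

theorem differentiableWithinAt_coord (e : Chart M) {x : M} (hx : x ∈ e.1.source) {F : M → W}
    (hF : MDifferentiableAt I3 𝓘(ℝ, W) F x) :
    DifferentiableWithinAt ℝ (F ∘ (coord e).symm) (range I3) (coord e x) := by
  obtain ⟨D, hD, -⟩ := exists_hasFDerivWithinAt_coord e hx hF
  exact hD.differentiableWithinAt

theorem pd_bilin (B : W₁ →L[ℝ] W₂ →L[ℝ] W₃) (e : Chart M) (c : Fin 3) {x : M}
    (hx : x ∈ e.1.source) {F : M → W₁} {G : M → W₂} (hF : MDifferentiableAt I3 𝓘(ℝ, W₁) F x)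
    (hG : MDifferentiableAt I3 𝓘(ℝ, W₂) G x) :
    pd e c (fun y => B (F y) (G y)) x = B (pd e c F x) (G x) + B (F x) (pd e c G x) := by
  have h1 : MDifferentiableAt I3 𝓘(ℝ, W₃) (fun y => B (F y) (G y)) x := by
    have h2 : DifferentiableAt ℝ (fun p : W₁ × W₂ => B p.1 p.2) (F x, G x) := by fun_prop
    exact h2.mdifferentiableAt.comp (f := fun y => (F y, G y)) x (hF.prodMk_space hG)
  rw [pd_eq e c hx h1, pd_eq e c hx hF, pd_eq e c hx hG]
  have h3 := B.hasFDerivWithinAt_of_bilinear (differentiableWithinAt_coord e hx hF).hasFDerivWithinAt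
    (differentiableWithinAt_coord e hx hG).hasFDerivWithinAt
  have h4 := DFunLike.congr_fun (h3.fderivWithin (uniqueDiffWithinAt_coord e x))
    (EuclideanSpace.single c 1)
  refine h4.trans ?_
  simp only [Function.comp_apply, coord_symm_coord e hx, add_apply,
    ContinuousLinearMap.precompR_apply, ContinuousLinearMap.precompL_apply]
  rw [add_comm]
  rfl

theorem pd_clm (B : W₁ →L[ℝ] W₂) (e : Chart M) (c : Fin 3) {x : M}
    {F : M → W₁} (hF : MDifferentiableAt I3 𝓘(ℝ, W₁) F x) :
    pd e c (fun y => B (F y)) x = B (pd e c F x) := by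
  have h := mfderiv_comp x (B.differentiableAt (x := F x)).mdifferentiableAt hF
  change mfderiv I3 𝓘(ℝ, W₂) (B ∘ F) x _ = _
  rw [h, mfderiv_eq_fderiv, ContinuousLinearMap.fderiv]
  rfl

theorem pd_add (e : Chart M) (c : Fin 3) {x : M} {F G : M → W}
    (hF : MDifferentiableAt I3 𝓘(ℝ, W) F x) (hG : MDifferentiableAt I3 𝓘(ℝ, W) G x) :
    pd e c (fun y => F y + G y) x = pd e c F x + pd e c G x := by
  change mfderiv I3 𝓘(ℝ, W) (F + G) x _ = _
  rw [mfderiv_add hF hG]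
  rfl

theorem pd_const (e : Chart M) (c : Fin 3) (x : M) (w : W) : pd e c (fun _ : M => w) x = 0 := by
  change mfderiv I3 𝓘(ℝ, W) (fun _ => w) x _ = _
  rw [mfderiv_const]
  rfl

theorem mdifferentiableAt_sum {κ : Type*} {t : Finset κ} {F : κ → M → W} {x : M}
    (hF : ∀ q ∈ t, MDifferentiableAt I3 𝓘(ℝ, W) (F q) x) :
    MDifferentiableAt I3 𝓘(ℝ, W) (fun y => ∑ q ∈ t, F q y) x := by
  classical
  induction t using Finset.induction_on with
  | empty => simpa using mdifferentiableAt_const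
  | insert a s ha ih =>
    simp only [Finset.sum_insert ha]
    exact (hF a (Finset.mem_insert_self _ _)).add
      (ih fun q hq => hF q (Finset.mem_insert_of_mem hq))

theorem pd_sum {κ : Type*} (e : Chart M) (c : Fin 3) {t : Finset κ} {F : κ → M → W} {x : M}
    (hF : ∀ q ∈ t, MDifferentiableAt I3 𝓘(ℝ, W) (F q) x) :
    pd e c (fun y => ∑ q ∈ t, F q y) x = ∑ q ∈ t, pd e c (F q) x := by
  classical
  induction t using Finset.induction_on with
  | empty => simpa using pd_const e c x 0
  | insert a s ha ih =>
    simp only [Finset.sum_insert ha]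
    rw [pd_add e c (hF a (Finset.mem_insert_self _ _))
      (mdifferentiableAt_sum fun q hq => hF q (Finset.mem_insert_of_mem hq)),
      ih fun q hq => hF q (Finset.mem_insert_of_mem hq)]

theorem pd_smul (e : Chart M) (c : Fin 3) {x : M} (hx : x ∈ e.1.source) {f : M → ℝ} {G : M → W}
    (hf : MDifferentiableAt I3 𝓘(ℝ, ℝ) f x) (hG : MDifferentiableAt I3 𝓘(ℝ, W) G x) :
    pd e c (fun y => f y • G y) x = pd e c f x • G x + f x • pd e c G x :=
  pd_bilin (ContinuousLinearMap.lsmul ℝ ℝ) e c hx hf hG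

theorem pd_mul (e : Chart M) (c : Fin 3) {x : M} (hx : x ∈ e.1.source) {f G : M → ℝ}
    (hf : MDifferentiableAt I3 𝓘(ℝ, ℝ) f x) (hG : MDifferentiableAt I3 𝓘(ℝ, ℝ) G x) :
    pd e c (fun y => f y * G y) x = pd e c f x * G x + f x * pd e c G x :=
  pd_smul e c hx hf hG

theorem pd_congr (e : Chart M) (c : Fin 3) {x : M} {F G : M → W} (h : F =ᶠ[nhds x] G) :
    pd e c F x = pd e c G x := by
  rw [pd, pd, dirDeriv, dirDeriv, h.mfderiv_eq]
  rfl

theorem pd_congr_on (e : Chart M) (c : Fin 3) {x : M} {O : Set M} (hO : IsOpen O) (hx : x ∈ O)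
    {F G : M → W} (h : ∀ y ∈ O, F y = G y) : pd e c F x = pd e c G x :=
  pd_congr e c (Filter.eventuallyEq_of_mem (hO.mem_nhds hx) h)

theorem ContMDiffOn.mdifferentiableAt' {O : Set M} (hO : IsOpen O) {F : M → W}
    (hF : ContMDiffOn I3 𝓘(ℝ, W) ∞ F O) {x : M} (hx : x ∈ O) :
    MDifferentiableAt I3 𝓘(ℝ, W) F x :=
  (hF.contMDiffAt (hO.mem_nhds hx)).mdifferentiableAt (by simp)

theorem contMDiffOn_pd (e : Chart M) (c : Fin 3) {O : Set M} (hO : IsOpen O)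
    {F : M → W} (hF : ContMDiffOn I3 𝓘(ℝ, W) ∞ F (e.1.source ∩ O)) :
    ContMDiffOn I3 𝓘(ℝ, W) ∞ (pd e c F) (e.1.source ∩ O) := by
  have h1 := contDiffOn_chart e hO hF
  have h2 := (h1.fderivWithin (uniqueDiffOn_chartDom e hO)
    (m := ∞) (by simp)).clm_apply (contDiffOn_const (c := EuclideanSpace.single c 1))
  refine contMDiffOn_chart e (h2.congr fun y hy => ?_)
  have h3 := coord_symm_mem e hy
  change pd e c F ((coord e).symm y) = _
  rw [pd_eq e c h3.1.1 (ContMDiffOn.mdifferentiableAt' (e.1.open_source.inter hO) hF h3.1), h3.2,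
    fderivWithin_congr_set (chartDom_eventuallyEq e hO hy)]

/-- Second partial derivatives commute. -/
theorem pd_comm (e : Chart M) (b c : Fin 3) {O : Set M} (hO : IsOpen O)
    {F : M → W} (hF : ContMDiffOn I3 𝓘(ℝ, W) ∞ F (e.1.source ∩ O)) {x : M}
    (hx : x ∈ e.1.source ∩ O) : pd e b (pd e c F) x = pd e c (pd e b F) x := by
  set G := F ∘ (coord e).symm
  set Ω := chartDom e O
  have hΩ : UniqueDiffOn ℝ Ω := uniqueDiffOn_chartDom e hO
  have hy : coord e x ∈ Ω := mem_chartDom e hx.1 hx.2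
  have hG : ContDiffOn ℝ ∞ G Ω := contDiffOn_chart e hO hF
  have hG' := hG.fderivWithin hΩ (m := ∞) (by simp)
  have key : ∀ b c : Fin 3, pd e b (pd e c F) x
      = fderivWithin ℝ (fderivWithin ℝ G Ω) Ω (coord e x) (EuclideanSpace.single b 1)
        (EuclideanSpace.single c 1) := by
    intro b c
    have h1 : MDifferentiableAt I3 𝓘(ℝ, W) (pd e c F) x :=
      ContMDiffOn.mdifferentiableAt' (e.1.open_source.inter hO) (contMDiffOn_pd e c hO hF) hx
    rw [pd_eq e b hx.1 h1, fderivWithin_congr_set (chartDom_eventuallyEq e hO hy)]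
    have h2 : ∀ y ∈ Ω, (pd e c F ∘ (coord e).symm) y
        = fderivWithin ℝ G Ω y (EuclideanSpace.single c 1) := by
      intro y hy
      have h3 := coord_symm_mem e hy
      change pd e c F ((coord e).symm y) = _
      rw [pd_eq e c h3.1.1 (ContMDiffOn.mdifferentiableAt' (e.1.open_source.inter hO) hF h3.1),
        h3.2, fderivWithin_congr_set (chartDom_eventuallyEq e hO hy)]
    rw [fderivWithin_congr h2 (h2 _ hy), fderivWithin_clm_apply (hΩ _ hy)
      (hG'.differentiableOn (by simp) _ hy) (differentiableWithinAt_const _)]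
    simp
  rw [key b c, key c b]
  have hcl : coord e x ∈ closure (interior Ω) := by
    obtain ⟨O', hO', h⟩ := exists_chartDom_eq e hO
    have h1 := I3.range_subset_closure_interior (chartDom_subset_range e O hy)
    change coord e x ∈ closure (interior (chartDom e O))
    rw [h, interior_inter, hO'.interior_eq, inter_comm]
    refine hO'.inter_closure ⟨?_, h1⟩
    have : coord e x ∈ chartDom e O := hy
    rw [h] at this
    exact this.2
  exact (hG _ hy).isSymmSndFDerivWithinAt
    (by rw [minSmoothness_of_isRCLikeNormedField]; exact WithTop.coe_le_coe.2 le_top) hΩ hcl hy _ _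

end PartialDerivatives

end Coulomb

namespace Coulomb

set_option linter.unusedSectionVars false

section Jacobian

variable {M : Type*} [TopologicalSpace M] [ChartedSpace (EuclideanHalfSpace 3) M]
  [IsManifold I3 ∞ M]
variable {W : Type*} [NormedAddCommGroup W] [NormedSpace ℝ W]

/-- The `d`-th coordinate on `ℝ³`. -/
def coordProj (d : Fin 3) : E3 →L[ℝ] ℝ := EuclideanSpace.proj d

/-- The coordinate function `y_d` of the chart `e`. -/
def coordFun (e : Chart M) (d : Fin 3) (x : M) : ℝ := coord e x d

theorem contMDiffOn_coordFun (e : Chart M) (d : Fin 3) :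
    ContMDiffOn I3 𝓘(ℝ, ℝ) ∞ (coordFun e d) e.1.source := by
  have h1 : ContMDiffOn I3 𝓘(ℝ, ℝ) ∞ (coordFun e d) (e.1.source ∩ univ) := by
    refine contMDiffOn_chart e ?_
    have h2 : ContDiffOn ℝ ∞ (fun y : E3 => y d) (chartDom e univ) := by fun_prop
    refine h2.congr fun y hy => ?_
    change coord e ((coord e).symm y) d = _
    rw [(coord_symm_mem e hy).2]
  simpa using h1

/-- The matrix of the derivative of the coordinate change from `e` to `e'`. -/
def jac (e e' : Chart M) (x : M) : Matrix (Fin 3) (Fin 3) ℝ :=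
  Matrix.of fun d c => pd e c (coordFun e' d) x

theorem coordVec_eq_sum (e e' : Chart M) (c : Fin 3) {x : M} (hx : x ∈ e.1.source ∩ e'.1.source) :
    coordVec e c x = ∑ d, jac e e' x d c • coordVec e' d x := by
  set e₀ : Chart M := achart (EuclideanHalfSpace 3) x
  have hx₀ : x ∈ e₀.1.source := mem_chart_source _ x
  have h1 := (tangentBundleCore I3 M).coordChange_comp e e' e₀ x ⟨hx, hx₀⟩
    (EuclideanSpace.single c 1)
  have h2 : (tangentBundleCore I3 M).coordChange e e' x (EuclideanSpace.single c 1)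
      = ∑ d, jac e e' x d c • EuclideanSpace.single d (1 : ℝ) := by
    ext d
    have h3 : jac e e' x d c = (tangentBundleCore I3 M).coordChange e e' x
        (EuclideanSpace.single c 1) d := by
      have h4 : MDifferentiableAt I3 𝓘(ℝ, ℝ) (coordFun e' d) x :=
        ContMDiffOn.mdifferentiableAt' e'.1.open_source (contMDiffOn_coordFun e' d) hx.2
      change pd e c _ x = _
      rw [pd_eq e c hx.1 h4]
      have hy := mem_chartDom e (V := e'.1.source ∩ univ) hx.1 ⟨hx.2, mem_univ _⟩
      have h5 := ((contDiffOn_chartTrans e e' univ).differentiableOn (by simp) _ hy).mono_of_mem_nhdsWithin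
        (chartDom_mem_nhdsWithin e (e'.1.open_source.inter isOpen_univ) hy)
      have h6 := ((coordProj d).hasFDerivAt).comp_hasFDerivWithinAt _ h5.hasFDerivWithinAt
      have h7 := h6.fderivWithin (uniqueDiffWithinAt_coord e x)
      exact DFunLike.congr_fun h7 _
    rw [← h3]
    fin_cases d <;> simp [Fin.sum_univ_three]
  rw [h2, map_sum] at h1
  simp only [map_smul] at h1
  exact h1.symm

theorem pd_eq_sum_jac (e e' : Chart M) (c : Fin 3) {x : M} (hx : x ∈ e.1.source ∩ e'.1.source)
    (F : M → W) : pd e c F x = ∑ d, jac e e' x d c • pd e' d F x := by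
  rw [pd, dirDeriv, coordVec_eq_sum e e' c hx, map_sum]
  simp only [map_smul]
  rfl

theorem pd_coordFun (e : Chart M) (c d : Fin 3) {x : M} (hx : x ∈ e.1.source) :
    pd e c (coordFun e d) x = if d = c then 1 else 0 := by
  have h4 : MDifferentiableAt I3 𝓘(ℝ, ℝ) (coordFun e d) x :=
    ContMDiffOn.mdifferentiableAt' e.1.open_source (contMDiffOn_coordFun e d) hx
  rw [pd_eq e c hx h4]
  have h6 : HasFDerivWithinAt (fun y : E3 => y d) (coordProj d) (range I3) (coord e x) :=
    (coordProj d).hasFDerivAt.hasFDerivWithinAt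
  have hy := mem_chartDom e (V := univ) hx (mem_univ x)
  have h7 : HasFDerivWithinAt (coordFun e d ∘ (coord e).symm) (coordProj d) (range I3) (coord e x) := by
    refine h6.congr_of_eventuallyEq ?_ ?_
    · filter_upwards [chartDom_mem_nhdsWithin e isOpen_univ hy] with y hy
      change coord e ((coord e).symm y) d = _
      rw [(coord_symm_mem e hy).2]
    · change coord e ((coord e).symm (coord e x)) d = _
      rw [coord_symm_coord e hx]
  rw [h7.fderivWithin (uniqueDiffWithinAt_coord e x)]
  change (EuclideanSpace.single c (1 : ℝ) : E3) d = _
  simp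

theorem jac_mul_jac (e e' : Chart M) {x : M} (hx : x ∈ e.1.source ∩ e'.1.source) :
    jac e' e x * jac e e' x = 1 := by
  ext b c
  have h1 := pd_eq_sum_jac e e' c hx (coordFun e b)
  rw [pd_coordFun e c b hx.1] at h1
  rw [Matrix.mul_apply, Matrix.one_apply, h1]
  exact Finset.sum_congr rfl fun d _ => mul_comm _ _

theorem contMDiffOn_jac (e e' : Chart M) (d c : Fin 3) :
    ContMDiffOn I3 𝓘(ℝ, ℝ) ∞ (fun x => jac e e' x d c) (e.1.source ∩ e'.1.source) :=
  contMDiffOn_pd e c e'.1.open_source ((contMDiffOn_coordFun e' d).mono inter_subset_right)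

theorem pd_jac_comm (e e' : Chart M) (b c d : Fin 3) {x : M} (hx : x ∈ e.1.source ∩ e'.1.source) :
    pd e b (fun y => jac e e' y d c) x = pd e c (fun y => jac e e' y d b) x :=
  pd_comm e b c e'.1.open_source ((contMDiffOn_coordFun e' d).mono inter_subset_right) hx

theorem contMDiffOn_coordVec (e : Chart M) (c : Fin 3) :
    ContMDiffOn I3 (I3.prod 𝓘(ℝ, E3)) ∞
      (fun x => Bundle.TotalSpace.mk' E3 (E := fun x : M => TangentSpace I3 x) x (coordVec e c x))
      e.1.source := by
  let T : Bundle.Trivialization E3 (Bundle.TotalSpace.proj : TangentBundle I3 M → M) :=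
    (tangentBundleCore I3 M).localTriv e
  have hT : MemTrivializationAtlas T := ⟨⟨e, rfl⟩⟩
  have h := T.contMDiffOn_section_baseSet_iff
    (IB := I3) (n := ∞) (s := fun x => coordVec e c x)
  refine h.2 ((contMDiffOn_const (c := EuclideanSpace.single c (1 : ℝ))).congr fun x hx => ?_)
  have hx : x ∈ e.1.source := hx
  have hx₀ : x ∈ (achart (EuclideanHalfSpace 3) x).1.source := mem_chart_source _ x
  have h1 := (tangentBundleCore I3 M).coordChange_comp e (achart _ x) e x ⟨⟨hx, hx₀⟩, hx⟩
    (EuclideanSpace.single c (1 : ℝ))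
  rw [(tangentBundleCore I3 M).coordChange_self e x hx] at h1
  exact h1

end Jacobian

section Gram

variable {M : Type*} [TopologicalSpace M] [ChartedSpace (EuclideanHalfSpace 3) M]
  [IsManifold I3 ∞ M] (g : Metric M)

theorem gram_isSymm (e : Chart M) (x : M) : (gram g e x).transpose = gram g e x := by
  ext b c
  exact g.symm x _ _

theorem contMDiffOn_gram (e : Chart M) (b c : Fin 3) :
    ContMDiffOn I3 𝓘(ℝ, ℝ) ∞ (fun x => gram g e x b c) e.1.source := by
  intro x hx
  have h : ContMDiffWithinAt I3 (I3.prod 𝓘(ℝ)) ∞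
      (fun m ↦ Bundle.TotalSpace.mk' ℝ (E := Bundle.Trivial M ℝ) m
        (g.inner m (coordVec e b m) (coordVec e c m))) e.1.source x := by
    apply ContMDiffWithinAt.clm_bundle_apply₂ (F₁ := E3) (F₂ := E3)
    · exact g.contMDiff.contMDiffAt.contMDiffWithinAt
    · exact contMDiffOn_coordVec e b x hx
    · exact contMDiffOn_coordVec e c x hx
  simp only [Bundle.contMDiffWithinAt_totalSpace] at h
  exact h.2

theorem gram_eq (e e' : Chart M) {x : M} (hx : x ∈ e.1.source ∩ e'.1.source) :
    gram g e x = (jac e e' x).transpose * gram g e' x * jac e e' x := by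
  ext b c
  change g.inner x (coordVec e b x) (coordVec e c x) = _
  rw [coordVec_eq_sum e e' b hx, coordVec_eq_sum e e' c hx, Matrix.mul_apply]
  simp only [map_sum, map_smul, Matrix.mul_apply, sum_apply, smul_apply,
    Matrix.transpose_apply, Finset.sum_mul, smul_eq_mul]
  refine Finset.sum_congr rfl fun d _ => ?_
  rw [Finset.mul_sum]
  refine Finset.sum_congr rfl fun d' _ => ?_
  change _ = _ * g.inner x (coordVec e' d' x) (coordVec e' d x) * _
  ring

theorem gram_posDef (e : Chart M) {x : M} (hx : x ∈ e.1.source) : (gram g e x).PosDef := by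
  refine Matrix.PosDef.of_dotProduct_mulVec_pos ?_ ?_
  · ext b c
    exact g.symm x _ _
  · intro v hv
    have h0 : (∑ b, v b • coordVec e b x : TangentSpace I3 x) ≠ 0 := by
      intro h0
      apply hv
      ext b
      have h1 : mfderiv I3 𝓘(ℝ, ℝ) (coordFun e b) x (∑ b, v b • coordVec e b x) = 0 := by
        rw [h0, map_zero]
      rw [map_sum] at h1
      simp only [map_smul] at h1
      have h2 : ∑ c, v c • pd e c (coordFun e b) x = 0 := h1
      simpa [pd_coordFun e _ _ hx] using h2
    have h1 := g.pos x _ h0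
    convert! h1 using 1
    simp only [map_sum, map_smul, sum_apply, smul_apply, dotProduct,
      Matrix.mulVec, smul_eq_mul, Finset.mul_sum, star_trivial]
    rw [Finset.sum_comm]
    refine Finset.sum_congr rfl fun b _ => Finset.sum_congr rfl fun c _ => ?_
    change _ * (g.inner x (coordVec e c x) (coordVec e b x) * _) = _
    ring

end Gram

end Coulomb

namespace Coulomb

set_option linter.unusedSectionVars false

section Divergence

variable {M : Type*} [TopologicalSpace M] [ChartedSpace (EuclideanHalfSpace 3) M]
  [IsManifold I3 ∞ M]
variable {W : Type*} [NormedAddCommGroup W] [NormedSpace ℝ W]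

theorem mdiff_smul {f : M → ℝ} {G : M → W} {x : M} (hf : MDifferentiableAt I3 𝓘(ℝ, ℝ) f x)
    (hG : MDifferentiableAt I3 𝓘(ℝ, W) G x) :
    MDifferentiableAt I3 𝓘(ℝ, W) (fun y => f y • G y) x := hf.smul hG

theorem mdiff_mul {f h : M → ℝ} {x : M} (hf : MDifferentiableAt I3 𝓘(ℝ, ℝ) f x)
    (hh : MDifferentiableAt I3 𝓘(ℝ, ℝ) h x) :
    MDifferentiableAt I3 𝓘(ℝ, ℝ) (fun y => f y * h y) x := hf.mul hh

theorem mdiff_add {f h : M → W} {x : M} (hf : MDifferentiableAt I3 𝓘(ℝ, W) f x)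
    (hh : MDifferentiableAt I3 𝓘(ℝ, W) h x) :
    MDifferentiableAt I3 𝓘(ℝ, W) (fun y => f y + h y) x := hf.add hh

theorem mdiff_sub {f h : M → W} {x : M} (hf : MDifferentiableAt I3 𝓘(ℝ, W) f x)
    (hh : MDifferentiableAt I3 𝓘(ℝ, W) h x) :
    MDifferentiableAt I3 𝓘(ℝ, W) (fun y => f y - h y) x := hf.sub hh

/-- The partial derivatives of the entries of a matrix valued function. -/
def pdM (e : Chart M) (b : Fin 3) (A : M → Matrix (Fin 3) (Fin 3) ℝ) (x : M) :
    Matrix (Fin 3) (Fin 3) ℝ :=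
  Matrix.of fun i j => pd e b (fun y => A y i j) x

/-- Matrix valued functions with differentiable entries. -/
def MDiffM (A : M → Matrix (Fin 3) (Fin 3) ℝ) (x : M) : Prop :=
  ∀ i j, MDifferentiableAt I3 𝓘(ℝ, ℝ) (fun y => A y i j) x

theorem MDiffM.mul {A B : M → Matrix (Fin 3) (Fin 3) ℝ} {x : M} (hA : MDiffM A x)
    (hB : MDiffM B x) : MDiffM (fun y => A y * B y) x := fun i j => by
  simp only [Matrix.mul_apply]
  exact mdifferentiableAt_sum fun k _ => mdiff_mul (hA i k) (hB k j)

theorem pdM_mul (e : Chart M) (b : Fin 3) {A B : M → Matrix (Fin 3) (Fin 3) ℝ} {x : M}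
    (hx : x ∈ e.1.source) (hA : MDiffM A x) (hB : MDiffM B x) :
    pdM e b (fun y => A y * B y) x = pdM e b A x * B x + A x * pdM e b B x := by
  ext i j
  simp only [pdM, Matrix.of_apply, Matrix.add_apply, Matrix.mul_apply]
  rw [pd_sum e b fun k _ => mdiff_mul (hA i k) (hB k j), ← Finset.sum_add_distrib]
  exact Finset.sum_congr rfl fun k _ => pd_mul e b hx (hA i k) (hB k j)

theorem pdM_congr_on (e : Chart M) (c : Fin 3) {x : M} {O : Set M} (hO : IsOpen O) (hx : x ∈ O)
    {A B : M → Matrix (Fin 3) (Fin 3) ℝ} (h : ∀ y ∈ O, A y = B y) : pdM e c A x = pdM e c B x := by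
  ext i j
  exact pd_congr_on e c hO hx fun y hy => by rw [h y hy]

theorem pdM_eq_zero_of_const (e : Chart M) (c : Fin 3) (x : M) (A : Matrix (Fin 3) (Fin 3) ℝ) :
    pdM e c (fun _ => A) x = 0 := by
  ext i j
  exact pd_const e c x _

/-- The chain rule with a real function. -/
theorem pd_comp_real (e : Chart M) (c : Fin 3) {x : M} {f : M → ℝ} {φ : ℝ → ℝ} {φ' : ℝ}
    (hf : MDifferentiableAt I3 𝓘(ℝ, ℝ) f x) (hφ : HasDerivAt φ φ' (f x)) :
    pd e c (fun y => φ (f y)) x = φ' * pd e c f x := by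
  have h := mfderiv_comp x hφ.differentiableAt.mdifferentiableAt hf
  change mfderiv I3 𝓘(ℝ, ℝ) (φ ∘ f) x _ = _
  rw [h, mfderiv_eq_fderiv, hφ.hasFDerivAt.fderiv]
  change (pd e c f x) * φ' = _
  ring

theorem pd_det (e : Chart M) (c : Fin 3) {A : M → Matrix (Fin 3) (Fin 3) ℝ} {x : M}
    (hx : x ∈ e.1.source) (hA : MDiffM A x) :
    pd e c (fun y => (A y).det) x = ((A x).adjugate * pdM e c A x).trace := by
  have hm : ∀ i j k l m n, pd e c (fun y => A y i j * A y k l * A y m n) x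
      = (pd e c (fun y => A y i j) x * A x k l + A x i j * pd e c (fun y => A y k l) x) * A x m n
        + A x i j * A x k l * pd e c (fun y => A y m n) x := fun i j k l m n => by
    rw [pd_mul e c hx (mdiff_mul (hA i j) (hA k l)) (hA m n), pd_mul e c hx (hA i j) (hA k l)]
  have hd : ∀ i j k l m n, MDifferentiableAt I3 𝓘(ℝ, ℝ) (fun y => A y i j * A y k l * A y m n) x :=
    fun i j k l m n => mdiff_mul (mdiff_mul (hA i j) (hA k l)) (hA m n)
  have hs : ∀ {f h : M → ℝ}, MDifferentiableAt I3 𝓘(ℝ, ℝ) f x → MDifferentiableAt I3 𝓘(ℝ, ℝ) h x →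
      pd e c (fun y => f y - h y) x = pd e c f x - pd e c h x := fun {f h} hf hh => by
    have h1 := pd_add e c (hf.sub hh) hh
    simp only [Pi.sub_apply, sub_add_cancel] at h1
    rw [eq_sub_iff_add_eq]
    exact h1.symm
  simp only [Matrix.det_fin_three]
  have d1 := hd 0 0 1 1 2 2
  have d2 := hd 0 0 1 2 2 1
  have d3 := hd 0 1 1 0 2 2
  have d4 := hd 0 1 1 2 2 0
  have d5 := hd 0 2 1 0 2 1
  have d6 := hd 0 2 1 1 2 0
  have s2 := mdiff_sub d1 d2
  have s3 := mdiff_sub s2 d3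
  have s4 := mdiff_add s3 d4
  have s5 := mdiff_add s4 d5
  rw [hs s5 d6, pd_add e c s4 d5, pd_add e c s3 d4, hs s2 d3, hs d1 d2]
  simp only [hm, Matrix.adjugate_fin_three, Matrix.trace, Matrix.diag, Matrix.mul_apply,
    Fin.sum_univ_three, pdM, Matrix.of_apply, Matrix.cons_val]
  ring

variable (g : Metric M)

theorem gram_det_pos (e : Chart M) {x : M} (hx : x ∈ e.1.source) : 0 < (gram g e x).det :=
  (gram_posDef g e hx).det_pos

theorem gram_mul_gramInv (e : Chart M) {x : M} (hx : x ∈ e.1.source) :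
    gram g e x * gramInv g e x = 1 :=
  Matrix.mul_nonsing_inv _ (gram_det_pos g e hx).ne'.isUnit

theorem gramInv_mul_gram (e : Chart M) {x : M} (hx : x ∈ e.1.source) :
    gramInv g e x * gram g e x = 1 :=
  Matrix.nonsing_inv_mul _ (gram_det_pos g e hx).ne'.isUnit

theorem gramInv_isSymm (e : Chart M) (x : M) : (gramInv g e x).transpose = gramInv g e x := by
  rw [gramInv, Matrix.transpose_nonsing_inv, gram_isSymm]

theorem gramInv_comm (e : Chart M) (x : M) (b c : Fin 3) : gramInv g e x b c = gramInv g e x c b :=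
  congrFun (congrFun (gramInv_isSymm g e x) c) b

theorem gramInv_zero_pos (e : Chart M) {x : M} (hx : x ∈ e.1.source) : 0 < gramInv g e x 0 0 :=
  (gram_posDef g e hx).inv.diag_pos

theorem contMDiffOn_gram_det (e : Chart M) :
    ContMDiffOn I3 𝓘(ℝ, ℝ) ∞ (fun x => (gram g e x).det) e.1.source := by
  simp only [Matrix.det_fin_three]
  have h := contMDiffOn_gram g e
  exact (((((((h 0 0).mul (h 1 1)).mul (h 2 2)).sub (((h 0 0).mul (h 1 2)).mul (h 2 1))).sub
    (((h 0 1).mul (h 1 0)).mul (h 2 2))).add (((h 0 1).mul (h 1 2)).mul (h 2 0))).add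
    (((h 0 2).mul (h 1 0)).mul (h 2 1))).sub (((h 0 2).mul (h 1 1)).mul (h 2 0))

theorem contMDiffOn_comp_real {O : Set M} {f : M → ℝ} {φ : ℝ → ℝ} (hf : ContMDiffOn I3 𝓘(ℝ, ℝ) ∞ f O)
    (hφ : ∀ x ∈ O, ContDiffAt ℝ ∞ φ (f x)) : ContMDiffOn I3 𝓘(ℝ, ℝ) ∞ (fun x => φ (f x)) O :=
  fun x hx => (hφ x hx).contMDiffAt.comp_contMDiffWithinAt x (hf x hx)

theorem contMDiffOn_gramInv (e : Chart M) (b c : Fin 3) :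
    ContMDiffOn I3 𝓘(ℝ, ℝ) ∞ (fun x => gramInv g e x b c) e.1.source := by
  have h := contMDiffOn_gram g e
  have hadj : ContMDiffOn I3 𝓘(ℝ, ℝ) ∞ (fun x => (gram g e x).adjugate b c) e.1.source := by
    have h2 : ∀ i j k l m n o p, ContMDiffOn I3 𝓘(ℝ, ℝ) ∞ (fun x =>
        gram g e x i j * gram g e x k l - gram g e x m n * gram g e x o p) e.1.source :=
      fun i j k l m n o p => ((h i j).mul (h k l)).sub ((h m n).mul (h o p))
    have h3 : ∀ i j k l m n o p, ContMDiffOn I3 𝓘(ℝ, ℝ) ∞ (fun x =>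
        -(gram g e x i j * gram g e x k l) + gram g e x m n * gram g e x o p) e.1.source :=
      fun i j k l m n o p => ((h i j).mul (h k l)).neg.add ((h m n).mul (h o p))
    simp only [Matrix.adjugate_fin_three]
    fin_cases b <;> fin_cases c <;> simp <;> first | exact h2 _ _ _ _ _ _ _ _ | exact h3 _ _ _ _ _ _ _ _
  have hdet := contMDiffOn_comp_real (contMDiffOn_gram_det g e) (φ := fun t => t⁻¹)
    fun x hx => contDiffAt_inv ℝ (gram_det_pos g e hx).ne'
  refine (hdet.mul hadj).congr fun x _ => ?_
  simp [gramInv, Matrix.inv_def]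

theorem contMDiffOn_density (e : Chart M) :
    ContMDiffOn I3 𝓘(ℝ, ℝ) ∞ (density g e) e.1.source :=
  contMDiffOn_comp_real (contMDiffOn_gram_det g e) fun _ hx =>
    Real.contDiffAt_sqrt (gram_det_pos g e hx).ne'

theorem density_pos (e : Chart M) {x : M} (hx : x ∈ e.1.source) : 0 < density g e x :=
  Real.sqrt_pos.2 (gram_det_pos g e hx)

theorem mDiffM_gram (e : Chart M) {x : M} (hx : x ∈ e.1.source) : MDiffM (gram g e) x :=
  fun i j => ContMDiffOn.mdifferentiableAt' e.1.open_source (contMDiffOn_gram g e i j) hx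

theorem mDiffM_gramInv (e : Chart M) {x : M} (hx : x ∈ e.1.source) : MDiffM (gramInv g e) x :=
  fun i j => ContMDiffOn.mdifferentiableAt' e.1.open_source (contMDiffOn_gramInv g e i j) hx

theorem mDiffM_jac (e e' : Chart M) {x : M} (hx : x ∈ e.1.source ∩ e'.1.source) :
    MDiffM (jac e e') x :=
  fun i j => ContMDiffOn.mdifferentiableAt' (e.1.open_source.inter e'.1.open_source)
    (contMDiffOn_jac e e' i j) hx

/-- The logarithmic derivative of the density. -/
def logDens (e : Chart M) (b : Fin 3) (x : M) : ℝ :=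
  1 / 2 * (gramInv g e x * pdM e b (gram g e) x).trace

theorem contMDiffOn_logDens (e : Chart M) (b : Fin 3) :
    ContMDiffOn I3 𝓘(ℝ, ℝ) ∞ (logDens g e b) e.1.source := by
  unfold logDens
  simp only [Matrix.trace, Matrix.diag, Matrix.mul_apply, Fin.sum_univ_three, pdM, Matrix.of_apply]
  have h : ∀ i j k l, ContMDiffOn I3 𝓘(ℝ, ℝ) ∞
      (fun x => gramInv g e x i j * pd e b (fun y => gram g e y k l) x) e.1.source := by
    intro i j k l
    have h1 := contMDiffOn_pd e b isOpen_univ ((contMDiffOn_gram g e k l).mono inter_subset_left)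
    rw [inter_univ] at h1
    exact (contMDiffOn_gramInv g e i j).mul h1
  have h3 : ∀ {a b c : M → ℝ}, ContMDiffOn I3 𝓘(ℝ, ℝ) ∞ a e.1.source →
      ContMDiffOn I3 𝓘(ℝ, ℝ) ∞ b e.1.source → ContMDiffOn I3 𝓘(ℝ, ℝ) ∞ c e.1.source →
      ContMDiffOn I3 𝓘(ℝ, ℝ) ∞ (fun x => a x + b x + c x) e.1.source :=
    fun ha hb hc => (ha.add hb).add hc
  exact contMDiffOn_const.mul (h3 (h3 (h _ _ _ _) (h _ _ _ _) (h _ _ _ _))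
    (h3 (h _ _ _ _) (h _ _ _ _) (h _ _ _ _)) (h3 (h _ _ _ _) (h _ _ _ _) (h _ _ _ _)))

theorem pd_density (e : Chart M) (b : Fin 3) {x : M} (hx : x ∈ e.1.source) :
    pd e b (density g e) x = density g e x * logDens g e b x := by
  have hd := gram_det_pos g e hx
  have h1 := pd_comp_real e b (ContMDiffOn.mdifferentiableAt' e.1.open_source
    (contMDiffOn_gram_det g e) hx) (Real.hasDerivAt_sqrt hd.ne')
  change pd e b (fun y => √(gram g e y).det) x = _
  rw [h1, pd_det e b hx (mDiffM_gram g e hx), logDens, density, gramInv, Matrix.inv_def,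
    Matrix.smul_mul, Matrix.trace_smul, Ring.inverse_eq_inv', smul_eq_mul]
  have h2 := Real.sq_sqrt hd.le
  have h3 := (Real.sqrt_pos.2 hd).ne'
  set s := √(gram g e x).det
  rw [← h2]
  field_simp

theorem pdM_gramInv (e : Chart M) (b : Fin 3) {x : M} (hx : x ∈ e.1.source) :
    pdM e b (gramInv g e) x = -(gramInv g e x * pdM e b (gram g e) x * gramInv g e x) := by
  have h1 := pdM_mul e b hx (mDiffM_gram g e hx) (mDiffM_gramInv g e hx)
  rw [pdM_congr_on e b e.1.open_source hx (B := fun _ => 1) fun y hy => gram_mul_gramInv g e hy,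
    pdM_eq_zero_of_const] at h1
  have h2 : gramInv g e x * (gram g e x * pdM e b (gramInv g e) x)
      = -(gramInv g e x * (pdM e b (gram g e) x * gramInv g e x)) := by
    rw [← mul_neg]
    congr 1
    exact (neg_eq_of_add_eq_zero_right h1.symm).symm
  rwa [← mul_assoc, gramInv_mul_gram g e hx, one_mul, ← mul_assoc] at h2

theorem gramInv_eq (e e' : Chart M) {x : M} (hx : x ∈ e.1.source ∩ e'.1.source) :
    gramInv g e' x = jac e e' x * gramInv g e x * (jac e e' x).transpose := by
  have h1 := jac_mul_jac e e' hx
  have h2 := mul_eq_one_comm.1 h1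
  have h3 : (jac e e' x).transpose * (jac e' e x).transpose = 1 := by
    rw [← Matrix.transpose_mul, h1, Matrix.transpose_one]
  have h4 := mul_eq_one_comm.1 h3
  refine Matrix.inv_eq_left_inv ?_
  rw [gram_eq g e' e hx.symm]
  calc _ = jac e e' x * (gramInv g e x * (((jac e e' x).transpose * (jac e' e x).transpose)
        * gram g e x)) * jac e' e x := by simp only [mul_assoc]
    _ = _ := by rw [h3, one_mul, gramInv_mul_gram g e hx.1, mul_one, h2]

theorem logDens_eq (e e' : Chart M) (b : Fin 3) {x : M} (hx : x ∈ e.1.source ∩ e'.1.source) :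
    logDens g e b x = (jac e' e x * pdM e b (jac e e') x).trace
      + ∑ d, jac e e' x d b * logDens g e' d x := by
  have h1 := jac_mul_jac e e' hx
  have h2 := mul_eq_one_comm.1 h1
  set J := jac e e' x with hJ
  set K := jac e' e x
  have hJd := mDiffM_jac e e' hx
  have hJtd : MDiffM (fun y => (jac e e' y).transpose) x := fun i j => hJd j i
  have hGd := mDiffM_gram g e' hx.2
  have e1 : pdM e b (gram g e) x = (pdM e b (jac e e') x).transpose * gram g e' x * J
      + J.transpose * pdM e b (gram g e') x * J
      + J.transpose * gram g e' x * pdM e b (jac e e') x := by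
    rw [pdM_congr_on e b (e.1.open_source.inter e'.1.open_source) hx fun y hy => gram_eq g e e' hy,
      pdM_mul e b hx.1 (hJtd.mul hGd) hJd, pdM_mul e b hx.1 hJtd hGd, add_mul]
    rfl
  have e2 : gramInv g e x = K * gramInv g e' x * K.transpose := gramInv_eq g e' e hx.symm
  have hKJ : K.transpose * J.transpose = 1 := by
    rw [← Matrix.transpose_mul, h2, Matrix.transpose_one]
  have hJK : J.transpose * K.transpose = 1 := mul_eq_one_comm.1 hKJ
  have t1 : (gramInv g e x * ((pdM e b (jac e e') x).transpose * gram g e' x * J)).trace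
      = (K * pdM e b (jac e e') x).trace := by
    rw [e2, ← Matrix.trace_transpose (K * _), Matrix.transpose_mul]
    calc _ = ((K * gramInv g e' x * K.transpose * (pdM e b (jac e e') x).transpose * gram g e' x)
          * J).trace := by simp only [mul_assoc]
      _ = ((J * K) * (gramInv g e' x * (K.transpose * (pdM e b (jac e e') x).transpose)
          * gram g e' x)).trace := by rw [Matrix.trace_mul_comm]; simp only [mul_assoc]
      _ = ((gram g e' x * gramInv g e' x)
          * (K.transpose * (pdM e b (jac e e') x).transpose)).trace := by
        rw [h2, one_mul, Matrix.trace_mul_comm, mul_assoc]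
      _ = _ := by rw [gram_mul_gramInv g e' hx.2, one_mul, Matrix.trace_mul_comm]
  have t2 : (gramInv g e x * (J.transpose * pdM e b (gram g e') x * J)).trace
      = (gramInv g e' x * pdM e b (gram g e') x).trace := by
    rw [e2]
    calc _ = ((K * gramInv g e' x * (K.transpose * J.transpose) * pdM e b (gram g e') x)
          * J).trace := by simp only [mul_assoc]
      _ = ((J * K) * (gramInv g e' x * pdM e b (gram g e') x)).trace := by
        rw [hKJ, mul_one, Matrix.trace_mul_comm]; simp only [mul_assoc]
      _ = _ := by rw [h2, one_mul]
  have t3 : (gramInv g e x * (J.transpose * gram g e' x * pdM e b (jac e e') x)).trace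
      = (K * pdM e b (jac e e') x).trace := by
    rw [e2]
    calc _ = (K * (gramInv g e' x * ((K.transpose * J.transpose) * gram g e' x))
          * pdM e b (jac e e') x).trace := by simp only [mul_assoc]
      _ = _ := by rw [hKJ, one_mul, gramInv_mul_gram g e' hx.2, mul_one]
  have e3 : pdM e b (gram g e') x = ∑ d, J d b • pdM e' d (gram g e') x := by
    ext i j
    rw [Matrix.sum_apply]
    exact pd_eq_sum_jac e e' b hx _
  rw [logDens, e1, mul_add, mul_add, Matrix.trace_add, Matrix.trace_add, t1, t2, t3, e3,
    Finset.mul_sum, Matrix.trace_sum]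
  simp only [logDens, Matrix.mul_smul, Matrix.trace_smul, smul_eq_mul, Fin.sum_univ_three]
  ring

/-- The divergence of a vector field with components `Y b` in the chart `e`. -/
def divg (e : Chart M) (Y : Fin 3 → M → W) (x : M) : W :=
  ∑ b, (pd e b (Y b) x + logDens g e b x • Y b x)

theorem divg_eq (e e' : Chart M) {Y Y' : Fin 3 → M → W} {O : Set M} (hO : IsOpen O)
    (hOe : O ⊆ e.1.source ∩ e'.1.source) {x : M} (hx : x ∈ O)
    (hY : ∀ b, MDifferentiableAt I3 𝓘(ℝ, W) (Y b) x)
    (h : ∀ y ∈ O, ∀ d, Y' d y = ∑ b, jac e e' y d b • Y b y) : divg g e Y x = divg g e' Y' x := by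
  have hJd := mDiffM_jac e e' (hOe hx)
  have e1 : ∀ d, pd e' d (Y' d) x = ∑ c, jac e' e x c d • ∑ b,
      (pd e c (fun y => jac e e' y d b) x • Y b x + jac e e' x d b • pd e c (Y b) x) := by
    intro d
    rw [pd_congr_on e' d hO hx fun y hy => h y hy d, pd_eq_sum_jac e' e d (hOe hx).symm]
    refine Finset.sum_congr rfl fun c _ => ?_
    rw [pd_sum e c fun b _ => mdiff_smul (hJd d b) (hY b)]
    congr 1
    exact Finset.sum_congr rfl fun b _ => pd_smul e c (hOe hx).1 (hJd d b) (hY b)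
  have hKJ := fun b c => congrFun (congrFun (jac_mul_jac e e' (hOe hx)) b) c
  simp only [Matrix.mul_apply, Matrix.one_apply] at hKJ
  simp only [divg, e1, h x hx]
  have e2 : ∀ b, logDens g e b x = (∑ c, ∑ d, jac e' e x c d * pd e c (fun y => jac e e' y d b) x)
      + ∑ d, jac e e' x d b * logDens g e' d x := by
    intro b
    rw [logDens_eq g e e' b (hOe hx)]
    congr 1
    simp only [Matrix.trace, Matrix.diag, Matrix.mul_apply, pdM, Matrix.of_apply]
    exact Finset.sum_congr rfl fun c _ => Finset.sum_congr rfl fun d _ => by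
      rw [pd_jac_comm e e' b c d (hOe hx)]
  simp only [e2, Finset.smul_sum, smul_add, add_smul, Finset.sum_add_distrib, Finset.sum_smul,
    smul_smul]
  have e3 : ∑ d, ∑ c, ∑ b, (jac e' e x c d * jac e e' x d b) • pd e c (Y b) x
      = ∑ b, pd e b (Y b) x := by
    rw [Finset.sum_comm]
    refine Finset.sum_congr rfl fun c _ => ?_
    rw [Finset.sum_comm]
    simp only [← Finset.sum_smul, hKJ]
    simp
  rw [e3]
  have e4 : ∑ d, ∑ c, ∑ b, (jac e' e x c d * pd e c (fun y => jac e e' y d b) x) • Y b x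
      = ∑ b, ∑ c, ∑ d, (jac e' e x c d * pd e c (fun y => jac e e' y d b) x) • Y b x := by
    rw [Finset.sum_comm]
    conv_rhs => rw [Finset.sum_comm]
    refine Finset.sum_congr rfl fun c _ => ?_
    rw [Finset.sum_comm]
  have e5 : ∑ b, ∑ d, (jac e e' x d b * logDens g e' d x) • Y b x
      = ∑ d, ∑ b, (logDens g e' d x * jac e e' x d b) • Y b x := by
    rw [Finset.sum_comm]
    simp only [mul_comm]
  rw [e4, e5]
  abel

theorem density_divg (e : Chart M) {x : M} (hx : x ∈ e.1.source) {η : Fin 3 → M → W}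
    (hη : ∀ b, MDifferentiableAt I3 𝓘(ℝ, W) (η b) x) :
    (density g e x)⁻¹ • ∑ b, pd e b (fun y => ∑ c, (density g e y * gramInv g e y b c) • η c y) x
      = divg g e (fun b y => ∑ c, gramInv g e y b c • η c y) x := by
  have ha := ContMDiffOn.mdifferentiableAt' e.1.open_source (contMDiffOn_density g e) hx
  have hY : ∀ b, MDifferentiableAt I3 𝓘(ℝ, W) (fun y => ∑ c, gramInv g e y b c • η c y) x :=
    fun b => mdifferentiableAt_sum fun c _ => mdiff_smul (mDiffM_gramInv g e hx b c) (hη c)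
  have h1 : ∀ b, pd e b (fun y => ∑ c, (density g e y * gramInv g e y b c) • η c y) x
      = density g e x • (pd e b (fun y => ∑ c, gramInv g e y b c • η c y) x
        + logDens g e b x • ∑ c, gramInv g e x b c • η c x) := by
    intro b
    simp only [mul_smul, ← Finset.smul_sum]
    rw [pd_smul e b hx ha (hY b), pd_density g e b hx, mul_smul, smul_add, add_comm]
  simp only [h1, ← Finset.smul_sum]
  rw [inv_smul_smul₀ (density_pos g e hx).ne']
  rfl

end Divergence

end Coulomb

namespace Coulomb

set_option linter.unusedSectionVars false

section BoundaryGeometry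

variable {M : Type*} [TopologicalSpace M] [ChartedSpace (EuclideanHalfSpace 3) M]
  [IsManifold I3 ∞ M]
variable {W W₁ W₂ W₃ : Type*} [NormedAddCommGroup W] [NormedSpace ℝ W]
  [NormedAddCommGroup W₁] [NormedSpace ℝ W₁] [NormedAddCommGroup W₂] [NormedSpace ℝ W₂]
  [NormedAddCommGroup W₃] [NormedSpace ℝ W₃]

theorem coordFun_zero_nonneg (e : Chart M) (x : M) : 0 ≤ coordFun e 0 x := by
  have h : coord e x ∈ range I3 := mem_range_self _
  rw [range_I3] at h
  exact h

theorem mem_bdry_iff (e : Chart M) {x : M} (hx : x ∈ e.1.source) :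
    x ∈ bdry M ↔ coordFun e 0 x = 0 := by
  constructor
  · intro hb
    by_contra h0
    have hpos : 0 < coordFun e 0 x := lt_of_le_of_ne (coordFun_zero_nonneg e x) (Ne.symm h0)
    rw [bdry, ← I3.compl_interior] at hb
    apply hb
    refine (I3.isInteriorPoint_iff_of_mem_atlas (n := ∞) (by simp) e.2 hx).2 ?_
    obtain ⟨O, hO, h⟩ := exists_chartDom_eq e isOpen_univ
    have hy := mem_chartDom e (V := univ) hx (mem_univ x)
    rw [h] at hy
    refine mem_interior.2 ⟨O ∩ {y : E3 | 0 < y 0}, ?_, hO.inter (isOpen_lt continuous_const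
      (coordProj 0).continuous), hy.2, hpos⟩
    rintro z ⟨hz, hz0⟩
    have hz1 : z ∈ chartDom e univ := by
      rw [h, range_I3]
      exact ⟨(show (0 : ℝ) < z 0 from hz0).le, hz⟩
    obtain ⟨w, hw, rfl⟩ := hz1
    exact (coord e).map_source (by simpa using hw.1)
  · intro h0
    refine mem_bdry_of_planeEmb e hx (z := WithLp.toLp 2 fun c => coord e x c.succ) ?_
    ext c
    refine Fin.cases ?_ (fun c => ?_) c
    · exact h0
    · simp [planeEmb]

/-- Tangential derivatives at the boundary of a function that vanishes on the boundary. -/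
theorem pd_succ_eq_zero (e : Chart M) (t : Fin 2) {O : Set M} (hO : IsOpen O) {x : M} (hx : x ∈ O)
    (hxe : x ∈ e.1.source) (hxb : x ∈ bdry M) {F : M → W}
    (hF : MDifferentiableAt I3 𝓘(ℝ, W) F x) (h : ∀ y ∈ O ∩ bdry M, F y = 0) :
    pd e t.succ F x = 0 := by
  obtain ⟨D, hD, h1⟩ := exists_hasFDerivWithinAt_coord e hxe hF
  rw [← h1]
  have h0 : coord e x 0 = 0 := (mem_bdry_iff e hxe).1 hxb
  set v : E3 := EuclideanSpace.single t.succ 1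
  have hv0 : v 0 = 0 := by simp [v, Fin.succ_ne_zero]
  have hγ : HasDerivAt (fun s : ℝ => coord e x + s • v) v 0 := by
    simpa using ((hasDerivAt_id (0 : ℝ)).smul_const v).const_add (coord e x)
  have hmem : ∀ s : ℝ, coord e x + s • v ∈ range I3 := by
    intro s
    rw [range_I3]
    change (0 : ℝ) ≤ coord e x 0 + s * v 0
    rw [h0, hv0]
    simp
  have h2 : HasDerivWithinAt (fun s : ℝ => (F ∘ (coord e).symm) (coord e x + s • v)) (D v) univ 0 := by
    have hD' : HasFDerivWithinAt (F ∘ (coord e).symm) D (range I3) (coord e x + (0 : ℝ) • v) := by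
      simpa using hD
    exact hD'.comp_hasDerivWithinAt 0 hγ.hasDerivWithinAt (fun s _ => hmem s)
  have h3 : ∀ᶠ s : ℝ in nhds 0, (F ∘ (coord e).symm) (coord e x + s • v) = 0 := by
    obtain ⟨O', hO', hd⟩ := exists_chartDom_eq e hO
    have hy := mem_chartDom e hxe hx
    rw [hd] at hy
    have hc : Filter.Tendsto (fun s : ℝ => coord e x + s • v) (nhds 0) (nhds (coord e x)) := by
      have := hγ.continuousAt.tendsto
      simpa using this
    filter_upwards [hc (hO'.mem_nhds hy.2)] with s hs
    have hs' : coord e x + s • v ∈ chartDom e O := by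
      rw [hd]
      exact ⟨hmem s, hs⟩
    have h4 := coord_symm_mem e hs'
    refine h _ ⟨h4.1.2, (mem_bdry_iff e h4.1.1).2 ?_⟩
    change coord e ((coord e).symm _) 0 = 0
    rw [h4.2]
    change coord e x 0 + s * v 0 = 0
    rw [h0, hv0]
    simp
  rw [hasDerivWithinAt_univ] at h2
  have h5 : HasDerivAt (fun _ : ℝ => (0 : W)) (D v) 0 :=
    h2.congr_of_eventuallyEq (h3.mono fun s hs => hs.symm)
  exact h5.unique (hasDerivAt_const 0 0)

theorem jac_zero_succ (e e' : Chart M) (t : Fin 2) {x : M} (hx : x ∈ e.1.source ∩ e'.1.source)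
    (hxb : x ∈ bdry M) : jac e e' x 0 t.succ = 0 :=
  pd_succ_eq_zero e t e'.1.open_source hx.2 hx.1 hxb
    (ContMDiffOn.mdifferentiableAt' e'.1.open_source (contMDiffOn_coordFun e' 0) hx.2)
    fun _ hy => (mem_bdry_iff e' hy.1).1 hy.2

theorem jac_zero_zero_pos (e e' : Chart M) {x : M} (hx : x ∈ e.1.source ∩ e'.1.source)
    (hxb : x ∈ bdry M) : 0 < jac e e' x 0 0 := by
  have hne : jac e e' x 0 0 ≠ 0 := by
    intro h0
    have hm := mul_eq_one_comm.1 (jac_mul_jac e e' hx)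
    have h1 := congrFun (congrFun hm 0) 0
    rw [Matrix.mul_apply, Fin.sum_univ_three, h0] at h1
    have h2 := jac_zero_succ e e' 0 hx hxb
    have h3 := jac_zero_succ e e' 1 hx hxb
    simp only [Fin.succ_zero_eq_one, Fin.succ_one_eq_two] at h2 h3
    rw [h2, h3] at h1
    simp at h1
  refine lt_of_le_of_ne ?_ hne.symm
  obtain ⟨D, hD, h1⟩ := exists_hasFDerivWithinAt_coord e hx.1
    (ContMDiffOn.mdifferentiableAt' e'.1.open_source (contMDiffOn_coordFun e' 0) hx.2)
  change 0 ≤ pd e 0 (coordFun e' 0) x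
  rw [← h1]
  set v : E3 := EuclideanSpace.single 0 1
  have hγ : HasDerivWithinAt (fun s : ℝ => coord e x + s • v) v (Ici 0) 0 := by
    have : HasDerivAt (fun s : ℝ => coord e x + s • v) v 0 := by
      simpa using ((hasDerivAt_id (0 : ℝ)).smul_const v).const_add (coord e x)
    exact this.hasDerivWithinAt
  have hmem : MapsTo (fun s : ℝ => coord e x + s • v) (Ici 0) (range I3) := by
    intro s hs
    rw [range_I3]
    change (0 : ℝ) ≤ coord e x 0 + s * v 0
    have h0 : (0 : ℝ) ≤ coord e x 0 := coordFun_zero_nonneg e x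
    have hs : (0 : ℝ) ≤ s := hs
    rw [show v 0 = 1 by simp [v], mul_one]
    positivity
  have hD' : HasFDerivWithinAt (coordFun e' 0 ∘ (coord e).symm) D (range I3)
      (coord e x + (0 : ℝ) • v) := by
    simpa using hD
  have h2 : HasDerivWithinAt (fun s : ℝ => (coordFun e' 0 ∘ (coord e).symm) (coord e x + s • v))
      (D v) (Ici 0) 0 := hD'.comp_hasDerivWithinAt 0 hγ hmem
  have h3 : (coordFun e' 0 ∘ (coord e).symm) (coord e x + (0 : ℝ) • v) = 0 := by
    rw [zero_smul, add_zero, Function.comp_apply, coord_symm_coord e hx.1]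
    exact (mem_bdry_iff e' hx.2).1 hxb
  have h5 := hasDerivWithinAt_iff_tendsto_slope.1 h2
  rw [Ici_sdiff_left] at h5
  refine ge_of_tendsto h5 ?_
  filter_upwards [self_mem_nhdsWithin] with s hs
  rw [slope_def_field, h3, sub_zero, sub_zero]
  have h4 : (0 : ℝ) ≤ s := le_of_lt hs
  exact div_nonneg (coordFun_zero_nonneg e' _) h4

variable (g : Metric M)

/-- The contraction `∑ g^{bc} B(a_b, a'_c)`. -/
def contr (B : W₁ →L[ℝ] W₂ →L[ℝ] W₃) (e : Chart M) (x : M) (a : Fin 3 → W₁) (a' : Fin 3 → W₂) :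
    W₃ :=
  ∑ b, ∑ c, gramInv g e x b c • B (a b) (a' c)

theorem contr_eq (B : W₁ →L[ℝ] W₂ →L[ℝ] W₃) (e e' : Chart M) {x : M}
    (hx : x ∈ e.1.source ∩ e'.1.source) {a b : Fin 3 → W₁} {a' b' : Fin 3 → W₂}
    (ha : ∀ c, a c = ∑ d, jac e e' x d c • b d) (ha' : ∀ c, a' c = ∑ d, jac e e' x d c • b' d) :
    contr g B e x a a' = contr g B e' x b b' := by
  have h := fun d d' => congrFun (congrFun (gramInv_eq g e e' hx) d) d'
  simp only [Matrix.mul_apply, Matrix.transpose_apply] at h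
  simp only [contr, ha, ha', map_add, map_smul, add_apply, smul_apply, h, Fin.sum_univ_three]
  module

/-- The inward unit normal, computed in the chart `e`. -/
def chartNormal (e : Chart M) (x : M) : TangentSpace I3 x :=
  (Real.sqrt (gramInv g e x 0 0))⁻¹ • ∑ c : Fin 3, gramInv g e x 0 c • coordVec e c x

theorem chartNormal_eq (e e' : Chart M) {x : M} (hx : x ∈ e.1.source ∩ e'.1.source)
    (hxb : x ∈ bdry M) : chartNormal g e x = chartNormal g e' x := by
  have h := fun d d' => congrFun (congrFun (gramInv_eq g e e' hx) d) d'
  simp only [Matrix.mul_apply, Matrix.transpose_apply] at h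
  have h1 := jac_zero_succ e e' 0 hx hxb
  have h2 := jac_zero_succ e e' 1 hx hxb
  simp only [Fin.succ_zero_eq_one, Fin.succ_one_eq_two] at h1 h2
  have h0 := jac_zero_zero_pos e e' hx hxb
  have hg := gramInv_zero_pos g e hx.1
  have e0 : gramInv g e' x 0 0 = jac e e' x 0 0 ^ 2 * gramInv g e x 0 0 := by
    rw [h]
    simp only [Fin.sum_univ_three, h1, h2]
    ring
  have e1 : ∀ d, gramInv g e' x 0 d = jac e e' x 0 0 * ∑ c, gramInv g e x 0 c * jac e e' x d c := by
    intro d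
    rw [h]
    simp only [Fin.sum_univ_three, h1, h2]
    ring
  rw [chartNormal, chartNormal, e0, Real.sqrt_mul (sq_nonneg _), Real.sqrt_sq h0.le]
  simp only [e1, coordVec_eq_sum e e' _ hx, mul_smul, ← Finset.smul_sum]
  rw [smul_smul, mul_inv, mul_comm, ← mul_assoc, mul_inv_cancel₀ h0.ne', one_mul]
  congr 1
  simp only [Finset.smul_sum, Finset.sum_smul, smul_smul]
  exact Finset.sum_comm

theorem inwardNormal_eq (e : Chart M) {x : M} (hx : x ∈ e.1.source) (hxb : x ∈ bdry M) :
    inwardNormal g x = chartNormal g e x :=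
  chartNormal_eq g (achart (EuclideanHalfSpace 3) x) e ⟨mem_chart_source _ x, hx⟩ hxb

/-- `τ` in the chart `e`. -/
def chartTau (e : Chart M) (x : M) : ℝ :=
  divg g e (fun b y => gramInv g e y b 0) x / √(gramInv g e x 0 0)
    - (∑ d, gramInv g e x 0 d * pd e d (fun y => gramInv g e y 0 0) x)
      / (2 * √(gramInv g e x 0 0) ^ 3)

theorem bdryGram_inv (e : Chart M) {x : M} (hx : x ∈ e.1.source) (b c : Fin 2) :
    (bdryGram g e x)⁻¹ b c = gramInv g e x b.succ c.succ
      - gramInv g e x b.succ 0 * gramInv g e x 0 c.succ / gramInv g e x 0 0 := by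
  have h0 := (gramInv_zero_pos g e hx).ne'
  suffices h : (bdryGram g e x)⁻¹ = Matrix.of fun b c : Fin 2 => gramInv g e x b.succ c.succ
      - gramInv g e x b.succ 0 * gramInv g e x 0 c.succ / gramInv g e x 0 0 by rw [h]; rfl
  refine Matrix.inv_eq_left_inv ?_
  ext b d
  have hm := fun b d => congrFun (congrFun (gramInv_mul_gram g e hx) b) d
  simp only [Matrix.mul_apply, Fin.sum_univ_succ (n := 2)] at hm
  have h1 := hm b.succ d.succ
  have h2 := hm 0 d.succ
  have e1 : (1 : Matrix (Fin 3) (Fin 3) ℝ) b.succ d.succ = (1 : Matrix (Fin 2) (Fin 2) ℝ) b d := by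
    simp [Matrix.one_apply]
  have e2 : (1 : Matrix (Fin 3) (Fin 3) ℝ) 0 d.succ = 0 := by
    simp [(Fin.succ_ne_zero d).symm]
  rw [e1] at h1
  rw [e2] at h2
  rw [Matrix.mul_apply, ← h1]
  simp only [bdryGram, Matrix.of_apply, Fin.sum_univ_two] at *
  field_simp
  linear_combination (-gramInv g e x b.succ 0) * h2

theorem tau_eq (x : M) : tau g x = chartTau g (achart (EuclideanHalfSpace 3) x) x := by
  have hx : x ∈ (achart (EuclideanHalfSpace 3) x).1.source := mem_chart_source _ x
  rw [tau, meanCurvature]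
  set e : Chart M := achart (EuclideanHalfSpace 3) x
  have h0 := gramInv_zero_pos g e hx
  have hs := Real.sqrt_pos.2 h0
  have hss := Real.sq_sqrt h0.le
  have hn : ∀ d, g.inner x (coordVec e d x) (-inwardNormal g x)
      = if d = 0 then -(√(gramInv g e x 0 0))⁻¹ else 0 := by
    intro d
    have hm := congrFun (congrFun (gramInv_mul_gram g e hx) 0) d
    rw [Matrix.mul_apply] at hm
    have h1 : g.inner x (coordVec e d x) (inwardNormal g x)
        = (√(gramInv g e x 0 0))⁻¹ * ∑ c, gramInv g e x 0 c * gram g e x c d := by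
      change g.inner x (coordVec e d x) ((√(gramInv g e x 0 0))⁻¹ •
        ∑ c, gramInv g e x 0 c • coordVec e c x) = _
      rw [map_smul, map_sum, smul_eq_mul]
      congr 1
      refine Finset.sum_congr rfl fun c _ => ?_
      rw [map_smul, smul_eq_mul, g.symm]
      rfl
    rw [map_neg, h1, hm, Matrix.one_apply]
    by_cases hd : d = 0
    · simp [hd]
    · simp [hd, Ne.symm hd]
  have hΓ : ∀ b c : Fin 2, secondFund g e x (-inwardNormal g x) b c
      = -(christoffel g e 0 b.succ c.succ x * (√(gramInv g e x 0 0))⁻¹) := by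
    intro b c
    rw [secondFund, Fin.sum_univ_three, hn, hn, hn]
    simp
  have hdi : ∀ d b c, pd e d (fun y => gramInv g e y b c) x
      = -(gramInv g e x * pdM e d (gram g e) x * gramInv g e x) b c := fun d b c =>
    congrFun (congrFun (pdM_gramInv g e d hx) b) c
  have hsG : ∀ d b c, pd e d (fun y => gram g e y b c) x = pd e d (fun y => gram g e y c b) x :=
    fun d b c => by
      congr 1
      ext y
      exact g.symm y _ _
  simp only [hΓ, bdryGram_inv g e hx, chartTau, divg, hdi, logDens, christoffel, Matrix.mul_apply,
    Matrix.trace, Matrix.diag, pdM, Matrix.of_apply, smul_eq_mul]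
  change _ * (_ * ∑ b : Fin 2, ∑ c : Fin 2, _ * -(_ * (∑ k, (pd e _ (fun y => gram g e y _ _) x
    + pd e _ (fun y => gram g e y _ _) x - pd e _ (fun y => gram g e y _ _) x) * _) * _)) = _
  have hI := gramInv_comm g e x
  generalize hD : (fun d b c => pd e d (fun y => gram g e y b c) x) = D at *
  have hD' : ∀ d b c, pd e d (fun y => gram g e y b c) x = D d b c := fun d b c => by rw [← hD]
  simp only [hD'] at hsG ⊢
  generalize gramInv g e x = h at *
  simp only [Fin.sum_univ_two, Fin.sum_univ_three, Fin.succ_zero_eq_one, Fin.succ_one_eq_two]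
  rw [hI 1 0, hI 2 0, hI 2 1]
  simp only [hsG _ 1 0, hsG _ 2 0, hsG _ 2 1]
  set s := √(h 0 0)
  rw [← hss]
  field_simp
  ring

end BoundaryGeometry

end Coulomb

namespace Coulomb

set_option linter.unusedSectionVars false

section BoundaryIdentity

variable {W₁ W₂ W₃ : Type*} [NormedAddCommGroup W₁] [NormedSpace ℝ W₁] [NormedAddCommGroup W₂]
  [NormedSpace ℝ W₂] [NormedAddCommGroup W₃] [NormedSpace ℝ W₃]

/-- The codifferential of a form with components `a c` and derivatives `p b c`, where `h`, `dh` and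
`l` are the inverse metric, its derivatives and the logarithmic derivatives of the density. -/
def codiffAlg (h : Fin 3 → Fin 3 → ℝ) (dh : Fin 3 → Fin 3 → Fin 3 → ℝ) (l : Fin 3 → ℝ)
    (p : Fin 3 → Fin 3 → W₁) (a : Fin 3 → W₁) : W₁ :=
  -∑ b, ∑ c, (h b c • p b c + (dh b b c + l b * h b c) • a c)

/-- The derivative in direction `d` of the contraction of two forms with components `a b`, `a' c`
and derivatives `p b c`, `p' b c`. -/
def dContrAlg (B : W₁ →L[ℝ] W₂ →L[ℝ] W₃) (h : Fin 3 → Fin 3 → ℝ) (dh : Fin 3 → Fin 3 → Fin 3 → ℝ)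
    (p : Fin 3 → Fin 3 → W₁) (a : Fin 3 → W₁) (p' : Fin 3 → Fin 3 → W₂) (a' : Fin 3 → W₂)
    (d : Fin 3) : W₃ :=
  ∑ b, ∑ c, (dh d b c • B (a b) (a' c) + h b c • (B (p d b) (a' c) + B (a b) (p' d c)))

/-- The normal derivative of the contraction of two forms with vanishing tangential parts. -/
theorem normal_contrAlg (B : W₁ →L[ℝ] W₂ →L[ℝ] W₃) {h : Fin 3 → Fin 3 → ℝ}
    {dh : Fin 3 → Fin 3 → Fin 3 → ℝ} {l : Fin 3 → ℝ} {p : Fin 3 → Fin 3 → W₁} {a : Fin 3 → W₁}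
    {p' : Fin 3 → Fin 3 → W₂} {a' : Fin 3 → W₂} (hI : ∀ b c, h b c = h c b) (h0 : 0 < h 0 0)
    (ha : ∀ t : Fin 2, a t.succ = 0) (ha' : ∀ t : Fin 2, a' t.succ = 0)
    (hp : ∀ s t : Fin 2, p s.succ t.succ = 0) (hp' : ∀ s t : Fin 2, p' s.succ t.succ = 0) :
    (√(h 0 0))⁻¹ • ∑ d, h 0 d • dContrAlg B h dh p a p' a' d
      = (-2 * ((∑ b, (dh b b 0 + l b * h b 0)) / √(h 0 0)
          - (∑ d, h 0 d * dh d 0 0) / (2 * √(h 0 0) ^ 3))) • ∑ b, ∑ c, h b c • B (a b) (a' c)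
        - √(h 0 0) • (B (codiffAlg h dh l p a) (a' 0) + B (a 0) (codiffAlg h dh l p' a')) := by
  have a1 : a 1 = 0 := ha 0
  have a2 : a 2 = 0 := ha 1
  have a1' : a' 1 = 0 := ha' 0
  have a2' : a' 2 = 0 := ha' 1
  have p1 : p 1 1 = 0 := hp 0 0
  have p2 : p 1 2 = 0 := hp 0 1
  have p3 : p 2 1 = 0 := hp 1 0
  have p4 : p 2 2 = 0 := hp 1 1
  have p1' : p' 1 1 = 0 := hp' 0 0
  have p2' : p' 1 2 = 0 := hp' 0 1
  have p3' : p' 2 1 = 0 := hp' 1 0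
  have p4' : p' 2 2 = 0 := hp' 1 1
  have hs := Real.sqrt_pos.2 h0
  have hss := Real.sq_sqrt h0.le
  simp only [dContrAlg, codiffAlg, Fin.sum_univ_three, a1, a2, a1', a2', p1, p2, p3, p4, p1', p2',
    p3', p4', map_zero, zero_apply, smul_zero, add_zero, zero_add, map_neg, map_add, map_smul,
    neg_apply, add_apply, smul_apply]
  rw [hI 1 0, hI 2 0]
  set s := √(h 0 0)
  rw [← hss]
  match_scalars <;> field_simp <;> ring

end BoundaryIdentity

section Tau

variable {M : Type*} [TopologicalSpace M] [ChartedSpace (EuclideanHalfSpace 3) M]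
  [IsManifold I3 ∞ M] (g : Metric M)
variable {W W₁ W₂ W₃ : Type*} [NormedAddCommGroup W] [NormedSpace ℝ W]
  [NormedAddCommGroup W₁] [NormedSpace ℝ W₁] [NormedAddCommGroup W₂]
  [NormedSpace ℝ W₂] [NormedAddCommGroup W₃] [NormedSpace ℝ W₃]

theorem divg_gradient (e : Chart M) {x : M} (hx : x ∈ e.1.source) {η : Fin 3 → M → W}
    (hη : ∀ b, MDifferentiableAt I3 𝓘(ℝ, W) (η b) x) :
    divg g e (fun b y => ∑ c, gramInv g e y b c • η c y) x
      = -codiffAlg (gramInv g e x) (fun d b c => pd e d (fun y => gramInv g e y b c) x)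
        (fun b => logDens g e b x) (fun b c => pd e b (η c) x) (fun c => η c x) := by
  have hG := mDiffM_gramInv g e hx
  simp only [codiffAlg, neg_neg, divg]
  refine Finset.sum_congr rfl fun b _ => ?_
  rw [pd_sum e b fun c _ => mdiff_smul (hG b c) (hη c), Finset.smul_sum, ← Finset.sum_add_distrib]
  refine Finset.sum_congr rfl fun c _ => ?_
  rw [pd_smul e b hx (hG b c) (hη c)]
  module

theorem pd_contr (B : W₁ →L[ℝ] W₂ →L[ℝ] W₃) (e : Chart M) (d : Fin 3) {x : M}
    (hx : x ∈ e.1.source) {η : Fin 3 → M → W₁} {η' : Fin 3 → M → W₂}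
    (hη : ∀ b, MDifferentiableAt I3 𝓘(ℝ, W₁) (η b) x)
    (hη' : ∀ b, MDifferentiableAt I3 𝓘(ℝ, W₂) (η' b) x) :
    pd e d (fun y => contr g B e y (fun b => η b y) (fun c => η' c y)) x
      = dContrAlg B (gramInv g e x) (fun d b c => pd e d (fun y => gramInv g e y b c) x)
        (fun b c => pd e b (η c) x) (fun c => η c x) (fun b c => pd e b (η' c) x)
        (fun c => η' c x) d := by
  have hG := mDiffM_gramInv g e hx
  have hB : ∀ b c, MDifferentiableAt I3 𝓘(ℝ, W₃) (fun y => B (η b y) (η' c y)) x := by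
    intro b c
    have h2 : DifferentiableAt ℝ (fun p : W₁ × W₂ => B p.1 p.2) (η b x, η' c x) := by fun_prop
    exact h2.mdifferentiableAt.comp (f := fun y => (η b y, η' c y)) x ((hη b).prodMk_space (hη' c))
  have h1 : ∀ b c, MDifferentiableAt I3 𝓘(ℝ, W₃)
      (fun y => gramInv g e y b c • B (η b y) (η' c y)) x := fun b c => mdiff_smul (hG b c) (hB b c)
  simp only [contr, dContrAlg]
  rw [pd_sum e d fun b _ => mdifferentiableAt_sum fun c _ => h1 b c]
  refine Finset.sum_congr rfl fun b _ => ?_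
  rw [pd_sum e d fun c _ => h1 b c]
  refine Finset.sum_congr rfl fun c _ => ?_
  rw [pd_smul e d hx (hG b c) (hB b c), pd_bilin B e d hx (hη b) (hη' c)]

theorem dirDeriv_chartNormal (e : Chart M) (x : M) (F : M → W) :
    dirDeriv F x (chartNormal g e x)
      = (√(gramInv g e x 0 0))⁻¹ • ∑ d, gramInv g e x 0 d • pd e d F x := by
  rw [dirDeriv, chartNormal, map_smul, map_sum]
  simp only [map_smul]
  rfl

theorem divg_coord (e : Chart M) (x : M) :
    divg g e (fun b y => gramInv g e y b 0) x = ∑ b, (pd e b (fun y => gramInv g e y b 0) x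
      + logDens g e b x * gramInv g e x b 0) := rfl

/-- `τ` in terms of a function that vanishes on the boundary. -/
theorem chartTau_intrinsic (e : Chart M) {x : M} (hx : x ∈ e.1.source) (hxb : x ∈ bdry M)
    {O : Set M} (hO : IsOpen O) (hxO : x ∈ O) {ρ : M → ℝ}
    (hρ : ContMDiffOn I3 𝓘(ℝ, ℝ) ∞ ρ (e.1.source ∩ O)) (hρ0 : ∀ y ∈ O ∩ bdry M, ρ y = 0)
    (hpos : 0 < pd e 0 ρ x) {Q : M → ℝ} (hQd : Q = fun y =>
      contr g (ContinuousLinearMap.mul ℝ ℝ) e y (fun b => pd e b ρ y) (fun b => pd e b ρ y)) :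
    chartTau g e x = divg g e (fun b y => ∑ c, gramInv g e y b c • pd e c ρ y) x / √(Q x)
      - dirDeriv Q x (chartNormal g e x) / (2 * Q x) := by
  have hOe : IsOpen (e.1.source ∩ O) := e.1.open_source.inter hO
  have h1 : ∀ c, ContMDiffOn I3 𝓘(ℝ, ℝ) ∞ (pd e c ρ) (e.1.source ∩ O) := fun c =>
    contMDiffOn_pd e c hO hρ
  have hd : ∀ c, MDifferentiableAt I3 𝓘(ℝ, ℝ) (pd e c ρ) x := fun c =>
    ContMDiffOn.mdifferentiableAt' hOe (h1 c) ⟨hx, hxO⟩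
  have ht : ∀ t : Fin 2, ∀ y ∈ e.1.source ∩ O ∩ bdry M, pd e t.succ ρ y = 0 := fun t y hy =>
    pd_succ_eq_zero e t hO hy.1.2 hy.1.1 hy.2
      (ContMDiffOn.mdifferentiableAt' hOe hρ hy.1) hρ0
  have htt : ∀ s t : Fin 2, pd e s.succ (pd e t.succ ρ) x = 0 := fun s t =>
    pd_succ_eq_zero e s hOe ⟨hx, hxO⟩ hx hxb (hd _) (ht t)
  have ha : ∀ t : Fin 2, pd e t.succ ρ x = 0 := fun t => ht t x ⟨⟨hx, hxO⟩, hxb⟩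
  have h0 := gramInv_zero_pos g e hx
  have hs := Real.sqrt_pos.2 h0
  have hss := Real.sq_sqrt h0.le
  have key := normal_contrAlg (ContinuousLinearMap.mul ℝ ℝ) (h := gramInv g e x)
    (dh := fun d b c => pd e d (fun y => gramInv g e y b c) x) (l := fun b => logDens g e b x)
    (p := fun b c => pd e b (pd e c ρ) x) (a := fun c => pd e c ρ x)
    (p' := fun b c => pd e b (pd e c ρ) x) (a' := fun c => pd e c ρ x) (gramInv_comm g e x) h0
    ha ha htt htt
  have hQ : Q x = gramInv g e x 0 0 * pd e 0 ρ x ^ 2 := by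
    have a1 : pd e 1 ρ x = 0 := ha 0
    have a2 : pd e 2 ρ x = 0 := ha 1
    simp only [hQd, contr, Fin.sum_univ_three, a1, a2, ContinuousLinearMap.mul_apply', smul_eq_mul]
    ring
  have hQ' : ∑ b, ∑ c, gramInv g e x b c • ContinuousLinearMap.mul ℝ ℝ (pd e b ρ x) (pd e c ρ x)
      = Q x := by rw [hQd]; rfl
  have hsQ : √(Q x) = √(gramInv g e x 0 0) * pd e 0 ρ x := by
    rw [hQ, Real.sqrt_mul h0.le, Real.sqrt_sq hpos.le]
  rw [dirDeriv_chartNormal, hsQ, chartTau, divg_coord]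
  rw [divg_gradient g e hx hd]
  have e1 := fun d => pd_contr g (ContinuousLinearMap.mul ℝ ℝ) e d hx hd hd
  rw [← hQd] at e1
  simp only [e1]
  beta_reduce at key
  rw [key, hQ', hQ]
  simp only [ContinuousLinearMap.mul_apply', smul_eq_mul]
  set s := √(gramInv g e x 0 0)
  rw [← hss]
  field_simp
  ring

theorem chartTau_eq (e e' : Chart M) {x : M} (hx : x ∈ e.1.source ∩ e'.1.source)
    (hxb : x ∈ bdry M) : chartTau g e x = chartTau g e' x := by
  set O := e.1.source ∩ e'.1.source
  have hO : IsOpen O := e.1.open_source.inter e'.1.open_source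
  set ρ := coordFun e 0
  have hρ : ContMDiffOn I3 𝓘(ℝ, ℝ) ∞ ρ O := (contMDiffOn_coordFun e 0).mono inter_subset_left
  have hρ0 : ∀ y ∈ O ∩ bdry M, ρ y = 0 := fun y hy => (mem_bdry_iff e hy.1.1).1 hy.2
  obtain ⟨Q, hQd⟩ : ∃ Q : M → ℝ, Q = fun y => contr g (ContinuousLinearMap.mul ℝ ℝ) e y
    (fun b => pd e b ρ y) (fun b => pd e b ρ y) := ⟨_, rfl⟩
  obtain ⟨Q', hQd'⟩ : ∃ Q' : M → ℝ, Q' = fun y => contr g (ContinuousLinearMap.mul ℝ ℝ) e' y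
    (fun b => pd e' b ρ y) (fun b => pd e' b ρ y) := ⟨_, rfl⟩
  have h1 := chartTau_intrinsic g e hx.1 hxb hO hx (hρ.mono inter_subset_right) hρ0 (by
    rw [pd_coordFun e 0 0 hx.1]; simp) hQd
  have h2 := chartTau_intrinsic g e' hx.2 hxb hO hx (hρ.mono inter_subset_right) hρ0
    (jac_zero_zero_pos e' e hx.symm hxb) hQd'
  have hJ : ∀ y ∈ O, ∀ c, pd e c ρ y = ∑ d, jac e e' y d c • pd e' d ρ y := fun y hy c =>
    pd_eq_sum_jac e e' c hy ρ
  have hQ : ∀ y ∈ O, Q y = Q' y := fun y hy => by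
    rw [hQd, hQd']
    exact contr_eq g _ e e' hy (hJ y hy) (hJ y hy)
  have hgrad : ∀ y ∈ O, ∀ d, ∑ c, gramInv g e' y d c • pd e' c ρ y
      = ∑ b, jac e e' y d b • ∑ c, gramInv g e y b c • pd e c ρ y := by
    intro y hy d
    have h := fun d d' => congrFun (congrFun (gramInv_eq g e e' hy) d) d'
    simp only [Matrix.mul_apply, Matrix.transpose_apply] at h
    simp only [h, hJ y hy, Fin.sum_univ_three]
    module
  have hOe : IsOpen (e.1.source ∩ O) := e.1.open_source.inter hO
  have hdd : ∀ b, MDifferentiableAt I3 𝓘(ℝ, ℝ) (fun y => ∑ c, gramInv g e y b c • pd e c ρ y) x :=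
    fun b => mdifferentiableAt_sum fun c _ => mdiff_smul (mDiffM_gramInv g e hx.1 b c)
      (ContMDiffOn.mdifferentiableAt' hOe (contMDiffOn_pd e c hO (hρ.mono inter_subset_right))
        ⟨hx.1, hx⟩)
  have hdiv := divg_eq g e e' hO subset_rfl hx hdd hgrad
  have hn := chartNormal_eq g e e' hx hxb
  have hdQ : ∀ v, dirDeriv Q x v = dirDeriv Q' x v := by
    intro v
    rw [dirDeriv, dirDeriv, (Filter.eventuallyEq_of_mem (hO.mem_nhds hx) hQ).mfderiv_eq]
    rfl
  rw [h1, h2, hdiv, hn, hdQ, hQ x hx]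

theorem tau_eq_chartTau (e : Chart M) {x : M} (hx : x ∈ e.1.source) (hxb : x ∈ bdry M) :
    tau g x = chartTau g e x := by
  rw [tau_eq]
  exact chartTau_eq g _ e ⟨mem_chart_source _ x, hx⟩ hxb

theorem contMDiffOn_chartTau (e : Chart M) : ContMDiffOn I3 𝓘(ℝ, ℝ) ∞ (chartTau g e) e.1.source := by
  have hp : ∀ {F : M → ℝ} (d), ContMDiffOn I3 𝓘(ℝ, ℝ) ∞ F e.1.source →
      ContMDiffOn I3 𝓘(ℝ, ℝ) ∞ (pd e d F) e.1.source := fun d hF => by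
    have h1 := contMDiffOn_pd e d isOpen_univ (hF.mono inter_subset_left)
    rwa [inter_univ] at h1
  have hh := contMDiffOn_gramInv g e
  have h0 : ∀ x ∈ e.1.source, gramInv g e x 0 0 ≠ 0 := fun x hx => (gramInv_zero_pos g e hx).ne'
  have hs : ContMDiffOn I3 𝓘(ℝ, ℝ) ∞ (fun x => (√(gramInv g e x 0 0))⁻¹) e.1.source :=
    contMDiffOn_comp_real (hh 0 0) (φ := fun t => (√t)⁻¹) fun x hx =>
      (Real.contDiffAt_sqrt (h0 x hx)).inv (Real.sqrt_pos.2 (gramInv_zero_pos g e hx)).ne'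
  have h3 : ∀ {a : Fin 3 → M → ℝ}, (∀ b, ContMDiffOn I3 𝓘(ℝ, ℝ) ∞ (a b) e.1.source) →
      ContMDiffOn I3 𝓘(ℝ, ℝ) ∞ (fun x => ∑ b, a b x) e.1.source := fun {a} ha => by
    simp only [Fin.sum_univ_three]
    exact ((ha 0).add (ha 1)).add (ha 2)
  have h4 : ContMDiffOn I3 𝓘(ℝ, ℝ) ∞ (divg g e (fun b y => gramInv g e y b 0)) e.1.source :=
    h3 fun b => (hp b (hh b 0)).add ((contMDiffOn_logDens g e b).mul (hh b 0))
  have h5 : ContMDiffOn I3 𝓘(ℝ, ℝ) ∞ (fun x => ∑ d, gramInv g e x 0 d *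
      pd e d (fun y => gramInv g e y 0 0) x) e.1.source := h3 fun d => (hh 0 d).mul (hp d (hh 0 0))
  refine ((h4.mul hs).sub ((contMDiffOn_const (c := (2 : ℝ)⁻¹)).mul
    (h5.mul ((hs.mul hs).mul hs)))).congr fun x _ => ?_
  simp only [chartTau, Pi.mul_apply]
  ring

end Tau

end Coulomb

namespace Coulomb

set_option linter.unusedSectionVars false

theorem deriv_mem_of_isClosed {W : Type*} [NormedAddCommGroup W] [NormedSpace ℝ W]
    {L : Submodule ℝ W} (hL : IsClosed (L : Set W)) {F : ℝ → W} {F' : W} {t₀ : ℝ}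
    (hF : HasDerivAt F F' t₀) (h : ∀ t, F t ∈ L) : F' ∈ L := by
  refine hL.mem_of_tendsto (hasDerivAt_iff_tendsto_slope.1 hF) ?_
  filter_upwards with t
  rw [slope_def_module]
  exact Submodule.smul_mem _ _ (Submodule.sub_mem _ (h t) (h t₀))

section Shortcuts

variable {𝕜 : Type*} [RCLike 𝕜] {n : ℕ}

scoped instance : SeminormedAddCommGroup (EndV 𝕜 n) := inferInstance
scoped instance : TopologicalSpace (EndV 𝕜 n) := inferInstance
scoped instance : NormedRing (EndV 𝕜 n) := inferInstance
scoped instance : Mul (EndV 𝕜 n) := inferInstance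
scoped instance : Monoid (EndV 𝕜 n) := inferInstance
scoped instance : StarRing (EndV 𝕜 n) := inferInstance
scoped instance : Star (EndV 𝕜 n) := inferInstance
scoped instance : CompleteSpace (EndV 𝕜 n) := inferInstance
scoped instance : SMul ℝ (EndV 𝕜 n) := inferInstance
scoped instance : Semiring (EndV 𝕜 n) := inferInstance
scoped instance : NonUnitalNonAssocSemiring (EndV 𝕜 n) := inferInstance
scoped instance : T2Space (EndV 𝕜 n) := inferInstance

end Shortcuts

section LieAlgebra

variable {𝕜 : Type*} [RCLike 𝕜] {n : ℕ}

/-- Composition of endomorphisms as a real bilinear map. -/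
def mulB (𝕜 : Type*) [RCLike 𝕜] (n : ℕ) : EndV 𝕜 n →L[ℝ] EndV 𝕜 n →L[ℝ] EndV 𝕜 n :=
  LinearMap.mkContinuous₂ (LinearMap.mk₂ ℝ (fun a b : EndV 𝕜 n => a * b) add_mul smul_mul_real
    mul_add mul_smul_real) 1 fun a b => by simpa using norm_mul_le a b

@[simp] theorem mulB_apply (a b : EndV 𝕜 n) : mulB 𝕜 n a b = a * b := rfl

/-- The commutator as a real bilinear map. -/
def lieB (𝕜 : Type*) [RCLike 𝕜] (n : ℕ) : EndV 𝕜 n →L[ℝ] EndV 𝕜 n →L[ℝ] EndV 𝕜 n :=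
  mulB 𝕜 n - (mulB 𝕜 n).flip

theorem lieB_apply (a b : EndV 𝕜 n) : lieB 𝕜 n a b = ⁅a, b⁆ := by
  simp [lieB, Ring.lie_def]

theorem lieB_eq (a b : EndV 𝕜 n) : lieB 𝕜 n a b = a * b - b * a := by
  simp [lieB]

theorem star_smul_real (c : ℝ) (a : EndV 𝕜 n) : star (c • a) = c • star a := by
  have h : ∀ b : EndV 𝕜 n, c • b = (c : 𝕜) • b := fun b => by
    ext1 v
    exact RCLike.real_smul_eq_coe_smul (K := 𝕜) c (b v)
  rw [h, h, star_smul, RCLike.star_def, RCLike.conj_ofReal]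

/-- The adjoint as a real linear map. -/
def starB (𝕜 : Type*) [RCLike 𝕜] (n : ℕ) : EndV 𝕜 n →L[ℝ] EndV 𝕜 n :=
  LinearMap.mkContinuous { toFun := star, map_add' := star_add, map_smul' := star_smul_real } 1
    fun a => by simp

@[simp] theorem starB_apply (a : EndV 𝕜 n) : starB 𝕜 n a = star a := rfl

/-- `X ↦ u X u^*`. -/
def conjB (u : EndV 𝕜 n) : EndV 𝕜 n →L[ℝ] EndV 𝕜 n :=
  (mulB 𝕜 n u).comp ((mulB 𝕜 n).flip (star u))

@[simp] theorem conjB_apply (u a : EndV 𝕜 n) : conjB u a = u * a * star u := by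
  simp [conjB, mul_assoc]

theorem contDiff_conjB : ContDiff ℝ ∞ (conjB : EndV 𝕜 n → EndV 𝕜 n →L[ℝ] EndV 𝕜 n) := by
  have h1 : ContDiff ℝ ∞ fun u : EndV 𝕜 n => mulB 𝕜 n u := (mulB 𝕜 n).contDiff
  have h2 : ContDiff ℝ ∞ fun u : EndV 𝕜 n => (mulB 𝕜 n).flip (starB 𝕜 n u) :=
    (mulB 𝕜 n).flip.contDiff.comp (starB 𝕜 n).contDiff
  exact h1.clm_comp h2

theorem lieB_conjB {u : EndV 𝕜 n} (hu : star u * u = 1) (a b : EndV 𝕜 n) :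
    lieB 𝕜 n (conjB u a) (conjB u b) = conjB u (lieB 𝕜 n a b) := by
  have h : ∀ a b : EndV 𝕜 n, (u * a * star u) * (u * b * star u) = u * (a * b) * star u :=
    fun a b => by
      calc _ = u * a * (star u * u) * b * star u := by simp only [mul_assoc]
        _ = _ := by rw [hu, mul_one]; simp only [mul_assoc]
  rw [lieB_eq, lieB_eq, conjB_apply, conjB_apply, conjB_apply, h, h, mul_sub, sub_mul]

scoped instance : FiniteDimensional ℝ (EndV 𝕜 n) := by
  have h1 : FiniteDimensional 𝕜 (EndV 𝕜 n) := inferInstance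
  have : IsScalarTower ℝ 𝕜 (EndV 𝕜 n) := ⟨fun r c b => by
    ext1 v
    exact smul_assoc r c (b v)⟩
  exact FiniteDimensional.trans ℝ 𝕜 (EndV 𝕜 n)

scoped instance : Algebra ℝ (EndV 𝕜 n) := Algebra.ofModule smul_mul_real fun c a b => mul_smul_real c a b

theorem norm_smul_endV (c : ℝ) (a : EndV 𝕜 n) : ‖c • a‖ ≤ ‖c‖ * ‖a‖ := norm_smul_le c a

scoped instance : NormedAlgebra ℝ (EndV 𝕜 n) where
  norm_smul_le := norm_smul_endV

scoped instance : NormedAlgebra ℚ (EndV 𝕜 n) := NormedAlgebra.restrictScalars ℚ ℝ _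

variable (K : Subgroup (unitary (EndV 𝕜 n)))

theorem isClosed_lieAlg : IsClosed (lieAlg K : Set (EndV 𝕜 n)) :=
  Submodule.closed_of_finiteDimensional _

theorem conjB_mem_lieAlg {u : unitary (EndV 𝕜 n)} (hu : u ∈ K) {X : EndV 𝕜 n}
    (hX : X ∈ lieAlg K) : conjB (u : EndV 𝕜 n) X ∈ lieAlg K := by
  induction hX using Submodule.span_induction with
  | mem X hX =>
    refine Submodule.subset_span fun t => ?_
    obtain ⟨k, hk, hk'⟩ := hX t
    refine ⟨u * k * u⁻¹, K.mul_mem (K.mul_mem hu hk) (K.inv_mem hu), ?_⟩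
    have h1 := NormedSpace.exp_units_conj (Unitary.toUnits u) (t • X)
    have h2 : ((Unitary.toUnits u : (EndV 𝕜 n)ˣ) : EndV 𝕜 n) = u := rfl
    have h3 : (((Unitary.toUnits u)⁻¹ : (EndV 𝕜 n)ˣ) : EndV 𝕜 n) = star (u : EndV 𝕜 n) := rfl
    rw [h2, h3] at h1
    rw [← map_smul, conjB_apply, h1, ← hk']
    rfl
  | zero => rw [map_zero]; exact zero_mem _
  | add X Y _ _ hX hY => rw [map_add]; exact add_mem hX hY
  | smul c X _ hX => rw [map_smul]; exact Submodule.smul_mem _ c hX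

theorem lieB_mem_lieAlg {X Y : EndV 𝕜 n} (hX : X ∈ lieAlg K) (hY : Y ∈ lieAlg K) :
    lieB 𝕜 n X Y ∈ lieAlg K := by
  induction hX using Submodule.span_induction with
  | mem X hX =>
    have hmem : ∀ t : ℝ, NormedSpace.exp (t • X) * Y * NormedSpace.exp (t • (-X)) ∈ lieAlg K := by
      intro t
      obtain ⟨k, hk, hk'⟩ := hX t
      have h1 := conjB_mem_lieAlg K hk hY
      have h2 : NormedSpace.exp (t • (-X)) = star (k : EndV 𝕜 n) := by
        have h3 : NormedSpace.exp (t • (-X)) * NormedSpace.exp (t • X) = 1 := by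
          rw [smul_neg, ← NormedSpace.exp_add_of_commute (Commute.refl (t • X)).neg_left, neg_add_cancel,
            NormedSpace.exp_zero]
        calc _ = NormedSpace.exp (t • (-X)) * (NormedSpace.exp (t • X) * star (k : EndV 𝕜 n)) := by
              rw [← hk']
              rw [show (k : EndV 𝕜 n) * star (k : EndV 𝕜 n) = 1 from Unitary.coe_mul_star_self k,
                mul_one]
          _ = _ := by rw [← mul_assoc, h3, one_mul]
      rw [h2, ← hk']
      rwa [conjB_apply] at h1
    have hd : ∀ Z : EndV 𝕜 n, HasDerivAt (fun t : ℝ => NormedSpace.exp (t • Z)) Z 0 := fun Z => by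
      have := hasDerivAt_exp_smul_const (𝕂 := ℝ) Z (0 : ℝ)
      simpa using this
    have h1 : HasDerivAt (fun t : ℝ => mulB 𝕜 n (mulB 𝕜 n (NormedSpace.exp (t • X)) Y)
        (NormedSpace.exp (t • (-X)))) (lieB 𝕜 n X Y) 0 := by
      have h2 : HasDerivAt (fun t : ℝ => mulB 𝕜 n (NormedSpace.exp (t • X)) Y) (X * Y) 0 :=
        ((mulB 𝕜 n).flip Y).hasFDerivAt.comp_hasDerivAt 0 (hd X)
      have h3 := (mulB 𝕜 n).hasDerivAt_of_bilinear (fun _ => h2) (fun _ => hd (-X))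
      have h4 : mulB 𝕜 n (mulB 𝕜 n (NormedSpace.exp ((0 : ℝ) • X)) Y) (-X)
          + mulB 𝕜 n (X * Y) (NormedSpace.exp ((0 : ℝ) • (-X))) = lieB 𝕜 n X Y := by
        rw [zero_smul, zero_smul, NormedSpace.exp_zero, lieB_eq]
        simp only [mulB_apply, one_mul, mul_one, mul_neg]
        abel
      rwa [h4] at h3
    exact deriv_mem_of_isClosed (isClosed_lieAlg K) h1 hmem
  | zero => rw [map_zero, zero_apply]; exact zero_mem _
  | add X Z _ _ hX hZ => rw [map_add, add_apply]; exact add_mem hX hZ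
  | smul c X _ hX => rw [map_smul, smul_apply]; exact Submodule.smul_mem _ c hX

variable {M : Type*} [TopologicalSpace M] [ChartedSpace (EuclideanHalfSpace 3) M]

theorem dirDeriv_mem_lieAlg {F : M → EndV 𝕜 n} {O : Set M} (hO : IsOpen O)
    (h : ∀ y ∈ O, F y ∈ lieAlg K) {x : M} (hx : x ∈ O)
    (hF : MDifferentiableAt I3 𝓘(ℝ, EndV 𝕜 n) F x) (v : TangentSpace I3 x) :
    dirDeriv F x v ∈ lieAlg K := by
  obtain ⟨q, hq⟩ := (lieAlg K).exists_isCompl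
  let π : EndV 𝕜 n →L[ℝ] q := LinearMap.toContinuousLinearMap (q.projectionOnto _ hq.symm)
  have hπ : ∀ X, π X = 0 ↔ X ∈ lieAlg K := fun X => by
    change X ∈ LinearMap.ker (q.projectionOnto _ hq.symm) ↔ _
    rw [Submodule.ker_projectionOnto]
  rw [← hπ]
  have h1 := mfderiv_comp x (π.differentiableAt (x := F x)).mdifferentiableAt hF
  have h2 : mfderiv I3 𝓘(ℝ, q) (π ∘ F) x = mfderiv I3 𝓘(ℝ, q) (fun _ : M => (0 : q)) x :=
    Filter.EventuallyEq.mfderiv_eq (Filter.eventuallyEq_of_mem (hO.mem_nhds hx) fun y hy =>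
      (hπ _).2 (h y hy))
  rw [mfderiv_const, h1, mfderiv_eq_fderiv, ContinuousLinearMap.fderiv] at h2
  exact DFunLike.congr_fun h2 v

end LieAlgebra

end Coulomb

namespace Coulomb

set_option linter.unusedSectionVars false

section Smoothness

variable {M : Type*} [TopologicalSpace M] [ChartedSpace (EuclideanHalfSpace 3) M]
  [IsManifold I3 ∞ M]
variable {W W₁ W₂ W₃ : Type*} [NormedAddCommGroup W] [NormedSpace ℝ W]
  [NormedAddCommGroup W₁] [NormedSpace ℝ W₁] [NormedAddCommGroup W₂] [NormedSpace ℝ W₂]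
  [NormedAddCommGroup W₃] [NormedSpace ℝ W₃]

theorem contMDiffOn_bilin (B : W₁ →L[ℝ] W₂ →L[ℝ] W₃) {O : Set M} {F : M → W₁} {G : M → W₂}
    (hF : ContMDiffOn I3 𝓘(ℝ, W₁) ∞ F O) (hG : ContMDiffOn I3 𝓘(ℝ, W₂) ∞ G O) :
    ContMDiffOn I3 𝓘(ℝ, W₃) ∞ (fun x => B (F x) (G x)) O :=
  (B.contDiff.contMDiff.comp_contMDiffOn hF).clm_apply hG

theorem contMDiffOn_finset_sum {κ : Type*} {t : Finset κ} {O : Set M} {F : κ → M → W}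
    (hF : ∀ q ∈ t, ContMDiffOn I3 𝓘(ℝ, W) ∞ (F q) O) :
    ContMDiffOn I3 𝓘(ℝ, W) ∞ (fun x => ∑ q ∈ t, F q x) O := by
  classical
  induction t using Finset.induction_on with
  | empty => simpa using contMDiffOn_const
  | insert a s ha ih =>
    simp only [Finset.sum_insert ha]
    exact (hF a (Finset.mem_insert_self _ _)).add
      (ih fun q hq => hF q (Finset.mem_insert_of_mem hq))

theorem contMDiffOn_of_charts {O : Set M} (hO : IsOpen O) {F : M → W}
    (h : ∀ e : Chart M, ContMDiffOn I3 𝓘(ℝ, W) ∞ F (e.1.source ∩ O)) :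
    ContMDiffOn I3 𝓘(ℝ, W) ∞ F O := fun x hx => by
  set e : Chart M := achart (EuclideanHalfSpace 3) x
  have hxe : x ∈ e.1.source := mem_chart_source _ x
  exact ((h e).contMDiffAt ((e.1.open_source.inter hO).mem_nhds ⟨hxe, hx⟩)).contMDiffWithinAt

theorem exists_tangent_eq_sum (e : Chart M) {x : M} (hx : x ∈ e.1.source)
    (v : TangentSpace I3 x) : ∃ c : Fin 3 → ℝ, v = ∑ b, c b • coordVec e b x := by
  set e₀ : Chart M := achart (EuclideanHalfSpace 3) x
  have hx₀ : x ∈ e₀.1.source := mem_chart_source _ x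
  obtain ⟨v', hv'⟩ : ∃ v' : E3, v' = v := ⟨v, rfl⟩
  have h1 := (tangentBundleCore I3 M).coordChange_comp e₀ e e₀ x ⟨⟨hx₀, hx⟩, hx₀⟩ v'
  rw [(tangentBundleCore I3 M).coordChange_self e₀ x hx₀] at h1
  set w := (tangentBundleCore I3 M).coordChange e₀ e x v'
  have h2 : w = ∑ b, w b • EuclideanSpace.single b (1 : ℝ) := by
    ext d
    fin_cases d <;> simp [Fin.sum_univ_three]
  rw [h2, map_sum] at h1
  simp only [map_smul] at h1
  exact ⟨fun b => w b, hv'.symm.trans h1.symm⟩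

variable (g : Metric M)

theorem contMDiffOn_contr (B : W₁ →L[ℝ] W₂ →L[ℝ] W₃) (e : Chart M) {O : Set M}
    {a : Fin 3 → M → W₁} {a' : Fin 3 → M → W₂}
    (ha : ∀ c, ContMDiffOn I3 𝓘(ℝ, W₁) ∞ (a c) (e.1.source ∩ O))
    (ha' : ∀ c, ContMDiffOn I3 𝓘(ℝ, W₂) ∞ (a' c) (e.1.source ∩ O)) :
    ContMDiffOn I3 𝓘(ℝ, W₃) ∞ (fun x => contr g B e x (fun c => a c x) (fun c => a' c x))
      (e.1.source ∩ O) :=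
  contMDiffOn_finset_sum fun b _ => contMDiffOn_finset_sum fun c _ =>
    ((contMDiffOn_gramInv g e b c).mono inter_subset_left).smul (contMDiffOn_bilin B (ha b) (ha' c))

theorem contMDiffOn_raise (e : Chart M) {O : Set M} {η : Fin 3 → M → W}
    (hη : ∀ c, ContMDiffOn I3 𝓘(ℝ, W) ∞ (η c) (e.1.source ∩ O)) (b : Fin 3) :
    ContMDiffOn I3 𝓘(ℝ, W) ∞ (fun y => ∑ c, gramInv g e y b c • η c y) (e.1.source ∩ O) :=
  contMDiffOn_finset_sum fun c _ => ((contMDiffOn_gramInv g e b c).mono inter_subset_left).smul (hη c)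

theorem contMDiffOn_divg (e : Chart M) {O : Set M} (hO : IsOpen O) {Y : Fin 3 → M → W}
    (hY : ∀ c, ContMDiffOn I3 𝓘(ℝ, W) ∞ (Y c) (e.1.source ∩ O)) :
    ContMDiffOn I3 𝓘(ℝ, W) ∞ (divg g e Y) (e.1.source ∩ O) :=
  contMDiffOn_finset_sum fun b _ => (contMDiffOn_pd e b hO (hY b)).add
    (((contMDiffOn_logDens g e b).mono inter_subset_left).smul (hY b))

theorem raise_eq (e e' : Chart M) {x : M} (hx : x ∈ e.1.source ∩ e'.1.source) {η η' : Fin 3 → W}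
    (h : ∀ c, η c = ∑ d, jac e e' x d c • η' d) (d : Fin 3) :
    ∑ c, gramInv g e' x d c • η' c = ∑ b, jac e e' x d b • ∑ c, gramInv g e x b c • η c := by
  have hg := fun d d' => congrFun (congrFun (gramInv_eq g e e' hx) d) d'
  simp only [Matrix.mul_apply, Matrix.transpose_apply] at hg
  simp only [hg, h, Fin.sum_univ_three]
  module

/-- The divergence of the dual vector field of a form does not depend on the chart. -/
theorem divg_raise_eq (e e' : Chart M) {O : Set M} (hO : IsOpen O) {x : M}
    (hx : x ∈ e.1.source ∩ O) (hx' : x ∈ e'.1.source) {η η' : Fin 3 → M → W}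
    (hη : ∀ c, ContMDiffOn I3 𝓘(ℝ, W) ∞ (η c) (e.1.source ∩ O))
    (h : ∀ y ∈ e.1.source ∩ e'.1.source, ∀ c, η c y = ∑ d, jac e e' y d c • η' d y) :
    divg g e (fun b y => ∑ c, gramInv g e y b c • η c y) x
      = divg g e' (fun b y => ∑ c, gramInv g e' y b c • η' c y) x :=
  divg_eq g e e' ((e.1.open_source.inter hO).inter (e.1.open_source.inter e'.1.open_source))
    inter_subset_right ⟨hx, hx.1, hx'⟩
    (fun b => ContMDiffOn.mdifferentiableAt' (e.1.open_source.inter hO)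
      (contMDiffOn_raise g e hη b) hx)
    fun y hy d => raise_eq g e e' hy.2 (h y hy.2) d

end Smoothness

section Operators

variable {𝕜 : Type*} [RCLike 𝕜] {n : ℕ} {K : Subgroup (unitary (EndV 𝕜 n))} {ι : Type*}
variable {M : Type*} [TopologicalSpace M] [ChartedSpace (EuclideanHalfSpace 3) M]
variable [IsManifold I3 ∞ M] {P : PrincipalBundle M K ι} (g : Metric M)

theorem PrincipalBundle.star_mul_g (P : PrincipalBundle M K ι) {i j : ι} {x : M}
    (hx : x ∈ P.U i ∩ P.U j) : star (P.g i j x) * P.g i j x = 1 := by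
  obtain ⟨k, -, hk⟩ := P.g_mem i j x hx
  rw [← hk]
  exact Unitary.coe_star_mul_self k

theorem PrincipalBundle.g_mul_star (P : PrincipalBundle M K ι) {i j : ι} {x : M}
    (hx : x ∈ P.U i ∩ P.U j) : P.g i j x * star (P.g i j x) = 1 := by
  obtain ⟨k, -, hk⟩ := P.g_mem i j x hx
  rw [← hk]
  exact Unitary.coe_mul_star_self k

theorem SmoothSec.gauge (f : SmoothSec P) {i j : ι} {x : M} (hx : x ∈ P.U i ∩ P.U j) :
    f.1 i x = conjB (P.g i j x) (f.1 j x) := by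
  rw [conjB_apply]; exact f.2.2.2 i j x hx

theorem SmoothForm.gauge (α : SmoothForm P) {i j : ι} {x : M} (hx : x ∈ P.U i ∩ P.U j)
    (v : TangentSpace I3 x) : α.1 i x v = conjB (P.g i j x) (α.1 j x v) := by
  rw [conjB_apply]; exact α.2.2.2 i j x hx v

/-- The components of a form. -/
def comp (α : ∀ x : M, TangentSpace I3 x →L[ℝ] EndV 𝕜 n) (e : Chart M) (c : Fin 3) (x : M) :
    EndV 𝕜 n := α x (coordVec e c x)

theorem comp_eq (α : ∀ x : M, TangentSpace I3 x →L[ℝ] EndV 𝕜 n) (e e' : Chart M) {x : M}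
    (hx : x ∈ e.1.source ∩ e'.1.source) (c : Fin 3) :
    comp α e c x = ∑ d, jac e e' x d c • comp α e' d x := by
  rw [comp, coordVec_eq_sum e e' c hx, map_sum]
  simp only [map_smul]
  rfl

/-- The covariant partial derivative `∂_b F + [A_b, F]`. -/
def cpd (A : ∀ x : M, TangentSpace I3 x →L[ℝ] EndV 𝕜 n) (e : Chart M) (b : Fin 3)
    (F : M → EndV 𝕜 n) (x : M) : EndV 𝕜 n := pd e b F x + lieB 𝕜 n (comp A e b x) (F x)

/-- The connection `A + h`. -/
def SmoothConn.addForm (A : SmoothConn P) (h : SmoothForm P) : SmoothConn P where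
  form := A.form + h.1
  smooth i e c := (A.smooth i e c).add (h.2.1 i e c)
  mem i x hx v := add_mem (A.mem i x hx v) (h.2.2.1 i x hx v)
  gauge i j x hx v := by
    have h1 := A.gauge i j x hx v
    have h2 := h.2.2.2 i j x hx v
    have h3 := P.star_mul_g hx
    have h4 : star (P.g i j x) * h.1 i x v * P.g i j x = h.1 j x v := by
      rw [h2]
      calc _ = (star (P.g i j x) * P.g i j x) * h.1 j x v * (star (P.g i j x) * P.g i j x) := by
            simp only [mul_assoc]
        _ = _ := by rw [h3, one_mul, mul_one]
    change A.form j x v + h.1 j x v = star (P.g i j x) * (A.form i x v + h.1 i x v) * P.g i j x + _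
    rw [h1, mul_add, add_mul, h4]
    abel

/-- Covariant derivatives transform like sections. -/
theorem cpd_gauge (A : SmoothConn P) (e : Chart M) (b : Fin 3) {i j : ι} {x : M}
    (hx : x ∈ P.U i ∩ P.U j) (hxe : x ∈ e.1.source) {F G : M → EndV 𝕜 n}
    (hG : MDifferentiableAt I3 𝓘(ℝ, EndV 𝕜 n) G x) {O : Set M} (hO : IsOpen O) (hxO : x ∈ O)
    (h : ∀ y ∈ O ∩ (P.U i ∩ P.U j), F y = conjB (P.g i j y) (G y)) :
    cpd (A.form i) e b F x = conjB (P.g i j x) (cpd (A.form j) e b G x) := by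
  have hU : IsOpen (P.U i ∩ P.U j) := (P.isOpen_U i).inter (P.isOpen_U j)
  set u := P.g i j with hu
  have hud : MDifferentiableAt I3 𝓘(ℝ, EndV 𝕜 n) u x :=
    ContMDiffOn.mdifferentiableAt' hU (P.g_smooth i j) hx
  have husd : MDifferentiableAt I3 𝓘(ℝ, EndV 𝕜 n) (fun y => starB 𝕜 n (u y)) x :=
    (starB 𝕜 n).differentiableAt.mdifferentiableAt.comp x hud
  have huG : MDifferentiableAt I3 𝓘(ℝ, EndV 𝕜 n) (fun y => mulB 𝕜 n (u y) (G y)) x :=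
    (((mulB 𝕜 n).differentiableAt.mdifferentiableAt.comp x hud).clm_apply hG)
  have e1 : pd e b F x = (pd e b u x * G x + u x * pd e b G x) * star (u x)
      + u x * G x * star (pd e b u x) := by
    have h1 : pd e b F x = pd e b (fun y => mulB 𝕜 n (mulB 𝕜 n (u y) (G y)) (starB 𝕜 n (u y))) x :=
      pd_congr_on e b (hO.inter hU) ⟨hxO, hx⟩ fun y hy => by
        rw [h y hy, conjB_apply]
        rfl
    rw [h1, pd_bilin _ e b hxe huG husd, pd_bilin _ e b hxe hud hG, pd_clm (starB 𝕜 n) e b hud]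
    rfl
  have e2 : pd e b u x * star (u x) + u x * star (pd e b u x) = 0 := by
    have h1 : pd e b (fun y => mulB 𝕜 n (u y) (starB 𝕜 n (u y))) x = 0 := by
      rw [← pd_const e b x (1 : EndV 𝕜 n)]
      exact pd_congr_on e b hU hx fun y hy => P.g_mul_star hy
    rw [pd_bilin _ e b hxe hud husd, pd_clm (starB 𝕜 n) e b hud] at h1
    exact h1
  have hg := A.gauge i j x hx (coordVec e b x)
  have hs := P.star_mul_g hx
  have hs' := P.g_mul_star hx
  have hFx := h x ⟨hxO, hx⟩
  rw [cpd, cpd, e1, hFx]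
  have ea : comp (A.form j) e b x = star (u x) * comp (A.form i) e b x * u x
      + star (u x) * pd e b u x := hg
  rw [ea]
  set Ai := comp (A.form i) e b x
  set du := pd e b u x
  set v := star (u x)
  have hs2 : v * u x = 1 := hs
  have hs3 : u x * v = 1 := hs'
  have e3 : u x * star du = -(du * v) := (neg_eq_of_add_eq_zero_right e2).symm
  have e4 : u x * G x * star du = -(u x * G x * v * du * v) := by
    calc _ = u x * G x * (v * u x) * star du := by rw [hs2, mul_one]
      _ = u x * G x * v * (u x * star du) := by simp only [mul_assoc]
      _ = _ := by rw [e3]; simp only [mul_assoc, mul_neg]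
  simp only [lieB_eq, conjB_apply, e4]
  change _ = u x * (pd e b G x + ((v * Ai * u x + v * du) * G x - G x * (v * Ai * u x + v * du))) * v
  have e5 : u x * ((v * Ai * u x + v * du) * G x) * v = Ai * (u x * G x * v) + du * G x * v := by
    calc _ = (u x * v) * Ai * u x * G x * v + (u x * v) * du * G x * v := by noncomm_ring
      _ = _ := by rw [hs3]; noncomm_ring
  have e6 : u x * (G x * (v * Ai * u x + v * du)) * v = u x * G x * v * Ai + u x * G x * v * du * v := by
    calc _ = u x * G x * v * Ai * (u x * v) + u x * G x * v * du * v := by noncomm_ring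
      _ = _ := by rw [hs3]; noncomm_ring
  have e7 : ∀ Y₁ Y₂ : EndV 𝕜 n, u x * (pd e b G x + (Y₁ - Y₂)) * v
      = u x * pd e b G x * v + (u x * Y₁ * v - u x * Y₂ * v) := fun Y₁ Y₂ => by noncomm_ring
  rw [e7, e5, e6]
  noncomm_ring

end Operators

end Coulomb

namespace Coulomb

set_option linter.unusedSectionVars false

section Operators

variable {𝕜 : Type*} [RCLike 𝕜] {n : ℕ} {K : Subgroup (unitary (EndV 𝕜 n))} {ι : Type*}
variable {M : Type*} [TopologicalSpace M] [ChartedSpace (EuclideanHalfSpace 3) M]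
variable [IsManifold I3 ∞ M] {P : PrincipalBundle M K ι} (g : Metric M)

theorem PrincipalBundle.conjB_mem (P : PrincipalBundle M K ι) {i j : ι} {x : M}
    (hx : x ∈ P.U i ∩ P.U j) {X : EndV 𝕜 n} (hX : X ∈ lieAlg K) :
    conjB (P.g i j x) X ∈ lieAlg K := by
  obtain ⟨k, hk, hk'⟩ := P.g_mem i j x hx
  rw [← hk']
  exact conjB_mem_lieAlg K hk hX

theorem PrincipalBundle.lieB_conjB (P : PrincipalBundle M K ι) {i j : ι} {x : M}
    (hx : x ∈ P.U i ∩ P.U j) (X Y : EndV 𝕜 n) :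
    lieB 𝕜 n (conjB (P.g i j x) X) (conjB (P.g i j x) Y) = conjB (P.g i j x) (lieB 𝕜 n X Y) :=
  Coulomb.lieB_conjB (P.star_mul_g hx) X Y

/-- A section is given by its values in charts and trivializations. -/
theorem exists_smoothSec (φ : ι → Chart M → M → EndV 𝕜 n)
    (hs : ∀ i (e : Chart M), ContMDiffOn I3 𝓘(ℝ, EndV 𝕜 n) ∞ (φ i e) (e.1.source ∩ P.U i))
    (hc : ∀ i (e e' : Chart M), ∀ x ∈ P.U i, x ∈ e.1.source → x ∈ e'.1.source → φ i e x = φ i e' x)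
    (hm : ∀ i (e : Chart M), ∀ x ∈ P.U i, x ∈ e.1.source → φ i e x ∈ lieAlg K)
    (hg : ∀ i j (e : Chart M), ∀ x ∈ P.U i ∩ P.U j, x ∈ e.1.source →
      φ i e x = conjB (P.g i j x) (φ j e x)) :
    ∃ u : SmoothSec P, ∀ i (e : Chart M), ∀ x ∈ e.1.source ∩ P.U i, u.1 i x = φ i e x := by
  have h0 : ∀ x : M, x ∈ (achart (EuclideanHalfSpace 3) x).1.source := fun x => mem_chart_source _ x
  refine ⟨⟨fun i x => φ i (achart _ x) x, fun i => ?_, fun i x hx => hm i _ x hx (h0 x),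
    fun i j x hx => ?_⟩, fun i e x hx => hc i _ e x hx.2 (h0 x) hx.1⟩
  · exact contMDiffOn_of_charts (P.isOpen_U i) fun e => (hs i e).congr fun x hx =>
      hc i _ e x hx.2 (h0 x) hx.1
  · rw [← conjB_apply]
    exact hg i j _ x hx (h0 x)

/-- A section over the boundary is given by its values in charts and trivializations. -/
theorem exists_bdrySec (φ : ι → Chart M → M → EndV 𝕜 n)
    (hs : ∀ i (e : Chart M), ContinuousOn (φ i e) (e.1.source ∩ P.U i))
    (hc : ∀ i (e e' : Chart M), ∀ x ∈ P.U i, x ∈ bdry M → x ∈ e.1.source → x ∈ e'.1.source →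
      φ i e x = φ i e' x)
    (hm : ∀ i (e : Chart M), ∀ x ∈ P.U i, x ∈ e.1.source → φ i e x ∈ lieAlg K)
    (hg : ∀ i j (e : Chart M), ∀ x ∈ P.U i ∩ P.U j, x ∈ e.1.source →
      φ i e x = conjB (P.g i j x) (φ j e x)) :
    ∃ u : BdrySec P, ∀ i (e : Chart M), ∀ x ∈ e.1.source ∩ P.U i, x ∈ bdry M →
      u.1 i x = φ i e x := by
  have h0 : ∀ x : M, x ∈ (achart (EuclideanHalfSpace 3) x).1.source := fun x => mem_chart_source _ x
  refine ⟨⟨fun i x => φ i (achart _ x) x, fun i x hx => ?_,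
    fun i x hx => hm i _ x hx.1 (h0 x),
    fun i j x hx => ?_⟩, fun i e x hx hxb => hc i _ e x hx.2 hxb (h0 x) hx.1⟩
  · set e : Chart M := achart (EuclideanHalfSpace 3) x
    have h1 : ContinuousWithinAt (φ i e) (P.U i ∩ bdry M ∩ e.1.source) x :=
      (hs i e x ⟨h0 x, hx.1⟩).mono fun y hy => ⟨hy.2, hy.1.1⟩
    have h2 : ContinuousWithinAt (fun y => φ i (achart _ y) y) (P.U i ∩ bdry M ∩ e.1.source) x :=
      h1.congr (fun y hy => hc i _ e y hy.1.1 hy.1.2 (h0 y) hy.2) rfl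
    exact (continuousWithinAt_inter (e.1.open_source.mem_nhds (h0 x))).1 h2
  · rw [← conjB_apply]
    exact hg i j _ x hx.1 (h0 x)

theorem SmoothSec.smooth (f : SmoothSec P) (i : ι) :
    ContMDiffOn I3 𝓘(ℝ, EndV 𝕜 n) ∞ (f.1 i) (P.U i) := f.2.1 i

theorem SmoothSec.mdiff (f : SmoothSec P) {i : ι} {x : M} (hx : x ∈ P.U i) :
    MDifferentiableAt I3 𝓘(ℝ, EndV 𝕜 n) (f.1 i) x :=
  ContMDiffOn.mdifferentiableAt' (P.isOpen_U i) (f.2.1 i) hx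

theorem SmoothForm.smooth (α : SmoothForm P) (i : ι) (e : Chart M) (c : Fin 3) :
    ContMDiffOn I3 𝓘(ℝ, EndV 𝕜 n) ∞ (comp (α.1 i) e c) (e.1.source ∩ P.U i) := α.2.1 i e c

theorem SmoothForm.mdiff (α : SmoothForm P) {i : ι} {e : Chart M} {x : M}
    (hx : x ∈ e.1.source ∩ P.U i) (c : Fin 3) :
    MDifferentiableAt I3 𝓘(ℝ, EndV 𝕜 n) (comp (α.1 i) e c) x :=
  ContMDiffOn.mdifferentiableAt' (e.1.open_source.inter (P.isOpen_U i)) (α.2.1 i e c) hx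

theorem SmoothForm.comp_gauge (α : SmoothForm P) (e : Chart M) (c : Fin 3) {i j : ι} {x : M}
    (hx : x ∈ P.U i ∩ P.U j) : comp (α.1 i) e c x = conjB (P.g i j x) (comp (α.1 j) e c x) :=
  SmoothForm.gauge α hx _

theorem isBracket_iff {α β : SmoothForm P} {u : SmoothSec P} :
    IsBracket P g α β u ↔ ∀ i (e : Chart M), ∀ x ∈ e.1.source ∩ P.U i, u.1 i x =
      contr g (lieB 𝕜 n) e x (fun b => comp (α.1 i) e b x) (fun c => comp (β.1 i) e c x) := by
  simp only [IsBracket, contr, lieB_apply]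
  rfl

theorem contr_gauge {i j : ι} {x : M} (hx : x ∈ P.U i ∩ P.U j) (e : Chart M)
    (a a' : Fin 3 → EndV 𝕜 n) :
    contr g (lieB 𝕜 n) e x (fun b => conjB (P.g i j x) (a b)) (fun c => conjB (P.g i j x) (a' c))
      = conjB (P.g i j x) (contr g (lieB 𝕜 n) e x a a') := by
  simp only [contr, P.lieB_conjB hx, map_sum, map_smul]

theorem contr_mem_lieAlg (e : Chart M) (x : M) {a a' : Fin 3 → EndV 𝕜 n}
    (ha : ∀ b, a b ∈ lieAlg K) (ha' : ∀ b, a' b ∈ lieAlg K) :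
    contr g (lieB 𝕜 n) e x a a' ∈ lieAlg K :=
  sum_mem fun b _ => sum_mem fun c _ => Submodule.smul_mem _ _ (lieB_mem_lieAlg K (ha b) (ha' c))

theorem exists_isBracket (α β : SmoothForm P) : ∃ u, IsBracket P g α β u := by
  simp only [isBracket_iff]
  refine exists_smoothSec (fun i e x => contr g (lieB 𝕜 n) e x (fun b => comp (α.1 i) e b x)
    (fun c => comp (β.1 i) e c x)) ?_ ?_ ?_ ?_
  · exact fun i e => contMDiffOn_contr g _ e (SmoothForm.smooth α i e) (SmoothForm.smooth β i e)
  · exact fun i e e' x _ hx hx' => contr_eq g _ e e' ⟨hx, hx'⟩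
      (fun c => comp_eq _ e e' ⟨hx, hx'⟩ c) (fun c => comp_eq _ e e' ⟨hx, hx'⟩ c)
  · exact fun i e x hx _ => contr_mem_lieAlg g e x (fun b => α.2.2.1 i x hx _)
      (fun b => β.2.2.1 i x hx _)
  · intro i j e x hx _
    simp only [fun c => SmoothForm.comp_gauge α e c hx, fun c => SmoothForm.comp_gauge β e c hx]
    exact contr_gauge g hx e _ _

theorem cpd_mem_lieAlg (A : SmoothConn P) (e : Chart M) (b : Fin 3) {i : ι} {F : M → EndV 𝕜 n}
    {O : Set M} (hO : IsOpen O) (hF : ∀ y ∈ O, F y ∈ lieAlg K) {x : M} (hx : x ∈ O)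
    (hxU : x ∈ P.U i) (hd : MDifferentiableAt I3 𝓘(ℝ, EndV 𝕜 n) F x) :
    cpd (A.form i) e b F x ∈ lieAlg K :=
  add_mem (dirDeriv_mem_lieAlg K hO hF hx hd _) (lieB_mem_lieAlg K (A.mem i x hxU _) (hF x hx))

theorem contMDiffOn_cpd (A : SmoothConn P) (e : Chart M) (b : Fin 3) (i : ι) {F : M → EndV 𝕜 n}
    (hF : ContMDiffOn I3 𝓘(ℝ, EndV 𝕜 n) ∞ F (e.1.source ∩ P.U i)) :
    ContMDiffOn I3 𝓘(ℝ, EndV 𝕜 n) ∞ (cpd (A.form i) e b F) (e.1.source ∩ P.U i) :=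
  (contMDiffOn_pd e b (P.isOpen_U i) hF).add (contMDiffOn_bilin _ (A.smooth i e b) hF)

theorem isCovDeriv_iff {A : ι → ∀ x : M, TangentSpace I3 x →L[ℝ] EndV 𝕜 n} {f : SmoothSec P}
    {η : SmoothForm P} : IsCovDeriv P A f η ↔ ∀ i (e : Chart M), ∀ x ∈ e.1.source ∩ P.U i, ∀ c,
      comp (η.1 i) e c x = cpd (A i) e c (f.1 i) x := by
  constructor
  · intro h i e x hx c
    rw [comp, h i x hx.2, cpd, lieB_apply]
    rfl
  · intro h i x hx v
    have hxe : x ∈ (achart (EuclideanHalfSpace 3) x).1.source := mem_chart_source _ x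
    obtain ⟨c, rfl⟩ := exists_tangent_eq_sum _ hxe v
    have h1 := h i _ x ⟨hxe, hx⟩
    simp only [comp, cpd] at h1
    rw [← lieB_apply]
    simp only [dirDeriv, map_sum, map_smul, h1, smul_add, Finset.sum_add_distrib, sum_apply,
      smul_apply]
    rfl

theorem exists_isCovDeriv (A : SmoothConn P) (f : SmoothSec P) : ∃ η, IsCovDeriv P A.form f η := by
  let θ : ι → ∀ x : M, TangentSpace I3 x →L[ℝ] EndV 𝕜 n := fun i x =>
    (show TangentSpace I3 x →L[ℝ] EndV 𝕜 n from mfderiv I3 𝓘(ℝ, EndV 𝕜 n) (f.1 i) x)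
      + ((lieB 𝕜 n).flip (f.1 i x)).comp (A.form i x)
  have hθ : ∀ i e c x, comp (θ i) e c x = cpd (A.form i) e c (f.1 i) x := fun i e c x => rfl
  refine ⟨⟨θ, fun i e c => ?_, fun i x hx v => ?_, fun i j x hx v => ?_⟩,
    isCovDeriv_iff.2 fun i e x hx c => hθ i e c x⟩
  · exact contMDiffOn_cpd A e c i ((SmoothSec.smooth f i).mono inter_subset_right)
  · exact add_mem (dirDeriv_mem_lieAlg K (P.isOpen_U i) (f.2.2.1 i) hx (SmoothSec.mdiff f hx) _)
      (lieB_mem_lieAlg K (A.mem i x hx _) (f.2.2.1 i x hx))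
  · have hxe : x ∈ (achart (EuclideanHalfSpace 3) x).1.source := mem_chart_source _ x
    obtain ⟨c, rfl⟩ := exists_tangent_eq_sum _ hxe v
    rw [← conjB_apply]
    simp only [map_sum, map_smul]
    refine Finset.sum_congr rfl fun b _ => congrArg _ ?_
    exact cpd_gauge A _ b hx hxe (SmoothSec.mdiff f hx.2) isOpen_univ trivial fun y hy => SmoothSec.gauge f hy.2

/-- The codifferential in a chart and a trivialization. -/
def codiffLoc (A η : ∀ x : M, TangentSpace I3 x →L[ℝ] EndV 𝕜 n) (e : Chart M) (x : M) : EndV 𝕜 n :=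
  codiffAlg (gramInv g e x) (fun d b c => pd e d (fun y => gramInv g e y b c) x)
    (fun b => logDens g e b x) (fun b c => cpd A e b (comp η e c) x) (fun c => comp η e c x)

theorem codiffLoc_eq (A η : ∀ x : M, TangentSpace I3 x →L[ℝ] EndV 𝕜 n) (e : Chart M) {x : M}
    (hx : x ∈ e.1.source) (hη : ∀ c, MDifferentiableAt I3 𝓘(ℝ, EndV 𝕜 n) (comp η e c) x) :
    codiffLoc g A η e x = -divg g e (fun b y => ∑ c, gramInv g e y b c • comp η e c y) x
      - contr g (lieB 𝕜 n) e x (fun b => comp A e b x) (fun c => comp η e c x) := by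
  rw [divg_gradient g e hx hη]
  simp only [codiffLoc, codiffAlg, contr, cpd, smul_add, Finset.sum_add_distrib]
  abel

theorem isCodiff_iff {A : ι → ∀ x : M, TangentSpace I3 x →L[ℝ] EndV 𝕜 n} {η : SmoothForm P}
    {u : SmoothSec P} : IsCodiff P g A η u ↔ ∀ i (e : Chart M), ∀ x ∈ e.1.source ∩ P.U i,
      u.1 i x = codiffLoc g (A i) (η.1 i) e x := by
  refine forall_congr' fun i => forall_congr' fun e => forall_congr' fun x =>
    forall_congr' fun hx => ?_
  rw [codiffLoc_eq g _ _ e hx.1 (SmoothForm.mdiff η hx), ← density_divg g e hx.1 (SmoothForm.mdiff η hx)]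
  simp only [contr, lieB_apply]
  rfl

theorem exists_isCodiff (A : SmoothConn P) (η : SmoothForm P) :
    ∃ u, IsCodiff P g A.form η u := by
  simp only [isCodiff_iff]
  have hdiv := fun i e x (hx : x ∈ e.1.source ∩ P.U i) =>
    codiffLoc_eq g (A.form i) (η.1 i) e hx.1 (SmoothForm.mdiff η hx)
  refine exists_smoothSec (fun i e x => codiffLoc g (A.form i) (η.1 i) e x) ?_ ?_ ?_ ?_
  · exact fun i e => (((contMDiffOn_divg g e (P.isOpen_U i)
      (contMDiffOn_raise g e (SmoothForm.smooth η i e))).neg).sub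
      (contMDiffOn_contr g _ e (A.smooth i e) (SmoothForm.smooth η i e))).congr (hdiv i e)
  · intro i e e' x hx hxe hxe'
    have h1 : divg g e (fun b y => ∑ c, gramInv g e y b c • comp (η.1 i) e c y) x
        = divg g e' (fun b y => ∑ c, gramInv g e' y b c • comp (η.1 i) e' c y) x :=
      divg_raise_eq g e e' (P.isOpen_U i) ⟨hxe, hx⟩ hxe' (η := fun c => comp (η.1 i) e c)
        (η' := fun c => comp (η.1 i) e' c) (SmoothForm.smooth η i e)
        fun y hy c => comp_eq (η.1 i) e e' hy c
    have h2 := contr_eq g (lieB 𝕜 n) e e' ⟨hxe, hxe'⟩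
      (fun c => comp_eq (A.form i) e e' ⟨hxe, hxe'⟩ c) (fun c => comp_eq (η.1 i) e e' ⟨hxe, hxe'⟩ c)
    rw [hdiv i e x ⟨hxe, hx⟩, hdiv i e' x ⟨hxe', hx⟩, h1]
    exact congrArg _ h2
  · intro i e x hx hxe
    refine neg_mem (sum_mem fun b _ => sum_mem fun c _ => add_mem (Submodule.smul_mem _ _ ?_)
      (Submodule.smul_mem _ _ (η.2.2.1 i x hx _)))
    exact cpd_mem_lieAlg A e b (P.isOpen_U i) (fun y hy => η.2.2.1 i y hy _) hx hx
      (SmoothForm.mdiff η ⟨hxe, hx⟩ c)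
  · intro i j e x hx hxe
    have h1 : ∀ b c, cpd (A.form i) e b (comp (η.1 i) e c) x
        = conjB (P.g i j x) (cpd (A.form j) e b (comp (η.1 j) e c) x) := fun b c =>
      cpd_gauge A e b hx hxe (SmoothForm.mdiff η ⟨hxe, hx.2⟩ c) isOpen_univ trivial
        fun y hy => SmoothForm.comp_gauge η e c hy.2
    simp only [codiffLoc, codiffAlg, h1, fun c => SmoothForm.comp_gauge η e c hx, map_neg, map_sum, map_add,
      map_smul]

/-- The normal derivative in a chart and a trivialization. -/
def normalLoc (A : ∀ x : M, TangentSpace I3 x →L[ℝ] EndV 𝕜 n) (F : M → EndV 𝕜 n) (e : Chart M)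
    (x : M) : EndV 𝕜 n := (√(gramInv g e x 0 0))⁻¹ • ∑ d, gramInv g e x 0 d • cpd A e d F x

theorem normalLoc_eq (A : ∀ x : M, TangentSpace I3 x →L[ℝ] EndV 𝕜 n) (F : M → EndV 𝕜 n)
    (e : Chart M) (x : M) : normalLoc g A F e x
      = dirDeriv F x (chartNormal g e x) + ⁅A x (chartNormal g e x), F x⁆ := by
  rw [dirDeriv_chartNormal, ← lieB_apply, chartNormal]
  simp only [normalLoc, cpd, smul_add, Finset.sum_add_distrib, map_smul, map_sum, smul_apply,
    sum_apply]
  rfl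

theorem isNormalDeriv_iff {A : ι → ∀ x : M, TangentSpace I3 x →L[ℝ] EndV 𝕜 n} {u : SmoothSec P}
    {w : BdrySec P} : IsNormalDeriv P g A u w ↔ ∀ i (e : Chart M), ∀ x ∈ e.1.source ∩ P.U i,
      x ∈ bdry M → w.1 i x = normalLoc g (A i) (u.1 i) e x := by
  constructor
  · intro h i e x hx hxb
    rw [h i x ⟨hx.2, hxb⟩, normalLoc_eq, inwardNormal_eq g e hx.1 hxb]
  · intro h i x hx
    rw [h i (achart (EuclideanHalfSpace 3) x) x ⟨mem_chart_source _ x, hx.1⟩ hx.2, normalLoc_eq]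
    rfl

theorem contMDiffOn_inv_sqrt (e : Chart M) : ContMDiffOn I3 𝓘(ℝ, ℝ) ∞
    (fun x => (√(gramInv g e x 0 0))⁻¹) e.1.source :=
  contMDiffOn_comp_real (contMDiffOn_gramInv g e 0 0) (φ := fun t => (√t)⁻¹) fun _ hx =>
    (Real.contDiffAt_sqrt (gramInv_zero_pos g e hx).ne').inv
      (Real.sqrt_pos.2 (gramInv_zero_pos g e hx)).ne'

theorem exists_isNormalDeriv (A : SmoothConn P) (u : SmoothSec P) :
    ∃ w, IsNormalDeriv P g A.form u w := by
  simp only [isNormalDeriv_iff]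
  refine exists_bdrySec (fun i e x => normalLoc g (A.form i) (u.1 i) e x) ?_ ?_ ?_ ?_
  · intro i e
    refine ((contMDiffOn_inv_sqrt g e).mono inter_subset_left).continuousOn.smul ?_
    exact (contMDiffOn_finset_sum fun d _ => ((contMDiffOn_gramInv g e 0 d).mono
      inter_subset_left).smul (contMDiffOn_cpd A e d i
        ((SmoothSec.smooth u i).mono inter_subset_right))).continuousOn
  · intro i e e' x hx hxb hxe hxe'
    rw [normalLoc_eq, normalLoc_eq, chartNormal_eq g e e' ⟨hxe, hxe'⟩ hxb]
  · intro i e x hx hxe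
    refine Submodule.smul_mem _ _ (sum_mem fun d _ => Submodule.smul_mem _ _ ?_)
    exact cpd_mem_lieAlg A e d (P.isOpen_U i) (u.2.2.1 i) hx hx (SmoothSec.mdiff u hx)
  · intro i j e x hx hxe
    have h1 : ∀ d, cpd (A.form i) e d (u.1 i) x = conjB (P.g i j x) (cpd (A.form j) e d (u.1 j) x) :=
      fun d => cpd_gauge A e d hx hxe (SmoothSec.mdiff u hx.2) isOpen_univ trivial fun y hy => SmoothSec.gauge u hy.2
    simp only [normalLoc, h1, map_sum, map_smul]

theorem isTauMul_iff {u : SmoothSec P} {w : BdrySec P} :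
    IsTauMul P g u w ↔ ∀ i (e : Chart M), ∀ x ∈ e.1.source ∩ P.U i,
      x ∈ bdry M → w.1 i x = chartTau g e x • u.1 i x := by
  constructor
  · intro h i e x hx hxb
    rw [h i x ⟨hx.2, hxb⟩, tau_eq_chartTau g e hx.1 hxb]
  · intro h i x hx
    have hxe : x ∈ (achart (EuclideanHalfSpace 3) x).1.source := mem_chart_source _ x
    rw [h i _ x ⟨hxe, hx.1⟩ hx.2, tau_eq_chartTau g _ hxe hx.2]

theorem exists_isTauMul (u : SmoothSec P) : ∃ w, IsTauMul P g u w := by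
  simp only [isTauMul_iff]
  refine exists_bdrySec (fun i e x => chartTau g e x • u.1 i x) ?_ ?_ ?_ ?_
  · exact fun i e => (((contMDiffOn_chartTau g e).mono inter_subset_left).smul
      ((SmoothSec.smooth u i).mono inter_subset_right)).continuousOn
  · intro i e e' x hx hxb hxe hxe'
    rw [chartTau_eq g e e' ⟨hxe, hxe'⟩ hxb]
  · exact fun i e x hx _ => Submodule.smul_mem _ _ (u.2.2.1 i x hx)
  · intro i j e x hx hxe
    rw [map_smul, ← SmoothSec.gauge u hx]

/-- `η = [h, f]`. -/
def IsFormBracket (h : SmoothForm P) (f : SmoothSec P) (η : SmoothForm P) : Prop :=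
  ∀ i (e : Chart M), ∀ x ∈ e.1.source ∩ P.U i, ∀ c,
    comp (η.1 i) e c x = lieB 𝕜 n (comp (h.1 i) e c x) (f.1 i x)

/-- `w = [h(ν), u]`. -/
def IsNormalBracket (h : SmoothForm P) (u : SmoothSec P) (w : BdrySec P) : Prop :=
  ∀ i (e : Chart M), ∀ x ∈ e.1.source ∩ P.U i, x ∈ bdry M → w.1 i x =
    (√(gramInv g e x 0 0))⁻¹ • ∑ d, gramInv g e x 0 d • lieB 𝕜 n (comp (h.1 i) e d x) (u.1 i x)

theorem cpd_add_form (A h : ∀ x : M, TangentSpace I3 x →L[ℝ] EndV 𝕜 n) (e : Chart M) (b : Fin 3)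
    (F : M → EndV 𝕜 n) (x : M) :
    cpd (A + h) e b F x = cpd A e b F x + lieB 𝕜 n (comp h e b x) (F x) := by
  simp only [cpd, comp, Pi.add_apply, add_apply, map_add]
  abel

theorem isCovDeriv_add {A : SmoothConn P} {h : SmoothForm P} {f : SmoothSec P}
    {η η₀ : SmoothForm P} (h₀ : IsCovDeriv P A.form f η₀) (h₁ : IsCovDeriv P (A.form + h.1) f η) :
    IsFormBracket h f (η - η₀) := by
  rw [isCovDeriv_iff] at h₀ h₁
  intro i e x hx c
  change comp (η.1 i) e c x - comp (η₀.1 i) e c x = _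
  rw [h₀ i e x hx c, h₁ i e x hx c, Pi.add_apply, cpd_add_form]
  abel

theorem isCodiff_add {A : SmoothConn P} {h η : SmoothForm P} {u u₀ : SmoothSec P}
    (h₀ : IsCodiff P g A.form η u₀) (h₁ : IsCodiff P g (A.form + h.1) η u) :
    IsBracket P g h η (u₀ - u) := by
  rw [isCodiff_iff] at h₀ h₁
  rw [isBracket_iff]
  intro i e x hx
  change u₀.1 i x - u.1 i x = _
  rw [h₀ i e x hx, h₁ i e x hx, Pi.add_apply]
  simp only [codiffLoc, codiffAlg, cpd_add_form, contr, smul_add, Finset.sum_add_distrib]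
  abel

theorem isNormalDeriv_add {A : SmoothConn P} {h : SmoothForm P} {u : SmoothSec P}
    {w w₀ : BdrySec P} (h₀ : IsNormalDeriv P g A.form u w₀)
    (h₁ : IsNormalDeriv P g (A.form + h.1) u w) : IsNormalBracket g h u (w - w₀) := by
  rw [isNormalDeriv_iff] at h₀ h₁
  intro i e x hx hxb
  change w.1 i x - w₀.1 i x = _
  rw [h₀ i e x hx hxb, h₁ i e x hx hxb, Pi.add_apply]
  simp only [normalLoc, cpd_add_form, smul_add, Finset.sum_add_distrib]
  abel

end Operators

end Coulomb

namespace Coulomb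

set_option linter.unusedSectionVars false

theorem norm_le_of_enorm_sq_le {X Y : Type*} [NormedAddCommGroup X] [NormedAddCommGroup Y] {x : X}
    {y : Y} {C : NNReal} (h : ‖x‖ₑ ^ 2 ≤ C * ‖y‖ₑ ^ 2) : ‖x‖ ≤ NNReal.sqrt C * ‖y‖ := by
  have h1 : ‖x‖ₑ ≤ NNReal.sqrt C * ‖y‖ₑ := by
    refine ennreal_sq_le_sq (h.trans (le_of_eq ?_))
    rw [mul_pow, ← ENNReal.coe_pow, NNReal.sq_sqrt]
  rw [enorm_eq_nnnorm, enorm_eq_nnnorm, ← ENNReal.coe_mul, ENNReal.coe_le_coe] at h1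
  simpa using NNReal.coe_le_coe.2 h1

theorem norm_le_of_enorm_sq_le₂ {X Y Z : Type*} [NormedAddCommGroup X] [NormedAddCommGroup Y]
    [NormedAddCommGroup Z] {x : X} {y : Y} {z : Z} {C : NNReal}
    (h : ‖x‖ₑ ^ 2 ≤ C * (‖y‖ₑ ^ 2 * ‖z‖ₑ ^ 2)) : ‖x‖ ≤ NNReal.sqrt C * ‖y‖ * ‖z‖ := by
  have h1 : ‖x‖ₑ ≤ NNReal.sqrt C * (‖y‖ₑ * ‖z‖ₑ) := by
    refine ennreal_sq_le_sq (h.trans (le_of_eq ?_))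
    rw [mul_pow, ← ENNReal.coe_pow, NNReal.sq_sqrt, mul_pow]
  rw [enorm_eq_nnnorm, enorm_eq_nnnorm, enorm_eq_nnnorm, ← ENNReal.coe_mul, ← ENNReal.coe_mul,
    ENNReal.coe_le_coe, ← mul_assoc] at h1
  simpa using NNReal.coe_le_coe.2 h1

section Pointwise

variable {M : Type*} [TopologicalSpace M] [ChartedSpace (EuclideanHalfSpace 3) M]
  [IsManifold I3 ∞ M]
variable {W W₁ W₂ W₃ : Type*} [NormedAddCommGroup W] [NormedSpace ℝ W]
  [NormedAddCommGroup W₁] [NormedSpace ℝ W₁] [NormedAddCommGroup W₂] [NormedSpace ℝ W₂]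
  [NormedAddCommGroup W₃] [NormedSpace ℝ W₃]

theorem pd_symm_eq (e : Chart M) {V : Set M} (hV : IsOpen V) (c : Fin 3) {F : M → W}
    (hF : ContMDiffOn I3 𝓘(ℝ, W) ∞ F (e.1.source ∩ V)) {y : E3} (hy : y ∈ chartDom e V) :
    pd e c F ((coord e).symm y) = fderivWithin ℝ (F ∘ (coord e).symm) (chartDom e V) y
      (EuclideanSpace.single c 1) := by
  have h := coord_symm_mem e hy
  rw [pd_eq e c h.1.1 (ContMDiffOn.mdifferentiableAt' (e.1.open_source.inter hV) hF h.1), h.2,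
    fderivWithin_congr_set (chartDom_eventuallyEq e hV hy)]

/-- The jets of a first order operator. -/
theorem exists_jetFun_firstOrder_le (e : Chart M) {V : Set M} (hV : IsOpen V) {B : Set E3}
    (hB : IsCompact B) (hBΩ : B ⊆ chartDom e V) {Ψ₀ : M → W₁ →L[ℝ] W₂}
    (h₀ : ContMDiffOn I3 𝓘(ℝ, W₁ →L[ℝ] W₂) ∞ Ψ₀ (e.1.source ∩ V)) {Ψ₁ : Fin 3 → M → W₁ →L[ℝ] W₂}
    (h₁ : ∀ c, ContMDiffOn I3 𝓘(ℝ, W₁ →L[ℝ] W₂) ∞ (Ψ₁ c) (e.1.source ∩ V)) (j : ℕ) :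
    ∃ C : ℝ, 0 ≤ C ∧ ∀ (F : M → W₁) (G : M → W₂), ContMDiffOn I3 𝓘(ℝ, W₁) ∞ F (e.1.source ∩ V) →
      (∀ x ∈ e.1.source ∩ V, G x = Ψ₀ x (F x) + ∑ c, Ψ₁ c x (pd e c F x)) → ∀ y ∈ B,
      ‖jetFun e j G y‖ ≤ C * ∑ p ∈ Finset.range (j + 2), ‖jetFun e p F y‖ := by
  set Ω := chartDom e V
  have hΩ : UniqueDiffOn ℝ Ω := uniqueDiffOn_chartDom e hV
  obtain ⟨C₀, hC₀, k₀⟩ := exists_jet_clm_apply_le hΩ (contDiffOn_chart e hV h₀) hB hBΩ j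
  let ev : Fin 3 → (E3 →L[ℝ] W₁) →L[ℝ] W₁ := fun c =>
    ContinuousLinearMap.apply ℝ W₁ (EuclideanSpace.single c 1)
  let Φ : E3 → (E3 →L[ℝ] W₁) →L[ℝ] W₂ := fun y => ∑ c, ((Ψ₁ c ∘ (coord e).symm) y).comp (ev c)
  have hΦ : ContDiffOn ℝ ∞ Φ Ω := ContDiffOn.sum fun c _ =>
    (contDiffOn_chart e hV (h₁ c)).clm_comp contDiffOn_const
  obtain ⟨C₁, hC₁, k₁⟩ := exists_jet_clm_apply_le hΩ hΦ hB hBΩ j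
  refine ⟨C₀ + C₁, by positivity, fun F G hF hG y hy => ?_⟩
  have hf := contDiffOn_chart e hV hF
  set f := F ∘ (coord e).symm with hfd
  have hf' : ContDiffOn ℝ ∞ (fderivWithin ℝ f Ω) Ω := hf.fderivWithin hΩ (by simp)
  have e1 : ∀ z ∈ Ω, (G ∘ (coord e).symm) z = (Ψ₀ ∘ (coord e).symm) z (f z)
      + Φ z (fderivWithin ℝ f Ω z) := fun z hz => by
    have h1 := coord_symm_mem e hz
    rw [Function.comp_apply, hG _ h1.1]
    simp only [Φ, ev, sum_apply, ContinuousLinearMap.comp_apply, ContinuousLinearMap.apply_apply]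
    simp only [fun c => pd_symm_eq e hV c hF hz]
    rfl
  have hyΩ := hBΩ hy
  have e2 : jetFun e j G y = iteratedFDerivWithin ℝ j (fun z => (Ψ₀ ∘ (coord e).symm) z (f z)) Ω y
      + iteratedFDerivWithin ℝ j (fun z => Φ z (fderivWithin ℝ f Ω z)) Ω y := by
    rw [jetFun_eq e hV j G hyΩ, iteratedFDerivWithin_congr e1 hyΩ]
    exact iteratedFDerivWithin_add_apply
      ((((contDiffOn_chart e hV h₀).clm_apply hf) y hyΩ).of_le (mod_cast le_top))
      (((hΦ.clm_apply hf') y hyΩ).of_le (mod_cast le_top)) hΩ hyΩ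
  have hj : ∀ p, ‖jetFun e p F y‖ = ‖iteratedFDerivWithin ℝ p f Ω y‖ := fun p => by
    rw [jetFun_eq e hV p F hyΩ]
  rw [e2, add_mul]
  refine (norm_add_le _ _).trans (add_le_add ((k₀ f hf y hy).trans ?_) ((k₁ _ hf' y hy).trans ?_))
  · refine mul_le_mul_of_nonneg_left ?_ hC₀
    simp only [hj]
    exact Finset.sum_le_sum_of_subset_of_nonneg (Finset.range_mono (by omega))
      fun _ _ _ => norm_nonneg _
  · refine mul_le_mul_of_nonneg_left ?_ hC₁
    simp only [norm_iteratedFDerivWithin_fderivWithin hΩ hyΩ, hj]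
    rw [Finset.sum_range_succ' _ (j + 1)]
    exact le_add_of_nonneg_right (norm_nonneg _)

/-- The jets of a bilinear operator of order zero. -/
theorem exists_jetFun_bilin_le (e : Chart M) {V : Set M} (hV : IsOpen V) {B : Set E3}
    (hB : IsCompact B) (hBΩ : B ⊆ chartDom e V) {Ψ : M → W₁ →L[ℝ] W₂ →L[ℝ] W₃}
    (h : ContMDiffOn I3 𝓘(ℝ, W₁ →L[ℝ] W₂ →L[ℝ] W₃) ∞ Ψ (e.1.source ∩ V)) (j : ℕ) :
    ∃ C : ℝ, 0 ≤ C ∧ ∀ (F : M → W₁) (F' : M → W₂) (G : M → W₃),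
      ContMDiffOn I3 𝓘(ℝ, W₁) ∞ F (e.1.source ∩ V) → ContMDiffOn I3 𝓘(ℝ, W₂) ∞ F' (e.1.source ∩ V) →
      (∀ x ∈ e.1.source ∩ V, G x = Ψ x (F x) (F' x)) → ∀ y ∈ B, ‖jetFun e j G y‖ ≤ C *
        ∑ i ∈ Finset.range (j + 1), ∑ p ∈ Finset.range (i + 1),
          ‖jetFun e p F y‖ * ‖jetFun e (j - i) F' y‖ := by
  obtain ⟨C, hC, k⟩ := exists_jet_clm_apply₂_le (uniqueDiffOn_chartDom e hV)
    (contDiffOn_chart e hV h) hB hBΩ j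
  refine ⟨C, hC, fun F F' G hF hF' hG y hy => ?_⟩
  have hyΩ := hBΩ hy
  simp only [jetFun_eq e hV _ _ hyΩ]
  rw [iteratedFDerivWithin_congr (f₁ := G ∘ (coord e).symm)
    (f := fun z => (Ψ ∘ (coord e).symm) z ((F ∘ (coord e).symm) z)
    ((F' ∘ (coord e).symm) z)) (fun z hz => hG _ (coord_symm_mem e hz).1) hyΩ]
  exact k _ _ (contDiffOn_chart e hV hF) (contDiffOn_chart e hV hF') y hy

end Pointwise

section Operators

variable {𝕜 : Type*} [RCLike 𝕜] {n : ℕ} {K : Subgroup (unitary (EndV 𝕜 n))} {ι : Type*}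
variable {M : Type*} [TopologicalSpace M] [ChartedSpace (EuclideanHalfSpace 3) M]
variable [IsManifold I3 ∞ M] {P : PrincipalBundle M K ι} {𝒰 : PatchCover P}
variable {S₁ S₂ S₃ W₁ W₂ W₃ : Type*} [AddCommGroup S₁] [Module ℝ S₁] [AddCommGroup S₂] [Module ℝ S₂]
  [AddCommGroup S₃] [Module ℝ S₃]
  [NormedAddCommGroup W₁] [NormedSpace ℝ W₁] [NormedAddCommGroup W₂] [NormedSpace ℝ W₂]
  [NormedAddCommGroup W₃] [NormedSpace ℝ W₃]
  {loc₁ : LocalReps 𝒰 S₁ W₁} {loc₂ : LocalReps 𝒰 S₂ W₂} {loc₃ : LocalReps 𝒰 S₃ W₃}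

/-- The domain of a patch in `M`. -/
abbrev patchSet (𝒰 : PatchCover P) (a : Fin 𝒰.N) : Set M :=
  (𝒰.chart a).1.source ∩ P.U (𝒰.triv a)

/-- The order of square integrability of sums. -/
theorem enorm_modelJet_le_of_jet_le {r : ℕ} {s : S₂} (C : Fin 𝒰.N → ℕ → NNReal) {X : ℝ≥0∞}
    (h : ∀ a, ∀ j ≤ r, ∫⁻ y in coord (𝒰.chart a) '' 𝒰.C a,
      ‖jetFun (𝒰.chart a) j (loc₂ a s).1 y‖ₑ ^ 2 ≤ C a j * X) :
    ‖modelJet 𝒰 loc₂ r s‖ₑ ^ 2 ≤ ((∑ a, ∑ j ∈ Finset.range (r + 1), C a j : NNReal) : ℝ≥0∞) * X := by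
  refine enorm_modelJet_sq_le loc₂ r s fun a j hj => (h a j hj).trans ?_
  gcongr
  refine (Finset.single_le_sum (f := C a) (fun _ _ => zero_le) (Finset.mem_range.2
    (Nat.lt_succ_of_le hj))).trans ?_
  exact Finset.single_le_sum (f := fun a => ∑ j ∈ Finset.range (r + 1), C a j)
    (fun _ _ => zero_le) (Finset.mem_univ a)

/-- First order operators are bounded in Sobolev norms. -/
theorem exists_modelJet_firstOrder_le (loc₁ : LocalReps 𝒰 S₁ W₁) (loc₂ : LocalReps 𝒰 S₂ W₂)
    {R : S₁ → S₂ → Prop}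
    (h : ∀ a, ∃ (Ψ₀ : M → W₁ →L[ℝ] W₂) (Ψ₁ : Fin 3 → M → W₁ →L[ℝ] W₂),
      ContMDiffOn I3 𝓘(ℝ, W₁ →L[ℝ] W₂) ∞ Ψ₀ (patchSet 𝒰 a) ∧
      (∀ c, ContMDiffOn I3 𝓘(ℝ, W₁ →L[ℝ] W₂) ∞ (Ψ₁ c) (patchSet 𝒰 a)) ∧
      ∀ s t, R s t → ∀ x ∈ patchSet 𝒰 a, (loc₂ a t).1 x
        = Ψ₀ x ((loc₁ a s).1 x) + ∑ c, Ψ₁ c x (pd (𝒰.chart a) c (loc₁ a s).1 x))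
    {r m : ℕ} (hr : r + 1 ≤ m) :
    ∃ C : ℝ, ∀ s t, R s t → ‖modelJet 𝒰 loc₂ r t‖ ≤ C * ‖modelJet 𝒰 loc₁ m s‖ := by
  have key : ∀ a, ∀ j, ∃ C : NNReal, ∀ s t, j ≤ r → R s t →
      ∫⁻ y in coord (𝒰.chart a) '' 𝒰.C a,
        ‖jetFun (𝒰.chart a) j (loc₂ a t).1 y‖ₑ ^ 2 ≤ C * ‖modelJet 𝒰 loc₁ m s‖ₑ ^ 2 := by
    intro a j
    obtain ⟨Ψ₀, Ψ₁, h₀, h₁, hR⟩ := h a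
    obtain ⟨C, hC, k⟩ := exists_jetFun_firstOrder_le (𝒰.chart a) (P.isOpen_U (𝒰.triv a))
      (isCompact_coord_patch 𝒰 a) (coord_image_subset 𝒰 a) h₀ h₁ j
    refine ⟨(C ^ 2 * (Finset.range (j + 2)).card).toNNReal * (j + 2 : ℕ), fun s t hj hst => ?_⟩
    calc _ ≤ ∫⁻ y in coord (𝒰.chart a) '' 𝒰.C a,
          ENNReal.ofReal (C ^ 2 * (Finset.range (j + 2)).card) *
          ∑ q ∈ Finset.range (j + 2), ‖jetFun (𝒰.chart a) q (loc₁ a s).1 y‖ₑ ^ 2 := by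
          refine setLIntegral_mono' (isCompact_coord_patch 𝒰 a).measurableSet fun y hy => ?_
          simpa only [ofReal_norm] using enorm_sq_le_of_norm_le_sum (fun _ _ => norm_nonneg _)
            (k _ _ (loc₁ a s).2 (hR s t hst) y hy)
      _ = ENNReal.ofReal (C ^ 2 * (Finset.range (j + 2)).card) *
          ∑ q ∈ Finset.range (j + 2), ∫⁻ y in coord (𝒰.chart a) '' 𝒰.C a,
            ‖jetFun (𝒰.chart a) q (loc₁ a s).1 y‖ₑ ^ 2 := by
          rw [lintegral_const_mul' _ _ ENNReal.ofReal_ne_top, lintegral_finsetSum' _ fun q _ => ?_]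
          exact aemeasurable_jet_sq a s q (isCompact_coord_patch 𝒰 a).measurableSet
            (coord_image_subset 𝒰 a)
      _ ≤ ENNReal.ofReal (C ^ 2 * (Finset.range (j + 2)).card) *
          ∑ _q ∈ Finset.range (j + 2), ‖modelJet 𝒰 loc₁ m s‖ₑ ^ 2 := by
          gcongr with q hq
          have := Finset.mem_range.1 hq
          exact lintegral_jet_patch_le loc₁ m s a (by omega)
      _ = _ := by
          rw [Finset.sum_const, Finset.card_range, nsmul_eq_mul]
          push_cast
          rw [ENNReal.ofReal]
          ring
  choose C hC using key
  exact ⟨_, fun s t hst => norm_le_of_enorm_sq_le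
    (enorm_modelJet_le_of_jet_le C fun a j hj => hC a j s t hj hst)⟩

variable [T2Space M] [CompleteSpace W₁] [CompleteSpace W₂]

/-- Bilinear operators of order zero are bounded in Sobolev norms. -/
theorem exists_modelJet_bilin_le (hl₁ : IsModel 𝒰 loc₁) (hl₂ : IsModel 𝒰 loc₂)
    (loc₃ : LocalReps 𝒰 S₃ W₃) {R : S₁ → S₂ → S₃ → Prop}
    (h : ∀ a, ∃ Ψ : M → W₁ →L[ℝ] W₂ →L[ℝ] W₃,
      ContMDiffOn I3 𝓘(ℝ, W₁ →L[ℝ] W₂ →L[ℝ] W₃) ∞ Ψ (patchSet 𝒰 a) ∧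
      ∀ s t z, R s t z → ∀ x ∈ patchSet 𝒰 a, (loc₃ a z).1 x
        = Ψ x ((loc₁ a s).1 x) ((loc₂ a t).1 x))
    {r m₁ m₂ : ℕ} (hr : ∀ p q, p + q ≤ r → ProductOrders m₁ m₂ p q) :
    ∃ C : ℝ, ∀ s t z, R s t z →
      ‖modelJet 𝒰 loc₃ r z‖ ≤ C * ‖modelJet 𝒰 loc₁ m₁ s‖ * ‖modelJet 𝒰 loc₂ m₂ t‖ := by
  have key : ∀ a, ∀ j, ∃ C : NNReal, ∀ s t z, j ≤ r → R s t z →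
      ∫⁻ y in coord (𝒰.chart a) '' 𝒰.C a,
        ‖jetFun (𝒰.chart a) j (loc₃ a z).1 y‖ₑ ^ 2
          ≤ C * (‖modelJet 𝒰 loc₁ m₁ s‖ₑ ^ 2 * ‖modelJet 𝒰 loc₂ m₂ t‖ₑ ^ 2) := by
    intro a j
    by_cases hj : j ≤ r
    swap
    · exact ⟨0, fun s t z hj' => absurd hj' hj⟩
    obtain ⟨Ψ, hΨ, hR⟩ := h a
    obtain ⟨C, hC, k⟩ := exists_jetFun_bilin_le (𝒰.chart a) (P.isOpen_U (𝒰.triv a))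
      (isCompact_coord_patch 𝒰 a) (coord_image_subset 𝒰 a) hΨ j
    have hBm := (isCompact_coord_patch 𝒰 a).measurableSet
    set T := (Finset.range (j + 1)).sigma fun i => Finset.range (i + 1) with hT
    have hq : ∀ q : (_ : ℕ) × ℕ, ∃ D : NNReal, q ∈ T → ∀ s t,
        ∫⁻ y in coord (𝒰.chart a) '' 𝒰.C a, (‖jetFun (𝒰.chart a) q.2 (loc₁ a s).1 y‖ₑ *
        ‖jetFun (𝒰.chart a) (j - q.1) (loc₂ a t).1 y‖ₑ) ^ 2
          ≤ D * (‖modelJet 𝒰 loc₁ m₁ s‖ₑ ^ 2 * ‖modelJet 𝒰 loc₂ m₂ t‖ₑ ^ 2) := by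
      intro q
      by_cases hq : q ∈ T
      · have h1 := Finset.mem_sigma.1 hq
        have h2 := Finset.mem_range.1 h1.1
        have h3 := Finset.mem_range.1 h1.2
        obtain ⟨D, hD⟩ := exists_product_jet_le hl₁ hl₂ a (isCompact_coord_patch 𝒰 a)
          (coord_image_subset 𝒰 a) (hr q.2 (j - q.1) (by omega))
        exact ⟨D, fun _ => hD⟩
      · exact ⟨0, fun h => absurd h hq⟩
    choose D hD using hq
    refine ⟨(C ^ 2 * T.card).toNNReal * ∑ q ∈ T, D q, fun s t z _ hst => ?_⟩
    calc _ ≤ ∫⁻ y in coord (𝒰.chart a) '' 𝒰.C a, ENNReal.ofReal (C ^ 2 * T.card) *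
          ∑ q ∈ T, (‖jetFun (𝒰.chart a) q.2 (loc₁ a s).1 y‖ₑ *
            ‖jetFun (𝒰.chart a) (j - q.1) (loc₂ a t).1 y‖ₑ) ^ 2 := by
          refine setLIntegral_mono' hBm fun y hy => ?_
          have h1 := k _ _ _ (loc₁ a s).2 (loc₂ a t).2 (hR s t z hst) y hy
          rw [Finset.sum_sigma'] at h1
          have h2 := enorm_sq_le_of_norm_le_sum
            (fun _ _ => mul_nonneg (norm_nonneg _) (norm_nonneg _)) h1
          simpa only [ENNReal.ofReal_mul (norm_nonneg _), ofReal_norm] using h2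
      _ = ENNReal.ofReal (C ^ 2 * T.card) * ∑ q ∈ T, ∫⁻ y in coord (𝒰.chart a) '' 𝒰.C a,
            (‖jetFun (𝒰.chart a) q.2 (loc₁ a s).1 y‖ₑ *
            ‖jetFun (𝒰.chart a) (j - q.1) (loc₂ a t).1 y‖ₑ) ^ 2 := by
          rw [lintegral_const_mul' _ _ ENNReal.ofReal_ne_top, lintegral_finsetSum' _ fun q _ => ?_]
          simp only [mul_pow]
          exact (aemeasurable_jet_sq a s _ hBm (coord_image_subset 𝒰 a)).mul
            (aemeasurable_jet_sq a t _ hBm (coord_image_subset 𝒰 a))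
      _ ≤ ENNReal.ofReal (C ^ 2 * T.card) * ∑ q ∈ T,
          (D q * (‖modelJet 𝒰 loc₁ m₁ s‖ₑ ^ 2 * ‖modelJet 𝒰 loc₂ m₂ t‖ₑ ^ 2)) := by
          gcongr with q hq
          exact hD q hq s t
      _ = _ := by
          rw [← Finset.sum_mul, ENNReal.coe_mul, ENNReal.ofReal, ENNReal.ofNNReal_finsetSum, mul_assoc]
  choose C hC using key
  exact ⟨_, fun s t z hst => norm_le_of_enorm_sq_le₂
    (enorm_modelJet_le_of_jet_le C fun a j hj => hC a j s t z hj hst)⟩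

omit [CompleteSpace W₁] [CompleteSpace W₂] [T2Space M] in
theorem enorm_bdryJet_sq_le {w : BdrySec P} {c : ℝ≥0∞}
    (h : ∀ a, ∫⁻ z in planeEmb ⁻¹' (coord (𝒰.chart a) '' 𝒰.C a),
      ‖bdryFun (𝒰.chart a) (w.1 (𝒰.triv a)) z‖ₑ ^ 2 ≤ c) : ‖bdryJet 𝒰 w‖ₑ ^ 2 ≤ c := by
  have hc : c = (c ^ (1 / 2 : ℝ)) ^ 2 := by
    rw [← ENNReal.rpow_natCast, ← ENNReal.rpow_mul]
    simp
  rw [hc]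
  refine pow_le_pow_left' (pi_enorm_le fun a => ennreal_sq_le_sq ?_) 2
  rw [← hc]
  exact (enorm_toLp_sq (bdryFun_memLp (𝒰.chart a) (w.2.1 (𝒰.triv a)) (𝒰.isCompact a)
    (𝒰.subset a))).trans_le (h a)

omit [CompleteSpace W₁] [CompleteSpace W₂] in
theorem mem_patch_of_planeEmb (a : Fin 𝒰.N) {z : EuclideanSpace ℝ (Fin 2)}
    (hz : z ∈ planeEmb ⁻¹' (coord (𝒰.chart a) '' 𝒰.C a)) :
    (coord (𝒰.chart a)).symm (planeEmb z) ∈ 𝒰.C a ∩ bdry M := by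
  obtain ⟨x, hx, hxz⟩ := hz
  have h1 := (𝒰.subset a hx).1
  rw [← hxz, coord_symm_coord _ h1]
  exact ⟨hx, mem_bdry_of_planeEmb _ h1 hxz⟩

/-- First order operators followed by restriction to the boundary are bounded on `H²`. -/
theorem exists_bdryJet_firstOrder_le (hl₁ : IsModel 𝒰 loc₁) {R : S₁ → BdrySec P → Prop}
    (h : ∀ a, ∃ (Ψ₀ : M → W₁ →L[ℝ] EndV 𝕜 n) (Ψ₁ : Fin 3 → M → W₁ →L[ℝ] EndV 𝕜 n),
      ContMDiffOn I3 𝓘(ℝ, W₁ →L[ℝ] EndV 𝕜 n) ∞ Ψ₀ (patchSet 𝒰 a) ∧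
      (∀ c, ContMDiffOn I3 𝓘(ℝ, W₁ →L[ℝ] EndV 𝕜 n) ∞ (Ψ₁ c) (patchSet 𝒰 a)) ∧
      ∀ s w, R s w → ∀ x ∈ patchSet 𝒰 a ∩ bdry M, w.1 (𝒰.triv a) x
        = Ψ₀ x ((loc₁ a s).1 x) + ∑ c, Ψ₁ c x (pd (𝒰.chart a) c (loc₁ a s).1 x))
    {m : ℕ} (hm : 2 ≤ m) :
    ∃ C : ℝ, ∀ s w, R s w → ‖bdryJet 𝒰 w‖ ≤ C * ‖modelJet 𝒰 loc₁ m s‖ := by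
  have key : ∀ a, ∃ C : NNReal, ∀ s w, R s w →
      ∫⁻ z in planeEmb ⁻¹' (coord (𝒰.chart a) '' 𝒰.C a),
        ‖bdryFun (𝒰.chart a) (w.1 (𝒰.triv a)) z‖ₑ ^ 2 ≤ C * ‖modelJet 𝒰 loc₁ m s‖ₑ ^ 2 := by
    intro a
    obtain ⟨Ψ₀, Ψ₁, h₀, h₁, hR⟩ := h a
    obtain ⟨C, hC, k⟩ := exists_jetFun_firstOrder_le (𝒰.chart a) (P.isOpen_U (𝒰.triv a))
      (isCompact_coord_patch 𝒰 a) (coord_image_subset 𝒰 a) h₀ h₁ 0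
    have ht : ∀ q : ℕ, ∃ D : NNReal, q ∈ Finset.range 2 → ∀ s,
        ∫⁻ z in planeEmb ⁻¹' (coord (𝒰.chart a) '' 𝒰.C a),
        ‖jetFun (𝒰.chart a) q (loc₁ a s).1 (planeEmb z)‖ₑ ^ 2 ≤ D * ‖modelJet 𝒰 loc₁ m s‖ₑ ^ 2 := by
      intro q
      by_cases hq : q ∈ Finset.range 2
      · have := Finset.mem_range.1 hq
        obtain ⟨D, hD⟩ := exists_trace_jet_le hl₁ a (isCompact_coord_patch 𝒰 a)
          (coord_image_subset 𝒰 a) (show q + 1 ≤ m by omega)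
        exact ⟨D, fun _ => hD⟩
      · exact ⟨0, fun h => absurd h hq⟩
    choose D hD using ht
    have hBm : MeasurableSet (planeEmb ⁻¹' (coord (𝒰.chart a) '' 𝒰.C a)) :=
      (isCompact_planeEmb_preimage (isCompact_coord_patch 𝒰 a)).measurableSet
    refine ⟨(C ^ 2 * (Finset.range 2).card).toNNReal * ∑ q ∈ Finset.range 2, D q,
      fun s w hsw => ?_⟩
    calc _ ≤ ∫⁻ z in planeEmb ⁻¹' (coord (𝒰.chart a) '' 𝒰.C a),
          ENNReal.ofReal (C ^ 2 * (Finset.range 2).card) *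
          ∑ q ∈ Finset.range 2, ‖jetFun (𝒰.chart a) q (loc₁ a s).1 (planeEmb z)‖ₑ ^ 2 := by
          refine setLIntegral_mono' hBm fun z hz => ?_
          have hx := mem_patch_of_planeEmb a hz
          have h1 := k _ (fun x => Ψ₀ x ((loc₁ a s).1 x) + ∑ c, Ψ₁ c x (pd (𝒰.chart a) c (loc₁ a s).1 x))
            (loc₁ a s).2 (fun x _ => rfl) _ hz
          rw [jetFun, norm_iteratedFDerivWithin_zero] at h1
          have h2 : ‖bdryFun (𝒰.chart a) (w.1 (𝒰.triv a)) z‖ ≤ C * ∑ q ∈ Finset.range 2,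
              ‖jetFun (𝒰.chart a) q (loc₁ a s).1 (planeEmb z)‖ := by
            rw [bdryFun, hR s w hsw _ ⟨𝒰.subset a hx.1, hx.2⟩]
            exact h1
          simpa only [ofReal_norm] using enorm_sq_le_of_norm_le_sum (fun _ _ => norm_nonneg _) h2
      _ = ENNReal.ofReal (C ^ 2 * (Finset.range 2).card) * ∑ q ∈ Finset.range 2,
          ∫⁻ z in planeEmb ⁻¹' (coord (𝒰.chart a) '' 𝒰.C a),
            ‖jetFun (𝒰.chart a) q (loc₁ a s).1 (planeEmb z)‖ₑ ^ 2 := by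
          rw [lintegral_const_mul' _ _ ENNReal.ofReal_ne_top, lintegral_finsetSum' _ fun q _ => ?_]
          obtain ⟨v', v'', hv, -⟩ := hasDerivsWithNorms_jet (loc := loc₁) a s q
          have hv1 : ContinuousOn (jetFun (𝒰.chart a) q (loc₁ a s).1) (coord (𝒰.chart a) '' 𝒰.C a) :=
            fun y hy => ((hv y (coord_image_subset 𝒰 a hy)).continuousWithinAt).mono
              (coord_image_subset 𝒰 a)
          exact (((hv1.comp continuous_planeEmb.continuousOn fun z hz => hz).enorm.aemeasurable
            hBm).pow_const 2)
      _ ≤ ENNReal.ofReal (C ^ 2 * (Finset.range 2).card) *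
          ∑ q ∈ Finset.range 2, (D q * ‖modelJet 𝒰 loc₁ m s‖ₑ ^ 2) := by
          gcongr with q hq
          exact hD q hq s
      _ = _ := by
          rw [← Finset.sum_mul, ENNReal.coe_mul, ENNReal.ofReal, ENNReal.ofNNReal_finsetSum, mul_assoc]
  choose C hC using key
  refine ⟨_, fun s w hsw => norm_le_of_enorm_sq_le (C := ∑ a, C a) ?_⟩
  refine enorm_bdryJet_sq_le fun a => (hC a s w hsw).trans ?_
  gcongr
  exact Finset.single_le_sum (f := C) (fun _ _ => zero_le) (Finset.mem_univ a)

/-- Products of boundary values are bounded on `H¹ × H²`. -/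
theorem exists_bdryJet_bilin_le (hl₁ : IsModel 𝒰 loc₁) (hl₂ : IsModel 𝒰 loc₂)
    {R : S₁ → S₂ → BdrySec P → Prop}
    (h : ∀ a, ∃ Ψ : M → W₁ →L[ℝ] W₂ →L[ℝ] EndV 𝕜 n,
      ContMDiffOn I3 𝓘(ℝ, W₁ →L[ℝ] W₂ →L[ℝ] EndV 𝕜 n) ∞ Ψ (patchSet 𝒰 a) ∧
      ∀ s t w, R s t w → ∀ x ∈ patchSet 𝒰 a ∩ bdry M, w.1 (𝒰.triv a) x
        = Ψ x ((loc₁ a s).1 x) ((loc₂ a t).1 x))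
    {m₁ m₂ : ℕ} (hm₁ : 1 ≤ m₁) (hm₂ : 2 ≤ m₂) :
    ∃ C : ℝ, ∀ s t w, R s t w →
      ‖bdryJet 𝒰 w‖ ≤ C * ‖modelJet 𝒰 loc₁ m₁ s‖ * ‖modelJet 𝒰 loc₂ m₂ t‖ := by
  have key : ∀ a, ∃ C : NNReal, ∀ s t w, R s t w →
      ∫⁻ z in planeEmb ⁻¹' (coord (𝒰.chart a) '' 𝒰.C a),
        ‖bdryFun (𝒰.chart a) (w.1 (𝒰.triv a)) z‖ₑ ^ 2
          ≤ C * (‖modelJet 𝒰 loc₁ m₁ s‖ₑ ^ 2 * ‖modelJet 𝒰 loc₂ m₂ t‖ₑ ^ 2) := by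
    intro a
    obtain ⟨Ψ, hΨ, hR⟩ := h a
    obtain ⟨C, hC, k⟩ := exists_jetFun_bilin_le (𝒰.chart a) (P.isOpen_U (𝒰.triv a))
      (isCompact_coord_patch 𝒰 a) (coord_image_subset 𝒰 a) hΨ 0
    obtain ⟨D₁, hD₁⟩ := exists_trace_jet_le hl₁ a (isCompact_coord_patch 𝒰 a)
      (coord_image_subset 𝒰 a) (show 0 + 1 ≤ m₁ by omega)
    obtain ⟨D₂, hD₂⟩ := exists_sup_jet_le hl₂ a (isCompact_coord_patch 𝒰 a)
      (coord_image_subset 𝒰 a) (show 0 + 2 ≤ m₂ by omega)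
    have hBm : MeasurableSet (planeEmb ⁻¹' (coord (𝒰.chart a) '' 𝒰.C a)) :=
      (isCompact_planeEmb_preimage (isCompact_coord_patch 𝒰 a)).measurableSet
    have hfin : ∀ t, ‖modelJet 𝒰 loc₂ m₂ t‖ₑ ^ 2 ≠ ⊤ := fun t => ENNReal.pow_ne_top enorm_ne_top
    refine ⟨(C ^ 2).toNNReal * (D₁ * D₂), fun s t w hsw => ?_⟩
    calc _ ≤ ∫⁻ z in planeEmb ⁻¹' (coord (𝒰.chart a) '' 𝒰.C a), ENNReal.ofReal (C ^ 2) *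
          (‖jetFun (𝒰.chart a) 0 (loc₁ a s).1 (planeEmb z)‖ₑ ^ 2 *
            (D₂ * ‖modelJet 𝒰 loc₂ m₂ t‖ₑ ^ 2)) := by
          refine setLIntegral_mono' hBm fun z hz => ?_
          have hx := mem_patch_of_planeEmb a hz
          have h1 := k _ _ (fun x => Ψ x ((loc₁ a s).1 x) ((loc₂ a t).1 x))
            (loc₁ a s).2 (loc₂ a t).2 (fun x _ => rfl) _ hz
          simp only [zero_add, Finset.sum_range_one] at h1
          have h2 : ‖bdryFun (𝒰.chart a) (w.1 (𝒰.triv a)) z‖ ≤ C * ∑ _q ∈ Finset.range 1,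
              (‖jetFun (𝒰.chart a) 0 (loc₁ a s).1 (planeEmb z)‖ *
                ‖jetFun (𝒰.chart a) 0 (loc₂ a t).1 (planeEmb z)‖) := by
            rw [bdryFun, hR s t w hsw _ ⟨𝒰.subset a hx.1, hx.2⟩, Finset.sum_range_one]
            rwa [jetFun, norm_iteratedFDerivWithin_zero] at h1
          have h3 := enorm_sq_le_of_norm_le_sum
            (fun _ _ => mul_nonneg (norm_nonneg _) (norm_nonneg _)) h2
          simp only [ENNReal.ofReal_mul (norm_nonneg _), ofReal_norm, Finset.card_range,
            Nat.cast_one, mul_one, Finset.sum_range_one] at h3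
          refine h3.trans ?_
          rw [mul_pow]
          gcongr
          exact hD₂ t _ hz
      _ ≤ ENNReal.ofReal (C ^ 2) * ((D₁ * ‖modelJet 𝒰 loc₁ m₁ s‖ₑ ^ 2) *
            (D₂ * ‖modelJet 𝒰 loc₂ m₂ t‖ₑ ^ 2)) := by
          rw [lintegral_const_mul' _ _ ENNReal.ofReal_ne_top,
            lintegral_mul_const' _ _ (ENNReal.mul_ne_top ENNReal.coe_ne_top (hfin t))]
          gcongr
          exact hD₁ s
      _ = _ := by
          push_cast
          rw [ENNReal.ofReal]
          ring
  choose C hC using key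
  refine ⟨_, fun s t w hsw => norm_le_of_enorm_sq_le₂ (C := ∑ a, C a) ?_⟩
  refine enorm_bdryJet_sq_le fun a => (hC a s t w hsw).trans ?_
  gcongr
  exact Finset.single_le_sum (f := C) (fun _ _ => zero_le) (Finset.mem_univ a)

end Operators

end Coulomb

namespace Coulomb

set_option linter.unusedSectionVars false

section Relations

variable {S₁ S₂ S₃ E₁ E₂ F : Type*} [AddCommGroup S₁] [Module ℝ S₁] [AddCommGroup S₂] [Module ℝ S₂]
  [AddCommGroup S₃] [Module ℝ S₃] [NormedAddCommGroup E₁] [NormedSpace ℝ E₁]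
  [NormedAddCommGroup E₂] [NormedSpace ℝ E₂] [NormedAddCommGroup F] [NormedSpace ℝ F]
  [CompleteSpace F]

/-- A bounded linear relation extends to a continuous linear map. -/
theorem exists_clm_of_rel {e₁ : S₁ →ₗ[ℝ] E₁} (he₁ : DenseRange e₁) (c : S₃ →ₗ[ℝ] F)
    {R : S₁ → S₃ → Prop} (hex : ∀ x, ∃ z, R x z)
    (hlin : ∀ (r : ℝ) x y z w, R x z → R y w → R (r • x + y) (r • z + w)) {C : ℝ}
    (hb : ∀ x z, R x z → ‖c z‖ ≤ C * ‖e₁ x‖) :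
    ∃ T : E₁ →L[ℝ] F, ∀ x z, R x z → c z = T (e₁ x) := by
  have huniq : ∀ x z z', R x z → R x z' → c z = c z' := by
    intro x z z' h h'
    have h1 := hb _ _ (hlin (-1) x x z z' h h')
    simp only [neg_smul, one_smul, neg_add_cancel, map_zero, norm_zero, mul_zero, norm_le_zero_iff,
      map_add, map_neg, neg_add_eq_zero] at h1
    exact h1
  choose Z hZ using hex
  have h0 : c (Z 0) = 0 := norm_le_zero_iff.1 ((hb _ _ (hZ 0)).trans_eq (by simp))
  have hlin' : ∀ (r : ℝ) x y, c (Z (r • x + y)) = r • c (Z x) + c (Z y) := fun r x y => by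
    rw [huniq _ _ _ (hZ _) (hlin r x y _ _ (hZ x) (hZ y)), map_add, map_smul]
  let f : S₁ →ₗ[ℝ] F :=
    { toFun := fun x => c (Z x)
      map_add' := fun x y => by simpa using hlin' 1 x y
      map_smul' := fun r x => by simpa [h0] using hlin' r x 0 }
  obtain ⟨T, hT⟩ := exists_extension he₁ f (C := C) fun x => hb x _ (hZ x)
  exact ⟨T, fun x z h => (huniq x _ _ h (hZ x)).trans (hT x).symm⟩

/-- A bounded bilinear relation extends to a continuous bilinear map. -/
theorem exists_clm_of_rel₂ {e₁ : S₁ →ₗ[ℝ] E₁} (he₁ : DenseRange e₁) {e₂ : S₂ →ₗ[ℝ] E₂}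
    (he₂ : DenseRange e₂) (c : S₃ →ₗ[ℝ] F) {R : S₁ → S₂ → S₃ → Prop} (hex : ∀ x y, ∃ z, R x y z)
    (hlin₁ : ∀ (r : ℝ) x x' y z w, R x y z → R x' y w → R (r • x + x') y (r • z + w))
    (hlin₂ : ∀ (r : ℝ) x y y' z w, R x y z → R x y' w → R x (r • y + y') (r • z + w)) {C : ℝ}
    (hb : ∀ x y z, R x y z → ‖c z‖ ≤ C * ‖e₁ x‖ * ‖e₂ y‖) :
    ∃ T : E₁ →L[ℝ] E₂ →L[ℝ] F, ∀ x y z, R x y z → c z = T (e₁ x) (e₂ y) := by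
  have huniq : ∀ x y z z', R x y z → R x y z' → c z = c z' := by
    intro x y z z' h h'
    have h1 := hb _ _ _ (hlin₁ (-1) x x y z z' h h')
    simp only [neg_smul, one_smul, neg_add_cancel, map_zero, norm_zero, mul_zero, zero_mul,
      norm_le_zero_iff, map_add, map_neg, neg_add_eq_zero] at h1
    exact h1
  choose Z hZ using hex
  have h0 : ∀ y, c (Z 0 y) = 0 := fun y =>
    norm_le_zero_iff.1 ((hb _ _ _ (hZ 0 y)).trans_eq (by simp))
  have h0' : ∀ x, c (Z x 0) = 0 := fun x =>
    norm_le_zero_iff.1 ((hb _ _ _ (hZ x 0)).trans_eq (by simp))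
  have hl₁ : ∀ (r : ℝ) x x' y, c (Z (r • x + x') y) = r • c (Z x y) + c (Z x' y) :=
    fun r x x' y => by
      rw [huniq _ _ _ _ (hZ _ _) (hlin₁ r x x' y _ _ (hZ x y) (hZ x' y)), map_add, map_smul]
  have hl₂ : ∀ (r : ℝ) x y y', c (Z x (r • y + y')) = r • c (Z x y) + c (Z x y') :=
    fun r x y y' => by
      rw [huniq _ _ _ _ (hZ _ _) (hlin₂ r x y y' _ _ (hZ x y) (hZ x y')), map_add, map_smul]
  let B : S₁ →ₗ[ℝ] S₂ →ₗ[ℝ] F := LinearMap.mk₂ ℝ (fun x y => c (Z x y))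
    (fun x x' y => by simpa using hl₁ 1 x x' y) (fun r x y => by simpa [h0] using hl₁ r x 0 y)
    (fun x y y' => by simpa using hl₂ 1 x y y') (fun r x y => by simpa [h0'] using hl₂ r x y 0)
  obtain ⟨T, hT⟩ := exists_extension₂ he₁ he₂ B (C := C) fun x y => hb x y _ (hZ x y)
  exact ⟨T, fun x y z h => (huniq x y _ _ h (hZ x y)).trans (hT x y).symm⟩

end Relations

section Operators

variable {𝕜 : Type*} [RCLike 𝕜] {n : ℕ} {K : Subgroup (unitary (EndV 𝕜 n))} {ι : Type*}
variable {M : Type*} [TopologicalSpace M] [ChartedSpace (EuclideanHalfSpace 3) M]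
variable [IsManifold I3 ∞ M] {P : PrincipalBundle M K ι} {𝒰 : PatchCover P}
variable {S₁ S₂ S₃ W₁ W₂ W₃ E₁ E₂ E₃ : Type*} [AddCommGroup S₁] [Module ℝ S₁] [AddCommGroup S₂]
  [Module ℝ S₂] [AddCommGroup S₃] [Module ℝ S₃]
  [NormedAddCommGroup W₁] [NormedSpace ℝ W₁] [NormedAddCommGroup W₂] [NormedSpace ℝ W₂]
  [NormedAddCommGroup W₃] [NormedSpace ℝ W₃] [NormedAddCommGroup E₁] [NormedSpace ℝ E₁]
  [NormedAddCommGroup E₂] [NormedSpace ℝ E₂] [NormedAddCommGroup E₃] [NormedSpace ℝ E₃]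
  [CompleteSpace E₃]
  {loc₁ : LocalReps 𝒰 S₁ W₁} {loc₂ : LocalReps 𝒰 S₂ W₂} {loc₃ : LocalReps 𝒰 S₃ W₃}

theorem firstOrder_lin (e : Chart M) {O : Set M} (hO : IsOpen O) {x : M} (hx : x ∈ e.1.source ∩ O)
    {F G : M → W₁} (hF : ContMDiffOn I3 𝓘(ℝ, W₁) ∞ F (e.1.source ∩ O))
    (hG : ContMDiffOn I3 𝓘(ℝ, W₁) ∞ G (e.1.source ∩ O)) (r : ℝ) (L₀ : W₁ →L[ℝ] W₂)
    (L₁ : Fin 3 → W₁ →L[ℝ] W₂) :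
    L₀ ((r • F + G) x) + ∑ c, L₁ c (pd e c (r • F + G) x)
      = r • (L₀ (F x) + ∑ c, L₁ c (pd e c F x)) + (L₀ (G x) + ∑ c, L₁ c (pd e c G x)) := by
  have hd := fun {F : M → W₁} (hF : ContMDiffOn I3 𝓘(ℝ, W₁) ∞ F (e.1.source ∩ O)) =>
    ContMDiffOn.mdifferentiableAt' (e.1.open_source.inter hO) hF hx
  have h1 : MDifferentiableAt I3 𝓘(ℝ, W₁) (fun y => (r • ContinuousLinearMap.id ℝ W₁) (F y)) x :=
    (r • ContinuousLinearMap.id ℝ W₁).differentiableAt.mdifferentiableAt.comp x (hd hF)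
  have h : ∀ c, pd e c (r • F + G) x = r • pd e c F x + pd e c G x := fun c => by
    have h2 := pd_clm (r • ContinuousLinearMap.id ℝ W₁) e c (hd hF)
    have h3 := pd_add e c h1 (hd hG)
    rw [h2] at h3
    exact h3
  simp only [h, Pi.add_apply, Pi.smul_apply, map_add, map_smul, smul_add, Finset.sum_add_distrib,
    Finset.smul_sum]
  abel

/-- First order operators extend to Sobolev spaces. -/
theorem exists_clm_firstOrder {loc₁ : LocalReps 𝒰 S₁ W₁} {loc₃ : LocalReps 𝒰 S₃ W₃} {r m : ℕ}
    {e₁ : S₁ →ₗ[ℝ] E₁} (he₁ : DenseRange e₁) (hn₁ : ∀ s, ‖e₁ s‖ = ‖modelJet 𝒰 loc₁ m s‖)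
    {e₃ : S₃ →ₗ[ℝ] E₃} (hn₃ : ∀ s, ‖e₃ s‖ = ‖modelJet 𝒰 loc₃ r s‖)
    {R : S₁ → S₃ → Prop} (hex : ∀ s, ∃ t, R s t)
    (h : ∀ a, ∃ (Ψ₀ : M → W₁ →L[ℝ] W₃) (Ψ₁ : Fin 3 → M → W₁ →L[ℝ] W₃),
      ContMDiffOn I3 𝓘(ℝ, W₁ →L[ℝ] W₃) ∞ Ψ₀ (patchSet 𝒰 a) ∧
      (∀ c, ContMDiffOn I3 𝓘(ℝ, W₁ →L[ℝ] W₃) ∞ (Ψ₁ c) (patchSet 𝒰 a)) ∧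
      ∀ s t, R s t → ∀ x ∈ patchSet 𝒰 a, (loc₃ a t).1 x
        = Ψ₀ x ((loc₁ a s).1 x) + ∑ c, Ψ₁ c x (pd (𝒰.chart a) c (loc₁ a s).1 x))
    (hr : r + 1 ≤ m) :
    ∃ T : E₁ →L[ℝ] E₃, ∀ s t, R s t → e₃ t = T (e₁ s) := by
  choose Ψ₀ Ψ₁ h₀ h₁ hR using h
  let R' : S₁ → S₃ → Prop := fun s t => ∀ a, ∀ x ∈ patchSet 𝒰 a, (loc₃ a t).1 x
    = Ψ₀ a x ((loc₁ a s).1 x) + ∑ c, Ψ₁ a c x (pd (𝒰.chart a) c (loc₁ a s).1 x)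
  obtain ⟨C, hC⟩ := exists_modelJet_firstOrder_le loc₁ loc₃ (R := R')
    (fun a => ⟨Ψ₀ a, Ψ₁ a, h₀ a, h₁ a, fun s t h => h a⟩) hr
  obtain ⟨T, hT⟩ := exists_clm_of_rel he₁ e₃ (R := R')
    (fun s => (hex s).imp fun t ht a => hR a s t ht) (fun r s s' t t' h h' a x hx => by
      rw [map_add, map_smul, map_add, map_smul]
      change r • (loc₃ a t).1 x + (loc₃ a t').1 x = _
      rw [h a x hx, h' a x hx]
      exact (firstOrder_lin _ (P.isOpen_U _) hx (loc₁ a s).2 (loc₁ a s').2 r _ _).symm)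
    (C := C) fun s t h => by rw [hn₁, hn₃]; exact hC s t h
  exact ⟨T, fun s t h => hT s t fun a => hR a s t h⟩

variable [T2Space M] [CompleteSpace W₁] [CompleteSpace W₂]

/-- Bilinear operators of order zero extend to Sobolev spaces. -/
theorem exists_clm_bilin (hl₁ : IsModel 𝒰 loc₁) (hl₂ : IsModel 𝒰 loc₂)
    {loc₃ : LocalReps 𝒰 S₃ W₃} {r m₁ m₂ : ℕ}
    {e₁ : S₁ →ₗ[ℝ] E₁} (he₁ : DenseRange e₁) (hn₁ : ∀ s, ‖e₁ s‖ = ‖modelJet 𝒰 loc₁ m₁ s‖)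
    {e₂ : S₂ →ₗ[ℝ] E₂} (he₂ : DenseRange e₂) (hn₂ : ∀ s, ‖e₂ s‖ = ‖modelJet 𝒰 loc₂ m₂ s‖)
    {e₃ : S₃ →ₗ[ℝ] E₃} (hn₃ : ∀ s, ‖e₃ s‖ = ‖modelJet 𝒰 loc₃ r s‖)
    {R : S₁ → S₂ → S₃ → Prop} (hex : ∀ s t, ∃ z, R s t z)
    (h : ∀ a, ∃ Ψ : M → W₁ →L[ℝ] W₂ →L[ℝ] W₃,
      ContMDiffOn I3 𝓘(ℝ, W₁ →L[ℝ] W₂ →L[ℝ] W₃) ∞ Ψ (patchSet 𝒰 a) ∧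
      ∀ s t z, R s t z → ∀ x ∈ patchSet 𝒰 a, (loc₃ a z).1 x
        = Ψ x ((loc₁ a s).1 x) ((loc₂ a t).1 x))
    (hr : ∀ p q, p + q ≤ r → ProductOrders m₁ m₂ p q) :
    ∃ T : E₁ →L[ℝ] E₂ →L[ℝ] E₃, ∀ s t z, R s t z → e₃ z = T (e₁ s) (e₂ t) := by
  choose Ψ h₀ hR using h
  let R' : S₁ → S₂ → S₃ → Prop := fun s t z => ∀ a, ∀ x ∈ patchSet 𝒰 a, (loc₃ a z).1 x
    = Ψ a x ((loc₁ a s).1 x) ((loc₂ a t).1 x)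
  obtain ⟨C, hC⟩ := exists_modelJet_bilin_le hl₁ hl₂ loc₃ (R := R')
    (fun a => ⟨Ψ a, h₀ a, fun s t z h => h a⟩) hr
  obtain ⟨T, hT⟩ := exists_clm_of_rel₂ he₁ he₂ e₃ (R := R')
    (fun s t => (hex s t).imp fun z hz a => hR a s t z hz)
    (fun r s s' t z z' h h' a x hx => by
      rw [map_add, map_smul, map_add, map_smul]
      change r • (loc₃ a z).1 x + (loc₃ a z').1 x
        = Ψ a x (r • (loc₁ a s).1 x + (loc₁ a s').1 x) _
      rw [h a x hx, h' a x hx, map_add, map_smul]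
      rfl)
    (fun r s t t' z z' h h' a x hx => by
      rw [map_add, map_smul, map_add, map_smul]
      change r • (loc₃ a z).1 x + (loc₃ a z').1 x
        = Ψ a x _ (r • (loc₂ a t).1 x + (loc₂ a t').1 x)
      rw [h a x hx, h' a x hx, map_add, map_smul])
    (C := C) fun s t z h => by rw [hn₁, hn₂, hn₃]; exact hC s t z h
  exact ⟨T, fun s t z h => hT s t z fun a => hR a s t z h⟩

/-- First order operators to the boundary extend to Sobolev spaces. -/
theorem exists_clm_bdry_firstOrder (hl₁ : IsModel 𝒰 loc₁) {m : ℕ}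
    {e₁ : S₁ →ₗ[ℝ] E₁} (he₁ : DenseRange e₁) (hn₁ : ∀ s, ‖e₁ s‖ = ‖modelJet 𝒰 loc₁ m s‖)
    {e₃ : BdrySec P →ₗ[ℝ] E₃} (hn₃ : ∀ s, ‖e₃ s‖ = ‖bdryJet 𝒰 s‖)
    {R : S₁ → BdrySec P → Prop} (hex : ∀ s, ∃ t, R s t)
    (h : ∀ a, ∃ (Ψ₀ : M → W₁ →L[ℝ] EndV 𝕜 n) (Ψ₁ : Fin 3 → M → W₁ →L[ℝ] EndV 𝕜 n),
      ContMDiffOn I3 𝓘(ℝ, W₁ →L[ℝ] EndV 𝕜 n) ∞ Ψ₀ (patchSet 𝒰 a) ∧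
      (∀ c, ContMDiffOn I3 𝓘(ℝ, W₁ →L[ℝ] EndV 𝕜 n) ∞ (Ψ₁ c) (patchSet 𝒰 a)) ∧
      ∀ s w, R s w → ∀ x ∈ patchSet 𝒰 a ∩ bdry M, w.1 (𝒰.triv a) x
        = Ψ₀ x ((loc₁ a s).1 x) + ∑ c, Ψ₁ c x (pd (𝒰.chart a) c (loc₁ a s).1 x))
    (hm : 2 ≤ m) :
    ∃ T : E₁ →L[ℝ] E₃, ∀ s t, R s t → e₃ t = T (e₁ s) := by
  choose Ψ₀ Ψ₁ h₀ h₁ hR using h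
  let R' : S₁ → BdrySec P → Prop := fun s w => ∀ a, ∀ x ∈ patchSet 𝒰 a ∩ bdry M,
    w.1 (𝒰.triv a) x
      = Ψ₀ a x ((loc₁ a s).1 x) + ∑ c, Ψ₁ a c x (pd (𝒰.chart a) c (loc₁ a s).1 x)
  obtain ⟨C, hC⟩ := exists_bdryJet_firstOrder_le hl₁ (R := R')
    (fun a => ⟨Ψ₀ a, Ψ₁ a, h₀ a, h₁ a, fun s t h => h a⟩) hm
  obtain ⟨T, hT⟩ := exists_clm_of_rel he₁ e₃ (R := R')
    (fun s => (hex s).imp fun t ht a => hR a s t ht) (fun r s s' t t' h h' a x hx => by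
      rw [map_add, map_smul]
      change r • t.1 (𝒰.triv a) x + t'.1 (𝒰.triv a) x = _
      rw [h a x hx, h' a x hx]
      exact (firstOrder_lin _ (P.isOpen_U _) hx.1 (loc₁ a s).2 (loc₁ a s').2 r _ _).symm)
    (C := C) fun s t h => by rw [hn₁, hn₃]; exact hC s t h
  exact ⟨T, fun s t h => hT s t fun a => hR a s t h⟩

/-- Bilinear operators to the boundary extend to Sobolev spaces. -/
theorem exists_clm_bdry_bilin (hl₁ : IsModel 𝒰 loc₁) (hl₂ : IsModel 𝒰 loc₂) {m₁ m₂ : ℕ}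
    {e₁ : S₁ →ₗ[ℝ] E₁} (he₁ : DenseRange e₁) (hn₁ : ∀ s, ‖e₁ s‖ = ‖modelJet 𝒰 loc₁ m₁ s‖)
    {e₂ : S₂ →ₗ[ℝ] E₂} (he₂ : DenseRange e₂) (hn₂ : ∀ s, ‖e₂ s‖ = ‖modelJet 𝒰 loc₂ m₂ s‖)
    {e₃ : BdrySec P →ₗ[ℝ] E₃} (hn₃ : ∀ s, ‖e₃ s‖ = ‖bdryJet 𝒰 s‖)
    {R : S₁ → S₂ → BdrySec P → Prop} (hex : ∀ s t, ∃ z, R s t z)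
    (h : ∀ a, ∃ Ψ : M → W₁ →L[ℝ] W₂ →L[ℝ] EndV 𝕜 n,
      ContMDiffOn I3 𝓘(ℝ, W₁ →L[ℝ] W₂ →L[ℝ] EndV 𝕜 n) ∞ Ψ (patchSet 𝒰 a) ∧
      ∀ s t w, R s t w → ∀ x ∈ patchSet 𝒰 a ∩ bdry M, w.1 (𝒰.triv a) x
        = Ψ x ((loc₁ a s).1 x) ((loc₂ a t).1 x))
    (hm₁ : 1 ≤ m₁) (hm₂ : 2 ≤ m₂) :
    ∃ T : E₁ →L[ℝ] E₂ →L[ℝ] E₃, ∀ s t z, R s t z → e₃ z = T (e₁ s) (e₂ t) := by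
  choose Ψ h₀ hR using h
  let R' : S₁ → S₂ → BdrySec P → Prop := fun s t w => ∀ a, ∀ x ∈ patchSet 𝒰 a ∩ bdry M,
    w.1 (𝒰.triv a) x = Ψ a x ((loc₁ a s).1 x) ((loc₂ a t).1 x)
  obtain ⟨C, hC⟩ := exists_bdryJet_bilin_le hl₁ hl₂ (R := R')
    (fun a => ⟨Ψ a, h₀ a, fun s t z h => h a⟩) hm₁ hm₂
  obtain ⟨T, hT⟩ := exists_clm_of_rel₂ he₁ he₂ e₃ (R := R')
    (fun s t => (hex s t).imp fun z hz a => hR a s t z hz)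
    (fun r s s' t z z' h h' a x hx => by
      rw [map_add, map_smul]
      change r • z.1 (𝒰.triv a) x + z'.1 (𝒰.triv a) x
        = Ψ a x (r • (loc₁ a s).1 x + (loc₁ a s').1 x) _
      rw [h a x hx, h' a x hx, map_add, map_smul]
      rfl)
    (fun r s t t' z z' h h' a x hx => by
      rw [map_add, map_smul]
      change r • z.1 (𝒰.triv a) x + z'.1 (𝒰.triv a) x
        = Ψ a x _ (r • (loc₂ a t).1 x + (loc₂ a t').1 x)
      rw [h a x hx, h' a x hx, map_add, map_smul])
    (C := C) fun s t z h => by rw [hn₁, hn₂, hn₃]; exact hC s t z h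
  exact ⟨T, fun s t z h => hT s t z fun a => hR a s t z h⟩

end Operators

end Coulomb

namespace Coulomb

set_option linter.unusedSectionVars false

section Sobolev

variable {𝕜 : Type*} [RCLike 𝕜] {n : ℕ} {K : Subgroup (unitary (EndV 𝕜 n))} {ι : Type*}
variable {M : Type*} [TopologicalSpace M] [ChartedSpace (EuclideanHalfSpace 3) M]
variable [IsManifold I3 ∞ M] {P : PrincipalBundle M K ι} (𝒰 : PatchCover P)

set_option synthInstance.maxHeartbeats 400000 in
scoped instance : AddCommGroup (SmoothForm P) := Submodule.addCommGroup _

set_option synthInstance.maxHeartbeats 400000 in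
scoped instance : Module ℝ (SmoothForm P) := Submodule.module _

scoped instance : AddCommGroup (SmoothSec P) := Submodule.addCommGroup _

scoped instance : Module ℝ (SmoothSec P) := Submodule.module _

scoped instance : AddCommGroup (BdrySec P) := Submodule.addCommGroup _

scoped instance : Module ℝ (BdrySec P) := Submodule.module _

/-- The local representatives of sections. -/
def secReps : LocalReps 𝒰 (SmoothSec P) (EndV 𝕜 n) := fun a => secLoc (𝒰.triv a) (𝒰.chart a)

/-- The local representatives of forms. -/
def formReps : LocalReps 𝒰 (SmoothForm P) (Fin 3 → EndV 𝕜 n) := fun a =>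
  formLoc (𝒰.triv a) (𝒰.chart a)

theorem isModel_secReps : IsModel 𝒰 (secReps 𝒰) := fun a b =>
  ⟨fun x => conjB (P.g (𝒰.triv a) (𝒰.triv b) x),
    (contDiff_conjB.contMDiff.comp_contMDiffOn (P.g_smooth (𝒰.triv a) (𝒰.triv b))).mono
      fun _ hx => hx.2.2, fun s _ hx => SmoothSec.gauge s hx.2.2⟩

theorem smul_add_add_rotate {W : Type*} [AddCommGroup W] [Module ℝ W] (r : ℝ) (p q s : W) :
    r • (p + q) + s = r • q + s + r • p := by module

/-- The coordinate projections of `EndV³`. -/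
abbrev projV (𝕜 : Type*) [RCLike 𝕜] (n : ℕ) (c : Fin 3) : (Fin 3 → EndV 𝕜 n) →L[ℝ] EndV 𝕜 n :=
  ContinuousLinearMap.proj c

/-- The coordinate inclusions of `EndV³`. -/
abbrev inclV (𝕜 : Type*) [RCLike 𝕜] (n : ℕ) (c : Fin 3) : EndV 𝕜 n →L[ℝ] (Fin 3 → EndV 𝕜 n) :=
  ContinuousLinearMap.single ℝ (fun _ : Fin 3 => EndV 𝕜 n) c

theorem sum_inclV_apply (w : Fin 3 → EndV 𝕜 n) (c : Fin 3) :
    (∑ d, inclV 𝕜 n d (w d)) c = w c := by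
  rw [Finset.sum_apply, Finset.sum_eq_single c (fun d _ hd => ?_) (by simp)]
  · simp
  · simp [hd.symm]

theorem contMDiffOn_clm {W₁ W₂ : Type*} [NormedAddCommGroup W₁] [NormedSpace ℝ W₁]
    [NormedAddCommGroup W₂] [NormedSpace ℝ W₂] (L : W₁ →L[ℝ] W₂) {O : Set M} {F : M → W₁}
    (hF : ContMDiffOn I3 𝓘(ℝ, W₁) ∞ F O) : ContMDiffOn I3 𝓘(ℝ, W₂) ∞ (fun x => L (F x)) O :=
  L.contDiff.contMDiff.comp_contMDiffOn hF

theorem contMDiffOn_smul_const {W : Type*} [NormedAddCommGroup W] [NormedSpace ℝ W] {O : Set M}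
    {f : M → ℝ} (hf : ContMDiffOn I3 𝓘(ℝ, ℝ) ∞ f O) (w : W) :
    ContMDiffOn I3 𝓘(ℝ, W) ∞ (fun x => f x • w) O := hf.smul contMDiffOn_const

theorem isModel_formReps : IsModel 𝒰 (formReps 𝒰) := fun a b => by
  set e := 𝒰.chart a
  set e' := 𝒰.chart b
  refine ⟨fun x => ∑ c, ∑ d, jac e e' x d c •
    (ContinuousLinearMap.compL ℝ _ _ _ (inclV 𝕜 n c) ((ContinuousLinearMap.compL ℝ _ _ _).flip
      (projV 𝕜 n d) (conjB (P.g (𝒰.triv a) (𝒰.triv b) x)))), ?_, fun s x hx => ?_⟩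
  · refine contMDiffOn_finset_sum fun c _ => contMDiffOn_finset_sum fun d _ => ?_
    refine ((contMDiffOn_jac e e' d c).mono fun x hx => ⟨hx.1, hx.2.1⟩).smul ?_
    refine contMDiffOn_clm _ (contMDiffOn_clm _ ?_)
    exact (contDiff_conjB.contMDiff.comp_contMDiffOn (P.g_smooth (𝒰.triv a) (𝒰.triv b))).mono
      fun _ hx => hx.2.2
  · have h1 : ∀ c, comp (s.1 (𝒰.triv a)) e c x = ∑ d, jac e e' x d c •
        conjB (P.g (𝒰.triv a) (𝒰.triv b) x) (comp (s.1 (𝒰.triv b)) e' d x) := fun c => by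
      rw [comp_eq _ e e' ⟨hx.1, hx.2.1⟩ c]
      simp only [fun d => SmoothForm.comp_gauge s e' d hx.2.2]
    funext c
    change comp (s.1 (𝒰.triv a)) e c x = _
    rw [h1, ← sum_inclV_apply (fun c => ∑ d, jac e e' x d c •
        conjB (P.g (𝒰.triv a) (𝒰.triv b) x) (comp (s.1 (𝒰.triv b)) e' d x)) c]
    refine congrFun ?_ c
    simp only [sum_apply, smul_apply, map_sum, map_smul]
    rfl

variable {𝒰}

theorem norm_toHSec (m : ℕ) (s : SmoothSec P) :
    ‖toHSec 𝒰 m s‖ = ‖modelJet 𝒰 (secReps 𝒰) m s‖ := rfl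

theorem norm_toHForm (m : ℕ) (s : SmoothForm P) :
    ‖toHForm 𝒰 m s‖ = ‖modelJet 𝒰 (formReps 𝒰) m s‖ := rfl

theorem norm_toL2Bdry (s : BdrySec P) : ‖toL2Bdry 𝒰 s‖ = ‖bdryJet 𝒰 s‖ := rfl

theorem denseRange_codRestrict_closure {S E : Type*} [AddCommGroup S] [Module ℝ S]
    [NormedAddCommGroup E] [NormedSpace ℝ E] (f : S →ₗ[ℝ] E)
    (h : ∀ x, f x ∈ (LinearMap.range f).topologicalClosure) :
    DenseRange (f.codRestrict (LinearMap.range f).topologicalClosure h) := by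
  intro p
  rw [Topology.IsInducing.subtypeVal.closure_eq_preimage_closure_image]
  have h1 := p.2
  rw [← SetLike.mem_coe, Submodule.topologicalClosure_coe] at h1
  refine closure_mono ?_ h1
  rintro _ ⟨x, rfl⟩
  exact ⟨_, ⟨x, rfl⟩, rfl⟩

variable (𝒰) in
theorem denseRange_toHSec (m : ℕ) : DenseRange (toHSec 𝒰 m) :=
  denseRange_codRestrict_closure (secJet 𝒰 m) _

variable (𝒰) in
theorem denseRange_toHForm (m : ℕ) : DenseRange (toHForm 𝒰 m) :=
  denseRange_codRestrict_closure (formJet 𝒰 m) _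

scoped instance (W : Type*) [NormedAddCommGroup W] [NormedSpace ℝ W] [CompleteSpace W] (e : Chart M)
    (C : Set M) (j : ℕ) : CompleteSpace (JetL2 W e C j) :=
  inferInstanceAs (CompleteSpace ↥(Lp (E3 [×j]→L[ℝ] W) 2 (chartMeasure e C)))

scoped instance (W : Type*) [NormedAddCommGroup W] [NormedSpace ℝ W] [CompleteSpace W] (e : Chart M)
    (C : Set M) : CompleteSpace (BdryL2 W e C) :=
  inferInstanceAs (CompleteSpace ↥(Lp W 2 (bdryMeasure e C)))

scoped instance : CompleteSpace (EndV 𝕜 n) := FiniteDimensional.complete ℝ _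

scoped instance (m : ℕ) : CompleteSpace (HSec 𝒰 m) :=
  (Submodule.isClosed_topologicalClosure _).completeSpace_coe

scoped instance (m : ℕ) : CompleteSpace (HForm 𝒰 m) :=
  (Submodule.isClosed_topologicalClosure _).completeSpace_coe

scoped instance : CompleteSpace (L2Bdry 𝒰) :=
  (Submodule.isClosed_topologicalClosure _).completeSpace_coe

variable (𝒰) (g : Metric M)

theorem exists_covDeriv_clm (A₀ : SmoothConn P) {r m : ℕ} (hr : r + 1 ≤ m) :
    ∃ T : HSec 𝒰 m →L[ℝ] HForm 𝒰 r, ∀ f η, IsCovDeriv P A₀.form f η →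
      toHForm 𝒰 r η = T (toHSec 𝒰 m f) := by
  refine exists_clm_firstOrder (loc₁ := secReps 𝒰) (loc₃ := formReps 𝒰) (e₁ := toHSec 𝒰 m)
    (e₃ := toHForm 𝒰 r) (denseRange_toHSec 𝒰 m) (norm_toHSec m) (norm_toHForm r)
    (exists_isCovDeriv A₀) (fun a => ?_) hr
  set e := 𝒰.chart a
  refine ⟨fun x => ∑ c, ContinuousLinearMap.compL ℝ _ _ _ (inclV 𝕜 n c)
      (lieB 𝕜 n (comp (A₀.form (𝒰.triv a)) e c x)), fun c _ => inclV 𝕜 n c,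
    contMDiffOn_finset_sum fun c _ => contMDiffOn_clm _ (contMDiffOn_clm _ (A₀.smooth _ e c)),
    fun c => contMDiffOn_const, fun f η h x hx => ?_⟩
  rw [isCovDeriv_iff] at h
  funext c
  rw [← sum_inclV_apply ((formReps 𝒰 a η).1 x) c]
  refine congrFun ?_ c
  rw [sum_apply, ← Finset.sum_add_distrib]
  refine Finset.sum_congr rfl fun d _ => ?_
  change inclV 𝕜 n d (comp (η.1 (𝒰.triv a)) e d x) = _
  rw [h _ e x hx d, cpd, add_comm, map_add]
  rfl

theorem exists_formBracket_clm [T2Space M] (A₀ : SmoothConn P) {r m₁ m₂ : ℕ}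
    (hr : ∀ p q, p + q ≤ r → ProductOrders m₁ m₂ p q) :
    ∃ T : HForm 𝒰 m₁ →L[ℝ] HSec 𝒰 m₂ →L[ℝ] HForm 𝒰 r, ∀ (h : SmoothForm P) f η,
      IsFormBracket h f η → toHForm 𝒰 r η = T (toHForm 𝒰 m₁ h) (toHSec 𝒰 m₂ f) := by
  refine exists_clm_bilin (loc₃ := formReps 𝒰) (e₁ := toHForm 𝒰 m₁) (e₂ := toHSec 𝒰 m₂)
    (e₃ := toHForm 𝒰 r) (isModel_formReps 𝒰) (isModel_secReps 𝒰) (denseRange_toHForm 𝒰 m₁)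
    (norm_toHForm m₁) (denseRange_toHSec 𝒰 m₂) (norm_toHSec m₂) (norm_toHForm r)
    (fun h f => ?_) (fun a => ?_) hr
  · obtain ⟨η₀, h₀⟩ := exists_isCovDeriv A₀ f
    obtain ⟨η, h₁⟩ := exists_isCovDeriv (A₀.addForm h) f
    exact ⟨_, isCovDeriv_add h₀ h₁⟩
  set e := 𝒰.chart a
  refine ⟨fun _ => ∑ c, (ContinuousLinearMap.compL ℝ _ _ _ (inclV 𝕜 n c)).comp
      ((lieB 𝕜 n).comp (projV 𝕜 n c)), contMDiffOn_const, fun h f η hη x hx => ?_⟩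
  funext c
  rw [← sum_inclV_apply ((formReps 𝒰 a η).1 x) c]
  refine congrFun ?_ c
  rw [sum_apply, sum_apply]
  refine Finset.sum_congr rfl fun d _ => ?_
  change inclV 𝕜 n d (comp (η.1 (𝒰.triv a)) e d x) = _
  rw [hη _ e x hx d]
  rfl

theorem exists_bracket_clm [T2Space M] {r m₁ m₂ : ℕ}
    (hr : ∀ p q, p + q ≤ r → ProductOrders m₁ m₂ p q) :
    ∃ T : HForm 𝒰 m₁ →L[ℝ] HForm 𝒰 m₂ →L[ℝ] HSec 𝒰 r, ∀ (α β : SmoothForm P) u,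
      IsBracket P g α β u → toHSec 𝒰 r u = T (toHForm 𝒰 m₁ α) (toHForm 𝒰 m₂ β) := by
  refine exists_clm_bilin (loc₃ := secReps 𝒰) (e₁ := toHForm 𝒰 m₁) (e₂ := toHForm 𝒰 m₂)
    (e₃ := toHSec 𝒰 r) (isModel_formReps 𝒰) (isModel_formReps 𝒰) (denseRange_toHForm 𝒰 m₁)
    (norm_toHForm m₁) (denseRange_toHForm 𝒰 m₂) (norm_toHForm m₂) (norm_toHSec r)
    (exists_isBracket g) (fun a => ?_) hr
  set e := 𝒰.chart a
  refine ⟨fun x => ∑ b, ∑ c, gramInv g e x b c •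
      (lieB 𝕜 n).bilinearComp (projV 𝕜 n b) (projV 𝕜 n c), contMDiffOn_finset_sum fun b _ =>
      contMDiffOn_finset_sum fun c _ => contMDiffOn_smul_const
        ((contMDiffOn_gramInv g e b c).mono inter_subset_left) _, fun α β u hu x hx => ?_⟩
  rw [isBracket_iff] at hu
  refine (hu _ e x hx).trans ?_
  simp only [contr, sum_apply, smul_apply]
  rfl

set_option maxHeartbeats 1000000 in
theorem exists_codiff_clm (A₀ : SmoothConn P) {r m : ℕ} (hr : r + 1 ≤ m) :
    ∃ T : HForm 𝒰 m →L[ℝ] HSec 𝒰 r, ∀ η u, IsCodiff P g A₀.form η u →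
      toHSec 𝒰 r u = T (toHForm 𝒰 m η) := by
  refine exists_clm_firstOrder (loc₁ := formReps 𝒰) (loc₃ := secReps 𝒰) (e₁ := toHForm 𝒰 m)
    (e₃ := toHSec 𝒰 r) (denseRange_toHForm 𝒰 m) (norm_toHForm m) (norm_toHSec r)
    (exists_isCodiff g A₀) (fun a => ?_) hr
  set e := 𝒰.chart a
  have hU := P.isOpen_U (𝒰.triv a)
  have hg := fun b c => (contMDiffOn_gramInv g e b c).mono
    (inter_subset_left (t := P.U (𝒰.triv a)))
  refine ⟨fun x => -∑ b, ∑ c, (gramInv g e x b c • (ContinuousLinearMap.compL ℝ _ _ _).flip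
      (projV 𝕜 n c) (lieB 𝕜 n (comp (A₀.form (𝒰.triv a)) e b x))
      + (pd e b (fun y => gramInv g e y b c) x + logDens g e b x * gramInv g e x b c) •
        projV 𝕜 n c),
    fun b x => -∑ c, gramInv g e x b c • projV 𝕜 n c, ?_, ?_, fun η u h x hx => ?_⟩
  · refine (contMDiffOn_finset_sum fun b _ => contMDiffOn_finset_sum fun c _ => ?_).neg
    refine ContMDiffOn.add ((hg b c).smul (contMDiffOn_clm _ (contMDiffOn_clm _
      (A₀.smooth _ e b)))) (contMDiffOn_smul_const ?_ _)
    exact (contMDiffOn_pd e b hU (hg b c)).add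
      (((contMDiffOn_logDens g e b).mono inter_subset_left).mul (hg b c))
  · exact fun b => (contMDiffOn_finset_sum fun c _ => contMDiffOn_smul_const (hg b c) _).neg
  · rw [isCodiff_iff] at h
    refine (h _ e x hx).trans ?_
    have hd : MDifferentiableAt I3 𝓘(ℝ, Fin 3 → EndV 𝕜 n) (formReps 𝒰 a η).1 x :=
      ContMDiffOn.mdifferentiableAt' (e.1.open_source.inter hU) (formReps 𝒰 a η).2 hx
    have h1 : ∀ b c, pd e b (comp (η.1 (𝒰.triv a)) e c) x
        = projV 𝕜 n c (pd e b (formReps 𝒰 a η).1 x) := fun b c => pd_clm (projV 𝕜 n c) e b hd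
    simp only [codiffLoc, codiffAlg, cpd, h1, neg_apply, sum_apply, smul_apply, add_apply]
    rw [Finset.sum_neg_distrib, ← neg_add, ← Finset.sum_add_distrib]
    refine congrArg _ (Finset.sum_congr rfl fun b _ => ?_)
    rw [← Finset.sum_add_distrib]
    refine Finset.sum_congr rfl fun c _ => ?_
    exact smul_add_add_rotate _ _ _ _

theorem exists_normalDeriv_clm [T2Space M] (A₀ : SmoothConn P) {m : ℕ} (hm : 2 ≤ m) :
    ∃ T : HSec 𝒰 m →L[ℝ] L2Bdry 𝒰, ∀ u w, IsNormalDeriv P g A₀.form u w →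
      toL2Bdry 𝒰 w = T (toHSec 𝒰 m u) := by
  refine exists_clm_bdry_firstOrder (isModel_secReps 𝒰) (denseRange_toHSec 𝒰 m) (norm_toHSec m)
    norm_toL2Bdry (exists_isNormalDeriv g A₀) (fun a => ?_) hm
  set e := 𝒰.chart a
  have hc := fun d => ((contMDiffOn_inv_sqrt g e).mul (contMDiffOn_gramInv g e 0 d)).mono
    (inter_subset_left (t := P.U (𝒰.triv a)))
  refine ⟨fun x => ∑ d, ((√(gramInv g e x 0 0))⁻¹ * gramInv g e x 0 d) •
      lieB 𝕜 n (comp (A₀.form (𝒰.triv a)) e d x),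
    fun d x => ((√(gramInv g e x 0 0))⁻¹ * gramInv g e x 0 d) • ContinuousLinearMap.id ℝ _,
    contMDiffOn_finset_sum fun d _ => (hc d).smul (contMDiffOn_clm _ (A₀.smooth _ e d)),
    fun d => contMDiffOn_smul_const (hc d) _, fun u w h x hx => ?_⟩
  rw [isNormalDeriv_iff] at h
  refine (h _ e x hx.1 hx.2).trans ?_
  simp only [normalLoc, cpd, sum_apply, smul_apply, smul_add, Finset.smul_sum, smul_smul,
    Finset.sum_add_distrib]
  exact add_comm _ _

theorem exists_normalBracket_clm [T2Space M] (A₀ : SmoothConn P) {m₁ m₂ : ℕ} (hm₁ : 1 ≤ m₁) (hm₂ : 2 ≤ m₂) :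
    ∃ T : HForm 𝒰 m₁ →L[ℝ] HSec 𝒰 m₂ →L[ℝ] L2Bdry 𝒰, ∀ (h : SmoothForm P) u w,
      IsNormalBracket g h u w → toL2Bdry 𝒰 w = T (toHForm 𝒰 m₁ h) (toHSec 𝒰 m₂ u) := by
  refine exists_clm_bdry_bilin (isModel_formReps 𝒰) (isModel_secReps 𝒰) (denseRange_toHForm 𝒰 m₁)
    (norm_toHForm m₁) (denseRange_toHSec 𝒰 m₂) (norm_toHSec m₂) norm_toL2Bdry
    (fun h u => ?_) (fun a => ?_) hm₁ hm₂
  · obtain ⟨w₀, h₀⟩ := exists_isNormalDeriv g A₀ u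
    obtain ⟨w, h₁⟩ := exists_isNormalDeriv g (A₀.addForm h) u
    exact ⟨_, isNormalDeriv_add g h₀ h₁⟩
  set e := 𝒰.chart a
  have hc := fun d => ((contMDiffOn_inv_sqrt g e).mul (contMDiffOn_gramInv g e 0 d)).mono
    (inter_subset_left (t := P.U (𝒰.triv a)))
  refine ⟨fun x => ∑ d, ((√(gramInv g e x 0 0))⁻¹ * gramInv g e x 0 d) •
      (lieB 𝕜 n).comp (projV 𝕜 n d),
    contMDiffOn_finset_sum fun d _ => contMDiffOn_smul_const (hc d) _, fun h u w hw x hx => ?_⟩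
  refine (hw _ e x hx.1 hx.2).trans ?_
  simp only [sum_apply, smul_apply, Finset.smul_sum, smul_smul]
  rfl

theorem exists_tauMul_clm [T2Space M] {m : ℕ} (hm : 2 ≤ m) :
    ∃ T : HSec 𝒰 m →L[ℝ] L2Bdry 𝒰, ∀ u w, IsTauMul P g u w →
      toL2Bdry 𝒰 w = T (toHSec 𝒰 m u) := by
  refine exists_clm_bdry_firstOrder (isModel_secReps 𝒰) (denseRange_toHSec 𝒰 m) (norm_toHSec m)
    norm_toL2Bdry (exists_isTauMul g) (fun a => ?_) hm
  refine ⟨fun x => chartTau g (𝒰.chart a) x • ContinuousLinearMap.id ℝ _, fun _ _ => 0,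
    contMDiffOn_smul_const ((contMDiffOn_chartTau g _).mono inter_subset_left) _,
    fun _ => contMDiffOn_const, fun u w h x hx => ?_⟩
  rw [isTauMul_iff] at h
  refine (h _ _ x hx.1 hx.2).trans ?_
  simp only [smul_apply, zero_apply, Finset.sum_const_zero, add_zero]
  rfl

end Sobolev

end Coulomb

namespace Coulomb

set_option linter.unusedSectionVars false

/-- The closure of the graph of an operator that is the sum of a linear and a bilinear one. -/
theorem mem_closure_graph_add {S₁ S₂ S₃ E₁ E₂ F : Type*} [AddCommGroup S₁] [Module ℝ S₁]
    [AddCommGroup S₂] [Module ℝ S₂] [AddCommGroup S₃] [Module ℝ S₃] [NormedAddCommGroup E₁]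
    [NormedSpace ℝ E₁] [NormedAddCommGroup E₂] [NormedSpace ℝ E₂] [NormedAddCommGroup F]
    [NormedSpace ℝ F] {e₁ : S₁ →ₗ[ℝ] E₁} (he₁ : DenseRange e₁) {e₂ : S₂ →ₗ[ℝ] E₂}
    (he₂ : DenseRange e₂) {c : S₃ →ₗ[ℝ] F} {R R₁ : S₁ → S₂ → S₃ → Prop} {R₀ : S₂ → S₃ → Prop}
    {T : E₂ →L[ℝ] F} {B : E₁ →L[ℝ] E₂ →L[ℝ] F} (hT : ∀ y z, R₀ y z → c z = T (e₂ y))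
    (hB : ∀ x y z, R₁ x y z → c z = B (e₁ x) (e₂ y)) (hex₀ : ∀ y, ∃ z, R₀ y z)
    (hex : ∀ x y, ∃ z, R x y z) (hadd : ∀ x y z₀ z, R₀ y z₀ → R x y z → R₁ x y (z - z₀))
    (p : E₁) (q : E₂) (r : F) :
    (p, q, r) ∈ closure {s : E₁ × E₂ × F | ∃ x y z, R x y z ∧ s = (e₁ x, e₂ y, c z)} ↔
      r = T q + B p q := by
  refine mem_closure_graph₂ he₁ he₂ (c := c) (R := R) (F := fun q => T q.2 + B q.1 q.2)
    (by fun_prop) hex (fun x y z h => ?_) p q r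
  obtain ⟨z₀, h₀⟩ := hex₀ y
  have h1 := hB x y _ (hadd x y z₀ z h₀ h)
  rw [map_sub, hT y z₀ h₀] at h1
  exact (add_eq_of_eq_sub' h1.symm).symm

theorem exists_neg_clm {S₁ S₂ S₃ E₁ E₂ F : Type*} [AddCommGroup S₃] [Module ℝ S₃]
    [NormedAddCommGroup E₁] [NormedSpace ℝ E₁] [NormedAddCommGroup E₂] [NormedSpace ℝ E₂]
    [NormedAddCommGroup F] [NormedSpace ℝ F] (c : S₃ →ₗ[ℝ] F) (e₁ : S₁ → E₁) (e₂ : S₂ → E₂)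
    {R : S₁ → S₂ → S₃ → Prop} (B : E₁ →L[ℝ] E₂ →L[ℝ] F)
    (hB : ∀ x y z, R x y z → c z = B (e₁ x) (e₂ y)) :
    ∃ B' : E₁ →L[ℝ] E₂ →L[ℝ] F, ∀ x y z, R x y (-z) → c z = B' (e₁ x) (e₂ y) :=
  ⟨-B, fun x y z h => by
    have := hB x y _ h
    rw [map_neg] at this
    exact neg_eq_iff_eq_neg.1 this⟩

theorem exists_comp_clm {E₁ E₂ F G : Type*} [NormedAddCommGroup E₁] [NormedSpace ℝ E₁]
    [NormedAddCommGroup E₂] [NormedSpace ℝ E₂] [NormedAddCommGroup F] [NormedSpace ℝ F]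
    [NormedAddCommGroup G] [NormedSpace ℝ G] (T : E₂ →L[ℝ] F) (B : E₁ →L[ℝ] E₂ →L[ℝ] F)
    (T' : F →L[ℝ] G) (B' : E₁ →L[ℝ] F →L[ℝ] G) :
    ∃ L : E₁ → E₂ →L[ℝ] G, (∀ x y, L x y = T' (T y + B x y) + B' x (T y + B x y)) ∧
      ∀ y, Continuous fun x => L x y :=
  ⟨fun x => (T' + B' x).comp (T + B x), fun _ _ => rfl, fun y => by
    simp only [ContinuousLinearMap.comp_apply, add_apply]
    fun_prop⟩

theorem exists_comp_clm₂ {E₁ E₂ F G : Type*} [NormedAddCommGroup E₁] [NormedSpace ℝ E₁]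
    [NormedAddCommGroup E₂] [NormedSpace ℝ E₂] [NormedAddCommGroup F] [NormedSpace ℝ F]
    [NormedAddCommGroup G] [NormedSpace ℝ G] (L : E₁ → E₂ →L[ℝ] F)
    (hL : ∀ y, Continuous fun x => L x y) (T T' : F →L[ℝ] G) (B : E₁ →L[ℝ] F →L[ℝ] G) :
    ∃ U : E₁ → E₂ →L[ℝ] G,
      (∀ x y, U x y = T (L x y) + B x (L x y) + (2 : ℝ) • T' (L x y)) ∧
      ∀ y, Continuous fun x => U x y :=
  ⟨fun x => (T + B x + (2 : ℝ) • T').comp (L x), fun _ _ => rfl, fun y => by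
    have := hL y
    simp only [ContinuousLinearMap.comp_apply, add_apply, smul_apply]
    fun_prop⟩

section Extensions

variable {𝕜 : Type*} [RCLike 𝕜] {n : ℕ} {K : Subgroup (unitary (EndV 𝕜 n))} {ι : Type*}
variable {M : Type*} [TopologicalSpace M] [ChartedSpace (EuclideanHalfSpace 3) M]
variable [IsManifold I3 ∞ M] {P : PrincipalBundle M K ι} (𝒰 : PatchCover P)
variable [T2Space M] (g : Metric M) (A₀ : SmoothConn P)

theorem exists_sobCovDeriv_clm {l s r : ℕ} (hr : r + 1 ≤ s)
    (hp : ∀ p q, p + q ≤ r → ProductOrders l s p q) :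
    ∃ (T : HSec 𝒰 s →L[ℝ] HForm 𝒰 r) (B : HForm 𝒰 l →L[ℝ] HSec 𝒰 s →L[ℝ] HForm 𝒰 r),
      ∀ h f η, SobCovDeriv 𝒰 A₀ h f η ↔ η = T f + B h f := by
  obtain ⟨T, hT⟩ := exists_covDeriv_clm 𝒰 A₀ hr
  obtain ⟨B, hB⟩ := exists_formBracket_clm 𝒰 A₀ hp
  exact ⟨T, B, fun h f η => mem_closure_graph_add (e₁ := toHForm 𝒰 l) (e₂ := toHSec 𝒰 s)
    (c := toHForm 𝒰 r) (denseRange_toHForm 𝒰 l) (denseRange_toHSec 𝒰 s)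
    (R := fun h f η => IsCovDeriv P (A₀.form + h.1) f η) hT hB (exists_isCovDeriv A₀)
    (fun h f => exists_isCovDeriv (A₀.addForm h) f) (fun _ _ _ _ => isCovDeriv_add) h f η⟩

theorem exists_sobCodiff_clm {l s r : ℕ} (hr : r + 1 ≤ s)
    (hp : ∀ p q, p + q ≤ r → ProductOrders l s p q) :
    ∃ (T : HForm 𝒰 s →L[ℝ] HSec 𝒰 r) (B : HForm 𝒰 l →L[ℝ] HForm 𝒰 s →L[ℝ] HSec 𝒰 r),
      ∀ h η u, SobCodiff 𝒰 g A₀ h η u ↔ u = T η + B h η := by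
  obtain ⟨T, hT⟩ := exists_codiff_clm 𝒰 g A₀ hr
  obtain ⟨B, hB⟩ := exists_bracket_clm 𝒰 g hp
  obtain ⟨B', hB'⟩ := exists_neg_clm (toHSec 𝒰 r) (toHForm 𝒰 l) (toHForm 𝒰 s) B hB
  exact ⟨T, B', fun h f η => mem_closure_graph_add (e₁ := toHForm 𝒰 l) (e₂ := toHForm 𝒰 s)
    (c := toHSec 𝒰 r) (denseRange_toHForm 𝒰 l) (denseRange_toHForm 𝒰 s)
    (R := fun h η u => IsCodiff P g (A₀.form + h.1) η u)
    (R₁ := fun h η u => IsBracket P g h η (-u)) hT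
    hB' (exists_isCodiff g A₀)
    (fun h f => exists_isCodiff g (A₀.addForm h) f)
    (fun _ _ _ _ h₀ h₁ => by rw [neg_sub]; exact isCodiff_add g h₀ h₁) h f η⟩

theorem exists_sobBracket_clm {s r : ℕ} (hp : ∀ p q, p + q ≤ r → ProductOrders s s p q) :
    ∃ B : HForm 𝒰 s →L[ℝ] HForm 𝒰 s →L[ℝ] HSec 𝒰 r,
      ∀ α β u, SobBracket 𝒰 g α β u ↔ u = B α β := by
  obtain ⟨B, hB⟩ := exists_bracket_clm 𝒰 g hp
  exact ⟨B, fun α β u => mem_closure_graph₂ (denseRange_toHForm 𝒰 s) (denseRange_toHForm 𝒰 s)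
    (c := toHSec 𝒰 r) (R := fun α β u => IsBracket P g α β u)
    (F := fun q => B q.1 q.2) B.continuous₂ (exists_isBracket g) hB α β u⟩

theorem exists_sobNormalDeriv_clm {l s : ℕ} (hl : 1 ≤ l) (hs : 2 ≤ s) :
    ∃ (T : HSec 𝒰 s →L[ℝ] L2Bdry 𝒰) (B : HForm 𝒰 l →L[ℝ] HSec 𝒰 s →L[ℝ] L2Bdry 𝒰),
      ∀ h u w, SobNormalDeriv 𝒰 g A₀ h u w ↔ w = T u + B h u := by
  obtain ⟨T, hT⟩ := exists_normalDeriv_clm 𝒰 g A₀ hs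
  obtain ⟨B, hB⟩ := exists_normalBracket_clm 𝒰 g A₀ hl hs
  exact ⟨T, B, fun h u w => mem_closure_graph_add (e₁ := toHForm 𝒰 l) (e₂ := toHSec 𝒰 s)
    (c := toL2Bdry 𝒰) (denseRange_toHForm 𝒰 l) (denseRange_toHSec 𝒰 s)
    (R := fun h u w => IsNormalDeriv P g (A₀.form + h.1) u w) hT hB (exists_isNormalDeriv g A₀)
    (fun h f => exists_isNormalDeriv g (A₀.addForm h) f) (fun _ _ _ _ => isNormalDeriv_add g) h u w⟩

theorem exists_sobTauMul_clm {s : ℕ} (hs : 2 ≤ s) :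
    ∃ T : HSec 𝒰 s →L[ℝ] L2Bdry 𝒰, ∀ u w, SobTauMul 𝒰 g u w ↔ w = T u := by
  obtain ⟨T, hT⟩ := exists_tauMul_clm 𝒰 g hs
  exact ⟨T, fun u w => mem_closure_graph (denseRange_toHSec 𝒰 s) (c := toL2Bdry 𝒰)
    (R := fun u w => IsTauMul P g u w) (F := T) T.continuous (exists_isTauMul g) hT u w⟩

/-- The Laplacian extends to Sobolev spaces. -/
theorem exists_sobLaplacian_clm {k : ℕ} (hk : 3 ≤ k) :
    ∃ L : HForm 𝒰 k → HSec 𝒰 (k + 1) →L[ℝ] HSec 𝒰 (k - 1),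
      (∀ h f u, SobLaplacian 𝒰 g A₀ h f u ↔ u = L h f) ∧ ∀ f, Continuous fun h => L h f := by
  obtain ⟨T, B, h1⟩ := exists_sobCovDeriv_clm 𝒰 A₀ (l := k) (s := k + 1) (r := k) le_rfl
    fun p q hpq => by simp only [ProductOrders]; omega
  obtain ⟨T', B', h2⟩ := exists_sobCodiff_clm 𝒰 g A₀ (l := k) (s := k) (r := k - 1) (by omega)
    fun p q hpq => by simp only [ProductOrders]; omega
  obtain ⟨L, hL, hLc⟩ := exists_comp_clm T B T' B'
  refine ⟨L, fun h f u => ?_, hLc⟩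
  rw [hL]
  constructor
  · rintro ⟨η, hη, hu⟩
    rw [h1] at hη
    rw [h2] at hu
    rw [hu, hη]
  · intro hu
    exact ⟨T f + B h f, (h1 _ _ _).2 rfl, (h2 _ _ _).2 hu⟩

/-- The operator `T_A`. -/
theorem exists_TA_clm {k : ℕ} (hk : 3 ≤ k) :
    ∃ T : HForm 𝒰 k → HSec 𝒰 (k + 1) →L[ℝ] L2Bdry 𝒰,
      (∀ h f w, IsTA 𝒰 g A₀ h f w ↔ w = T h f) ∧ ∀ f, Continuous fun h => T h f := by
  obtain ⟨L, hL, hLc⟩ := exists_sobLaplacian_clm 𝒰 g A₀ hk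
  obtain ⟨T, B, h1⟩ := exists_sobNormalDeriv_clm 𝒰 g A₀ (l := k) (s := k - 1) (by omega) (by omega)
  obtain ⟨T', h2⟩ := exists_sobTauMul_clm 𝒰 g (s := k - 1) (by omega)
  obtain ⟨U, hU, hUc⟩ := exists_comp_clm₂ L hLc T T' B
  refine ⟨U, fun h f w => ?_, hUc⟩
  rw [hU]
  constructor
  · rintro ⟨u, w₁, w₂, hu, hw₁, hw₂, rfl⟩
    rw [hL] at hu
    rw [h1] at hw₁
    rw [h2] at hw₂
    rw [hw₁, hw₂, hu]
  · intro hw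
    exact ⟨L h f, _, _, (hL _ _ _).2 rfl, (h1 _ _ _).2 rfl, (h2 _ _).2 rfl, hw⟩

end Extensions

end Coulomb

namespace Coulomb

set_option linter.unusedSectionVars false

section Closedness

variable {E X W W₁ W₂ W₃ : Type*} [TopologicalSpace E] [FirstCountableTopology E]
  [MeasurableSpace X] {μ₀ μ : Measure X} [NormedAddCommGroup W] [NormedAddCommGroup W₁]
  [NormedAddCommGroup W₂] [NormedAddCommGroup W₃]

theorem exists_subseq_ae_tendsto {f : ℕ → Lp W 2 μ} {F : Lp W 2 μ}
    (h : Filter.Tendsto f Filter.atTop (nhds F)) :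
    ∃ ns : ℕ → ℕ, StrictMono ns ∧
      ∀ᵐ x ∂μ, Filter.Tendsto (fun i => f (ns i) x) Filter.atTop (nhds (F x)) :=
  (tendstoInMeasure_of_tendsto_Lp h).exists_seq_tendsto_ae

theorem exists_subseq_forall_ae_tendsto {κ : Type*} [Finite κ] {μ : κ → Measure X}
    {f : ∀ b, ℕ → Lp W 2 (μ b)} {F : ∀ b, Lp W 2 (μ b)}
    (h : ∀ b, Filter.Tendsto (f b) Filter.atTop (nhds (F b))) :
    ∃ ns : ℕ → ℕ, StrictMono ns ∧
      ∀ b, ∀ᵐ x ∂μ b, Filter.Tendsto (fun i => f b (ns i) x) Filter.atTop (nhds (F b x)) := by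
  classical
  cases nonempty_fintype κ
  suffices H : ∀ s : Finset κ, ∃ ns : ℕ → ℕ, StrictMono ns ∧ ∀ b ∈ s,
      ∀ᵐ x ∂μ b, Filter.Tendsto (fun i => f b (ns i) x) Filter.atTop (nhds (F b x)) by
    obtain ⟨ns, h1, h2⟩ := H Finset.univ
    exact ⟨ns, h1, fun b => h2 b (Finset.mem_univ b)⟩
  intro s
  induction s using Finset.induction_on with
  | empty => exact ⟨id, strictMono_id, by simp⟩
  | insert b s _ ih =>
    obtain ⟨ns, h1, h2⟩ := ih
    obtain ⟨ms, h3, h4⟩ := exists_subseq_ae_tendsto ((h b).comp h1.tendsto_atTop)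
    refine ⟨ns ∘ ms, h1.comp h3, fun c hc => ?_⟩
    rcases Finset.mem_insert.1 hc with rfl | hc
    · exact h4
    · filter_upwards [h2 c hc] with x hx
      exact hx.comp h3.tendsto_atTop

/-- Pointwise relations between `L²`-functions that depend continuously on a parameter are closed
conditions. -/
theorem isClosed_setOf_ae_eq (hμ : μ₀ ≪ μ) {G : E → Lp W 2 μ₀} (hG : Continuous G) {G₁ : E → Lp W₁ 2 μ}
    (hG₁ : Continuous G₁) {G₂ : E → Lp W₂ 2 μ} (hG₂ : Continuous G₂) {G₃ : E → Lp W₃ 2 μ}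
    (hG₃ : Continuous G₃) {Φ : X → W₁ → W₂ → W₃ → W}
    (hΦ : ∀ x, Continuous fun q : W₁ × W₂ × W₃ => Φ x q.1 q.2.1 q.2.2) :
    IsClosed {p : E | ∀ᵐ x ∂μ₀, G p x = Φ x (G₁ p x) (G₂ p x) (G₃ p x)} := by
  refine isSeqClosed_iff_isClosed.1 fun u p hu hup => ?_
  obtain ⟨n₀, h₀, k₀⟩ := exists_subseq_ae_tendsto ((hG.tendsto p).comp hup)
  obtain ⟨n₁, h₁, k₁⟩ := exists_subseq_ae_tendsto
    (((hG₁.tendsto p).comp hup).comp h₀.tendsto_atTop)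
  obtain ⟨n₂, h₂, k₂⟩ := exists_subseq_ae_tendsto
    (((hG₂.tendsto p).comp hup).comp (h₀.comp h₁).tendsto_atTop)
  obtain ⟨n₃, h₃, k₃⟩ := exists_subseq_ae_tendsto
    (((hG₃.tendsto p).comp hup).comp ((h₀.comp h₁).comp h₂).tendsto_atTop)
  have hu' : ∀ᵐ x ∂μ₀, ∀ n, G (u n) x = Φ x (G₁ (u n) x) (G₂ (u n) x) (G₃ (u n) x) :=
    ae_all_iff.2 hu
  change ∀ᵐ x ∂μ₀, _
  filter_upwards [k₀, hμ.ae_le k₁, hμ.ae_le k₂, hμ.ae_le k₃, hu'] with x y₀ y₁ y₂ y₃ hx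
  have z₀ := y₀.comp ((h₁.comp h₂).comp h₃).tendsto_atTop
  have z₁ := y₁.comp (h₂.comp h₃).tendsto_atTop
  have z₂ := y₂.comp h₃.tendsto_atTop
  refine tendsto_nhds_unique z₀ ?_
  refine (((hΦ x).tendsto (G₁ p x, G₂ p x, G₃ p x)).comp
    (z₁.prodMk_nhds (z₂.prodMk_nhds y₃))).congr fun i => ?_
  exact (hx _).symm

end Closedness

section WeakDerivatives

theorem continuous_integral_smul {X W : Type*} [MeasurableSpace X] {μ : Measure X}
    [NormedAddCommGroup W] [NormedSpace ℝ W] {c : X → ℝ} (hc : MemLp c 2 μ) :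
    Continuous fun F : Lp W 2 μ => ∫ x, c x • F x ∂μ := by
  have hi : ∀ F : Lp W 2 μ, Integrable (fun x => c x • F x) μ := fun F =>
    memLp_one_iff_integrable.1 (MemLp.smul (p := 2) (q := 2) (r := 1) (Lp.memLp F) hc)
  let T : Lp W 2 μ →ₗ[ℝ] W :=
    { toFun := fun F => ∫ x, c x • F x ∂μ
      map_add' := fun F G => by
        rw [← integral_add (hi F) (hi G)]
        refine integral_congr_ae ?_
        filter_upwards [Lp.coeFn_add F G] with x hx
        rw [hx, Pi.add_apply, smul_add]
      map_smul' := fun r F => by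
        rw [RingHom.id_apply, ← integral_smul]
        refine integral_congr_ae ?_
        filter_upwards [Lp.coeFn_smul r F] with x hx
        rw [hx, Pi.smul_apply, smul_comm] }
  refine (T.mkContinuous (eLpNorm c 2 μ).toReal fun F => ?_).continuous
  change ‖∫ x, c x • F x ∂μ‖ ≤ _
  rw [Lp.norm_def, ← ENNReal.toReal_mul]
  rw [← toReal_enorm]
  refine ENNReal.toReal_mono (ENNReal.mul_ne_top hc.2.ne (Lp.memLp F).2.ne) ?_
  refine (enorm_integral_le_lintegral_enorm _).trans ?_
  rw [← eLpNorm_one_eq_lintegral_enorm]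
  exact eLpNorm_smul_le_mul_eLpNorm (p := 2) (q := 2) (r := 1) (Lp.memLp F).1 hc.1

variable {E W : Type*} [NormedAddCommGroup E] [NormedSpace ℝ E] [FiniteDimensional ℝ E]
  [MeasurableSpace E] [BorelSpace E] {μ : Measure E} [μ.IsAddHaarMeasure] [NormedAddCommGroup W]
  [NormedSpace ℝ W]

/-- Integration by parts against a test function. -/
theorem integral_smul_fderiv_of_tsupport {D : Set E} (hD : IsOpen D) {v : E → W}
    (hv : ContDiffOn ℝ 1 v D) {c : E → ℝ} (hc : ContDiff ℝ ∞ c) (hs : HasCompactSupport c)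
    (hcD : tsupport c ⊆ D) (t : E) :
    ∫ x, c x • fderiv ℝ v x t ∂μ = -∫ x, fderiv ℝ c x t • v x ∂μ := by
  have hi : ∀ {b : E → ℝ} {w : E → W}, Continuous b → HasCompactSupport b → tsupport b ⊆ D →
      ContinuousOn w D → Integrable (fun x => b x • w x) μ := by
    intro b w hb hbs hbD hw
    have hbw : Continuous fun x => b x • w x := by
      refine continuous_of_tsupport fun x hx => ?_
      have hxD := hbD (closure_mono (fun y hy => by
        intro h0
        exact hy (by simp [h0])) hx)
      exact hb.continuousAt.smul (hw.continuousAt (hD.mem_nhds hxD))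
    exact hbw.integrable_of_hasCompactSupport hbs.smul_right
  have hc' : Continuous fun x => fderiv ℝ c x t := (hc.continuous_fderiv (by simp)).clm_apply
    continuous_const
  have hts : tsupport (fun x => fderiv ℝ c x t) ⊆ tsupport c :=
    tsupport_fderiv_apply_subset ℝ t
  refine integral_smul_fderiv_eq_neg_fderiv_smul_of_integrable (hi hc' (hs.fderiv_apply (𝕜 := ℝ) t)
    (hts.trans hcD) hv.continuousOn) (hi hc.continuous hs hcD ?_)
    (hi hc.continuous hs hcD hv.continuousOn) (fun x _ => hc.differentiable (by simp) x)
    fun x hx => (hv.differentiableOn (by simp)).differentiableAt (hD.mem_nhds (hcD hx))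
  exact (hv.continuousOn_fderiv_of_isOpen hD le_rfl).clm_apply continuousOn_const

/-- If the functions `f p` depend continuously on `p` in `L²` and have the derivatives `f' p` in
direction `t` for `p` in a dense set, then `f' p = 0` where `f p = 0`. -/
theorem weak_deriv_eq_zero [CompleteSpace W] {H S : Type*} [TopologicalSpace H] {e : S → H}
    (he : DenseRange e) {L : Set E} (hL : IsCompact L) {G G' : H → Lp W 2 (μ.restrict L)}
    (hG : Continuous G) (hG' : Continuous G') {v : S → E → W} (t : E)
    (hv : ∀ s, ContDiffOn ℝ 1 (v s) (interior L))
    (h : ∀ s, ∀ᵐ x ∂μ.restrict L, G (e s) x = v s x)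
    (h' : ∀ s, ∀ᵐ x ∂μ.restrict L, x ∈ interior L → G' (e s) x = fderiv ℝ (v s) x t)
    {p : H} (hp : ∀ᵐ x ∂μ.restrict L, x ∈ interior L → G p x = 0) :
    ∀ᵐ x ∂μ, x ∈ interior L → G' p x = 0 := by
  have hLf : IsFiniteMeasure (μ.restrict L) := ⟨by simpa using hL.measure_lt_top⟩
  have hbd : ∀ {c : E → ℝ}, Continuous c → HasCompactSupport c → MemLp c 2 (μ.restrict L) :=
    fun hc hs => hc.memLp_of_hasCompactSupport hs
  refine IsOpen.ae_eq_zero_of_integral_contDiff_smul_eq_zero isOpen_interior ?_ fun c hc hs hcL => ?_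
  · have h1 : IntegrableOn (G' p) L μ := (Lp.memLp (G' p)).integrable (by norm_num)
    exact (h1.mono_set interior_subset).locallyIntegrableOn
  have hc' : Continuous fun x => fderiv ℝ c x t := (hc.continuous_fderiv (by simp)).clm_apply
    continuous_const
  have hs' : HasCompactSupport fun x => fderiv ℝ c x t := hs.fderiv_apply (𝕜 := ℝ) t
  have hts : tsupport (fun x => fderiv ℝ c x t) ⊆ tsupport c := tsupport_fderiv_apply_subset ℝ t
  have hset : ∀ {b : E → ℝ} {w : E → W}, tsupport b ⊆ tsupport c →
      ∫ x in L, b x • w x ∂μ = ∫ x, b x • w x ∂μ := by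
    intro b w hb
    refine setIntegral_eq_integral_of_forall_compl_eq_zero fun x hx => ?_
    have : b x = 0 := by
      by_contra h0
      exact hx (interior_subset (hcL (hb (subset_tsupport _ h0))))
    rw [this, zero_smul]
  have hset' : ∀ {b : E → ℝ} {w w' : E → W}, tsupport b ⊆ tsupport c →
      (∀ᵐ x ∂μ.restrict L, x ∈ interior L → w x = w' x) →
      ∫ x in L, b x • w x ∂μ = ∫ x in L, b x • w' x ∂μ := by
    intro b w w' hb hw
    refine integral_congr_ae ?_
    filter_upwards [hw] with x hx
    by_cases h0 : b x = 0
    · simp [h0]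
    · rw [hx (hcL (hb (subset_tsupport _ h0)))]
  have key : ∀ q : H, ∫ x in L, c x • G' q x ∂μ = -∫ x in L, fderiv ℝ c x t • G q x ∂μ := by
    intro q
    refine he.induction_on (p := fun q => ∫ x in L, c x • G' q x ∂μ
      = -∫ x in L, fderiv ℝ c x t • G q x ∂μ) q ?_ fun s => ?_
    · exact isClosed_eq ((continuous_integral_smul (hbd hc.continuous hs)).comp hG')
        ((continuous_integral_smul (hbd hc' hs')).comp hG).neg
    · rw [hset' subset_rfl (h' s), hset' hts ((h s).mono fun x hx _ => hx), hset subset_rfl,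
        hset hts]
      exact integral_smul_fderiv_of_tsupport isOpen_interior (hv s) hc hs hcL t
  rw [← hset subset_rfl, key p, hset' (w' := fun _ => 0) hts hp]
  simp

end WeakDerivatives

end Coulomb

namespace Coulomb

set_option linter.unusedSectionVars false

/-- The Euclidean space `ℝ²`. -/
abbrev E2 := EuclideanSpace ℝ (Fin 2)

/-- The inclusion of the plane as a continuous linear map. -/
def planeL : E2 →L[ℝ] E3 :=
  LinearMap.toContinuousLinearMap
    { toFun := planeEmb
      map_add' := fun x y => by
        ext i
        refine Fin.cases ?_ (fun i => ?_) i <;> simp [planeEmb]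
      map_smul' := fun c x => by
        ext i
        refine Fin.cases ?_ (fun i => ?_) i <;> simp [planeEmb] }

theorem planeL_apply (z : E2) : planeL z = planeEmb z := rfl

theorem planeL_single (t : Fin 2) :
    planeL (EuclideanSpace.single t 1) = EuclideanSpace.single t.succ 1 := by
  rw [planeL_apply]
  ext i
  refine Fin.cases ?_ (fun i => ?_) i
  · simp [planeEmb, (Fin.succ_ne_zero t).symm]
  · simp [planeEmb, Pi.single_apply, Fin.succ_inj]

section Planar

variable {M : Type*} [TopologicalSpace M] [ChartedSpace (EuclideanHalfSpace 3) M]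

/-- The boundary part of an open set in the chart `e`. -/
def planeDom (e : Chart M) (V : Set M) : Set E2 := planeEmb ⁻¹' chartDom e V

theorem isOpen_planeDom (e : Chart M) {V : Set M} (hV : IsOpen V) : IsOpen (planeDom e V) := by
  obtain ⟨O, hO, h⟩ := exists_chartDom_eq e hV
  have : planeDom e V = planeEmb ⁻¹' O := by
    ext z
    simp only [planeDom, h, mem_preimage, mem_inter_iff, and_iff_right_iff_imp]
    intro _
    rw [range_I3, mem_ofPred_eq, planeEmb_apply_zero]
  rw [this]
  exact hO.preimage continuous_planeEmb

theorem exists_planeEmb_eq (e : Chart M) {x : M} (hx : x ∈ e.1.source) [IsManifold I3 ∞ M]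
    (hxb : x ∈ bdry M) : ∃ z, planeEmb z = coord e x := by
  rw [mem_bdry_iff e hx] at hxb
  refine ⟨WithLp.toLp 2 fun i => coord e x i.succ, ?_⟩
  ext i
  refine Fin.cases ?_ (fun i => ?_) i
  · exact hxb.symm
  · simp [planeEmb]

variable [IsManifold I3 ∞ M]
variable {W : Type*} [NormedAddCommGroup W] [NormedSpace ℝ W]

theorem mem_of_planeDom (e : Chart M) {V : Set M} {z : E2} (hz : z ∈ planeDom e V) :
    (coord e).symm (planeEmb z) ∈ (e.1.source ∩ V) ∩ bdry M := by
  have h := coord_symm_mem e hz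
  exact ⟨h.1, mem_bdry_of_planeEmb e h.1.1 h.2⟩

theorem contDiffOn_plane (e : Chart M) {V : Set M} (hV : IsOpen V) {F : M → W}
    (hF : ContMDiffOn I3 𝓘(ℝ, W) ∞ F (e.1.source ∩ V)) :
    ContDiffOn ℝ ∞ (fun z => F ((coord e).symm (planeEmb z))) (planeDom e V) :=
  (contDiffOn_chart e hV hF).comp planeL.contDiff.contDiffOn fun _ hz => hz

theorem fderiv_plane (e : Chart M) {V : Set M} (hV : IsOpen V) {F : M → W}
    (hF : ContMDiffOn I3 𝓘(ℝ, W) ∞ F (e.1.source ∩ V)) (t : Fin 2) {z : E2}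
    (hz : z ∈ planeDom e V) :
    fderiv ℝ (fun z => F ((coord e).symm (planeEmb z))) z (EuclideanSpace.single t 1)
      = pd e t.succ F ((coord e).symm (planeEmb z)) := by
  rw [pd_symm_eq e hV t.succ hF hz, ← planeL_single]
  have h1 := ((contDiffOn_chart e hV hF).differentiableOn (by simp) _ hz).hasFDerivWithinAt
  have h2 := h1.comp z (planeL.hasFDerivAt.hasFDerivWithinAt (s := planeDom e V)) fun _ hz => hz
  have h3 := h2.hasFDerivAt ((isOpen_planeDom e hV).mem_nhds hz)
  exact DFunLike.congr_fun h3.fderiv _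

/-- Properties that hold almost everywhere on the boundary parts of compact sets that cover `M` hold
almost everywhere on the boundary in any chart. -/
theorem ae_planeDom_of_cover {κ : Type*} [Countable κ] (f : κ → Chart M) (C : κ → Set M)
    (hC : ∀ b, C b ⊆ (f b).1.source) (hcov : ∀ x, ∃ b, x ∈ C b) {p : M → Prop}
    (hp : ∀ b, ∀ᵐ z ∂bdryMeasure (f b) (C b), p ((coord (f b)).symm (planeEmb z)))
    (hm : ∀ b, MeasurableSet (planeEmb ⁻¹' (coord (f b) '' C b)))
    (e : Chart M) : ∀ᵐ z : E2, z ∈ planeDom e univ → p ((coord e).symm (planeEmb z)) := by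
  let r : E3 →L[ℝ] E2 := LinearMap.toContinuousLinearMap
    { toFun := fun y => WithLp.toLp 2 fun i => y i.succ
      map_add' := fun x y => rfl
      map_smul' := fun c x => rfl }
  have hr : ∀ z, r (planeEmb z) = z := fun z => rfl
  have hbad : ∀ b, ∀ᵐ z : E2, z ∉ (fun z => r (chartTrans (f b) e (planeEmb z))) ''
      ({z | z ∈ planeEmb ⁻¹' (coord (f b) '' C b) ∧ ¬ p ((coord (f b)).symm (planeEmb z))}
        ∩ planeDom (f b) (e.1.source ∩ univ)) := by
    intro b
    refine measure_eq_zero_iff_ae_notMem.1 ?_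
    refine addHaar_image_eq_zero_of_differentiableOn_of_addHaar_eq_zero _ ?_ ?_
    · have h1 := (contDiffOn_chartTrans (f b) e univ).differentiableOn (by simp)
      have h2 := h1.comp planeL.differentiable.differentiableOn
        (s := planeDom (f b) (e.1.source ∩ univ)) fun _ hz => hz
      exact (r.differentiable.comp_differentiableOn h2).mono inter_subset_right
    · refine measure_mono_null inter_subset_left ?_
      have h1 := (ae_restrict_iff' (hm b)).1 (hp b)
      rw [ae_iff] at h1
      refine measure_mono_null (fun z hz => ?_) h1
      simpa only [mem_ofPred_eq, Classical.not_imp] using hz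
  filter_upwards [ae_all_iff.2 hbad] with z hz hze
  by_contra hn
  have hx := mem_of_planeDom e hze
  obtain ⟨b, hb⟩ := hcov ((coord e).symm (planeEmb z))
  obtain ⟨z', hz'⟩ := exists_planeEmb_eq (f b) (hC b hb) hx.2
  have hsymm : (coord (f b)).symm (planeEmb z') = (coord e).symm (planeEmb z) := by
    rw [hz', coord_symm_coord _ (hC b hb)]
  refine hz b ⟨z', ⟨⟨?_, ?_⟩, ?_⟩, ?_⟩
  · exact ⟨_, hb, hz'.symm⟩
  · rwa [hsymm]
  · exact ⟨_, ⟨hC b hb, hx.1.1, trivial⟩, hz'.symm⟩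
  · simp only [chartTrans, hsymm]
    rw [(coord_symm_mem e hze).2, hr]

end Planar

section Traces

variable {𝕜 : Type*} [RCLike 𝕜] {n : ℕ} {K : Subgroup (unitary (EndV 𝕜 n))} {ι : Type*}
variable {M : Type*} [TopologicalSpace M] [ChartedSpace (EuclideanHalfSpace 3) M]
variable [IsManifold I3 ∞ M] {P : PrincipalBundle M K ι} {𝒰 : PatchCover P} [T2Space M]
variable {S W : Type*} [AddCommGroup S] [Module ℝ S] [NormedAddCommGroup W] [NormedSpace ℝ W]
  [CompleteSpace W] {loc : LocalReps 𝒰 S W}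
variable {E : Type*} [NormedAddCommGroup E] [NormedSpace ℝ E]

/-- The boundary part of the `a`-th chart and trivialization. -/
abbrev planePatch (𝒰 : PatchCover P) (a : Fin 𝒰.N) : Set E2 :=
  planeDom (𝒰.chart a) (P.U (𝒰.triv a))

/-- The boundary point with coordinates `z` in the `a`-th chart. -/
abbrev planePt (𝒰 : PatchCover P) (a : Fin 𝒰.N) (z : E2) : M :=
  (coord (𝒰.chart a)).symm (planeEmb z)

theorem exists_trace_clm_of_bound (hloc : IsModel 𝒰 loc) (a : Fin 𝒰.N) {L : Set E2}
    (hL : IsCompact L) (hLD : L ⊆ planePatch 𝒰 a) {m r : ℕ} (hr : r ≤ m) {e : S →ₗ[ℝ] E}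
    (he : DenseRange e) (hn : ∀ s, ‖e s‖ = ‖modelJet 𝒰 loc m s‖) {Z : Type*} [NormedAddCommGroup Z]
    [NormedSpace ℝ Z] [CompleteSpace Z] (φ : S → E2 → Z) (hφ : ∀ s, ContinuousOn (φ s) L)
    (ha : ∀ s t, ∀ z ∈ L, φ (s + t) z = φ s z + φ t z)
    (hs : ∀ (c : ℝ) s, ∀ z ∈ L, φ (c • s) z = c • φ s z)
    (hb : ∀ s, ∀ z ∈ L, ‖φ s z‖ ≤ 1 * ∑ q ∈ Finset.range r,
      ‖jetFun (𝒰.chart a) q (loc a s).1 (planeEmb z)‖) :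
    ∃ T : E →L[ℝ] Lp Z 2 (volume.restrict L), ∀ s, ∀ᵐ z ∂volume.restrict L, T (e s) z = φ s z := by
  have hae : ∀ {p : E2 → Prop}, (∀ z ∈ L, p z) → ∀ᵐ z ∂volume.restrict L, p z := fun h =>
    (ae_restrict_iff' hL.measurableSet).2 (Filter.Eventually.of_forall h)
  have hm : ∀ s, MemLp (φ s) 2 (volume.restrict L) := fun s => memLp_of_continuousOn_compact hL (hφ s)
  let f : S →ₗ[ℝ] Lp Z 2 (volume.restrict L) := lpLin (volume.restrict L) φ hm
    (fun s t => hae (ha s t)) fun c s => hae (hs c s)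
  have hB : IsCompact (planeEmb '' L) := hL.image continuous_planeEmb
  have hBD : planeEmb '' L ⊆ patchDom 𝒰 a := by
    rintro _ ⟨z, hz, rfl⟩
    exact hLD hz
  have ht : ∀ q : ℕ, ∃ D : NNReal, q ∈ Finset.range r → ∀ s, ∫⁻ z in L,
      ‖jetFun (𝒰.chart a) q (loc a s).1 (planeEmb z)‖ₑ ^ 2 ≤ D * ‖e s‖ₑ ^ 2 := by
    intro q
    by_cases hq : q ∈ Finset.range r
    · have := Finset.mem_range.1 hq
      obtain ⟨D, hD⟩ := exists_trace_jet_le hloc a hB hBD (show q + 1 ≤ m by omega)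
      refine ⟨D, fun _ s => ?_⟩
      rw [← ofReal_norm (e s), hn, ofReal_norm]
      exact (lintegral_mono_set (subset_preimage_image _ _)).trans (hD s)
    · exact ⟨0, fun h => absurd h hq⟩
  choose D hD using ht
  have hf : ∀ s, ‖f s‖ₑ ^ 2 ≤ ((r : NNReal) * ∑ q ∈ Finset.range r, D q : NNReal) * ‖e s‖ₑ ^ 2 := by
    intro s
    calc ‖f s‖ₑ ^ 2 = ∫⁻ z in L, ‖φ s z‖ₑ ^ 2 := enorm_toLp_sq (hm s)
      _ ≤ ∫⁻ z in L, ENNReal.ofReal (1 ^ 2 * (Finset.range r).card) *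
          ∑ q ∈ Finset.range r, ‖jetFun (𝒰.chart a) q (loc a s).1 (planeEmb z)‖ₑ ^ 2 := by
          refine setLIntegral_mono' hL.measurableSet fun z hz => ?_
          simpa only [ofReal_norm] using enorm_sq_le_of_norm_le_sum (fun _ _ => norm_nonneg _)
            (hb s z hz)
      _ = ENNReal.ofReal (1 ^ 2 * (Finset.range r).card) * ∑ q ∈ Finset.range r,
          ∫⁻ z in L, ‖jetFun (𝒰.chart a) q (loc a s).1 (planeEmb z)‖ₑ ^ 2 := by
          rw [lintegral_const_mul' _ _ ENNReal.ofReal_ne_top, lintegral_finsetSum' _ fun q _ => ?_]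
          obtain ⟨v', v'', hv, -⟩ := hasDerivsWithNorms_jet (loc := loc) a s q
          have hv1 : ContinuousOn (jetFun (𝒰.chart a) q (loc a s).1) (patchDom 𝒰 a) :=
            fun y hy => (hv y hy).continuousWithinAt
          exact ((hv1.comp continuous_planeEmb.continuousOn fun z hz => hLD hz).enorm.aemeasurable
            hL.measurableSet).pow_const 2
      _ ≤ ENNReal.ofReal (1 ^ 2 * (Finset.range r).card) *
          ∑ q ∈ Finset.range r, (D q * ‖e s‖ₑ ^ 2) := by
          gcongr with q hq
          exact hD q hq s
      _ = _ := by
          rw [← Finset.sum_mul, ENNReal.coe_mul, ENNReal.ofNNReal_finsetSum, mul_assoc, one_pow,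
            one_mul, Finset.card_range, ENNReal.ofReal_natCast]
          rfl
  obtain ⟨T, hT⟩ := exists_extension he f (C := _) fun s => norm_le_of_enorm_sq_le (hf s)
  refine ⟨T, fun s => ?_⟩
  rw [hT]
  exact (hm s).coeFn_toLp

theorem jetFun_zero_norm (a : Fin 𝒰.N) (s : S) {z : E2} :
    ‖jetFun (𝒰.chart a) 0 (loc a s).1 (planeEmb z)‖ = ‖(loc a s).1 (planePt 𝒰 a z)‖ := by
  rw [jetFun, norm_iteratedFDerivWithin_zero]
  rfl

/-- The trace operator on `H¹`. -/
theorem exists_trace_clm (hloc : IsModel 𝒰 loc) (a : Fin 𝒰.N) {L : Set E2}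
    (hL : IsCompact L) (hLD : L ⊆ planePatch 𝒰 a) {m : ℕ} (hm : 1 ≤ m) {e : S →ₗ[ℝ] E}
    (he : DenseRange e) (hn : ∀ s, ‖e s‖ = ‖modelJet 𝒰 loc m s‖) :
    ∃ T : E →L[ℝ] Lp W 2 (volume.restrict L), ∀ s, ∀ᵐ z ∂volume.restrict L,
      T (e s) z = (loc a s).1 (planePt 𝒰 a z) := by
  refine exists_trace_clm_of_bound hloc a hL hLD hm he hn (fun s z => (loc a s).1 (planePt 𝒰 a z))
    (fun s => (contDiffOn_plane _ (P.isOpen_U _) (loc a s).2).continuousOn.mono hLD)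
    (fun s t z _ => by rw [map_add]; rfl) (fun c s z _ => by rw [map_smul]; rfl) fun s z _ => ?_
  simp [jetFun_zero_norm]

/-- The trace on `H²` of a function and its partial derivatives. -/
theorem exists_trace_pd_clm (hloc : IsModel 𝒰 loc) (a : Fin 𝒰.N) {L : Set E2}
    (hL : IsCompact L) (hLD : L ⊆ planePatch 𝒰 a) {m : ℕ} (hm : 2 ≤ m) {e : S →ₗ[ℝ] E}
    (he : DenseRange e) (hn : ∀ s, ‖e s‖ = ‖modelJet 𝒰 loc m s‖) :
    ∃ T : E →L[ℝ] Lp (W × (Fin 3 → W)) 2 (volume.restrict L), ∀ s, ∀ᵐ z ∂volume.restrict L,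
      T (e s) z = ((loc a s).1 (planePt 𝒰 a z),
        fun b => pd (𝒰.chart a) b (loc a s).1 (planePt 𝒰 a z)) := by
  have hd : ∀ s, ∀ z ∈ L, MDifferentiableAt I3 𝓘(ℝ, W) (loc a s).1 (planePt 𝒰 a z) := fun s z hz =>
    ContMDiffOn.mdifferentiableAt' ((𝒰.chart a).1.open_source.inter (P.isOpen_U _)) (loc a s).2
      (mem_of_planeDom _ (hLD hz)).1
  refine exists_trace_clm_of_bound hloc a hL hLD hm he hn
    (fun s z => ((loc a s).1 (planePt 𝒰 a z),
        fun b => pd (𝒰.chart a) b (loc a s).1 (planePt 𝒰 a z))) (fun s => ?_)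
    (fun s t z hz => ?_) (fun c s z hz => ?_) fun s z hz => ?_
  · refine ((contDiffOn_plane _ (P.isOpen_U _) (loc a s).2).continuousOn.mono hLD).prodMk
      (continuousOn_pi.2 fun b => ?_)
    exact (contDiffOn_plane _ (P.isOpen_U _) (contMDiffOn_pd _ b (P.isOpen_U _)
      (loc a s).2)).continuousOn.mono hLD
  · refine Prod.ext (by rw [map_add]; rfl) (funext fun b => ?_)
    have h := pd_add (𝒰.chart a) b (hd s z hz) (hd t z hz)
    rw [map_add]
    exact h
  · refine Prod.ext (by rw [map_smul]; rfl) (funext fun b => ?_)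
    have h := pd_clm (c • ContinuousLinearMap.id ℝ W) (𝒰.chart a) b (hd s z hz)
    rw [map_smul]
    exact h
  · rw [one_mul, Finset.sum_range_succ, Finset.sum_range_one, jetFun_zero_norm]
    have h1 : ∀ b, ‖pd (𝒰.chart a) b (loc a s).1 (planePt 𝒰 a z)‖
        ≤ ‖jetFun (𝒰.chart a) 1 (loc a s).1 (planeEmb z)‖ := by
      intro b
      rw [pd_symm_eq _ (P.isOpen_U _) b (loc a s).2 (hLD hz), jetFun_eq _ (P.isOpen_U _) 1 _ (hLD hz),
        norm_iteratedFDerivWithin_one _ (uniqueDiffOn_chartDom _ (P.isOpen_U _) _ (hLD hz))]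
      refine (ContinuousLinearMap.le_opNorm _ _).trans_eq ?_
      simp
    refine norm_prod_le_iff.2 ⟨le_add_of_nonneg_right (norm_nonneg _), ?_⟩
    exact ((pi_norm_le_iff_of_nonneg (norm_nonneg _)).2 h1).trans
      (le_add_of_nonneg_left (norm_nonneg _))

/-- The tangential derivatives of the trace of a function vanish where the trace vanishes. -/
theorem trace_pd_eq_zero (a : Fin 𝒰.N) {L : Set E2}
    (hL : IsCompact L) (hLD : L ⊆ planePatch 𝒰 a) {e : S →ₗ[ℝ] E} (he : DenseRange e)
    {T : E →L[ℝ] Lp (W × (Fin 3 → W)) 2 (volume.restrict L)}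
    (hT : ∀ s, ∀ᵐ z ∂volume.restrict L, T (e s) z = ((loc a s).1 (planePt 𝒰 a z),
        fun b => pd (𝒰.chart a) b (loc a s).1 (planePt 𝒰 a z)))
    {W' : Type*} [NormedAddCommGroup W'] [NormedSpace ℝ W'] [CompleteSpace W'] (π : W →L[ℝ] W')
    {p : E} (hp : ∀ᵐ z ∂volume.restrict L, z ∈ interior L → π (T p z).1 = 0) (t : Fin 2) :
    ∀ᵐ z, z ∈ interior L → π ((T p z).2 t.succ) = 0 := by
  let π₀ : (W × (Fin 3 → W)) →L[ℝ] W' := π.comp (ContinuousLinearMap.fst ℝ W (Fin 3 → W))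
  let π₁ : (W × (Fin 3 → W)) →L[ℝ] W' := π.comp
    ((ContinuousLinearMap.proj (R := ℝ) (φ := fun _ : Fin 3 => W) t.succ).comp
      (ContinuousLinearMap.snd ℝ W (Fin 3 → W)))
  have h0 : ∀ q, ∀ᵐ z ∂volume.restrict L, π₀.compLp (T q) z = π (T q z).1 := fun q =>
    π₀.coeFn_compLp (T q)
  have h1 : ∀ q, ∀ᵐ z ∂volume.restrict L, π₁.compLp (T q) z = π ((T q z).2 t.succ) := fun q =>
    π₁.coeFn_compLp (T q)
  have hint : interior L ⊆ planePatch 𝒰 a := interior_subset.trans hLD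
  have hsm : ∀ s, ContMDiffOn I3 𝓘(ℝ, W') ∞ (fun x => π ((loc a s).1 x)) (patchSet 𝒰 a) := fun s =>
    contMDiffOn_clm π (loc a s).2
  have key := weak_deriv_eq_zero he hL (μ := volume) (G := fun q => π₀.compLp (T q))
    (G' := fun q => π₁.compLp (T q)) ((π₀.compLpL 2 _).continuous.comp T.continuous)
    ((π₁.compLpL 2 _).continuous.comp T.continuous)
    (v := fun s z => π ((loc a s).1 (planePt 𝒰 a z))) (EuclideanSpace.single t 1)
    (fun s => ((contDiffOn_plane _ (P.isOpen_U _) (hsm s)).mono hint).of_le (mod_cast le_top))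
    (fun s => ?_) (fun s => ?_) (p := p) ?_
  · have h2 := (ae_restrict_iff' hL.measurableSet).1 (h1 p)
    filter_upwards [key, h2] with z k1 k2 hz
    rw [← k2 (interior_subset hz), k1 hz]
  · filter_upwards [h0 (e s), hT s] with z k1 k2
    rw [k1, k2]
  · filter_upwards [h1 (e s), hT s] with z k1 k2 hz
    rw [k1, k2, fderiv_plane _ (P.isOpen_U _) (hsm s) t (hint hz), pd_clm π]
    exact ContMDiffOn.mdifferentiableAt' ((𝒰.chart a).1.open_source.inter (P.isOpen_U _)) (loc a s).2
      (mem_of_planeDom _ (hint hz)).1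
  · filter_upwards [h0 p, hp] with z k1 k2 hz
    rw [k1, k2 hz]

end Traces

end Coulomb

namespace Coulomb

set_option linter.unusedSectionVars false

section Algebra

variable {W : Type*} [NormedAddCommGroup W] [NormedSpace ℝ W] (B : W →L[ℝ] W →L[ℝ] W)
  (h : Fin 3 → Fin 3 → ℝ) (dh : Fin 3 → Fin 3 → Fin 3 → ℝ) (l : Fin 3 → ℝ) (A : Fin 3 → W)

/-- The codifferential for the connection form `A + a₀` of a form with value and partial derivatives
`q` at a point. -/
def codiffPt (a₀ : Fin 3 → W) (q : (Fin 3 → W) × (Fin 3 → Fin 3 → W)) : W :=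
  codiffAlg h dh l (fun b c => q.2 b c + B (A b + a₀ b) (q.1 c)) q.1

/-- The normal derivative for the connection form `A + a₀` of the contraction of two forms. -/
def normalPt (a₀ : Fin 3 → W) (q q' : (Fin 3 → W) × (Fin 3 → Fin 3 → W)) : W :=
  (√(h 0 0))⁻¹ • ∑ d, h 0 d • dContrAlg B h dh (fun b c => q.2 b c + B (A b + a₀ b) (q.1 c)) q.1
    (fun b c => q'.2 b c + B (A b + a₀ b) (q'.1 c)) q'.1 d

theorem continuous_codiffPt : Continuous fun p : (Fin 3 → W) × ((Fin 3 → W) × (Fin 3 → Fin 3 → W)) =>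
    codiffPt B h dh l A p.1 p.2 := by
  unfold codiffPt codiffAlg
  fun_prop

theorem continuous_normalPt : Continuous fun p : (Fin 3 → W) ×
    ((Fin 3 → W) × (Fin 3 → Fin 3 → W)) × ((Fin 3 → W) × (Fin 3 → Fin 3 → W)) =>
    normalPt B h dh A p.1 p.2.1 p.2.2 := by
  unfold normalPt dContrAlg
  fun_prop

variable {B h}

theorem dContrAlg_add_bracket (hJ : ∀ x y z, B x (B y z) = B (B x y) z + B y (B x z))
    (p p' : Fin 3 → Fin 3 → W) (a a' : Fin 3 → W) (d : Fin 3) :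
    dContrAlg B h dh (fun b c => p b c + B (A b) (a c)) a (fun b c => p' b c + B (A b) (a' c)) a' d
      = dContrAlg B h dh p a p' a' d + B (A d) (∑ b, ∑ c, h b c • B (a b) (a' c)) := by
  have hJ' := fun b c => hJ (A d) (a b) (a' c)
  simp only [dContrAlg, map_sum, map_smul, ← Finset.sum_add_distrib, hJ']
  refine Finset.sum_congr rfl fun b _ => Finset.sum_congr rfl fun c _ => ?_
  simp only [map_add, add_apply]
  module

theorem normalPt_eq (hI : ∀ b c, h b c = h c b) (h0 : 0 < h 0 0) {a₀ : Fin 3 → W}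
    {q q' : (Fin 3 → W) × (Fin 3 → Fin 3 → W)} (ha : ∀ t : Fin 2, q.1 t.succ = 0)
    (ha' : ∀ t : Fin 2, q'.1 t.succ = 0) (hq : ∀ s t : Fin 2, q.2 s.succ t.succ = 0)
    (hq' : ∀ s t : Fin 2, q'.2 s.succ t.succ = 0) (hc : codiffPt B h dh l A a₀ q = 0)
    (hc' : codiffPt B h dh l A a₀ q' = 0) :
    normalPt B h dh A a₀ q q' = (-2 * ((∑ b, (dh b b 0 + l b * h b 0)) / √(h 0 0)
          - (∑ d, h 0 d * dh d 0 0) / (2 * √(h 0 0) ^ 3))) • ∑ b, ∑ c, h b c • B (q.1 b) (q'.1 c) := by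
  rw [normalPt, normal_contrAlg B (l := l) hI h0 ha ha' (fun s t => by rw [hq, ha, map_zero, add_zero])
    fun s t => by rw [hq', ha', map_zero, add_zero]]
  rw [codiffPt] at hc hc'
  rw [hc, hc']
  simp

end Algebra

section Interpolation

variable {𝕜 : Type*} [RCLike 𝕜] {n : ℕ} {K : Subgroup (unitary (EndV 𝕜 n))} {ι : Type*}
variable {M : Type*} [TopologicalSpace M] [ChartedSpace (EuclideanHalfSpace 3) M]
variable [IsManifold I3 ∞ M] {P : PrincipalBundle M K ι} {𝒰 : PatchCover P} [T2Space M]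
variable {S W : Type*} [AddCommGroup S] [Module ℝ S] [NormedAddCommGroup W] [NormedSpace ℝ W]
  [CompleteSpace W] {loc : LocalReps 𝒰 S W}
variable {E₀ E₁ : Type*} [NormedAddCommGroup E₀] [NormedSpace ℝ E₀] [CompleteSpace E₀]
  [NormedAddCommGroup E₁] [NormedSpace ℝ E₁]

/-- The inclusion of `H¹` in `L²`. -/
theorem exists_incl_clm {e₀ : S →ₗ[ℝ] E₀} (hn₀ : ∀ s, ‖e₀ s‖ = ‖modelJet 𝒰 loc 0 s‖)
    {e₁ : S →ₗ[ℝ] E₁} (he₁ : DenseRange e₁) (hn₁ : ∀ s, ‖e₁ s‖ = ‖modelJet 𝒰 loc 1 s‖) :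
    ∃ J : E₁ →L[ℝ] E₀, ∀ s, J (e₁ s) = e₀ s :=
  exists_extension he₁ e₀ (C := 1) fun s => by
    have h := enorm_modelJet_mono loc (zero_le_one : 0 ≤ 1) s
    rw [hn₀, hn₁, one_mul]
    have h1 := ennreal_sq_le_sq h
    rw [enorm_eq_nnnorm, enorm_eq_nnnorm, ENNReal.coe_le_coe] at h1
    exact h1

/-- The trace of an element of `H¹` that vanishes in `L²`. -/
theorem trace_eq_zero_of_incl (hloc : IsModel 𝒰 loc) (a : Fin 𝒰.N) {L : Set E2}
    (hL : IsCompact L) (hLD : L ⊆ planePatch 𝒰 a)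
    {e₀ : S →ₗ[ℝ] E₀} (hn₀ : ∀ s, ‖e₀ s‖ = ‖modelJet 𝒰 loc 0 s‖)
    {e₁ : S →ₗ[ℝ] E₁} (he₁ : DenseRange e₁) (hn₁ : ∀ s, ‖e₁ s‖ = ‖modelJet 𝒰 loc 1 s‖)
    {J : E₁ →L[ℝ] E₀} (hJ : ∀ s, J (e₁ s) = e₀ s) {T : E₁ →L[ℝ] Lp W 2 (volume.restrict L)}
    (hT : ∀ s, ∀ᵐ z ∂volume.restrict L, T (e₁ s) z = (loc a s).1 (planePt 𝒰 a z)) {u : E₁}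
    (hu : J u = 0) : T u = 0 := by
  have hBD : planeEmb '' L ⊆ patchDom 𝒰 a := by
    rintro _ ⟨z, hz, rfl⟩
    exact hLD hz
  obtain ⟨C, hC⟩ := exists_trace_jet_le_param hloc a (hL.image continuous_planeEmb) hBD 0
  have key : ∀ ε : ℝ, 0 < ε → ε ≤ 1 → ∀ u : E₁,
      ‖T u‖ ^ 2 ≤ C * (ε⁻¹ * ‖J u‖ ^ 2 + ε * ‖u‖ ^ 2) := by
    intro ε h0 h1 u
    refine he₁.induction_on (p := fun u => ‖T u‖ ^ 2 ≤ C * (ε⁻¹ * ‖J u‖ ^ 2 + ε * ‖u‖ ^ 2)) u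
      (isClosed_le (by fun_prop) (by fun_prop)) fun s => ?_
    have h2 : ‖T (e₁ s)‖ₑ ^ 2 ≤ C * (ENNReal.ofReal ε⁻¹ * ‖e₀ s‖ₑ ^ 2
        + ENNReal.ofReal ε * ‖e₁ s‖ₑ ^ 2) := by
      have h3 : ‖T (e₁ s)‖ₑ ^ 2 = ∫⁻ z in L, ‖T (e₁ s) z‖ₑ ^ 2 := by
        conv_lhs => rw [← Lp.toLp_coeFn (T (e₁ s)) (Lp.memLp _)]
        exact enorm_toLp_sq _
      have h4 : ∫⁻ z in L, ‖T (e₁ s) z‖ₑ ^ 2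
          = ∫⁻ z in L, ‖jetFun (𝒰.chart a) 0 (loc a s).1 (planeEmb z)‖ₑ ^ 2 := by
        refine lintegral_congr_ae ?_
        filter_upwards [hT s] with z hz
        rw [hz, ← ofReal_norm, ← ofReal_norm, jetFun_zero_norm]
      rw [h3, h4, ← ofReal_norm (e₀ s), ← ofReal_norm (e₁ s), hn₀, hn₁, ofReal_norm, ofReal_norm]
      exact (lintegral_mono_set (subset_preimage_image _ _)).trans (hC ε h0 h1 s)
    rw [hJ, ← ENNReal.ofReal_le_ofReal_iff (by positivity)]
    rw [ENNReal.ofReal_pow (norm_nonneg _), ofReal_norm]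
    refine h2.trans_eq ?_
    rw [ENNReal.ofReal_mul (by positivity), ENNReal.ofReal_add (by positivity) (by positivity),
      ENNReal.ofReal_mul (by positivity), ENNReal.ofReal_mul (by positivity),
      ENNReal.ofReal_pow (norm_nonneg _), ENNReal.ofReal_pow (norm_nonneg _), ofReal_norm,
      ofReal_norm, ENNReal.ofReal_coe_nnreal]
  have h1 : ∀ ε : ℝ, 0 < ε → ε ≤ 1 → ‖T u‖ ^ 2 ≤ ε * (C * ‖u‖ ^ 2) := by
    intro ε h0 h1
    refine (key ε h0 h1 u).trans_eq ?_
    rw [hu, norm_zero]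
    ring
  have h2 : ‖T u‖ ^ 2 ≤ 0 := by
    have h3 := (tendsto_one_div_add_atTop_nhds_zero_nat (𝕜 := ℝ)).mul_const (C * ‖u‖ ^ 2)
    rw [zero_mul] at h3
    refine ge_of_tendsto' h3 fun i => h1 _ (by positivity) ?_
    rw [div_le_one (by positivity)]
    exact le_add_of_nonneg_left (Nat.cast_nonneg i)
  exact norm_eq_zero.1 (pow_eq_zero_iff (two_ne_zero) |>.1 (le_antisymm h2 (sq_nonneg _)))

end Interpolation

section Horizontal

variable {𝕜 : Type*} [RCLike 𝕜] {n : ℕ} {K : Subgroup (unitary (EndV 𝕜 n))} {ι : Type*}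
variable {M : Type*} [TopologicalSpace M] [ChartedSpace (EuclideanHalfSpace 3) M]
variable [IsManifold I3 ∞ M] {P : PrincipalBundle M K ι} {𝒰 : PatchCover P} [T2Space M]

theorem coeFn_formPullback (α : SmoothForm P) (b : Fin 𝒰.N) :
    ∀ᵐ z ∂bdryMeasure (𝒰.chart b) (𝒰.C b),
      (show Lp (Fin 2 → EndV 𝕜 n) 2 (bdryMeasure (𝒰.chart b) (𝒰.C b)) from formPullback 𝒰 α b) z
        = fun c => comp (α.1 (𝒰.triv b)) (𝒰.chart b) c.succ (planePt 𝒰 b z) :=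
  (bdryFun_memLp (𝒰.chart b) (tangLoc (𝒰.triv b) (𝒰.chart b) α).2 (𝒰.isCompact b)
      (fun _ hx => ⟨(𝒰.subset b hx).1, 𝒰.subset b hx⟩)).coeFn_toLp

/-- The tangential components of the traces of conductor forms vanish. -/
theorem trace_tang_eq_zero {m : ℕ} {α : HForm 𝒰 m} (hα : α ∈ HFormCon 𝒰 m) (a : Fin 𝒰.N)
    {L : Set E2} (hL : IsCompact L) (hLD : L ⊆ planePatch 𝒰 a) {W : Type*} [NormedAddCommGroup W]
    [NormedSpace ℝ W] {T : HForm 𝒰 m →L[ℝ] Lp W 2 (volume.restrict L)} {π : W →L[ℝ] Fin 3 → EndV 𝕜 n}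
    (hT : ∀ s, ∀ᵐ z ∂volume.restrict L, π (T (toHForm 𝒰 m s) z) = (formReps 𝒰 a s).1 (planePt 𝒰 a z))
    (t : Fin 2) : ∀ᵐ z ∂volume.restrict L, π (T α z) t.succ = 0 := by
  obtain ⟨u, hu, hlim⟩ := mem_closure_iff_seq_limit.1 (show (α, (0 : BdryJetSpace 𝒰 (Fin 2 → EndV 𝕜 n)))
    ∈ closure (LinearMap.range ((toHForm 𝒰 m).prod (formPullback 𝒰)) : Set _) from hα)
  choose α' hα' using hu
  have h1 : Filter.Tendsto (fun i => toHForm 𝒰 m (α' i)) Filter.atTop (nhds α) :=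
    ((continuous_fst.tendsto _).comp hlim).congr fun i => by rw [Function.comp_apply, ← hα']; rfl
  have h2 : ∀ b, Filter.Tendsto (fun i => formPullback 𝒰 (α' i) b) Filter.atTop (nhds 0) := fun b =>
    (((continuous_apply b).comp continuous_snd).tendsto _ |>.comp hlim).congr fun i => by
      rw [Function.comp_apply, ← hα']; rfl
  obtain ⟨ns, hns, hae⟩ := exists_subseq_forall_ae_tendsto
    (μ := fun b => bdryMeasure (𝒰.chart b) (𝒰.C b)) (W := Fin 2 → EndV 𝕜 n) (F := fun _ => 0) h2
  obtain ⟨ms, hms, hae'⟩ := exists_subseq_ae_tendsto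
    (((T.continuous.tendsto α).comp h1).comp hns.tendsto_atTop)
  have hp : ∀ b, ∀ᵐ z ∂bdryMeasure (𝒰.chart b) (𝒰.C b), ∀ i (e : Chart M),
      (planePt 𝒰 b z) ∈ e.1.source ∩ P.U i → Filter.Tendsto
        (fun j => comp ((α' (ns j)).1 i) e t.succ (planePt 𝒰 b z)) Filter.atTop (nhds 0) := by
    intro b
    have hz0 : ∀ᵐ z ∂bdryMeasure (𝒰.chart b) (𝒰.C b),
        (0 : Lp (Fin 2 → EndV 𝕜 n) 2 (bdryMeasure (𝒰.chart b) (𝒰.C b))) z = 0 :=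
      Lp.coeFn_zero _ _ _
    have hin : ∀ᵐ z ∂bdryMeasure (𝒰.chart b) (𝒰.C b), planePt 𝒰 b z ∈ 𝒰.C b ∩ bdry M :=
      (ae_restrict_iff' (isCompact_planeEmb_preimage (isCompact_coord_patch 𝒰 b)).measurableSet).2
        (Filter.Eventually.of_forall fun z hz => mem_patch_of_planeEmb b hz)
    filter_upwards [hae b, ae_all_iff.2 fun i => coeFn_formPullback (α' (ns i)) b, hz0, hin]
      with z k1 k2 k3 k4 i e hx
    have hxb := 𝒰.subset b k4.1
    have k5 : ∀ d : Fin 2, Filter.Tendsto (fun j => comp ((α' (ns j)).1 (𝒰.triv b)) (𝒰.chart b) d.succ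
        (planePt 𝒰 b z)) Filter.atTop (nhds 0) := by
      intro d
      have := (tendsto_pi_nhds.1 k1) d
      rw [k3] at this
      exact this.congr fun j => congrFun (k2 j) d
    have k6 : ∀ j, comp ((α' (ns j)).1 i) e t.succ (planePt 𝒰 b z) = ∑ d : Fin 2,
        jac e (𝒰.chart b) (planePt 𝒰 b z) d.succ t.succ • conjB (P.g i (𝒰.triv b) (planePt 𝒰 b z))
          (comp ((α' (ns j)).1 (𝒰.triv b)) (𝒰.chart b) d.succ (planePt 𝒰 b z)) := by
      intro j
      rw [SmoothForm.comp_gauge _ e _ ⟨hx.2, hxb.2⟩, comp_eq _ e (𝒰.chart b) ⟨hx.1, hxb.1⟩, map_sum,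
        Fin.sum_univ_succ, jac_zero_succ e _ t ⟨hx.1, hxb.1⟩ k4.2, zero_smul, map_zero, zero_add]
      exact Finset.sum_congr rfl fun d _ => map_smul _ _ _
    simp only [k6]
    rw [← Finset.sum_const_zero (s := (Finset.univ : Finset (Fin 2)))]
    refine tendsto_finsetSum _ fun d _ => ?_
    have k7 := (((conjB (P.g i (𝒰.triv b) (planePt 𝒰 b z))).continuous.tendsto 0).comp (k5 d)).const_smul
      (jac e (𝒰.chart b) (planePt 𝒰 b z) d.succ t.succ)
    rw [map_zero, smul_zero] at k7
    exact k7
  have hfin := ae_planeDom_of_cover 𝒰.chart 𝒰.C (fun b x hx => (𝒰.subset b hx).1) 𝒰.cover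
    (p := fun x => ∀ i (e : Chart M), x ∈ e.1.source ∩ P.U i → Filter.Tendsto
        (fun j => comp ((α' (ns j)).1 i) e t.succ x) Filter.atTop (nhds 0)) hp
    (fun b => (isCompact_planeEmb_preimage (isCompact_coord_patch 𝒰 b)).measurableSet) (𝒰.chart a)
  have hfin' := ae_restrict_of_ae (s := L) hfin
  have hmem : ∀ᵐ z ∂volume.restrict L, z ∈ L := ae_restrict_mem hL.measurableSet
  filter_upwards [hae', hfin', hmem, ae_all_iff.2 fun i => hT (α' (ns (ms i)))] with z k1 k2 k3 k4
  have hx := mem_of_planeDom _ (hLD k3)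
  have k5 := (k2 (chartDom_mono _ (subset_univ _) (hLD k3)) _ _ hx.1).comp hms.tendsto_atTop
  have k6 := tendsto_pi_nhds.1 ((π.continuous.tendsto _).comp k1) t.succ
  exact tendsto_nhds_unique k6 (k5.congr fun i => (congrFun (k4 i) t.succ).symm)

end Horizontal

end Coulomb

namespace Coulomb

set_option linter.unusedSectionVars false

section Pointwise

variable {𝕜 : Type*} [RCLike 𝕜] {n : ℕ} {K : Subgroup (unitary (EndV 𝕜 n))} {ι : Type*}
variable {M : Type*} [TopologicalSpace M] [ChartedSpace (EuclideanHalfSpace 3) M]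
variable [IsManifold I3 ∞ M] {P : PrincipalBundle M K ι} {𝒰 : PatchCover P} (g : Metric M)
  (A₀ : SmoothConn P)

theorem lieB_jacobi (x y z : EndV 𝕜 n) :
    lieB 𝕜 n x (lieB 𝕜 n y z) = lieB 𝕜 n (lieB 𝕜 n x y) z + lieB 𝕜 n y (lieB 𝕜 n x z) := by
  simp only [lieB_eq]
  noncomm_ring

/-- The value and the partial derivatives of the components of a form at a point. -/
abbrev formJetPt (a : Fin 𝒰.N) (η : SmoothForm P) (x : M) :
    (Fin 3 → EndV 𝕜 n) × (Fin 3 → Fin 3 → EndV 𝕜 n) :=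
  ((formReps 𝒰 a η).1 x, fun b => pd (𝒰.chart a) b (formReps 𝒰 a η).1 x)

theorem pd_formReps (a : Fin 𝒰.N) (η : SmoothForm P) {x : M} (hx : x ∈ patchSet 𝒰 a) (b c : Fin 3) :
    pd (𝒰.chart a) b (formReps 𝒰 a η).1 x c
      = pd (𝒰.chart a) b (comp (η.1 (𝒰.triv a)) (𝒰.chart a) c) x :=
  (pd_clm (projV 𝕜 n c) (𝒰.chart a) b (ContMDiffOn.mdifferentiableAt'
    ((𝒰.chart a).1.open_source.inter (P.isOpen_U _)) (formReps 𝒰 a η).2 hx)).symm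

/-- The connection form in the `a`-th patch. -/
abbrev connPt (a : Fin 𝒰.N) (x : M) : Fin 3 → EndV 𝕜 n := fun b =>
  comp (A₀.form (𝒰.triv a)) (𝒰.chart a) b x

theorem cpd_formReps (a : Fin 𝒰.N) (h η : SmoothForm P) {x : M} (hx : x ∈ patchSet 𝒰 a)
    (b c : Fin 3) : cpd ((A₀.form + h.1) (𝒰.triv a)) (𝒰.chart a) b
      (comp (η.1 (𝒰.triv a)) (𝒰.chart a) c) x = (formJetPt a η x).2 b c
      + lieB 𝕜 n (connPt A₀ a x b + (formReps 𝒰 a h).1 x b) ((formJetPt a η x).1 c) := by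
  rw [cpd]
  dsimp only [formJetPt]
  rw [pd_formReps a η hx b c]
  rfl

theorem isCodiff_pt {h η : SmoothForm P} {u : SmoothSec P} (hu : IsCodiff P g (A₀.form + h.1) η u)
    (a : Fin 𝒰.N) {x : M} (hx : x ∈ patchSet 𝒰 a) :
    (secReps 𝒰 a u).1 x = codiffPt (lieB 𝕜 n) (gramInv g (𝒰.chart a) x)
      (fun d b c => pd (𝒰.chart a) d (fun y => gramInv g (𝒰.chart a) y b c) x)
      (fun b => logDens g (𝒰.chart a) b x) (connPt A₀ a x) ((formReps 𝒰 a h).1 x)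
      (formJetPt a η x) := by
  rw [isCodiff_iff] at hu
  refine (hu _ _ x hx).trans ?_
  simp only [codiffLoc, codiffPt, cpd_formReps A₀ a h η hx]
  rfl

theorem isNormalDeriv_pt {h α β : SmoothForm P} {u : SmoothSec P} {w : BdrySec P}
    (hu : IsBracket P g α β u) (hw : IsNormalDeriv P g (A₀.form + h.1) u w)
    (a : Fin 𝒰.N) {x : M} (hx : x ∈ patchSet 𝒰 a) (hxb : x ∈ bdry M) :
    w.1 (𝒰.triv a) x = normalPt (lieB 𝕜 n) (gramInv g (𝒰.chart a) x)
      (fun d b c => pd (𝒰.chart a) d (fun y => gramInv g (𝒰.chart a) y b c) x)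
      (connPt A₀ a x) ((formReps 𝒰 a h).1 x) (formJetPt a α x) (formJetPt a β x) := by
  rw [isNormalDeriv_iff] at hw
  rw [isBracket_iff] at hu
  refine (hw _ _ x hx hxb).trans ?_
  unfold normalLoc normalPt
  refine congrArg _ (Finset.sum_congr rfl fun d _ => congrArg _ ?_)
  refine Eq.trans ?_ (dContrAlg_add_bracket (h := fun b c => gramInv g (𝒰.chart a) x b c) _
    (fun b => connPt A₀ a x b + (formReps 𝒰 a h).1 x b) lieB_jacobi (formJetPt a α x).2
    (formJetPt a β x).2 (formJetPt a α x).1 (formJetPt a β x).1 d).symm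
  rw [cpd, pd_congr_on (𝒰.chart a) d ((𝒰.chart a).1.open_source.inter (P.isOpen_U (𝒰.triv a))) hx
      (hu (𝒰.triv a) (𝒰.chart a)), pd_contr g (lieB 𝕜 n) (𝒰.chart a) d hx.1 (SmoothForm.mdiff α hx)
      (SmoothForm.mdiff β hx), hu (𝒰.triv a) (𝒰.chart a) x hx]
  simp only [← pd_formReps _ _ hx]
  rfl

end Pointwise

section Identity

variable {𝕜 : Type*} [RCLike 𝕜] {n : ℕ} {K : Subgroup (unitary (EndV 𝕜 n))} {ι : Type*}
variable {M : Type*} [TopologicalSpace M] [ChartedSpace (EuclideanHalfSpace 3) M]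
variable [IsManifold I3 ∞ M] {P : PrincipalBundle M K ι} {𝒰 : PatchCover P} [T2Space M]
  (g : Metric M) (A₀ : SmoothConn P)

theorem map_extension_eq {S₁ S₂ S₃ E₁ E₂ F F' : Type*} [NormedAddCommGroup E₁] [NormedSpace ℝ E₁]
    [NormedAddCommGroup E₂] [NormedSpace ℝ E₂] [NormedAddCommGroup F] [NormedSpace ℝ F]
    [NormedAddCommGroup F'] [NormedSpace ℝ F'] {e₁ : S₁ → E₁} {e₂ : S₂ → E₂} {c : S₃ → F}
    {c' : S₃ → F'} {R : S₁ → S₂ → S₃ → Prop} {f : E₁ → E₂ → F} {f' : E₁ → E₂ → F'}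
    (hf : ∀ p q r, (p, q, r) ∈ closure {s : E₁ × E₂ × F | ∃ x y z, R x y z ∧
      s = (e₁ x, e₂ y, c z)} ↔ r = f p q)
    (hf' : ∀ p q r, (p, q, r) ∈ closure {s : E₁ × E₂ × F' | ∃ x y z, R x y z ∧
      s = (e₁ x, e₂ y, c' z)} ↔ r = f' p q) {J : F →L[ℝ] F'} (hJ : ∀ z, J (c z) = c' z) (p : E₁)
    (q : E₂) : J (f p q) = f' p q := by
  refine (hf' p q _).1 (map_mem_closure (f := fun s : E₁ × E₂ × F => (s.1, s.2.1, J s.2.2))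
    (by fun_prop) ((hf p q _).2 rfl) ?_)
  rintro _ ⟨x, y, z, hr, rfl⟩
  exact ⟨x, y, z, hr, by simp only [hJ]⟩

/-- Relations between smooth objects and traces extend to Sobolev spaces. -/
theorem ae_eq_of_dense {S₁ S₂ S₃ E₁ E₂ E₃ W W₁ W₂ W₃ : Type*} [NormedAddCommGroup E₁] [NormedAddCommGroup E₂]
    [NormedAddCommGroup E₃] [NormedAddCommGroup W] [NormedAddCommGroup W₁] [NormedAddCommGroup W₂]
    [NormedAddCommGroup W₃] {e₁ : S₁ → E₁} (h₁ : DenseRange e₁) {e₂ : S₂ → E₂} (h₂ : DenseRange e₂)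
    {e₃ : S₃ → E₃} (h₃ : DenseRange e₃) {X : Type*} [MeasurableSpace X] {μ₀ μ : Measure X}
    (hμ : μ₀ ≪ μ) {G : E₁ × E₂ × E₃ → Lp W 2 μ₀} (hG : Continuous G) {T₁ : E₁ → Lp W₁ 2 μ}
    (hT₁ : Continuous T₁) {T₂ : E₂ → Lp W₂ 2 μ} (hT₂ : Continuous T₂) {T₃ : E₃ → Lp W₃ 2 μ}
    (hT₃ : Continuous T₃) {Φ : X → W₁ → W₂ → W₃ → W}
    (hΦ : ∀ x, Continuous fun q : W₁ × W₂ × W₃ => Φ x q.1 q.2.1 q.2.2)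
    (h : ∀ s₁ s₂ s₃, ∀ᵐ x ∂μ₀, G (e₁ s₁, e₂ s₂, e₃ s₃) x
      = Φ x (T₁ (e₁ s₁) x) (T₂ (e₂ s₂) x) (T₃ (e₃ s₃) x)) (p : E₁ × E₂ × E₃) :
    ∀ᵐ x ∂μ₀, G p x = Φ x (T₁ p.1 x) (T₂ p.2.1 x) (T₃ p.2.2 x) := by
  have hc := isClosed_setOf_ae_eq hμ hG (hT₁.comp continuous_fst)
    (hT₂.comp (continuous_fst.comp continuous_snd)) (hT₃.comp (continuous_snd.comp continuous_snd)) hΦ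
  have hd := h₁.prodMap (h₂.prodMap h₃)
  refine hd.induction_on (p := fun p => ∀ᵐ x ∂μ₀, G p x
    = Φ x (T₁ p.1 x) (T₂ p.2.1 x) (T₃ p.2.2 x)) p hc ?_
  rintro ⟨s₁, s₂, s₃⟩
  exact h s₁ s₂ s₃

theorem ae_eq_of_dense_affine {S₁ S₂ S₃ E₁ E₂ F W W₁ W₂ : Type*} [NormedAddCommGroup E₁]
    [NormedSpace ℝ E₁] [NormedAddCommGroup E₂] [NormedSpace ℝ E₂] [NormedAddCommGroup F]
    [NormedSpace ℝ F] [NormedAddCommGroup W] [NormedSpace ℝ W] [NormedAddCommGroup W₁]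
    [NormedSpace ℝ W₁] [NormedAddCommGroup W₂] [NormedSpace ℝ W₂] {e₁ : S₁ → E₁}
    (h₁ : DenseRange e₁) {e₂ : S₂ → E₂} (h₂ : DenseRange e₂) (c : S₃ → F) {X : Type*}
    [MeasurableSpace X] {μ : Measure X} (C : E₂ →L[ℝ] F) (B : E₁ →L[ℝ] E₂ →L[ℝ] F)
    (U : F →L[ℝ] Lp W 2 μ) (T₁ : E₁ →L[ℝ] Lp W₁ 2 μ) (T₂ : E₂ →L[ℝ] Lp W₂ 2 μ)
    {Φ : X → W₁ → W₂ → W} (hΦ : ∀ x, Continuous fun q : W₁ × W₂ => Φ x q.1 q.2)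
    (h : ∀ x y, ∃ z, c z = C (e₂ y) + B (e₁ x) (e₂ y) ∧ ∀ᵐ t ∂μ, U (c z) t
      = Φ t (T₁ (e₁ x) t) (T₂ (e₂ y) t)) (p : E₁) (q : E₂) :
    ∀ᵐ t ∂μ, U (C q + B p q) t = Φ t (T₁ p t) (T₂ q t) := by
  refine ae_eq_of_dense h₁ h₂ h₂ (Measure.AbsolutelyContinuous.refl _)
    (G := fun p => U (C p.2.1 + B p.1 p.2.1)) (by fun_prop) T₁.continuous T₂.continuous
    T₂.continuous (Φ := fun t p q _ => Φ t p q)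
    (fun t => (hΦ t).comp (continuous_fst.prodMk (continuous_fst.comp continuous_snd)))
    (fun x y _ => ?_) (p, q, q)
  obtain ⟨z, hz, hz'⟩ := h x y
  simpa only [hz] using hz'

set_option maxHeartbeats 1000000 in
/-- The traces of horizontal forms satisfy the equation `d_A^* α = 0`. -/
theorem trace_codiffPt_eq_zero {k s : ℕ} (hk : 1 ≤ k) (hs : 2 ≤ s) {h : HForm 𝒰 k} {α : HForm 𝒰 s}
    (hα : SobCodiff 𝒰 g A₀ h α (0 : HSec 𝒰 0)) (a : Fin 𝒰.N) {L : Set E2} (hL : IsCompact L)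
    (hLD : L ⊆ planePatch 𝒰 a) {T₁ : HForm 𝒰 k →L[ℝ] Lp (Fin 3 → EndV 𝕜 n) 2 (volume.restrict L)}
    (hT₁ : ∀ s, ∀ᵐ z ∂volume.restrict L, T₁ (toHForm 𝒰 k s) z
      = (formReps 𝒰 a s).1 (planePt 𝒰 a z))
    {T₂ : HForm 𝒰 s →L[ℝ] Lp ((Fin 3 → EndV 𝕜 n) × (Fin 3 → Fin 3 → EndV 𝕜 n)) 2 (volume.restrict L)}
    (hT₂ : ∀ η, ∀ᵐ z ∂volume.restrict L, T₂ (toHForm 𝒰 s η) z = formJetPt a η (planePt 𝒰 a z)) :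
    ∀ᵐ z ∂volume.restrict L, codiffPt (lieB 𝕜 n) (gramInv g (𝒰.chart a) (planePt 𝒰 a z))
      (fun d b c => pd (𝒰.chart a) d (fun y => gramInv g (𝒰.chart a) y b c) (planePt 𝒰 a z))
      (fun b => logDens g (𝒰.chart a) b (planePt 𝒰 a z)) (connPt A₀ a (planePt 𝒰 a z)) (T₁ h z)
      (T₂ α z) = 0 := by
  obtain ⟨C, B, hCB⟩ := exists_sobCodiff_clm 𝒰 g A₀ (l := k) (s := s) (r := 1) (by omega)
    fun p q hpq => by simp only [ProductOrders]; omega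
  obtain ⟨C', B', hCB'⟩ := exists_sobCodiff_clm 𝒰 g A₀ (l := k) (s := s) (r := 0) (by omega)
    fun p q hpq => by simp only [ProductOrders]; omega
  obtain ⟨J, hJ⟩ := exists_incl_clm (loc := secReps 𝒰) (norm_toHSec 0) (denseRange_toHSec 𝒰 1)
    (norm_toHSec 1)
  obtain ⟨U, hU⟩ := exists_trace_clm (isModel_secReps 𝒰) a hL hLD le_rfl (denseRange_toHSec 𝒰 1)
    (norm_toHSec 1)
  have h0 : J (C α + B h α) = 0 :=
    (map_extension_eq (e₁ := toHForm 𝒰 k) (e₂ := toHForm 𝒰 s) (c := toHSec 𝒰 1) (c' := toHSec 𝒰 0)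
      (R := fun h η u => IsCodiff P g (A₀.form + h.1) η u) (f := fun h η => C η + B h η) (f' := fun h η => C' η + B' h η) hCB hCB' hJ h
      α).trans ((hCB' _ _ _).1 hα).symm
  have h1 := trace_eq_zero_of_incl (isModel_secReps 𝒰) a hL hLD (norm_toHSec 0)
    (denseRange_toHSec 𝒰 1) (norm_toHSec 1) hJ hU h0
  have hmem : ∀ᵐ z ∂volume.restrict L, z ∈ L := ae_restrict_mem hL.measurableSet
  have key := ae_eq_of_dense_affine (denseRange_toHForm 𝒰 k) (denseRange_toHForm 𝒰 s) (toHSec 𝒰 1)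
    C B U T₁ T₂
    (Φ := fun z => codiffPt (lieB 𝕜 n) (gramInv g (𝒰.chart a) (planePt 𝒰 a z))
      (fun d b c => pd (𝒰.chart a) d (fun y => gramInv g (𝒰.chart a) y b c) (planePt 𝒰 a z))
      (fun b => logDens g (𝒰.chart a) b (planePt 𝒰 a z)) (connPt A₀ a (planePt 𝒰 a z)))
    (fun z => continuous_codiffPt _ _ _ _ _) (fun h' η' => ?_) h α
  · have hz0 : ∀ᵐ z ∂volume.restrict L, (0 : Lp (EndV 𝕜 n) 2 (volume.restrict L)) z = 0 :=
      Lp.coeFn_zero _ _ _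
    rw [h1] at key
    filter_upwards [key, hz0] with z k1 k2
    rw [← k1, k2]
  · obtain ⟨u', hu'⟩ := exists_isCodiff g (A₀.addForm h') η'
    refine ⟨u', (hCB _ _ _).1 (subset_closure ⟨h', η', u', hu', rfl⟩), ?_⟩
    filter_upwards [hU u', hT₁ h', hT₂ η', hmem] with z k1 k2 k3 k4
    rw [k1, k2, k3]
    exact isCodiff_pt g A₀ hu' a (mem_of_planeDom _ (hLD k4)).1

end Identity

end Coulomb

namespace Coulomb

set_option linter.unusedSectionVars false

theorem ae_eq_of_dense_normal {S₁ S₂ E₁ E₂ F G W W₁ W₂ : Type*} [NormedAddCommGroup E₁]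
    [NormedSpace ℝ E₁] [NormedAddCommGroup E₂] [NormedSpace ℝ E₂] [NormedAddCommGroup F]
    [NormedSpace ℝ F] [NormedAddCommGroup G] [NormedSpace ℝ G] [NormedAddCommGroup W]
    [NormedSpace ℝ W] [NormedAddCommGroup W₁]
    [NormedSpace ℝ W₁] [NormedAddCommGroup W₂] [NormedSpace ℝ W₂] {e₁ : S₁ → E₁}
    (h₁ : DenseRange e₁) {e₂ : S₂ → E₂} (h₂ : DenseRange e₂) {X : Type*}
    [MeasurableSpace X] {μ₀ μ : Measure X} (hμ : μ₀ ≪ μ) (B : E₂ →L[ℝ] E₂ →L[ℝ] F) (N : F →L[ℝ] G)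
    (N' : E₁ →L[ℝ] F →L[ℝ] G) (V : F →L[ℝ] G) {ev : G → Lp W 2 μ₀} (hev : Continuous ev)
    (T₁ : E₁ →L[ℝ] Lp W₁ 2 μ) (T₂ : E₂ →L[ℝ] Lp W₂ 2 μ)
    {Φ : X → W₁ → W₂ → W₂ → W} (hΦ : ∀ x, Continuous fun q : W₁ × W₂ × W₂ => Φ x q.1 q.2.1 q.2.2)
    (h : ∀ x y y', ∃ w, N (B (e₂ y) (e₂ y')) + N' (e₁ x) (B (e₂ y) (e₂ y'))
      + (2 : ℝ) • V (B (e₂ y) (e₂ y')) = w ∧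
      ∀ᵐ t ∂μ₀, ev w t = Φ t (T₁ (e₁ x) t) (T₂ (e₂ y) t) (T₂ (e₂ y') t)) (p : E₁) (q q' : E₂) :
    ∀ᵐ t ∂μ₀, ev (N (B q q') + N' p (B q q') + (2 : ℝ) • V (B q q')) t
      = Φ t (T₁ p t) (T₂ q t) (T₂ q' t) := by
  refine ae_eq_of_dense h₁ h₂ h₂ hμ
    (G := fun p => ev (N (B p.2.1 p.2.2) + N' p.1 (B p.2.1 p.2.2) + (2 : ℝ) • V (B p.2.1 p.2.2)))
    (hev.comp (by fun_prop)) T₁.continuous T₂.continuous T₂.continuous hΦ (fun x y y' => ?_) (p, q, q')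
  obtain ⟨w, hw, hw'⟩ := h x y y'
  rw [hw]
  exact hw'

section Identity

variable {𝕜 : Type*} [RCLike 𝕜] {n : ℕ} {K : Subgroup (unitary (EndV 𝕜 n))} {ι : Type*}
variable {M : Type*} [TopologicalSpace M] [ChartedSpace (EuclideanHalfSpace 3) M]
variable [IsManifold I3 ∞ M] {P : PrincipalBundle M K ι} {𝒰 : PatchCover P}

/-- The local representative of an element of `L²(𝔨_P|_{∂M})`. -/
def bdryEv (a : Fin 𝒰.N) (w : L2Bdry 𝒰) : Lp (EndV 𝕜 n) 2 (bdryMeasure (𝒰.chart a) (𝒰.C a)) := w.1 a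

theorem continuous_bdryEv (a : Fin 𝒰.N) : Continuous (bdryEv (𝒰 := 𝒰) a) :=
  (continuous_apply a).comp continuous_subtype_val

theorem coeFn_bdryEv (a : Fin 𝒰.N) (w : BdrySec P) :
    ∀ᵐ z ∂bdryMeasure (𝒰.chart a) (𝒰.C a),
      bdryEv a (toL2Bdry 𝒰 w) z = w.1 (𝒰.triv a) (planePt 𝒰 a z) :=
  (bdryFun_memLp (𝒰.chart a) (w.2.1 (𝒰.triv a)) (𝒰.isCompact a) (𝒰.subset a)).coeFn_toLp

theorem eq_zero_of_bdryEv {w : L2Bdry 𝒰} (h : ∀ a, ∀ᵐ z ∂bdryMeasure (𝒰.chart a) (𝒰.C a),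
    bdryEv a w z = 0) : w = 0 := by
  refine Subtype.ext (funext fun a => ?_)
  exact (Lp.eq_zero_iff_ae_eq_zero (f := bdryEv a w)).2 (h a)

variable [T2Space M] (g : Metric M) (A₀ : SmoothConn P)

/-- The relation between the normal derivative and the value of the bracket on the boundary, at a
point. -/
def identityPt (a : Fin 𝒰.N) (x : M) (a₀ : Fin 3 → EndV 𝕜 n)
    (q q' : (Fin 3 → EndV 𝕜 n) × (Fin 3 → Fin 3 → EndV 𝕜 n)) : EndV 𝕜 n :=
  normalPt (lieB 𝕜 n) (gramInv g (𝒰.chart a) x)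
    (fun d b c => pd (𝒰.chart a) d (fun y => gramInv g (𝒰.chart a) y b c) x)
    (connPt A₀ a x) a₀ q q' + (2 * chartTau g (𝒰.chart a) x) • contr g (lieB 𝕜 n) (𝒰.chart a) x q.1 q'.1

theorem continuous_identityPt (a : Fin 𝒰.N) (x : M) :
    Continuous fun p : (Fin 3 → EndV 𝕜 n) × ((Fin 3 → EndV 𝕜 n) × (Fin 3 → Fin 3 → EndV 𝕜 n)) ×
      ((Fin 3 → EndV 𝕜 n) × (Fin 3 → Fin 3 → EndV 𝕜 n)) =>
      identityPt g A₀ a x p.1 p.2.1 p.2.2 := by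
  have h : Continuous fun p : (Fin 3 → EndV 𝕜 n) × ((Fin 3 → EndV 𝕜 n) × (Fin 3 → Fin 3 → EndV 𝕜 n)) ×
      ((Fin 3 → EndV 𝕜 n) × (Fin 3 → Fin 3 → EndV 𝕜 n)) =>
      contr g (lieB 𝕜 n) (𝒰.chart a) x p.2.1.1 p.2.2.1 := by
    unfold contr
    fun_prop
  exact (continuous_normalPt _ _ _ _).add
    ((ContinuousLinearMap.lsmul ℝ ℝ (E := EndV 𝕜 n) (2 * chartTau g (𝒰.chart a) x)).continuous.comp h)

theorem identityPt_eq_zero (a : Fin 𝒰.N) {x : M} (hx : x ∈ (𝒰.chart a).1.source)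
    {a₀ : Fin 3 → EndV 𝕜 n} {q q' : (Fin 3 → EndV 𝕜 n) × (Fin 3 → Fin 3 → EndV 𝕜 n)}
    (ha : ∀ t : Fin 2, q.1 t.succ = 0)
    (ha' : ∀ t : Fin 2, q'.1 t.succ = 0) (hq : ∀ s t : Fin 2, q.2 s.succ t.succ = 0)
    (hq' : ∀ s t : Fin 2, q'.2 s.succ t.succ = 0)
    (hc : codiffPt (lieB 𝕜 n) (gramInv g (𝒰.chart a) x)
      (fun d b c => pd (𝒰.chart a) d (fun y => gramInv g (𝒰.chart a) y b c) x)
      (fun b => logDens g (𝒰.chart a) b x) (connPt A₀ a x) a₀ q = 0)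
    (hc' : codiffPt (lieB 𝕜 n) (gramInv g (𝒰.chart a) x)
      (fun d b c => pd (𝒰.chart a) d (fun y => gramInv g (𝒰.chart a) y b c) x)
      (fun b => logDens g (𝒰.chart a) b x) (connPt A₀ a x) a₀ q' = 0) :
    identityPt g A₀ a x a₀ q q' = 0 := by
  rw [identityPt]
  have h := normalPt_eq (h := fun b c => gramInv g (𝒰.chart a) x b c) _
    (fun b => logDens g (𝒰.chart a) b x) (connPt A₀ a x)
    (fun b c => gramInv_comm g (𝒰.chart a) x b c)
    (gramInv_zero_pos g (𝒰.chart a) hx) ha ha' hq hq' hc hc'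
  have h2 : ∀ (W : Type _) [AddCommGroup W] [Module ℝ W] (y z : W) (t : ℝ),
      y = (-2 * t) • z → y + (2 * t) • z = 0 := fun W _ _ y z t h => by rw [h]; module
  exact h2 _ _ _ _ h

set_option maxHeartbeats 2000000 in
/-- The normal derivative of `[α·β]` on the boundary for horizontal forms `α` and `β`. -/
theorem boundary_identity {k s r : ℕ} (hk : 1 ≤ k) (hr : 2 ≤ r) (hrs : r ≤ s) {h : HForm 𝒰 k}
    {α β : HForm 𝒰 s} (hα : α ∈ Horizontal 𝒰 g A₀ h s) (hβ : β ∈ Horizontal 𝒰 g A₀ h s)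
    {b : HSec 𝒰 r} {w v : L2Bdry 𝒰} (hb : SobBracket 𝒰 g α β b) (hw : SobNormalDeriv 𝒰 g A₀ h b w)
    (hv : SobTauMul 𝒰 g b v) : w + (2 : ℝ) • v = 0 := by
  have hs : 2 ≤ s := hr.trans hrs
  obtain ⟨B, hB⟩ := exists_sobBracket_clm 𝒰 g (s := s) (r := r)
    fun p q hpq => by simp only [ProductOrders]; omega
  obtain ⟨N, N', hN⟩ := exists_sobNormalDeriv_clm 𝒰 g A₀ hk hr
  obtain ⟨V, hV⟩ := exists_sobTauMul_clm 𝒰 g hr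
  rw [(hN _ _ _).1 hw, (hV _ _).1 hv, (hB _ _ _).1 hb]
  refine eq_zero_of_bdryEv fun a => ?_
  have hKc : IsCompact (planeEmb ⁻¹' (coord (𝒰.chart a) '' 𝒰.C a)) :=
    isCompact_planeEmb_preimage (isCompact_coord_patch 𝒰 a)
  obtain ⟨L, hL, hKL, hLD⟩ := exists_compact_between hKc (isOpen_planeDom (𝒰.chart a) (P.isOpen_U _))
    (preimage_mono (coord_image_subset 𝒰 a))
  have hμ : bdryMeasure (𝒰.chart a) (𝒰.C a) ≪ volume.restrict L :=
    (Measure.restrict_mono_set _ (hKL.trans interior_subset)).absolutelyContinuous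
  obtain ⟨T₁, hT₁⟩ := exists_trace_clm (isModel_formReps 𝒰) a hL hLD hk (denseRange_toHForm 𝒰 k)
    (norm_toHForm k)
  obtain ⟨T₂, hT₂⟩ := exists_trace_pd_clm (isModel_formReps 𝒰) a hL hLD hs (denseRange_toHForm 𝒰 s)
    (norm_toHForm s)
  have hin : ∀ᵐ z ∂bdryMeasure (𝒰.chart a) (𝒰.C a), z ∈ planeEmb ⁻¹' (coord (𝒰.chart a) '' 𝒰.C a) :=
    ae_restrict_mem hKc.measurableSet
  have key := ae_eq_of_dense_normal (denseRange_toHForm 𝒰 k) (denseRange_toHForm 𝒰 s) hμ B N N' V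
    (continuous_bdryEv a) T₁ T₂ (Φ := fun z => identityPt g A₀ a (planePt 𝒰 a z))
    (fun z => continuous_identityPt g A₀ a _) ?_ h α β
  · have tang : ∀ η ∈ Horizontal 𝒰 g A₀ h s, ∀ᵐ z ∂volume.restrict L, ∀ t : Fin 2,
        (T₂ η z).1 t.succ = 0 := fun η hη => ae_all_iff.2 fun t =>
      trace_tang_eq_zero hη.1 a hL hLD (T := T₂) (π := ContinuousLinearMap.fst ℝ _ _)
        (fun s => by filter_upwards [hT₂ s] with z hz; rw [hz]; rfl) t
    have dtang : ∀ η ∈ Horizontal 𝒰 g A₀ h s, ∀ᵐ z, z ∈ interior L → ∀ t t' : Fin 2,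
        (T₂ η z).2 t.succ t'.succ = 0 := by
      intro η hη
      have h1 : ∀ t t' : Fin 2, ∀ᵐ z, z ∈ interior L → (T₂ η z).2 t.succ t'.succ = 0 := fun t t' =>
        trace_pd_eq_zero a hL hLD (denseRange_toHForm 𝒰 s) hT₂ (projV 𝕜 n t'.succ)
          ((tang η hη).mono fun z hz _ => hz t') t
      filter_upwards [ae_all_iff.2 fun t => ae_all_iff.2 (h1 t)] with z hz hzL t t'
      exact hz t t' hzL
    have codiff : ∀ η ∈ Horizontal 𝒰 g A₀ h s, _ := fun η hη =>
      trace_codiffPt_eq_zero g A₀ hk hs hη.2 a hL hLD hT₁ hT₂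
    filter_upwards [key, hin, hμ.ae_le (tang α hα), hμ.ae_le (tang β hβ),
      ae_restrict_of_ae (dtang α hα), ae_restrict_of_ae (dtang β hβ), hμ.ae_le (codiff α hα),
      hμ.ae_le (codiff β hβ)] with z k1 k2 k3 k4 k5 k6 k7 k8
    rw [k1]
    exact identityPt_eq_zero g A₀ a (𝒰.subset a (mem_patch_of_planeEmb a k2).1).1 k3 k4
      (k5 (hKL k2)) (k6 (hKL k2)) k7 k8
  · intro h' α' β'
    obtain ⟨b', hb'⟩ := exists_isBracket g α' β'
    obtain ⟨w', hw'⟩ := exists_isNormalDeriv g (A₀.addForm h') b'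
    obtain ⟨v', hv'⟩ := exists_isTauMul g b'
    have h1 : toHSec 𝒰 r b' = B (toHForm 𝒰 s α') (toHForm 𝒰 s β') :=
      (hB _ _ _).1 (subset_closure ⟨α', β', b', hb', rfl⟩)
    have h2 : toL2Bdry 𝒰 w' = N (toHSec 𝒰 r b') + N' (toHForm 𝒰 k h') (toHSec 𝒰 r b') :=
      (hN _ _ _).1 (subset_closure ⟨h', b', w', hw', rfl⟩)
    have h3 : toL2Bdry 𝒰 v' = V (toHSec 𝒰 r b') := (hV _ _).1 (subset_closure ⟨b', v', hv', rfl⟩)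
    refine ⟨toL2Bdry 𝒰 (w' + (v' + v')), ?_, ?_⟩
    · rw [← h1, ← h2, ← h3, map_add, map_add, two_smul]
    · filter_upwards [coeFn_bdryEv a (w' + (v' + v')), hin, hμ.ae_le (hT₁ h'), hμ.ae_le (hT₂ α'),
        hμ.ae_le (hT₂ β')] with z k1 k2 k3 k4 k5
      have hx := mem_patch_of_planeEmb a k2
      have hx' := 𝒰.subset a hx.1
      rw [k1, k3, k4, k5, identityPt, ← isNormalDeriv_pt g A₀ hb' hw' a hx' hx.2, mul_smul, two_smul]
      rw [isTauMul_iff] at hv'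
      rw [isBracket_iff] at hb'
      have h4 := (hv' (𝒰.triv a) (𝒰.chart a) _ hx' hx.2).trans
        (congrArg _ (hb' (𝒰.triv a) (𝒰.chart a) _ hx'))
      exact congrArg (fun y => w'.1 (𝒰.triv a) (planePt 𝒰 a z) + (y + y)) h4

end Identity

end Coulomb

namespace Coulomb

set_option linter.unusedSectionVars false

section Vanishing

theorem contMDiffOn_smul_add_smul {M W : Type*} [TopologicalSpace M]
    [ChartedSpace (EuclideanHalfSpace 3) M] [NormedAddCommGroup W] [NormedSpace ℝ W] {O : Set M}
    {s t : M → ℝ} {F G : M → W} (hs : ContMDiffOn I3 𝓘(ℝ, ℝ) ∞ s O)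
    (hF : ContMDiffOn I3 𝓘(ℝ, W) ∞ F O) (ht : ContMDiffOn I3 𝓘(ℝ, ℝ) ∞ t O)
    (hG : ContMDiffOn I3 𝓘(ℝ, W) ∞ G O) :
    ContMDiffOn I3 𝓘(ℝ, W) ∞ (fun x => s x • F x + t x • G x) O :=
  (hs.smul hF).add (ht.smul hG)

variable {𝕜 : Type*} [RCLike 𝕜] {n : ℕ} {K : Subgroup (unitary (EndV 𝕜 n))} {ι : Type*}
variable {M : Type*} [TopologicalSpace M] [ChartedSpace (EuclideanHalfSpace 3) M]
variable [IsManifold I3 ∞ M] {P : PrincipalBundle M K ι}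

theorem cpd_smul (A : ∀ x : M, TangentSpace I3 x →L[ℝ] EndV 𝕜 n) (e : Chart M) (b : Fin 3) {x : M}
    (hx : x ∈ e.1.source) {t : M → ℝ} {G : M → EndV 𝕜 n} (ht : MDifferentiableAt I3 𝓘(ℝ, ℝ) t x)
    (hG : MDifferentiableAt I3 𝓘(ℝ, EndV 𝕜 n) G x) :
    cpd A e b (fun y => t y • G y) x = pd e b t x • G x + t x • cpd A e b G x := by
  rw [cpd, pd_smul e b hx ht hG, cpd, map_smul, smul_add, add_assoc]

theorem cpd_congr_on (A : ∀ x : M, TangentSpace I3 x →L[ℝ] EndV 𝕜 n) (e : Chart M) (b : Fin 3)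
    {O : Set M} (hO : IsOpen O) {x : M} (hx : x ∈ O) {F G : M → EndV 𝕜 n}
    (h : ∀ y ∈ O, F y = G y) : cpd A e b F x = cpd A e b G x := by
  rw [cpd, cpd, pd_congr_on e b hO hx h, h x hx]

theorem cpd_coordFun_pow_smul (A : ∀ x : M, TangentSpace I3 x →L[ℝ] EndV 𝕜 n) (e : Chart M)
    (b : Fin 3) (m : ℕ) {x : M} (hx : x ∈ e.1.source) {G : M → EndV 𝕜 n}
    (hG : MDifferentiableAt I3 𝓘(ℝ, EndV 𝕜 n) G x) :
    cpd A e b (fun y => coordFun e 0 y ^ (m + 1) • G y) x = coordFun e 0 x ^ m •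
      (((m + 1 : ℝ) * if (0 : Fin 3) = b then 1 else 0) • G x + coordFun e 0 x • cpd A e b G x) := by
  have h0 : MDifferentiableAt I3 𝓘(ℝ, ℝ) (coordFun e 0) x :=
    ContMDiffOn.mdifferentiableAt' e.1.open_source (contMDiffOn_coordFun e 0) hx
  induction m with
  | zero =>
    simp only [zero_add, pow_one, pow_zero, one_smul, Nat.cast_zero, one_mul]
    rw [cpd_smul A e b hx h0 hG, pd_coordFun e b 0 hx]
  | succ m ih =>
    have h1 : MDifferentiableAt I3 𝓘(ℝ, ℝ) (fun y => coordFun e 0 y ^ (m + 1)) x :=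
      ContMDiffOn.mdifferentiableAt' e.1.open_source ((contMDiffOn_coordFun e 0).pow (m + 1)) hx
    have h2 : MDifferentiableAt I3 𝓘(ℝ, EndV 𝕜 n) (fun y => coordFun e 0 y ^ (m + 1) • G y) x := by
      exact mdiff_smul h1 hG
    have h3 : (fun y => coordFun e 0 y ^ (m + 1 + 1) • G y)
        = fun y => coordFun e 0 y • (coordFun e 0 y ^ (m + 1) • G y) := by
      funext y
      rw [smul_smul, ← pow_succ']
    rw [h3, cpd_smul A e b hx h0 h2, ih, pd_coordFun e b 0 hx]
    push_cast
    module

theorem contMDiffOn_cpd_of_subset (A : SmoothConn P) (e : Chart M) (b : Fin 3) {i : ι} {O : Set M}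
    (hO : IsOpen O) (hOU : O ⊆ e.1.source ∩ P.U i) {F : M → EndV 𝕜 n}
    (hF : ContMDiffOn I3 𝓘(ℝ, EndV 𝕜 n) ∞ F O) :
    ContMDiffOn I3 𝓘(ℝ, EndV 𝕜 n) ∞ (cpd (A.form i) e b F) O := by
  have h1 : e.1.source ∩ O = O := inter_eq_right.2 fun x hx => (hOU hx).1
  have h2 := contMDiffOn_pd e b hO (F := F) (by rwa [h1])
  rw [h1] at h2
  exact h2.add (contMDiffOn_bilin _ ((A.smooth i e b).mono hOU) hF)

variable (g : Metric M)

theorem contMDiffOn_pd_gramInv (e : Chart M) (b b' c : Fin 3) : ContMDiffOn I3 𝓘(ℝ, ℝ) ∞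
    (fun x => pd e b (fun y => gramInv g e y b' c) x) e.1.source := by
  have := contMDiffOn_pd e b isOpen_univ (F := fun y => gramInv g e y b' c)
    ((contMDiffOn_gramInv g e b' c).mono inter_subset_left)
  rwa [inter_univ] at this

/-- The codifferential of a form that vanishes to second order on the boundary. -/
theorem exists_codiffLoc_eq (A : SmoothConn P) (e : Chart M) {i : ι} {O : Set M}
    (hO : IsOpen O) (hOU : O ⊆ e.1.source ∩ P.U i) (η : ∀ x : M, TangentSpace I3 x →L[ℝ] EndV 𝕜 n)
    {E : Fin 3 → M → EndV 𝕜 n} (hE : ∀ c, ContMDiffOn I3 𝓘(ℝ, EndV 𝕜 n) ∞ (E c) O)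
    (hη : ∀ c, ∀ x ∈ O, comp η e c x = coordFun e 0 x ^ 2 • E c x) :
    ∃ R : M → EndV 𝕜 n, ContMDiffOn I3 𝓘(ℝ, EndV 𝕜 n) ∞ R O ∧
      (∀ x ∈ O, codiffLoc g (A.form i) η e x = coordFun e 0 x • R x) ∧
      ∀ x ∈ O, coordFun e 0 x = 0 → R x = -(2 : ℝ) • ∑ c, gramInv g e x 0 c • E c x := by
  have hOs : O ⊆ e.1.source := fun x hx => (hOU hx).1
  have h0 : ContMDiffOn I3 𝓘(ℝ, ℝ) ∞ (coordFun e 0) O := (contMDiffOn_coordFun e 0).mono hOs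
  refine ⟨fun x => -∑ b, ∑ c, (gramInv g e x b c • ((2 * if (0 : Fin 3) = b then 1 else 0 : ℝ) • E c x
    + coordFun e 0 x • cpd (A.form i) e b (E c) x)
    + (pd e b (fun y => gramInv g e y b c) x + logDens g e b x * gramInv g e x b c) •
      (coordFun e 0 x • E c x)), ?_, fun x hx => ?_, fun x hx hx0 => ?_⟩
  · refine (contMDiffOn_finset_sum fun b _ => contMDiffOn_finset_sum fun c _ => ?_).neg
    refine contMDiffOn_smul_add_smul ((contMDiffOn_gramInv g e b c).mono hOs) ?_
      (((contMDiffOn_pd_gramInv g e b b c).mono hOs).add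
        (((contMDiffOn_logDens g e b).mono hOs).mul ((contMDiffOn_gramInv g e b c).mono hOs)))
      (h0.smul (hE c))
    exact contMDiffOn_smul_add_smul contMDiffOn_const (hE c) h0
      (contMDiffOn_cpd_of_subset A e b hO hOU (hE c))
  · have h1 : ∀ b c, cpd (A.form i) e b (comp η e c) x = coordFun e 0 x •
        ((2 * if (0 : Fin 3) = b then 1 else 0 : ℝ) • E c x
          + coordFun e 0 x • cpd (A.form i) e b (E c) x) := by
      intro b c
      rw [cpd_congr_on _ e b hO hx (hη c), cpd_coordFun_pow_smul _ e b 1 (hOs hx)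
        (ContMDiffOn.mdifferentiableAt' hO (hE c) hx)]
      norm_num
    simp only [codiffLoc, codiffAlg, h1, fun c => hη c x hx, smul_neg, Finset.smul_sum]
    congr 1
    refine Finset.sum_congr rfl fun b _ => Finset.sum_congr rfl fun c _ => ?_
    module
  · simp only [hx0, zero_smul, add_zero, smul_zero, Fin.sum_univ_three]
    simp
    module

/-- The boundary values of `d_A Δ_A f (ν)` for a section that vanishes to third order on the
boundary. -/
theorem normalDeriv_laplacian_eq (A : SmoothConn P) {f u : SmoothSec P} {η : SmoothForm P}
    {w : BdrySec P} (hη : IsCovDeriv P A.form f η) (hu : IsCodiff P g A.form η u)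
    (hw : IsNormalDeriv P g A.form u w) {e : Chart M} {i : ι} {O : Set M}
    (hO : IsOpen O) (hOU : O ⊆ e.1.source ∩ P.U i) {G : M → EndV 𝕜 n}
    (hG : ContMDiffOn I3 𝓘(ℝ, EndV 𝕜 n) ∞ G O)
    (hf : ∀ x ∈ O, f.1 i x = coordFun e 0 x ^ 3 • G x) {x : M} (hx : x ∈ O) (hxb : x ∈ bdry M) :
    u.1 i x = 0 ∧ w.1 i x = ((√(gramInv g e x 0 0))⁻¹ * gramInv g e x 0 0
      * (-6 * gramInv g e x 0 0)) • G x := by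
  rw [isCovDeriv_iff] at hη
  rw [isCodiff_iff] at hu
  rw [isNormalDeriv_iff] at hw
  have hx0 : coordFun e 0 x = 0 := (mem_bdry_iff e (hOU hx).1).1 hxb
  have hOs : O ⊆ e.1.source := fun x hx => (hOU hx).1
  have h0 : ContMDiffOn I3 𝓘(ℝ, ℝ) ∞ (coordFun e 0) O := (contMDiffOn_coordFun e 0).mono hOs
  obtain ⟨R, hR, hR1, hR2⟩ := exists_codiffLoc_eq g A e hO hOU (η.1 i)
    (E := fun c y => (3 * if (0 : Fin 3) = c then 1 else 0 : ℝ) • G y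
      + coordFun e 0 y • cpd (A.form i) e c G y)
    (fun c => contMDiffOn_smul_add_smul contMDiffOn_const hG h0
      (contMDiffOn_cpd_of_subset A e c hO hOU hG))
    (fun c y hy => by
      rw [hη i e y (hOU hy) c, cpd_congr_on _ e c hO hy hf, cpd_coordFun_pow_smul _ e c 2 (hOs hy)
        (ContMDiffOn.mdifferentiableAt' hO hG hy)]
      norm_num)
  have hu' : ∀ y ∈ O, u.1 i y = coordFun e 0 y • R y := fun y hy => by
    rw [hu i e y (hOU hy), hR1 y hy]
  refine ⟨by rw [hu' x hx, hx0, zero_smul], ?_⟩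
  have h1 : ∀ d, cpd (A.form i) e d (u.1 i) x = (if (0 : Fin 3) = d then 1 else 0 : ℝ) • R x := by
    intro d
    rw [cpd_congr_on _ e d hO hx hu', cpd_smul _ e d (hOs hx)
      (ContMDiffOn.mdifferentiableAt' hO h0 hx) (ContMDiffOn.mdifferentiableAt' hO hR hx), hx0,
      pd_coordFun e d 0 (hOs hx), zero_smul, add_zero]
  rw [hw i e x (hOU hx) hxb, normalLoc]
  simp only [h1, hR2 x hx hx0, hx0, zero_smul, add_zero, Fin.sum_univ_three]
  simp
  module

end Vanishing

end Coulomb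

namespace Coulomb

set_option linter.unusedSectionVars false

section Nonvanishing

variable {𝕜 : Type*} [RCLike 𝕜] {n : ℕ} {K : Subgroup (unitary (EndV 𝕜 n))} {ι : Type*}
variable {M : Type*} [TopologicalSpace M] [ChartedSpace (EuclideanHalfSpace 3) M]
variable [IsManifold I3 ∞ M] {P : PrincipalBundle M K ι}

/-- There are smooth sections, supported in a chart, that vanish exactly to third order at a given
boundary point. -/
theorem exists_cubic_bump [T2Space M] (P : PrincipalBundle M K ι) (e : Chart M) (i : ι) {x₀ : M}
    (hx₀ : x₀ ∈ e.1.source ∩ P.U i) {X : EndV 𝕜 n} (hX : X ∈ lieAlg K) (hX0 : X ≠ 0) :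
    ∃ (f : SmoothSec P) (S : Set M) (G : ι → M → EndV 𝕜 n), IsClosed S ∧
      S ⊆ e.1.source ∩ P.U i ∧ (∀ j, ∀ x ∉ S, f.1 j x = 0) ∧
      (∀ j, ContMDiffOn I3 𝓘(ℝ, EndV 𝕜 n) ∞ (G j) (e.1.source ∩ P.U i ∩ P.U j)) ∧
      (∀ j, ∀ x ∈ e.1.source ∩ P.U i ∩ P.U j, f.1 j x = coordFun e 0 x ^ 3 • G j x) ∧
      G i x₀ ≠ 0 := by
  have hV : IsOpen (e.1.source ∩ P.U i) := e.1.open_source.inter (P.isOpen_U i)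
  obtain ⟨χ, hχ⟩ :=
    (SmoothBumpFunction.nhds_basis_support (I := I3) (hV.mem_nhds hx₀)).ex_mem
  let G : ι → M → EndV 𝕜 n := fun j x => χ x • conjB (P.g j i x) X
  have hG : ∀ j, ContMDiffOn I3 𝓘(ℝ, EndV 𝕜 n) ∞ (G j) (e.1.source ∩ P.U i ∩ P.U j) := by
    intro j
    have h1 : ContMDiffOn I3 𝓘(ℝ, EndV 𝕜 n) ∞ (fun x => conjB (P.g j i x) X) (P.U j ∩ P.U i) :=
      (contDiff_conjB.clm_apply contDiff_const).contMDiff.comp_contMDiffOn (P.g_smooth j i)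
    exact χ.contMDiff.contMDiffOn.smul (h1.mono fun x hx => ⟨hx.2, hx.1.2⟩)
  have hχ0 : ∀ x ∉ tsupport χ, χ x = 0 := fun x hx => image_eq_zero_of_notMem_tsupport hx
  have hf0 : ∀ j, ∀ x ∉ tsupport χ, coordFun e 0 x ^ 3 • G j x = 0 := fun j x hx => by
    simp only [G, hχ0 x hx, zero_smul, smul_zero]
  refine ⟨⟨fun j x => coordFun e 0 x ^ 3 • G j x, fun j x hx => ?_, fun j x hx => ?_,
    fun j l x hx => ?_⟩, tsupport χ, G, isClosed_tsupport _, hχ, hf0, hG, fun j x _ => rfl, ?_⟩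
  · by_cases hxS : x ∈ tsupport χ
    · have h1 : ContMDiffOn I3 𝓘(ℝ, EndV 𝕜 n) ∞ (fun x => coordFun e 0 x ^ 3 • G j x)
          (e.1.source ∩ P.U i ∩ P.U j) :=
        (((contMDiffOn_coordFun e 0).pow 3).mono fun x hx => hx.1.1).smul (hG j)
      exact (h1.contMDiffAt ((hV.inter (P.isOpen_U j)).mem_nhds ⟨hχ hxS, hx⟩)).contMDiffWithinAt
    · refine ContMDiffAt.contMDiffWithinAt ((contMDiffAt_const (c := (0 : EndV 𝕜 n))).congr_of_eventuallyEq ?_)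
      filter_upwards [(isClosed_tsupport χ).isOpen_compl.mem_nhds hxS] with y hy using hf0 j y hy
  · by_cases hxS : x ∈ tsupport χ
    · exact Submodule.smul_mem _ _ (Submodule.smul_mem _ _ (P.conjB_mem ⟨hx, (hχ hxS).2⟩ hX))
    · beta_reduce
      rw [hf0 j x hxS]
      exact zero_mem _
  · by_cases hxS : x ∈ tsupport χ
    · have h1 := P.cocycle j l i x ⟨hx, (hχ hxS).2⟩
      rw [← conjB_apply]
      simp only [G, map_smul]
      rw [← h1]
      simp only [conjB_apply, star_mul, mul_assoc]
    · beta_reduce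
      rw [hf0 j x hxS, hf0 l x hxS, mul_zero, zero_mul]
  · have h1 := P.star_mul_g (i := i) (j := i) ⟨hx₀.2, hx₀.2⟩
    simp only [G, χ.eq_one, one_smul, conjB_apply]
    intro h
    refine hX0 ?_
    calc X = (star (P.g i i x₀) * P.g i i x₀) * X * (star (P.g i i x₀) * P.g i i x₀) := by
          rw [h1, one_mul, mul_one]
      _ = star (P.g i i x₀) * (P.g i i x₀ * X * star (P.g i i x₀)) * P.g i i x₀ := by
          simp only [mul_assoc]
      _ = 0 := by rw [h, mul_zero, zero_mul]

variable {𝒰 : PatchCover P}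

theorem bdryMeasure_ae_mem (a : Fin 𝒰.N) [T2Space M] : ∀ᵐ z ∂bdryMeasure (𝒰.chart a) (𝒰.C a),
    planePt 𝒰 a z ∈ 𝒰.C a ∩ bdry M := by
  refine (ae_restrict_iff' (isCompact_planeEmb_preimage
    (isCompact_coord_patch 𝒰 a)).measurableSet).2 ?_
  exact Filter.Eventually.of_forall fun z hz => mem_patch_of_planeEmb a hz

theorem toL2Bdry_eq_zero [T2Space M] {w : BdrySec P}
    (h : ∀ i, ∀ x ∈ P.U i ∩ bdry M, w.1 i x = 0) : toL2Bdry 𝒰 w = 0 := by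
  refine eq_zero_of_bdryEv fun a => ?_
  filter_upwards [coeFn_bdryEv a w, bdryMeasure_ae_mem a] with z h1 h2
  rw [h1, h _ _ ⟨(𝒰.subset a h2.1).2, h2.2⟩]

theorem eq_zero_of_toL2Bdry_eq_zero [T2Space M] {w : BdrySec P} (h : toL2Bdry 𝒰 w = 0) (i : ι)
    {x : M} (hx : x ∈ P.U i) (hxb : x ∈ bdry M) : w.1 i x = 0 := by
  have h1 : ∀ a, ∀ᵐ z ∂bdryMeasure (𝒰.chart a) (𝒰.C a),
      ∀ j, planePt 𝒰 a z ∈ P.U j → w.1 j (planePt 𝒰 a z) = 0 := by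
    intro a
    have h0 : ∀ᵐ z ∂bdryMeasure (𝒰.chart a) (𝒰.C a), bdryEv a (toL2Bdry 𝒰 w) z = 0 := by
      rw [h]
      exact (Lp.eq_zero_iff_ae_eq_zero (f := bdryEv a (0 : L2Bdry 𝒰))).1 rfl
    filter_upwards [coeFn_bdryEv a w, bdryMeasure_ae_mem a, h0] with z h2 h3 h4 j hj
    rw [w.2.2.2 j (𝒰.triv a) _ ⟨⟨hj, (𝒰.subset a h3.1).2⟩, h3.2⟩, ← h2, h4, mul_zero, zero_mul]
  set e : Chart M := achart (EuclideanHalfSpace 3) x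
  have hxe : x ∈ e.1.source := mem_chart_source _ x
  have h2 := ae_planeDom_of_cover 𝒰.chart 𝒰.C (fun b x hx => (𝒰.subset b hx).1) 𝒰.cover
    (p := fun x => ∀ j, x ∈ P.U j → w.1 j x = 0) h1
    (fun b => (isCompact_planeEmb_preimage (isCompact_coord_patch 𝒰 b)).measurableSet) e
  have hO : IsOpen (planeDom e (P.U i)) := isOpen_planeDom e (P.isOpen_U i)
  obtain ⟨z, hz⟩ := exists_planeEmb_eq e hxe hxb
  have hzO : z ∈ planeDom e (P.U i) := by
    change planeEmb z ∈ chartDom e (P.U i)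
    rw [hz]
    exact mem_chartDom e hxe hx
  have hc : ContinuousOn (fun z => w.1 i ((coord e).symm (planeEmb z))) (planeDom e (P.U i)) := by
    refine (w.2.1 i).comp ((e.1.continuousOn_extend_symm (I := I3)).comp
      continuous_planeEmb.continuousOn fun z hz => ?_) fun z hz => ?_
    · have h3 := coord_symm_mem e hz
      rw [← h3.2]
      exact (coord e).map_source (by simpa using h3.1.1)
    · have h3 := mem_of_planeDom e hz
      exact ⟨h3.1.2, h3.2⟩
  have h3 := Measure.eqOn_open_of_ae_eq (μ := (volume : Measure E2)) (f := fun z => w.1 i ((coord e).symm (planeEmb z)))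
    (g := fun _ => 0) (U := planeDom e (P.U i)) ((ae_restrict_iff' hO.measurableSet).2 (by
      filter_upwards [h2] with z h4 hz
      have h5 := mem_of_planeDom e hz
      refine h4 ?_ i h5.1.2
      change planeEmb z ∈ chartDom e univ
      rw [← (coord_symm_mem e hz).2]
      exact mem_chartDom e h5.1.1 trivial)) hO hc continuousOn_const hzO
  simp only [hz, coord_symm_coord e hxe] at h3
  exact h3

variable (g : Metric M) (A₀ : SmoothConn P)

theorem isTA_of_smooth {k : ℕ} {h : SmoothForm P} {f : SmoothSec P} {η : SmoothForm P}
    {u : SmoothSec P} {w v : BdrySec P} (hη : IsCovDeriv P (A₀.form + h.1) f η)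
    (hu : IsCodiff P g (A₀.form + h.1) η u) (hw : IsNormalDeriv P g (A₀.form + h.1) u w)
    (hv : IsTauMul P g u v) : IsTA 𝒰 g A₀ (toHForm 𝒰 k h) (toHSec 𝒰 (k + 1) f)
      (toL2Bdry 𝒰 w + (2 : ℝ) • toL2Bdry 𝒰 v) :=
  ⟨toHSec 𝒰 _ u, _, _, ⟨toHForm 𝒰 k η, subset_closure ⟨h, f, η, hη, rfl⟩,
    subset_closure ⟨h, η, u, hu, rfl⟩⟩, subset_closure ⟨h, u, w, hw, rfl⟩,
    subset_closure ⟨u, v, hv, rfl⟩, rfl⟩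

theorem mem_comap_inl_closure_range {S E F : Type*} [AddCommGroup S] [Module ℝ S]
    [NormedAddCommGroup E] [NormedSpace ℝ E] [NormedAddCommGroup F] [NormedSpace ℝ F]
    (a : S →ₗ[ℝ] E) (b : S →ₗ[ℝ] F) {f : S} (hf : b f = 0) :
    a f ∈ (LinearMap.range (a.prod b)).topologicalClosure.comap (LinearMap.inl ℝ E F) := by
  rw [Submodule.mem_comap]
  exact Submodule.le_topologicalClosure _ ⟨f, Prod.ext rfl hf⟩

theorem mem_HSecCon_of_restrictBdry {m : ℕ} {f : SmoothSec P}
    (hf : toL2Bdry 𝒰 (restrictBdry P f) = 0) : toHSec 𝒰 m f ∈ HSecCon 𝒰 m :=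
  mem_comap_inl_closure_range (toHSec 𝒰 m) (toL2Bdry 𝒰 ∘ₗ restrictBdry P) hf

/-- The boundary values of `T_A f` for a section that vanishes to third order on the boundary and
outside of a closed subset of a chart. -/
theorem exists_isTA_cubic [T2Space M] {f : SmoothSec P} {e : Chart M} {i : ι} {S : Set M}
    {G : ι → M → EndV 𝕜 n} (hS : IsClosed S) (hSV : S ⊆ e.1.source ∩ P.U i)
    (hfS : ∀ j, ∀ x ∉ S, f.1 j x = 0)
    (hG : ∀ j, ContMDiffOn I3 𝓘(ℝ, EndV 𝕜 n) ∞ (G j) (e.1.source ∩ P.U i ∩ P.U j))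
    (hfG : ∀ j, ∀ x ∈ e.1.source ∩ P.U i ∩ P.U j, f.1 j x = coordFun e 0 x ^ 3 • G j x)
    (k : ℕ) (h : SmoothForm P) : ∃ w : BdrySec P,
      IsTA 𝒰 g A₀ (toHForm 𝒰 k h) (toHSec 𝒰 (k + 1) f) (toL2Bdry 𝒰 w) ∧
      (∀ j, ∀ x ∈ P.U j ∩ bdry M, x ∉ S → w.1 j x = 0) ∧
      ∀ j, ∀ x ∈ e.1.source ∩ P.U i ∩ P.U j, x ∈ bdry M → w.1 j x = ((√(gramInv g e x 0 0))⁻¹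
        * gramInv g e x 0 0 * (-6 * gramInv g e x 0 0)) • G j x := by
  have hV : IsOpen (e.1.source ∩ P.U i) := e.1.open_source.inter (P.isOpen_U i)
  obtain ⟨η, hη⟩ := exists_isCovDeriv (A₀.addForm h) f
  obtain ⟨u, hu⟩ := exists_isCodiff g (A₀.addForm h) η
  obtain ⟨w, hw⟩ := exists_isNormalDeriv g (A₀.addForm h) u
  obtain ⟨v, hv⟩ := exists_isTauMul g u
  have hin : ∀ j, ∀ x ∈ e.1.source ∩ P.U i ∩ P.U j, x ∈ bdry M → u.1 j x = 0 ∧ w.1 j x =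
      ((√(gramInv g e x 0 0))⁻¹ * gramInv g e x 0 0 * (-6 * gramInv g e x 0 0)) • G j x :=
    fun j x hx hxb => normalDeriv_laplacian_eq g (A₀.addForm h) hη hu hw
      (hV.inter (P.isOpen_U j)) (fun y hy => ⟨hy.1.1, hy.2⟩) (hG j) (hfG j) hx hxb
  have hout : ∀ j, ∀ x ∈ P.U j ∩ bdry M, x ∉ S → u.1 j x = 0 ∧ w.1 j x = 0 := by
    intro j x hx hxS
    have h1 := normalDeriv_laplacian_eq g (A₀.addForm h) hη hu hw
      (e := achart (EuclideanHalfSpace 3) x) (i := j)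
      (O := Sᶜ ∩ ((achart (EuclideanHalfSpace 3) x).1.source ∩ P.U j)) (G := fun _ => 0)
      (hS.isOpen_compl.inter ((achart (EuclideanHalfSpace 3) x).1.open_source.inter
        (P.isOpen_U j))) inter_subset_right contMDiffOn_const
      (fun y hy => by rw [hfS j y hy.1, smul_zero]) ⟨hxS, mem_chart_source _ x, hx.1⟩ hx.2
    rwa [smul_zero] at h1
  have hv0 : toL2Bdry 𝒰 v = 0 := by
    refine toL2Bdry_eq_zero fun j x hx => ?_
    rw [hv j x hx]
    by_cases hxS : x ∈ S
    · rw [(hin j x ⟨hSV hxS, hx.1⟩ hx.2).1, smul_zero]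
    · rw [(hout j x hx hxS).1, smul_zero]
  refine ⟨w, ?_, fun j x hx hxS => (hout j x hx hxS).2, fun j x hx hxb => (hin j x hx hxb).2⟩
  have h1 := isTA_of_smooth (𝒰 := 𝒰) (k := k) g A₀ hη hu hw hv
  rwa [hv0, smul_zero, add_zero] at h1

theorem toL2Bdry_congr [T2Space M] {w w' : BdrySec P}
    (h : ∀ i, ∀ x ∈ P.U i ∩ bdry M, w.1 i x = w'.1 i x) : toL2Bdry 𝒰 w = toL2Bdry 𝒰 w' := by
  rw [← sub_eq_zero, ← map_sub]
  exact toL2Bdry_eq_zero fun i x hx => sub_eq_zero.2 (h i x hx)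

/-- The operator `T_A` does not vanish on the gauge Lie algebra. -/
theorem exists_TA_ne_zero [T2Space M] (hK0 : lieAlg K ≠ ⊥) (hM : (bdry M).Nonempty) {k : ℕ}
    {T : HForm 𝒰 k → HSec 𝒰 (k + 1) →L[ℝ] L2Bdry 𝒰}
    (hT : ∀ h f w, IsTA 𝒰 g A₀ h f w ↔ w = T h f) (hTc : ∀ f, Continuous fun h => T h f)
    (h : HForm 𝒰 k) : ∃ f ∈ HSecCon 𝒰 (k + 1), T h f ≠ 0 := by
  obtain ⟨X, hX, hX0⟩ := (Submodule.ne_bot_iff _).1 hK0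
  obtain ⟨x₀, hx₀⟩ := hM
  obtain ⟨i, hi⟩ := P.cover x₀
  obtain ⟨e, hx₀e⟩ : ∃ e : Chart M, x₀ ∈ e.1.source := ⟨achart _ x₀, mem_chart_source _ x₀⟩
  obtain ⟨f, S, G, hS, hSV, hfS, hG, hfG, hG0⟩ := exists_cubic_bump P e i ⟨hx₀e, hi⟩ hX hX0
  have hfb : toL2Bdry 𝒰 (restrictBdry P f) = 0 := by
    refine toL2Bdry_eq_zero fun j x hx => ?_
    change f.1 j x = 0
    by_cases hxS : x ∈ S
    · rw [hfG j x ⟨hSV hxS, hx.1⟩, (mem_bdry_iff e (hSV hxS).1).1 hx.2, zero_pow (by norm_num),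
        zero_smul]
    · exact hfS j x hxS
  obtain ⟨w₀, hw₀, hw₀S, hw₀V⟩ := exists_isTA_cubic (𝒰 := 𝒰) g A₀ hS hSV hfS hG hfG k 0
  have hconst : ∀ h' : SmoothForm P,
      T (toHForm 𝒰 k h') (toHSec 𝒰 (k + 1) f) = toL2Bdry 𝒰 w₀ := by
    intro h'
    obtain ⟨w, hw, hwS, hwV⟩ := exists_isTA_cubic (𝒰 := 𝒰) g A₀ hS hSV hfS hG hfG k h'
    rw [← (hT _ _ _).1 hw]
    refine toL2Bdry_congr fun j x hx => ?_
    by_cases hxS : x ∈ S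
    · rw [hwV j x ⟨hSV hxS, hx.1⟩ hx.2, hw₀V j x ⟨hSV hxS, hx.1⟩ hx.2]
    · rw [hwS j x hx hxS, hw₀S j x hx hxS]
  refine ⟨toHSec 𝒰 (k + 1) f, mem_HSecCon_of_restrictBdry hfb, fun h0 => ?_⟩
  have h2 : T h (toHSec 𝒰 (k + 1) f) = toL2Bdry 𝒰 w₀ :=
    congrFun ((denseRange_toHForm 𝒰 k).equalizer (hTc (toHSec 𝒰 (k + 1) f))
      (continuous_const (y := toL2Bdry 𝒰 w₀)) (funext hconst)) h
  have h1 := eq_zero_of_toL2Bdry_eq_zero (h2.symm.trans h0) i hi hx₀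
  rw [hw₀V i x₀ ⟨⟨hx₀e, hi⟩, hi⟩ hx₀] at h1
  have h2 := gramInv_zero_pos g e hx₀e
  exact smul_ne_zero (mul_ne_zero (mul_ne_zero (inv_ne_zero (Real.sqrt_pos.2 h2).ne') h2.ne')
    (mul_ne_zero (by norm_num) h2.ne')) hG0 h1

end Nonvanishing

end Coulomb

namespace Coulomb

set_option linter.unusedSectionVars false

theorem eq_neg_smul_of_add_eq_zero {W : Type*} [AddCommGroup W] [Module ℝ W] {c : ℝ} {w v : W}
    (h : w + c • v = 0) : w = (-c) • v := by
  rw [neg_smul]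
  exact eq_neg_of_add_eq_zero_left h

section Curvature

variable {𝕜 : Type*} [RCLike 𝕜] {n : ℕ} {K : Subgroup (unitary (EndV 𝕜 n))} {ι : Type*}
variable {M : Type*} [TopologicalSpace M] [ChartedSpace (EuclideanHalfSpace 3) M] [T2Space M]
variable [IsManifold I3 ∞ M] {P : PrincipalBundle M K ι} {𝒰 : PatchCover P}

theorem exists_bracket_boundary (g : Metric M) (A₀ : SmoothConn P) {k s : ℕ} (hk : 1 ≤ k)
    (hs : 2 ≤ s) {h : HForm 𝒰 k} {α β : HForm 𝒰 s} (hα : α ∈ Horizontal 𝒰 g A₀ h s)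
    (hβ : β ∈ Horizontal 𝒰 g A₀ h s) : ∃ (b : HSec 𝒰 s) (w v : L2Bdry 𝒰),
      (∀ b', SobBracket 𝒰 g α β b' ↔ b' = b) ∧
      (∀ w', SobNormalDeriv 𝒰 g A₀ h b w' ↔ w' = w) ∧
      (∀ v', SobTauMul 𝒰 g b v' ↔ v' = v) ∧ w = (-2 : ℝ) • v := by
  obtain ⟨B, hB⟩ := exists_sobBracket_clm 𝒰 g (s := s) (r := s)
    fun p q hpq => by simp only [ProductOrders]; omega
  obtain ⟨N, N', hN⟩ := exists_sobNormalDeriv_clm 𝒰 g A₀ hk hs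
  obtain ⟨V, hV⟩ := exists_sobTauMul_clm 𝒰 g hs
  refine ⟨B α β, _, _, hB α β, hN h _, hV _, ?_⟩
  exact eq_neg_smul_of_add_eq_zero (boundary_identity g A₀ hk hs le_rfl hα hβ ((hB _ _ _).2 rfl)
    ((hN _ _ _).2 rfl) ((hV _ _).2 rfl))

theorem exists_TA_annihilates_LA (hK0 : lieAlg K ≠ ⊥) (hM : (bdry M).Nonempty) (g : Metric M)
    (A₀ : SmoothConn P) {k : ℕ} (hk : 3 ≤ k) (h : HForm 𝒰 k) :
    ∃ T : HSecCon 𝒰 (k + 1) →L[ℝ] L2Bdry 𝒰, (∀ f w, IsTA 𝒰 g A₀ h f.1 w ↔ w = T f) ∧ T ≠ 0 ∧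
      LA 𝒰 g A₀ h ≤ LinearMap.ker (T : HSecCon 𝒰 (k + 1) →ₗ[ℝ] L2Bdry 𝒰) ∧
      ¬ Dense (LA 𝒰 g A₀ h : Set (HSecCon 𝒰 (k + 1))) := by
  obtain ⟨T, hT, hTc⟩ := exists_TA_clm 𝒰 g A₀ hk
  obtain ⟨f₁, hf₁, hf₁'⟩ := exists_TA_ne_zero g A₀ hK0 hM hT hTc h
  obtain ⟨N, N', hN⟩ := exists_sobNormalDeriv_clm 𝒰 g A₀ (l := k) (s := k - 1) (by omega) (by omega)
  obtain ⟨V, hV⟩ := exists_sobTauMul_clm 𝒰 g (s := k - 1) (by omega)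
  obtain ⟨S, hS⟩ : ∃ S : HSecCon 𝒰 (k + 1) →L[ℝ] L2Bdry 𝒰, ∀ f, S f = T h f.1 :=
    ⟨(T h).comp (HSecCon 𝒰 (k + 1)).subtypeL, fun f => rfl⟩
  have hker : LA 𝒰 g A₀ h ≤ LinearMap.ker (S : HSecCon 𝒰 (k + 1) →ₗ[ℝ] L2Bdry 𝒰) := by
    refine Submodule.span_le.2 ?_
    rintro f ⟨α, hα, β, hβ, b, f₀, hb, hf₀, rfl⟩
    refine LinearMap.mem_ker.2 ?_
    have h1 : S f₀ = 0 := by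
      have h2 := boundary_identity g A₀ (r := k - 1) (by omega) (by omega) (by omega) hα hβ hb
        ((hN h b _).2 rfl) ((hV b _).2 rfl)
      rw [hS, ← h2]
      exact ((hT h f₀.1 _).1 ⟨b, _, _, hf₀, (hN h b _).2 rfl, (hV b _).2 rfl, rfl⟩).symm
    change S ((-2 : ℝ) • f₀) = 0
    rw [map_smul, h1, smul_zero]
  have hne : S ⟨f₁, hf₁⟩ ≠ 0 := by rwa [hS]
  refine ⟨S, fun f w => by rw [hS]; exact hT h f.1 w, fun h0 => hne (by rw [h0]; rfl), hker,
    fun hd => hne ?_⟩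
  have h3 : IsClosed {f | S f = 0} := isClosed_eq S.continuous continuous_const
  have h4 : closure (LA 𝒰 g A₀ h : Set (HSecCon 𝒰 (k + 1))) ⊆ {f | S f = 0} :=
    closure_minimal (fun f hf => LinearMap.mem_ker.1 (hker hf)) h3
  exact h4 (hd _)

end Curvature

end Coulomb

end

theorem mainTheorem2
    {𝕜 : Type*} [RCLike 𝕜] {n : ℕ}
    (K : Subgroup (unitary (Coulomb.EndV 𝕜 n)))
    (hK : IsClosed (K : Set (unitary (Coulomb.EndV 𝕜 n))))
    (hK0 : Coulomb.lieAlg K ≠ ⊥)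
    {M : Type*} [TopologicalSpace M] [T2Space M] [CompactSpace M]
    [ChartedSpace (EuclideanHalfSpace 3) M] [IsManifold Coulomb.I3 ∞ M]
    (hM : (Coulomb.bdry M).Nonempty)
    (g : Coulomb.Metric M)
    {ι : Type*} (P : Coulomb.PrincipalBundle M K ι)
    (𝒰 : Coulomb.PatchCover P)
    (A₀ : Coulomb.SmoothConn P)
    (k : ℕ) (h : Coulomb.HForm 𝒰 k) (hh : h ∈ Coulomb.HFormCon 𝒰 k) :
    (3 / 2 < (k : ℝ) + 1 → ∀ s : ℕ, 3 / 2 < (s : ℝ) →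
      ∀ α ∈ Coulomb.Horizontal 𝒰 g A₀ h s, ∀ β ∈ Coulomb.Horizontal 𝒰 g A₀ h s,
        ∃ (b : Coulomb.HSec 𝒰 s) (w v : Coulomb.L2Bdry 𝒰),
          (∀ b', Coulomb.SobBracket 𝒰 g α β b' ↔ b' = b) ∧
          (∀ w', Coulomb.SobNormalDeriv 𝒰 g A₀ h b w' ↔ w' = w) ∧
          (∀ v', Coulomb.SobTauMul 𝒰 g b v' ↔ v' = v) ∧
          w = (-2 : ℝ) • v) ∧
    (3 / 2 + 1 < (k : ℝ) →
      ∃ T : Coulomb.HSecCon 𝒰 (k + 1) →L[ℝ] Coulomb.L2Bdry 𝒰,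
        (∀ f w, Coulomb.IsTA 𝒰 g A₀ h f.1 w ↔ w = T f) ∧
        T ≠ 0 ∧
        Coulomb.LA 𝒰 g A₀ h ≤ LinearMap.ker (T : Coulomb.HSecCon 𝒰 (k + 1) →ₗ[ℝ] Coulomb.L2Bdry 𝒰) ∧
        ¬ Dense (Coulomb.LA 𝒰 g A₀ h : Set (Coulomb.HSecCon 𝒰 (k + 1)))) := by
  refine ⟨fun hk s hs α hα β hβ => ?_, fun hk => ?_⟩
  · have hk1 : 1 ≤ k := by
      by_contra! hlt
      obtain rfl : k = 0 := by omega
      norm_num at hk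
    have hs2 : 2 ≤ s := by
      by_contra! hlt
      have : (s : ℝ) ≤ 1 := by exact_mod_cast (by omega : s ≤ 1)
      linarith
    exact Coulomb.exists_bracket_boundary g A₀ hk1 hs2 hα hβ
  · have hk3 : 3 ≤ k := by
      by_contra! hlt
      have : (k : ℝ) ≤ 2 := by exact_mod_cast (by omega : k ≤ 2)
      linarith
    exact Coulomb.exists_TA_annihilates_LA hK0 hM g A₀ hk3 h
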